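/- **Lemma 3.1.** *Setting.* Let $\varphi_0\in C^2(\mathbb R^2)$, $c_*\in\mathbb R$, $b>0$ be such that $\omega=\{\varphi_0<c_*\}\subset\mathbb R^2$ is non-empty, bounded and connected and $\nabla\varphi_0\ne0$ on $\{\varphi_0=c_*\}=\partial\omega$. Let $\Omega=\omega\times(-b,b)$, $S_1=\partial\omega\times(-b,b)$, $S_2=\omega\times\{-b,b\}$, $S=S_1\cup S_2$, $\bar n$ the unit outward normal, $\Omega^t=\Omega\times(0,t)$. Assume that $\Omega$ is not axially symmetric (no point $a\in\mathbb R^2$ is such that $\omega$ is invariant under all rotations about $a$). Let $\nu,\varkappa>0$, $\mathbf D(u)=(u_{i,x_j}+u_{j,x_i})_{i,j}$, $\mathbf T(u,p)=\nu\mathbf D(u)-p\mathbf I$, and $$\|u\|_{V_2^0(\Omega^t)}=\operatorname*{ess\,sup}_{0<s<t}\|u(s)\|_{L_2(\Omega)}+\Big(\int_0^t\|\nabla u\|_{L_2(\Omega)}^2ds\Big)^{1/2}.$$ *Data.* Let $0<T<\infty$, $\alpha\in C^2(\mathbb R)$, $a(x)=\sup\{|\alpha(y)|+|\alpha'(y)|:|y|\le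 x\}$. Let $v(0)\in L_2(\Omega)$, $\theta(0)\in L_\infty(\Omega)$, $h(0),\vartheta(0)\in L_2(\Omega)$, $f\in L_2(0,T;L_3(\Omega))\subset L_2(0,T;L_{6/5}(\Omega))$ with weak derivative $g=f_{,x_3}\in L_2(0,T;L_{6/5}(\Omega))$, and let the trace of the third component of $f$ on $S_2$ satisfy $f_3\in L_2(0,T;L_{4/3}(S_2))$. Put $c_1=a(\|\theta(0)\|_{L_\infty(\Omega)})$ and let $c_0$ be any number with $$c_1\|f\|_{L_2(0,T;L_{6/5}(\Omega))}+\|v(0)\|_{L_2(\Omega)}\le c_0,\qquad \|\theta(0)\|_{L_2(\Omega)}\le c_0 .$$ *Solutions.* Let $(v,p,\theta)$ satisfy $$v_{,t}+v\cdot\nabla v-\operatorname{div}\mathbf T(v,p)=\alpha(\theta)f,\quad \operatorname{div}v=0,\quad \theta_{,t}+v\cdot\nabla\theta-\varkappa\Delta\theta=0\quad\text{in }\Omega^T,$$ $$\bar n\cdot\mathbf D(v)\cdot\bar\tau=0\ \text{ for all tangent }\bar\tau,\quad \bar n\cdot v=0,\quad \bar n\cdot\nabla\theta=0\quad\text{on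 }S\times(0,T),$$ with initial values $v(0),\theta(0)$. Let $h=v_{,x_3}$, $q=p_{,x_3}$, $\vartheta=\theta_{,x_3}$ satisfy the $x_3$-differentiated problems $$h_{,t}-\operatorname{div}\mathbf T(h,q)=-v\cdot\nabla h-h\cdot\nabla v+\alpha'(\theta)\vartheta f+\alpha(\theta)g,\quad \operatorname{div}h=0\quad\text{in }\Omega^T,\tag{2.10}$$ $$\bar n\cdot h=0,\ \ \bar n\cdot\mathbf D(h)\cdot\bar\tau=0\ \text{ for all tangent }\bar\tau\ \text{ on }S_1\times(0,T),\qquad h_1=h_2=0,\ \ h_{3,x_3}=0\ \text{ on }S_2\times(0,T),$$ $$\vartheta_{,t}+v\cdot\nabla\vartheta+h\cdot\nabla\theta-\varkappa\Delta\vartheta=0\ \text{ in }\Omega^T,\qquad \bar n\cdot\nabla\vartheta=0\ \text{ on }S_1\times(0,T),\qquad \vartheta=0\ \text{ on }S_2\times(0,T),\tag{2.13}$$ with initial values $h(0),\vartheta(0)$. The solutions are assumed regular in the following sense: $v,\theta,h,\vartheta$ are of class $C^{2,1}$ and $p,q$ of class $C^{1,0}$ in $(x,t)$ on $\overline\Omega\times(0,T)$;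 the equations containing $f,g$ hold almost everywhere; the initial values are attained in $L_2(\Omega)$ as $t\to0^+$. *Conclusion.* There is a constant $c>0$ depending only on $\Omega,\nu,\varkappa$ such that, for all such data and solutions and all $0<t\le T$, $$\begin{aligned}\|h\|_{V_2^0(\Omega^t)}^2+\|\vartheta\|_{V_2^0(\Omega^t)}^2\le{}& c\exp\!\big(c\,c_1^2\|f\|_{L_2(0,t;L_3(\Omega))}^2\big)\big[c_0^2\|h\|_{L_\infty(0,t;L_3(\Omega))}^2+c_1^2\|g\|_{L_2(0,t;L_{6/5}(\Omega))}^2\\&+c_1^2\|f_3\|_{L_2(0,t;L_{4/3}(S_2))}^2+\|h(0)\|_{L_2(\Omega)}^2+\|\vartheta(0)\|_{L_2(\Omega)}^2\big],\end{aligned}\tag{3.1}$$ where the right-hand side may be infinite (with $0\cdot\infty=0$). If moreover $\nabla v,\nabla\theta\in L_2(0,T;L_3(\Omega))$, then $$\begin{aligned}\|h\|_{V_2^0(\Omega^t)}^2+\|\vartheta\|_{V_2^0(\Omega^t)}^2\le{}& c\exp\!\big[c\big(\|\nabla v\|_{L_2(0,t;L_3(\Omega))}^2+\|\nabla\theta\|_{L_2(0,t;L_3(\Omega))}^2+c_1^2\|f\|_{L_2(0,t;L_3(\Omega))}^2\big)\big]\\&\cdot\big[c_1^2\|g\|_{L_2(0,t;L_{6/5}(\Omega))}^2+c_1^2\|f_3\|_{L_2(0,t;L_{4/3}(S_2))}^2+\|h(0)\|_{L_2(\Omega)}^2+\|\vartheta(0)\|_{L_2(\Omega)}^2\big].\end{aligned}\tag{3.2}$$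 -/

import Mathlib

open Set Filter Topology MeasureTheory
open scoped ENNReal NNReal

noncomputable section

/-- The plane of the cross section. -/
abbrev E2 : Type := EuclideanSpace ℝ (Fin 2)

/-- The physical space; the coordinates `x₁, x₂, x₃` have the indices `0, 1, 2`. -/
abbrev E3 : Type := EuclideanSpace ℝ (Fin 3)

/-- The projection `(x₁, x₂, x₃) ↦ (x₁, x₂)`. -/
def horiz (x : E3) : E2 := !₂[x 0, x 1]

/-- The point `(x', s)` of space over the point `x'` of the plane. -/
def liftPt (x' : E2) (s : ℝ) : E3 := !₂[x' 0, x' 1, s]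

/-- A bounded straight cylinder `{φ₀(x₁, x₂) < c⋆, -b < x₃ < b}` over a bounded plane domain
whose boundary is the regular `C²` level set `{φ₀ = c⋆}`. -/
structure Cylinder where
  φ₀ : E2 → ℝ
  cstar : ℝ
  b : ℝ
  b_pos : 0 < b
  contDiff : ContDiff ℝ 2 φ₀
  regular : ∀ y, φ₀ y = cstar → gradient φ₀ y ≠ 0
  connected : IsConnected {y | φ₀ y < cstar}
  bounded : Bornology.IsBounded {y | φ₀ y < cstar}

namespace Cylinder

variable (C : Cylinder)

/-- The cross section. -/
def ω : Set E2 := {y | C.φ₀ y < C.cstar}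

/-- The cylinder. -/
def Ω : Set E3 := {x | horiz x ∈ C.ω ∧ -C.b < x 2 ∧ x 2 < C.b}

/-- The lateral boundary. -/
def S₁ : Set E3 := {x | C.φ₀ (horiz x) = C.cstar ∧ -C.b < x 2 ∧ x 2 < C.b}

/-- The bottom and the top. -/
def S₂ : Set E3 := {x | horiz x ∈ C.ω ∧ (x 2 = -C.b ∨ x 2 = C.b)}

/-- The unit outward normal on the lateral boundary. -/
def normal₁ (x : E3) : E3 :=
  ‖gradient C.φ₀ (horiz x)‖⁻¹ • liftPt (gradient C.φ₀ (horiz x)) 0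

/-- The unit outward normal on the bottom and the top. -/
def normal₂ (x : E3) : E3 := if x 2 = C.b then !₂[0, 0, 1] else !₂[0, 0, -1]

/-- Lebesgue measure on the cylinder. -/
def vol : Measure E3 := volume.restrict C.Ω

/-- The surface measure of the bottom and the top. -/
def surf₂ : Measure E3 :=
  Measure.map (fun y => liftPt y (-C.b)) (volume.restrict C.ω) +
    Measure.map (fun y => liftPt y C.b) (volume.restrict C.ω)

/-- Lebesgue measure on the space-time cylinder `Ω × (0, T)` (the time is the first variable). -/
def volT (T : ℝ) : Measure (ℝ × E3) := (volume.restrict (Ioo 0 T)).prod C.vol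

/-- The cylinder is a solid of revolution: its cross section is invariant under all rotations
about some point `a` of the plane. -/
def AxiallySymmetric : Prop :=
  ∃ a : E2, ∀ s : ℝ, ∀ y ∈ C.ω,
    (!₂[a 0 + Real.cos s * (y 0 - a 0) - Real.sin s * (y 1 - a 1),
        a 1 + Real.sin s * (y 0 - a 0) + Real.cos s * (y 1 - a 1)] : E2) ∈ C.ω

/-- The partial derivative `w_{,x_i}` of a scalar function on the closed cylinder. -/
def pd (i : Fin 3) (w : E3 → ℝ) (x : E3) : ℝ :=
  fderivWithin ℝ w (closure C.Ω) x (EuclideanSpace.single i 1)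

/-- The gradient of a scalar function. -/
def grad (w : E3 → ℝ) (x : E3) : EuclideanSpace ℝ (Fin 3) :=
  WithLp.toLp 2 fun i => C.pd i w x

/-- The gradient `(u_{i,x_j})` of a vector field, with the Frobenius norm. -/
def gradVec (u : E3 → E3) (x : E3) : EuclideanSpace ℝ (Fin 3 × Fin 3) :=
  WithLp.toLp 2 fun ij => C.pd ij.2 (fun y => u y ij.1) x

def divergence (u : E3 → E3) (x : E3) : ℝ := ∑ i, C.pd i (fun y => u y i) x

def laplacian (w : E3 → ℝ) (x : E3) : ℝ := ∑ i, C.pd i (C.pd i w) x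

/-- `u · ∇ w`. -/
def convect (u : E3 → E3) (w : E3 → ℝ) (x : E3) : ℝ := ∑ j, u x j * C.pd j w x

/-- The dilatation tensor `D(u) = (u_{i,x_j} + u_{j,x_i})`. -/
def dil (u : E3 → E3) (x : E3) (i j : Fin 3) : ℝ :=
  C.pd j (fun y => u y i) x + C.pd i (fun y => u y j) x

/-- The stress tensor `T(u, p) = ν D(u) - p I`. -/
def stress (ν : ℝ) (u : E3 → E3) (p : E3 → ℝ) (x : E3) (i j : Fin 3) : ℝ :=
  ν * C.dil u x i j - if i = j then p x else 0

/-- The `i`-th component of `div T(u, p)`. -/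
def divStress (ν : ℝ) (u : E3 → E3) (p : E3 → ℝ) (x : E3) (i : Fin 3) : ℝ :=
  ∑ j, C.pd j (fun y => C.stress ν u p y i j) x

/-- `n · D(u) · τ = 0` at `x` for all vectors `τ` orthogonal to `n`. -/
def SlipAt (n : E3) (u : E3 → E3) (x : E3) : Prop :=
  ∀ τ : E3, inner ℝ n τ = 0 → ∑ i, ∑ j, n i * C.dil u x i j * τ j = 0

/-- `u` is of class `C^{2,1}` in `(x, t)` on `closure Ω × (0, T)`. -/
structure IsC21 {F : Type*} [NormedAddCommGroup F] [NormedSpace ℝ F] (T : ℝ)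
    (u : ℝ → E3 → F) : Prop where
  contDiffOn : ∀ t ∈ Ioo 0 T, ContDiffOn ℝ 2 (u t) (closure C.Ω)
  differentiableAt : ∀ x ∈ closure C.Ω, ∀ t ∈ Ioo 0 T, DifferentiableAt ℝ (fun s => u s x) t
  cont : ContinuousOn (fun z : ℝ × E3 => u z.1 z.2) (Ioo 0 T ×ˢ closure C.Ω)
  cont_dx : ContinuousOn (fun z : ℝ × E3 => fderivWithin ℝ (u z.1) (closure C.Ω) z.2)
    (Ioo 0 T ×ˢ closure C.Ω)
  cont_dxx : ContinuousOn (fun z : ℝ × E3 =>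
      fderivWithin ℝ (fderivWithin ℝ (u z.1) (closure C.Ω)) (closure C.Ω) z.2)
    (Ioo 0 T ×ˢ closure C.Ω)
  cont_dt : ContinuousOn (fun z : ℝ × E3 => deriv (fun s => u s z.2) z.1)
    (Ioo 0 T ×ˢ closure C.Ω)

/-- `u` is of class `C^{1,0}` in `(x, t)` on `closure Ω × (0, T)`. -/
structure IsC10 (T : ℝ) (u : ℝ → E3 → ℝ) : Prop where
  contDiffOn : ∀ t ∈ Ioo 0 T, ContDiffOn ℝ 1 (u t) (closure C.Ω)
  cont : ContinuousOn (fun z : ℝ × E3 => u z.1 z.2) (Ioo 0 T ×ˢ closure C.Ω)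
  cont_dx : ContinuousOn (fun z : ℝ × E3 => fderivWithin ℝ (u z.1) (closure C.Ω) z.2)
    (Ioo 0 T ×ˢ closure C.Ω)

/-- The initial condition `u|_{t=0} = u₀`: `u(t) → u₀` in `L₂(Ω)` as `t → 0+`. -/
def HasInitial {F : Type*} [NormedAddCommGroup F] (u : ℝ → E3 → F) (u₀ : E3 → F) : Prop :=
  Tendsto (fun t => eLpNorm (fun x => u t x - u₀ x) 2 C.vol) (𝓝[>] 0) (𝓝 0)

/-- `g = f_{,x_3}` in `Ω × (0, T)`: along almost every vertical segment, ends included,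
`f` is absolutely continuous and `g` is its derivative. (So `f` is the representative
whose values on `S₂` are its trace.) -/
def IsX3Deriv (T : ℝ) (f g : ℝ → E3 → E3) : Prop :=
  ∀ᵐ z ∂((volume.restrict (Ioo 0 T)).prod (volume.restrict C.ω)),
    IntervalIntegrable (fun s => g z.1 (liftPt z.2 s)) volume (-C.b) C.b ∧
    ∀ s₁ ∈ Icc (-C.b) C.b, ∀ s₂ ∈ Icc (-C.b) C.b,
      f z.1 (liftPt z.2 s₂) - f z.1 (liftPt z.2 s₁) = ∫ s in s₁..s₂, g z.1 (liftPt z.2 s)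

/-- The Navier–Stokes equations with slip boundary conditions, coupled with the heat equation
with the Neumann condition, for the velocity `v`, the pressure `p` and the temperature `θ`. -/
structure SolvesNSHeat (T ν κ : ℝ) (α : ℝ → ℝ) (f : ℝ → E3 → E3) (v : ℝ → E3 → E3)
    (p θ : ℝ → E3 → ℝ) (v₀ : E3 → E3) (θ₀ : E3 → ℝ) : Prop where
  momentum : ∀ᵐ z ∂(C.volT T), ∀ i,
    deriv (fun s => v s z.2 i) z.1 + C.convect (v z.1) (fun y => v z.1 y i) z.2
      - C.divStress ν (v z.1) (p z.1) z.2 i = α (θ z.1 z.2) * f z.1 z.2 i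
  div_free : ∀ t ∈ Ioo 0 T, ∀ x ∈ C.Ω, C.divergence (v t) x = 0
  heat : ∀ t ∈ Ioo 0 T, ∀ x ∈ C.Ω,
    deriv (fun s => θ s x) t + C.convect (v t) (θ t) x - κ * C.laplacian (θ t) x = 0
  slip₁ : ∀ t ∈ Ioo 0 T, ∀ x ∈ C.S₁, C.SlipAt (C.normal₁ x) (v t) x
  slip₂ : ∀ t ∈ Ioo 0 T, ∀ x ∈ C.S₂, C.SlipAt (C.normal₂ x) (v t) x
  impermeable₁ : ∀ t ∈ Ioo 0 T, ∀ x ∈ C.S₁, inner ℝ (C.normal₁ x) (v t x) = 0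
  impermeable₂ : ∀ t ∈ Ioo 0 T, ∀ x ∈ C.S₂, inner ℝ (C.normal₂ x) (v t x) = 0
  neumann₁ : ∀ t ∈ Ioo 0 T, ∀ x ∈ C.S₁, inner ℝ (C.normal₁ x) (C.grad (θ t) x) = 0
  neumann₂ : ∀ t ∈ Ioo 0 T, ∀ x ∈ C.S₂, inner ℝ (C.normal₂ x) (C.grad (θ t) x) = 0
  initial_v : C.HasInitial v v₀
  initial_θ : C.HasInitial θ θ₀

/-- The problem for `h = v_{,x_3}`, `q = p_{,x_3}` (with `g = f_{,x_3}`, `ϑ = θ_{,x_3}`). -/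
structure SolvesH (T ν : ℝ) (α : ℝ → ℝ) (f g : ℝ → E3 → E3) (v : ℝ → E3 → E3)
    (θ ϑ : ℝ → E3 → ℝ) (h : ℝ → E3 → E3) (q : ℝ → E3 → ℝ) (h₀ : E3 → E3) : Prop where
  momentum : ∀ᵐ z ∂(C.volT T), ∀ i,
    deriv (fun s => h s z.2 i) z.1 - C.divStress ν (h z.1) (q z.1) z.2 i
      = -C.convect (v z.1) (fun y => h z.1 y i) z.2
        - C.convect (h z.1) (fun y => v z.1 y i) z.2
        + deriv α (θ z.1 z.2) * ϑ z.1 z.2 * f z.1 z.2 i + α (θ z.1 z.2) * g z.1 z.2 i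
  div_free : ∀ t ∈ Ioo 0 T, ∀ x ∈ C.Ω, C.divergence (h t) x = 0
  impermeable₁ : ∀ t ∈ Ioo 0 T, ∀ x ∈ C.S₁, inner ℝ (C.normal₁ x) (h t x) = 0
  slip₁ : ∀ t ∈ Ioo 0 T, ∀ x ∈ C.S₁, C.SlipAt (C.normal₁ x) (h t) x
  dirichlet₂ : ∀ t ∈ Ioo 0 T, ∀ x ∈ C.S₂, h t x 0 = 0 ∧ h t x 1 = 0
  neumann₂ : ∀ t ∈ Ioo 0 T, ∀ x ∈ C.S₂, C.pd 2 (fun y => h t y 2) x = 0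
  initial : C.HasInitial h h₀

/-- The problem for `ϑ = θ_{,x_3}`. -/
structure SolvesTheta (T κ : ℝ) (v h : ℝ → E3 → E3) (θ ϑ : ℝ → E3 → ℝ)
    (ϑ₀ : E3 → ℝ) : Prop where
  heat : ∀ t ∈ Ioo 0 T, ∀ x ∈ C.Ω,
    deriv (fun s => ϑ s x) t + C.convect (v t) (ϑ t) x + C.convect (h t) (θ t) x
      - κ * C.laplacian (ϑ t) x = 0
  neumann₁ : ∀ t ∈ Ioo 0 T, ∀ x ∈ C.S₁, inner ℝ (C.normal₁ x) (C.grad (ϑ t) x) = 0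
  dirichlet₂ : ∀ t ∈ Ioo 0 T, ∀ x ∈ C.S₂, ϑ t x = 0
  initial : C.HasInitial ϑ ϑ₀

end Cylinder

/-- The norm of `L_q(0, t; L_p(μ))`, with values in `[0, ∞]`. -/
def mixedNorm {X F : Type*} [MeasurableSpace X] [NormedAddCommGroup F] (q p : ℝ≥0∞)
    (μ : Measure X) (t : ℝ) (u : ℝ → X → F) : ℝ≥0∞ :=
  eLpNorm (fun s => eLpNorm (u s) p μ) q (volume.restrict (Ioo 0 t))

/-- The norm of `V_2^0(Ω × (0, t))` of a vector field. -/
def Cylinder.normV (C : Cylinder) (t : ℝ) (u : ℝ → E3 → E3) : ℝ≥0∞ :=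
  mixedNorm ∞ 2 C.vol t u + mixedNorm 2 2 C.vol t (fun s => C.gradVec (u s))

/-- The norm of `V_2^0(Ω × (0, t))` of a scalar function. -/
def Cylinder.normVScalar (C : Cylinder) (t : ℝ) (w : ℝ → E3 → ℝ) : ℝ≥0∞ :=
  mixedNorm ∞ 2 C.vol t w + mixedNorm 2 2 C.vol t (fun s => C.grad (w s))

/-- `a(x) = sup {|α(y)| + |α'(y)| : |y| ≤ x}`. -/
def aFun (α : ℝ → ℝ) (x : ℝ) : ℝ := sSup ((fun y => |α y| + |deriv α y|) '' {y | |y| ≤ x})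

end

noncomputable section

/-! ### Geometry of the closed cylinder. -/

namespace Cylinder

/-- The projection `horiz` as a continuous linear map. -/
def horizL : E3 →L[ℝ] E2 :=
  LinearMap.toContinuousLinearMap
    { toFun := horiz
      map_add' := by intro x y; ext i; fin_cases i <;> simp [horiz]
      map_smul' := by intro c x; ext i; fin_cases i <;> simp [horiz] }

theorem contDiff_horiz {n : WithTop ℕ∞} : ContDiff ℝ n horiz := horizL.contDiff

theorem continuous_horiz : Continuous horiz := horizL.continuous

theorem contDiff_coord {n : WithTop ℕ∞} (i : Fin 3) : ContDiff ℝ n (fun x : E3 => x i) :=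
  (EuclideanSpace.proj (𝕜 := ℝ) i).contDiff

variable (C : Cylinder)

/-- The functions `c⋆ - φ₀(x₁, x₂)` and `b² - x₃²`, which are positive exactly in the cylinder. -/
def rho (k : Fin 2) (x : E3) : ℝ :=
  if k = 0 then C.cstar - C.φ₀ (horiz x) else C.b ^ 2 - x 2 ^ 2

theorem rho_zero (x : E3) : C.rho 0 x = C.cstar - C.φ₀ (horiz x) := by simp [rho]
theorem rho_one (x : E3) : C.rho 1 x = C.b ^ 2 - x 2 ^ 2 := by simp [rho]

theorem contDiff_rho (k : Fin 2) : ContDiff ℝ 2 (C.rho k) := by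
  fin_cases k
  · have : C.rho 0 = fun x => C.cstar - C.φ₀ (horiz x) := funext C.rho_zero
    change ContDiff ℝ 2 (C.rho 0)
    rw [this]
    exact contDiff_const.sub (C.contDiff.comp contDiff_horiz)
  · have : C.rho 1 = fun x => C.b ^ 2 - x 2 ^ 2 := funext C.rho_one
    change ContDiff ℝ 2 (C.rho 1)
    rw [this]
    exact contDiff_const.sub ((contDiff_coord 2).pow 2)

theorem continuous_rho (k : Fin 2) : Continuous (C.rho k) := (C.contDiff_rho k).continuous

theorem differentiable_rho (k : Fin 2) : Differentiable ℝ (C.rho k) :=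
  (C.contDiff_rho k).differentiable (by norm_num)

theorem mem_Ω_iff (x : E3) : x ∈ C.Ω ↔ ∀ k, 0 < C.rho k x := by
  have hb := C.b_pos
  rw [Fin.forall_fin_two, rho_zero, rho_one]
  constructor
  · rintro ⟨h1, h2, h3⟩
    have h1' : C.φ₀ (horiz x) < C.cstar := h1
    exact ⟨by linarith, by nlinarith⟩
  · rintro ⟨h1, h2⟩
    have := abs_lt_of_sq_lt_sq (a := x 2) (b := C.b) (by linarith) hb.le
    exact ⟨by change C.φ₀ (horiz x) < C.cstar; linarith, (abs_lt.1 this).1, (abs_lt.1 this).2⟩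

theorem isOpen_Ω : IsOpen C.Ω := by
  have : C.Ω = ⋂ k, {x | 0 < C.rho k x} := by
    ext x; simp [mem_Ω_iff]
  rw [this]
  exact isOpen_iInter_of_finite fun k => isOpen_lt continuous_const (C.continuous_rho k)

theorem measurableSet_Ω : MeasurableSet C.Ω := C.isOpen_Ω.measurableSet

theorem isOpen_ω : IsOpen C.ω := isOpen_lt C.contDiff.continuous continuous_const

theorem norm_sq_eq_horiz (x : E3) : ‖x‖ ^ 2 = ‖horiz x‖ ^ 2 + x 2 ^ 2 := by
  simp [EuclideanSpace.norm_sq_eq, Fin.sum_univ_three, Fin.sum_univ_two, horiz]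

theorem isBounded_Ω : Bornology.IsBounded C.Ω := by
  obtain ⟨R, hR⟩ := C.bounded.exists_norm_le
  rw [isBounded_iff_forall_norm_le]
  refine ⟨R + C.b, fun x hx => ?_⟩
  have h1 : ‖horiz x‖ ≤ R := hR _ hx.1
  have h0 := norm_nonneg (horiz x)
  have hb := C.b_pos
  have h2 : x 2 ^ 2 ≤ C.b ^ 2 := by have := hx.2.1; have := hx.2.2; nlinarith
  have := norm_sq_eq_horiz x
  apply abs_le_of_sq_le_sq' _ (by linarith) |>.2
  nlinarith

theorem isCompact_closure_Ω : IsCompact (closure C.Ω) := C.isBounded_Ω.isCompact_closure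

theorem closure_Ω_subset : closure C.Ω ⊆ {x | ∀ k, 0 ≤ C.rho k x} := by
  have : IsClosed {x | ∀ k, 0 ≤ C.rho k x} := by
    simp only [ofPred_forall]
    exact isClosed_iInter fun k => isClosed_le continuous_const (C.continuous_rho k)
  exact closure_minimal (fun x hx k => ((C.mem_Ω_iff x).1 hx k).le) this

/-- The gradients of the functions `rho`. -/
def gradRho (k : Fin 2) (x : E3) : E3 := gradient (C.rho k) x

theorem fderiv_rho (k : Fin 2) (x d : E3) :
    fderiv ℝ (C.rho k) x d = inner ℝ (C.gradRho k x) d := by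
  simp [gradRho, gradient]

theorem contDiff_gradRho (k : Fin 2) : ContDiff ℝ 1 (C.gradRho k) := by
  have h : ContDiff ℝ 1 (fderiv ℝ (C.rho k)) := (C.contDiff_rho k).fderiv_right (by norm_num)
  exact ((InnerProductSpace.toDual ℝ E3).symm.toContinuousLinearEquiv.contDiff).comp h

theorem hasFDerivAt_rho_zero (x : E3) :
    HasFDerivAt (C.rho 0) (-((fderiv ℝ C.φ₀ (horiz x)).comp horizL)) x := by
  have h0 : C.rho 0 = fun x => C.cstar - C.φ₀ (horiz x) := funext C.rho_zero
  rw [h0]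
  have h1 : HasFDerivAt C.φ₀ (fderiv ℝ C.φ₀ (horiz x)) (horiz x) :=
    (C.contDiff.differentiable (by norm_num) _).hasFDerivAt
  exact (h1.comp x (horizL.hasFDerivAt)).const_sub _

theorem fderiv_rho_zero (x d : E3) :
    fderiv ℝ (C.rho 0) x d = -fderiv ℝ C.φ₀ (horiz x) (horiz d) := by
  rw [(C.hasFDerivAt_rho_zero x).fderiv]; rfl

theorem fderiv_rho_one (x d : E3) : fderiv ℝ (C.rho 1) x d = -(2 * x 2 * d 2) := by
  have h0 : C.rho 1 = fun x => C.b ^ 2 - x 2 ^ 2 := funext C.rho_one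
  have h1 : HasFDerivAt (fun x : E3 => x 2) (EuclideanSpace.proj (𝕜 := ℝ) (2 : Fin 3)) x :=
    (EuclideanSpace.proj (𝕜 := ℝ) (2 : Fin 3)).hasFDerivAt
  rw [h0, ((h1.pow 2).const_sub _).fderiv]
  simp

theorem gradRho_one (x : E3) : C.gradRho 1 x = !₂[0, 0, -(2 * x 2)] := by
  refine ext_inner_right ℝ fun d => ?_
  rw [← fderiv_rho, fderiv_rho_one]
  simp [PiLp.inner_apply, Fin.sum_univ_three]
  ring

theorem gradRho_zero (x : E3) : C.gradRho 0 x = -liftPt (gradient C.φ₀ (horiz x)) 0 := by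
  refine ext_inner_right ℝ fun d => ?_
  have : fderiv ℝ C.φ₀ (horiz x) (horiz d) = inner ℝ (gradient C.φ₀ (horiz x)) (horiz d) := by
    simp [gradient]
  rw [← fderiv_rho, fderiv_rho_zero, this]
  generalize gradient C.φ₀ (horiz x) = G
  simp [PiLp.inner_apply, Fin.sum_univ_three, Fin.sum_univ_two, liftPt, horiz]

/-- One gradient is horizontal, the other vertical. Orthogonality lets the two faces be treated
independently, even along the edge where they meet. -/
theorem inner_gradRho (x : E3) {j k : Fin 2} (hjk : j ≠ k) :
    inner ℝ (C.gradRho j x) (C.gradRho k x) = 0 := by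
  have h : inner ℝ (C.gradRho 0 x) (C.gradRho 1 x) = 0 := by
    rw [gradRho_zero, gradRho_one]
    simp [PiLp.inner_apply, Fin.sum_univ_three, liftPt]
  fin_cases j <;> fin_cases k
  · simp at hjk
  · exact h
  · change inner ℝ (C.gradRho 1 x) (C.gradRho 0 x) = 0
    rw [real_inner_comm]; exact h
  · simp at hjk

theorem gradRho_ne_zero {k : Fin 2} {x : E3} (hx : C.rho k x = 0) : C.gradRho k x ≠ 0 := by
  fin_cases k
  · change C.rho 0 x = 0 at hx
    change C.gradRho 0 x ≠ 0
    rw [rho_zero] at hx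
    have h := C.regular (horiz x) (by linarith)
    intro h0
    apply h
    rw [gradRho_zero, neg_eq_zero] at h0
    ext i
    fin_cases i
    · simpa [liftPt] using congrFun (congrArg WithLp.ofLp h0) 0
    · simpa [liftPt] using congrFun (congrArg WithLp.ofLp h0) 1
  · change C.rho 1 x = 0 at hx
    change C.gradRho 1 x ≠ 0
    intro h0
    rw [gradRho_one] at h0
    have h2 := congrFun (congrArg WithLp.ofLp h0) 2
    simp at h2
    rw [rho_one, h2] at hx
    have := C.b_pos
    nlinarith

/-- Rays from a point of `{rho ≥ 0}` with directions in a nonempty open set enter the cylinder. -/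
theorem eventually_ray_mem {x : E3} (hx : ∀ k, 0 ≤ C.rho k x) :
    ∃ U : Set E3, IsOpen U ∧ U.Nonempty ∧
      ∀ d ∈ U, ∀ᶠ s in 𝓝[>] (0 : ℝ), x + s • d ∈ C.Ω := by
  refine ⟨⋂ k, {d | C.rho k x = 0 → 0 < fderiv ℝ (C.rho k) x d}, ?_, ?_, ?_⟩
  · refine isOpen_iInter_of_finite fun k => ?_
    by_cases h : C.rho k x = 0
    · simp only [h, true_imp_iff]
      exact isOpen_lt continuous_const (fderiv ℝ (C.rho k) x).continuous
    · simp [h]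
  -- By orthogonality the sum of the gradients increases every `rho k` that vanishes at `x`, so it
  -- points inward also at the edge.
  · refine ⟨∑ k, C.gradRho k x, mem_iInter.2 fun k hk => ?_⟩
    rw [fderiv_rho, inner_sum]
    have h0 := C.gradRho_ne_zero hk
    have h1 : 0 < inner ℝ (C.gradRho k x) (C.gradRho k x) := by
      rw [real_inner_self_eq_norm_sq]; positivity
    rw [Finset.sum_eq_single k (fun j _ hj => C.inner_gradRho x hj.symm) (by simp)]
    exact h1
  · intro d hd
    simp only [mem_Ω_iff]
    rw [eventually_all]
    intro k
    have hk := mem_iInter.1 hd k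
    rcases (hx k).lt_or_eq with h | h
    · have hc : ContinuousAt (fun s : ℝ => C.rho k (x + s • d)) 0 :=
        ((C.continuous_rho k).comp (by fun_prop)).continuousAt
      have := hc.eventually (lt_mem_nhds (a := 0) (by simpa using h))
      exact this.filter_mono nhdsWithin_le_nhds
    · have hd0 := hk h.symm
      have hder : HasDerivAt (fun s : ℝ => C.rho k (x + s • d)) (fderiv ℝ (C.rho k) x d) 0 := by
        have h1 : HasFDerivAt (C.rho k) (fderiv ℝ (C.rho k) x) (x + (0 : ℝ) • d) := by
          simpa using (C.differentiable_rho k x).hasFDerivAt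
        have h2 : HasDerivAt (fun s : ℝ => x + s • d) d 0 := by
          simpa using ((hasDerivAt_id (0 : ℝ)).smul_const d).const_add x
        exact h1.comp_hasDerivAt 0 h2
      have := hder.tendsto_slope_zero_right.eventually (lt_mem_nhds hd0)
      filter_upwards [this, self_mem_nhdsWithin] with s hs hs0
      simp only [zero_add, zero_smul, add_zero, ← h, sub_zero, smul_eq_mul] at hs
      have hs0' : (0 : ℝ) < s := hs0
      exact (mul_pos_iff_of_pos_left (inv_pos.2 hs0')).1 hs

theorem closure_Ω_eq : closure C.Ω = {x | ∀ k, 0 ≤ C.rho k x} := by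
  refine subset_antisymm C.closure_Ω_subset fun x hx => ?_
  obtain ⟨U, -, ⟨d, hd⟩, hU⟩ := C.eventually_ray_mem hx
  have ht : Tendsto (fun s : ℝ => x + s • d) (𝓝[>] 0) (𝓝 x) := by
    have : Continuous fun s : ℝ => x + s • d := by fun_prop
    simpa using (this.tendsto 0).mono_left nhdsWithin_le_nhds
  exact mem_closure_of_tendsto ht (hU d hd)

theorem mem_closure_iff' (x : E3) :
    x ∈ closure C.Ω ↔ C.φ₀ (horiz x) ≤ C.cstar ∧ -C.b ≤ x 2 ∧ x 2 ≤ C.b := by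
  rw [closure_Ω_eq, mem_ofPred_eq, Fin.forall_fin_two, rho_zero, rho_one]
  have hb := C.b_pos
  refine and_congr (by constructor <;> intro h <;> linarith) ?_
  rw [sub_nonneg, sq_le_sq, abs_of_pos hb, abs_le]

/-- The directions of entering rays contain a nonempty open set, which spans the space. Hence
`fderivWithin` on the closed cylinder is determined, and the calculus of `pd` extends up to the
boundary. -/
theorem uniqueDiffOn_closure_Ω : UniqueDiffOn ℝ (closure C.Ω) := by
  intro x hx
  obtain ⟨U, hU, hne, h⟩ := C.eventually_ray_mem (C.closure_Ω_subset hx)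
  refine ⟨?_, subset_closure hx⟩
  have hsub : U ⊆ Submodule.span ℝ (tangentConeAt ℝ (closure C.Ω) x) := by
    intro d hd
    refine Submodule.subset_span ?_
    refine mem_tangentConeAt_of_add_smul_mem (l := 𝓝[>] (0 : ℝ)) (c := id) ?_ ?_
    · exact tendsto_id.mono_left (nhdsWithin_mono _ (fun y hy => ne_of_gt hy))
    · filter_upwards [h d hd] with s hs using subset_closure hs
  have : Submodule.span ℝ (tangentConeAt ℝ (closure C.Ω) x) = ⊤ :=
    Submodule.eq_top_of_nonempty_interior' _
      (hne.mono (interior_maximal hsub hU))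
  rw [this]
  exact dense_univ

theorem fderivWithin_eq {F : Type*} [NormedAddCommGroup F] [NormedSpace ℝ F] (w : E3 → F)
    {x : E3} (hx : x ∈ C.Ω) : fderivWithin ℝ w (closure C.Ω) x = fderiv ℝ w x :=
  fderivWithin_of_mem_nhds (mem_of_superset (C.isOpen_Ω.mem_nhds hx) subset_closure)

theorem closure_mem_nhds {x : E3} (hx : x ∈ C.Ω) : closure C.Ω ∈ 𝓝 x :=
  mem_of_superset (C.isOpen_Ω.mem_nhds hx) subset_closure

instance : IsFiniteMeasure C.vol :=
  ⟨by rw [vol, Measure.restrict_apply_univ]; exact C.isBounded_Ω.measure_lt_top⟩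

theorem ae_mem_Ω : ∀ᵐ x ∂C.vol, x ∈ C.Ω := ae_restrict_mem C.measurableSet_Ω

theorem aestronglyMeasurable_of_continuousOn {F : Type*} [NormedAddCommGroup F]
    {w : E3 → F} (hw : ContinuousOn w (closure C.Ω)) : AEStronglyMeasurable w C.vol :=
  (hw.mono subset_closure).aestronglyMeasurable C.measurableSet_Ω

theorem exists_bound_of_continuousOn {F : Type*} [NormedAddCommGroup F]
    {w : E3 → F} (hw : ContinuousOn w (closure C.Ω)) :
    ∃ B, 0 ≤ B ∧ ∀ x ∈ closure C.Ω, ‖w x‖ ≤ B := by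
  obtain ⟨B, hB⟩ := C.isCompact_closure_Ω.exists_bound_of_continuousOn hw
  exact ⟨max B 0, le_max_right _ _, fun x hx => (hB x hx).trans (le_max_left _ _)⟩

theorem memLp_of_continuousOn {F : Type*} [NormedAddCommGroup F]
    {w : E3 → F} (hw : ContinuousOn w (closure C.Ω)) (p : ℝ≥0∞) : MemLp w p C.vol := by
  obtain ⟨B, -, hB⟩ := C.exists_bound_of_continuousOn hw
  refine MemLp.of_bound (C.aestronglyMeasurable_of_continuousOn hw) B ?_
  filter_upwards [C.ae_mem_Ω] with x hx using hB x (subset_closure hx)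

theorem integrable_of_continuousOn {F : Type*} [NormedAddCommGroup F]
    {w : E3 → F} (hw : ContinuousOn w (closure C.Ω)) : Integrable w C.vol :=
  memLp_one_iff_integrable.1 (C.memLp_of_continuousOn hw 1)

end Cylinder

/-! ### Cutoff functions and the divergence theorem. -/

/-- A smooth monotone transition from `0` on `(-∞, 1/2]` to `1` on `[1, ∞)`. -/
def chi (s : ℝ) : ℝ := Real.smoothTransition (2 * s - 1)

theorem contDiff_chi : ContDiff ℝ 2 chi :=
  (Real.smoothTransition.contDiff (n := 2)).comp (by fun_prop)

theorem chi_nonneg (s : ℝ) : 0 ≤ chi s := Real.smoothTransition.nonneg _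
theorem chi_le_one (s : ℝ) : chi s ≤ 1 := Real.smoothTransition.le_one _
theorem chi_of_le {s : ℝ} (h : s ≤ 1 / 2) : chi s = 0 :=
  Real.smoothTransition.zero_of_nonpos (by linarith)
theorem chi_of_one_le {s : ℝ} (h : 1 ≤ s) : chi s = 1 :=
  Real.smoothTransition.one_of_one_le (by linarith)

theorem monotone_chi : Monotone chi := fun a b h =>
  Real.smoothTransition.monotone (by linarith)

theorem continuous_deriv_chi : Continuous (deriv chi) :=
  contDiff_chi.continuous_deriv (by norm_num)

theorem deriv_chi_nonneg (s : ℝ) : 0 ≤ deriv chi s := monotone_chi.deriv_nonneg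

theorem deriv_chi_of_one_le {s : ℝ} (h : 1 ≤ s) : deriv chi s = 0 := by
  refine IsLocalMax.deriv_eq_zero (Eventually.of_forall fun x => ?_)
  rw [chi_of_one_le h]; exact chi_le_one x

theorem clm_apply_eq_sum (L : E3 →L[ℝ] ℝ) (d : E3) :
    L d = ∑ i, d i * L (EuclideanSpace.single i 1) := by
  have h : d = ∑ i, d i • EuclideanSpace.single i (1 : ℝ) := by
    ext j; simp [Finset.sum_apply, Pi.single_apply]
  conv_lhs => rw [h]
  simp

theorem integral_fderiv_eq_zero {G : E3 → ℝ} (hG : ContDiff ℝ 1 G) (hc : HasCompactSupport G)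
    (v : E3) : ∫ x, fderiv ℝ G x v = 0 := by
  have hG' : Continuous fun x => fderiv ℝ G x v :=
    (hG.continuous_fderiv (by norm_num)).clm_apply continuous_const
  have hc' : HasCompactSupport fun x => fderiv ℝ G x v := hc.fderiv_apply (𝕜 := ℝ) v
  have := integral_mul_fderiv_eq_neg_fderiv_mul_of_integrable (μ := (volume : Measure E3))
    (f := fun _ : E3 => (1 : ℝ)) (g := G) (v := v) (by simp)
    (by simpa using hG'.integrable_of_hasCompactSupport hc')
    (by simpa using hG.continuous.integrable_of_hasCompactSupport hc)
    (fun x _ => by fun_prop) (fun x _ => hG.differentiable (by norm_num) x)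
  simpa using this

namespace Cylinder

variable (C : Cylinder)

theorem pd_eq {w : E3 → ℝ} {x : E3} (hx : x ∈ C.Ω) (i : Fin 3) :
    C.pd i w x = fderiv ℝ w x (EuclideanSpace.single i 1) := by
  rw [pd, C.fderivWithin_eq w hx]

theorem contDiff_mul_of_tsupport {η G : E3 → ℝ} (hη : ContDiff ℝ 1 η) (hs : tsupport η ⊆ C.Ω)
    (hG : ContDiffOn ℝ 1 G C.Ω) : ContDiff ℝ 1 fun x => η x * G x := by
  rw [contDiff_iff_contDiffAt]
  intro x
  by_cases hx : x ∈ tsupport η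
  · exact hη.contDiffAt.mul (hG.contDiffAt (C.isOpen_Ω.mem_nhds (hs hx)))
  · have : (fun x => η x * G x) =ᶠ[𝓝 x] fun _ => 0 := by
      have h0 := notMem_tsupport_iff_eventuallyEq.1 hx
      filter_upwards [h0] with y hy
      simp [hy]
    exact contDiffAt_const.congr_of_eventuallyEq this

theorem integral_cutoff_mul_fderiv {η G : E3 → ℝ} (hη : ContDiff ℝ 1 η)
    (hc : HasCompactSupport η) (hs : tsupport η ⊆ C.Ω) (hG : ContDiffOn ℝ 1 G C.Ω) (v : E3) :
    ∫ x, (η x * fderiv ℝ G x v + G x * fderiv ℝ η x v) ∂C.vol = 0 := by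
  have hH := C.contDiff_mul_of_tsupport hη hs hG
  have hHc : HasCompactSupport fun x => η x * G x := hc.mul_right
  have h0 := integral_fderiv_eq_zero hH hHc v
  rw [← setIntegral_eq_integral_of_forall_compl_eq_zero (s := C.Ω)] at h0
  · rw [← h0, vol]
    refine setIntegral_congr_fun C.measurableSet_Ω fun x hx => ?_
    have hd : DifferentiableAt ℝ G x :=
      (hG.contDiffAt (C.isOpen_Ω.mem_nhds hx)).differentiableAt (by norm_num)
    have := (hη.differentiable (by norm_num) x).hasFDerivAt.mul hd.hasFDerivAt
    simp only [Pi.mul_def] at this ⊢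
    rw [this.fderiv]
    simp
  · intro x hx
    have hx' : x ∉ tsupport (fun x => η x * G x) := fun h =>
      hx (hs (tsupport_mul_subset_left h))
    have : fderiv ℝ (fun x => η x * G x) x = 0 := by
      have h1 := notMem_tsupport_iff_eventuallyEq.1 hx'
      rw [h1.fderiv_eq]
      exact fderiv_const_apply 0
    rw [this]; rfl

/-- The cutoff function which vanishes near the boundary and is `1` where `rho ≥ δ`. -/
def cut (δ : ℝ) (x : E3) : ℝ := chi (C.rho 0 x / δ) * chi (C.rho 1 x / δ)

/-- The coefficients of `fderiv (cut δ)` with respect to `fderiv (rho k)`. -/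
def wt (δ : ℝ) (k : Fin 2) (x : E3) : ℝ :=
  deriv chi (C.rho k x / δ) / δ * chi (C.rho (1 - k) x / δ)

theorem contDiff_cut (δ : ℝ) : ContDiff ℝ 1 (C.cut δ) := by
  have h : ∀ k, ContDiff ℝ 2 fun x => chi (C.rho k x / δ) := fun k =>
    contDiff_chi.comp ((C.contDiff_rho k).div_const _)
  exact ((h 0).mul (h 1)).of_le (by norm_num)

theorem continuous_wt (δ : ℝ) (k : Fin 2) : Continuous (C.wt δ k) :=
  ((continuous_deriv_chi.comp ((C.continuous_rho k).div_const _)).div_const _).mul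
    (contDiff_chi.continuous.comp ((C.continuous_rho _).div_const _))

theorem wt_nonneg {δ : ℝ} (hδ : 0 < δ) (k : Fin 2) (x : E3) : 0 ≤ C.wt δ k x :=
  mul_nonneg (div_nonneg (deriv_chi_nonneg _) hδ.le) (chi_nonneg _)

theorem wt_eq_zero {δ : ℝ} (hδ : 0 < δ) {k : Fin 2} {x : E3} (h : δ ≤ C.rho k x) :
    C.wt δ k x = 0 := by
  rw [wt, deriv_chi_of_one_le ((one_le_div hδ).2 h)]; simp

theorem cut_nonneg (δ : ℝ) (x : E3) : 0 ≤ C.cut δ x := mul_nonneg (chi_nonneg _) (chi_nonneg _)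

theorem cut_le_one (δ : ℝ) (x : E3) : C.cut δ x ≤ 1 :=
  mul_le_one₀ (chi_le_one _) (chi_nonneg _) (chi_le_one _)

theorem cut_eq_one {δ : ℝ} (hδ : 0 < δ) {x : E3} (h : ∀ k, δ ≤ C.rho k x) : C.cut δ x = 1 := by
  rw [cut, chi_of_one_le ((one_le_div hδ).2 (h 0)), chi_of_one_le ((one_le_div hδ).2 (h 1)), one_mul]

theorem tsupport_cut_subset {δ : ℝ} (hδ : 0 < δ) :
    tsupport (C.cut δ) ⊆ {x | ∀ k, δ / 2 ≤ C.rho k x} := by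
  refine closure_minimal (fun x hx k => ?_) ?_
  · by_contra! hlt
    apply hx
    have hlt' : C.rho k x / δ ≤ 1 / 2 := by rw [div_le_iff₀ hδ]; linarith
    have h0 := chi_of_le hlt'
    fin_cases k
    · change chi (C.rho 0 x / δ) = 0 at h0; simp [cut, h0]
    · change chi (C.rho 1 x / δ) = 0 at h0; simp [cut, h0]
  · simp only [ofPred_forall]
    exact isClosed_iInter fun k => isClosed_le continuous_const (C.continuous_rho k)

theorem tsupport_cut_subset_Ω {δ : ℝ} (hδ : 0 < δ) : tsupport (C.cut δ) ⊆ C.Ω := by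
  intro x hx
  rw [mem_Ω_iff]
  intro k
  have := C.tsupport_cut_subset hδ hx k
  linarith

theorem hasCompactSupport_cut {δ : ℝ} (hδ : 0 < δ) : HasCompactSupport (C.cut δ) :=
  C.isCompact_closure_Ω.of_isClosed_subset (isClosed_tsupport _)
    ((C.tsupport_cut_subset_Ω hδ).trans subset_closure)

theorem fderiv_cut (δ : ℝ) (x d : E3) :
    fderiv ℝ (C.cut δ) x d = ∑ k, C.wt δ k x * fderiv ℝ (C.rho k) x d := by
  have h : ∀ k, HasFDerivAt (fun x => chi (C.rho k x / δ))
      ((deriv chi (C.rho k x / δ)) • (δ⁻¹ • fderiv ℝ (C.rho k) x)) x := fun k => by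
    have h1 : HasDerivAt chi (deriv chi (C.rho k x / δ)) (C.rho k x / δ) :=
      (contDiff_chi.differentiable (by norm_num) _).hasDerivAt
    have h2 : HasFDerivAt (fun x => C.rho k x / δ) (δ⁻¹ • fderiv ℝ (C.rho k) x) x := by
      simpa [div_eq_inv_mul] using (C.differentiable_rho k x).hasFDerivAt.const_mul δ⁻¹
    have h3 : HasFDerivAt (chi ∘ fun x => C.rho k x / δ) _ x := h1.comp_hasFDerivAt x h2
    exact h3
  have h2 := (h 0).mul (h 1)
  have h3 : C.cut δ = fun x => chi (C.rho 0 x / δ) * chi (C.rho 1 x / δ) := rfl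
  simp only [Pi.mul_def] at h2
  rw [h3, h2.fderiv, Fin.sum_univ_two]
  simp [wt]
  ring

theorem tendsto_cut {x : E3} (hx : x ∈ C.Ω) : Tendsto (fun δ => C.cut δ x) (𝓝[>] 0) (𝓝 1) := by
  rw [mem_Ω_iff] at hx
  have : ∀ k, ∀ᶠ δ in 𝓝[>] (0 : ℝ), δ ≤ C.rho k x := fun k =>
    (eventually_le_nhds (hx k)).filter_mono nhdsWithin_le_nhds
  refine tendsto_const_nhds.congr' ?_
  filter_upwards [eventually_all.2 this, self_mem_nhdsWithin] with δ h1 h2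
  exact (C.cut_eq_one h2 h1).symm

theorem contDiffOn_comp {F : E3 → E3} {n : WithTop ℕ∞} {s : Set E3} (hF : ContDiffOn ℝ n F s)
    (i : Fin 3) : ContDiffOn ℝ n (fun x => F x i) s :=
  (contDiff_coord i).comp_contDiffOn hF

theorem continuousOn_fderivWithin {w : E3 → ℝ} (hw : ContDiffOn ℝ 1 w (closure C.Ω)) :
    ContinuousOn (fderivWithin ℝ w (closure C.Ω)) (closure C.Ω) :=
  hw.continuousOn_fderivWithin C.uniqueDiffOn_closure_Ω (by norm_num)

theorem continuousOn_pd {w : E3 → ℝ} (hw : ContDiffOn ℝ 1 w (closure C.Ω)) (i : Fin 3) :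
    ContinuousOn (C.pd i w) (closure C.Ω) :=
  (C.continuousOn_fderivWithin hw).clm_apply continuousOn_const

theorem continuousOn_divergence {F : E3 → E3} (hF : ContDiffOn ℝ 1 F (closure C.Ω)) :
    ContinuousOn (C.divergence F) (closure C.Ω) :=
  continuousOn_finsetSum _ fun i _ => C.continuousOn_pd (contDiffOn_comp hF i) i

/-- The cutoff has compact support in the cylinder, so no boundary term appears. Its gradient lives
in thin layers along the two faces and plays the role of the surface integral as δ → 0. -/
theorem integral_cut_mul_divergence {F : E3 → E3} (hF : ContDiffOn ℝ 1 F (closure C.Ω))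
    {δ : ℝ} (hδ : 0 < δ) :
    ∫ x, C.cut δ x * C.divergence F x ∂C.vol =
      -∫ x, ∑ k, C.wt δ k x * fderiv ℝ (C.rho k) x (F x) ∂C.vol := by
  have hcomp := fun i => contDiffOn_comp hF i
  have h1 : ∀ i, ∫ x, (C.cut δ x * fderiv ℝ (fun y => F y i) x (EuclideanSpace.single i 1) +
      F x i * fderiv ℝ (C.cut δ) x (EuclideanSpace.single i 1)) ∂C.vol = 0 := fun i =>
    C.integral_cutoff_mul_fderiv (C.contDiff_cut δ) (C.hasCompactSupport_cut hδ)
      (C.tsupport_cut_subset_Ω hδ) ((hcomp i).mono subset_closure) _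
  have h1' : ∀ i, ∫ x, (C.cut δ x * C.pd i (fun y => F y i) x +
      F x i * fderiv ℝ (C.cut δ) x (EuclideanSpace.single i 1)) ∂C.vol = 0 := fun i => by
    rw [← h1 i]
    refine integral_congr_ae ?_
    filter_upwards [C.ae_mem_Ω] with x hx
    rw [C.pd_eq hx]
  have hcut := (C.contDiff_cut δ).continuous.continuousOn (s := closure C.Ω)
  have hcutd : Continuous (fderiv ℝ (C.cut δ)) :=
    (C.contDiff_cut δ).continuous_fderiv (by norm_num)
  have hsum : ∫ x, (C.cut δ x * C.divergence F x + fderiv ℝ (C.cut δ) x (F x)) ∂C.vol = 0 := by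
    have : ∀ x, C.cut δ x * C.divergence F x + fderiv ℝ (C.cut δ) x (F x) =
        ∑ i, (C.cut δ x * C.pd i (fun y => F y i) x +
          F x i * fderiv ℝ (C.cut δ) x (EuclideanSpace.single i 1)) := fun x => by
      rw [Finset.sum_add_distrib, ← clm_apply_eq_sum, divergence, Finset.mul_sum]
    simp only [this]
    rw [integral_finsetSum]
    · exact Finset.sum_eq_zero fun i _ => h1' i
    · intro i _
      refine C.integrable_of_continuousOn ?_
      exact (hcut.mul (C.continuousOn_pd (hcomp i) i)).add
        ((hcomp i).continuousOn.mul (hcutd.clm_apply continuous_const).continuousOn)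
  rw [integral_add] at hsum
  · simp only [← fderiv_cut]
    linarith
  · exact C.integrable_of_continuousOn (hcut.mul (C.continuousOn_divergence hF))
  · exact C.integrable_of_continuousOn (hcutd.continuousOn.clm_apply hF.continuousOn)

/-- The points with `f ≤ 0` form a compact set on which `rho k` is positive; its minimum there
serves as the thickness of the collar. -/
theorem exists_collar_pos {f : E3 → ℝ} (hf : ContinuousOn f (closure C.Ω)) (k : Fin 2)
    (hpos : ∀ x ∈ closure C.Ω, C.rho k x = 0 → 0 < f x) :
    ∃ δ > 0, ∀ x ∈ closure C.Ω, C.rho k x < δ → 0 < f x := by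
  have hA : IsCompact (closure C.Ω ∩ f ⁻¹' Iic 0) :=
    C.isCompact_closure_Ω.of_isClosed_subset
      (hf.preimage_isClosed_of_isClosed isClosed_closure isClosed_Iic) inter_subset_left
  rcases (closure C.Ω ∩ f ⁻¹' Iic 0).eq_empty_or_nonempty with he | hne
  · refine ⟨1, one_pos, fun x hx _ => ?_⟩
    by_contra! h
    have : x ∈ closure C.Ω ∩ f ⁻¹' Iic 0 := ⟨hx, h⟩
    rw [he] at this; exact this
  · obtain ⟨y, hy, hmin⟩ := hA.exists_isMinOn hne (C.continuous_rho k).continuousOn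
    refine ⟨C.rho k y, ?_, fun x hx hlt => ?_⟩
    · refine lt_of_le_of_ne (C.closure_Ω_subset hy.1 k) fun h => ?_
      exact absurd (hpos y hy.1 h.symm) (not_lt.2 hy.2)
    · by_contra! h
      exact absurd (hmin ⟨hx, h⟩) (not_le.2 hlt)

theorem exists_gradRho_lower_bound (k : Fin 2) :
    ∃ m > 0, ∃ δ > 0, ∀ x ∈ closure C.Ω, C.rho k x < δ → m ≤ ‖C.gradRho k x‖ ^ 2 := by
  have hg : Continuous fun x => ‖C.gradRho k x‖ ^ 2 := (C.contDiff_gradRho k).continuous.norm.pow 2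
  have hA : IsCompact (closure C.Ω ∩ C.rho k ⁻¹' {0}) :=
    C.isCompact_closure_Ω.inter_right (isClosed_singleton.preimage (C.continuous_rho k))
  obtain ⟨m, hm, hm'⟩ : ∃ m > 0, ∀ x ∈ closure C.Ω, C.rho k x = 0 → m ≤ ‖C.gradRho k x‖ ^ 2 := by
    rcases (closure C.Ω ∩ C.rho k ⁻¹' {0}).eq_empty_or_nonempty with he | hne
    · refine ⟨1, one_pos, fun x hx h => ?_⟩
      have : x ∈ closure C.Ω ∩ C.rho k ⁻¹' {0} := ⟨hx, h⟩
      rw [he] at this; exact this.elim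
    · obtain ⟨y, hy, hmin⟩ := hA.exists_isMinOn hne hg.continuousOn
      refine ⟨_, ?_, fun x hx h => hmin ⟨hx, h⟩⟩
      have := norm_pos_iff.2 (C.gradRho_ne_zero hy.2)
      positivity
  obtain ⟨δ, hδ, h⟩ := C.exists_collar_pos (f := fun x => ‖C.gradRho k x‖ ^ 2 - m / 2)
    (hg.sub continuous_const).continuousOn k (fun x hx h => by have := hm' x hx h; linarith)
  exact ⟨m / 2, by linarith, δ, hδ, fun x hx hlt => by have := h x hx hlt; linarith⟩

theorem divergence_smul {w : E3 → ℝ} {F : E3 → E3} (hw : ContDiffOn ℝ 1 w (closure C.Ω))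
    (hF : ContDiffOn ℝ 1 F (closure C.Ω)) {x : E3} (hx : x ∈ closure C.Ω) :
    C.divergence (fun y => w y • F y) x =
      fderivWithin ℝ w (closure C.Ω) x (F x) + w x * C.divergence F x := by
  rw [clm_apply_eq_sum, divergence, divergence, Finset.mul_sum, ← Finset.sum_add_distrib]
  refine Finset.sum_congr rfl fun i _ => ?_
  have hi := contDiffOn_comp hF i
  have h := fderivWithin_mul (C.uniqueDiffOn_closure_Ω x hx)
    (hw.differentiableOn (by norm_num) x hx) (hi.differentiableOn (by norm_num) x hx)
  simp only [Pi.mul_def] at h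
  simp only [PiLp.smul_apply, smul_eq_mul, pd]
  rw [h]
  simp
  ring

/-- Integrals over thin boundary layers are bounded by a `W^{1,1}` norm. -/
theorem exists_collar_bound :
    ∃ c, 0 ≤ c ∧ ∃ δ₀ > 0, ∀ δ, 0 < δ → δ ≤ δ₀ → ∀ (k : Fin 2) (w : E3 → ℝ),
      ContDiffOn ℝ 1 w (closure C.Ω) → (∀ x ∈ closure C.Ω, 0 ≤ w x) →
      ∫ x, w x * C.wt δ k x ∂C.vol ≤
        c * ∫ x, (w x + ‖fderivWithin ℝ w (closure C.Ω) x‖) ∂C.vol := by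
  choose m hm δ hδ hlow using C.exists_gradRho_lower_bound
  have hg := fun k => (C.contDiff_gradRho k).contDiffOn (s := closure C.Ω)
  choose B hB0 hB using fun k => C.exists_bound_of_continuousOn (hg k).continuousOn
  choose D hD0 hD using fun k => C.exists_bound_of_continuousOn (C.continuousOn_divergence (hg k))
  set c : Fin 2 → ℝ := fun k => (B k + D k) / m k with hc
  have hc0 : ∀ k, 0 ≤ c k := fun k =>
    div_nonneg (add_nonneg (hB0 k) (hD0 k)) (hm k).le
  refine ⟨∑ k, c k, Finset.sum_nonneg fun k _ => hc0 k, min (δ 0) (δ 1),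
    lt_min (hδ 0) (hδ 1), ?_⟩
  intro s hs hsδ k w hw hw0
  have hsk : s ≤ δ k := by
    fin_cases k
    · exact hsδ.trans (min_le_left _ _)
    · exact hsδ.trans (min_le_right _ _)
  -- Testing with `w • gradRho k` isolates the layer of index `k`: the other layer drops out by
  -- orthogonality, and the squared length of `gradRho k` is bounded below in a thin collar.
  have hF : ContDiffOn ℝ 1 (fun x => w x • C.gradRho k x) (closure C.Ω) := hw.smul (hg k)
  have hcut := (C.contDiff_cut s).continuous.continuousOn (s := closure C.Ω)
  have h1 := C.integral_cut_mul_divergence hF hs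
  have hin : ∀ x, ∑ j, C.wt s j x * fderiv ℝ (C.rho j) x (w x • C.gradRho k x) =
      w x * C.wt s k x * ‖C.gradRho k x‖ ^ 2 := fun x => by
    rw [Finset.sum_eq_single k]
    · rw [fderiv_rho, inner_smul_right, real_inner_self_eq_norm_sq]; ring
    · intro j _ hj
      rw [fderiv_rho, inner_smul_right, C.inner_gradRho x hj]; ring
    · simp
  simp only [hin] at h1
  have hWint : Integrable (fun x => w x + ‖fderivWithin ℝ w (closure C.Ω) x‖) C.vol :=
    C.integrable_of_continuousOn (hw.continuousOn.add (C.continuousOn_fderivWithin hw).norm)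
  have h2 : -∫ x, C.cut s x * C.divergence (fun x => w x • C.gradRho k x) x ∂C.vol ≤
      (B k + D k) * ∫ x, (w x + ‖fderivWithin ℝ w (closure C.Ω) x‖) ∂C.vol := by
    rw [← integral_neg, ← integral_const_mul]
    refine integral_mono_ae ?_ (hWint.const_mul _) ?_
    · exact (C.integrable_of_continuousOn (hcut.mul (C.continuousOn_divergence hF))).neg
    · filter_upwards [C.ae_mem_Ω] with x hx
      have hxK := subset_closure hx
      rw [C.divergence_smul hw (hg k) hxK]
      have a1 := hB k x hxK
      have a2 := hD k x hxK
      have a3 := (fderivWithin ℝ w (closure C.Ω) x).le_opNorm (C.gradRho k x)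
      have a4 := C.cut_nonneg s x
      have a5 := C.cut_le_one s x
      have a6 := hw0 x hxK
      rw [Real.norm_eq_abs] at a2 a3
      set W := fderivWithin ℝ w (closure C.Ω) x
      have a7 : |W (C.gradRho k x) + w x * C.divergence (C.gradRho k) x| ≤
          (B k + D k) * (w x + ‖W‖) := by
        have : |w x * C.divergence (C.gradRho k) x| ≤ w x * D k := by
          rw [abs_mul, abs_of_nonneg a6]; gcongr
        have h3 : ‖W‖ * ‖C.gradRho k x‖ ≤ ‖W‖ * B k := by gcongr
        have := abs_add_le (W (C.gradRho k x)) (w x * C.divergence (C.gradRho k) x)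
        nlinarith [mul_nonneg a6 (hB0 k), mul_nonneg (norm_nonneg W) (hD0 k)]
      calc -(C.cut s x * (W (C.gradRho k x) + w x * C.divergence (C.gradRho k) x))
          ≤ |C.cut s x * (W (C.gradRho k x) + w x * C.divergence (C.gradRho k) x)| :=
            neg_le_abs _
        _ = C.cut s x * |W (C.gradRho k x) + w x * C.divergence (C.gradRho k) x| := by
            rw [abs_mul, abs_of_nonneg a4]
        _ ≤ 1 * |W (C.gradRho k x) + w x * C.divergence (C.gradRho k) x| := by gcongr
        _ ≤ _ := by rw [one_mul]; exact a7
  have hwt := (C.continuous_wt s k).continuousOn (s := closure C.Ω)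
  have h3 : m k * ∫ x, w x * C.wt s k x ∂C.vol ≤
      ∫ x, w x * C.wt s k x * ‖C.gradRho k x‖ ^ 2 ∂C.vol := by
    rw [← integral_const_mul]
    refine integral_mono_ae ?_ ?_ ?_
    · exact (C.integrable_of_continuousOn (hw.continuousOn.mul hwt)).const_mul _
    · exact C.integrable_of_continuousOn
        ((hw.continuousOn.mul hwt).mul ((hg k).continuousOn.norm.pow 2))
    · filter_upwards [C.ae_mem_Ω] with x hx
      have hxK := subset_closure hx
      rcases lt_or_ge (C.rho k x) s with hlt | hge
      · have a1 := hlow k x hxK (hlt.trans_le hsk)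
        have := mul_nonneg (hw0 x hxK) (C.wt_nonneg hs k x)
        change m k * (w x * C.wt s k x) ≤ _
        nlinarith
      · simp [C.wt_eq_zero hs hge]
  have hI0 : 0 ≤ ∫ x, (w x + ‖fderivWithin ℝ w (closure C.Ω) x‖) ∂C.vol := by
    refine integral_nonneg_of_ae ?_
    filter_upwards [C.ae_mem_Ω] with x hx
    exact add_nonneg (hw0 x (subset_closure hx)) (norm_nonneg _)
  have h4 : ∫ x, w x * C.wt s k x ∂C.vol ≤
      c k * ∫ x, (w x + ‖fderivWithin ℝ w (closure C.Ω) x‖) ∂C.vol := by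
    rw [hc, div_mul_eq_mul_div, le_div_iff₀ (hm k)]
    nlinarith
  refine h4.trans (mul_le_mul_of_nonneg_right ?_ hI0)
  exact Finset.single_le_sum (f := c) (fun j _ => hc0 j) (Finset.mem_univ k)

/-- The divergence theorem as an inequality: the flux through the boundary is bounded by `W^{1,1}`
norms of majorants of the normal components. -/
theorem exists_flux_bound :
    ∃ c, 0 ≤ c ∧ ∀ (F : E3 → E3) (w : Fin 2 → E3 → ℝ), ContDiffOn ℝ 1 F (closure C.Ω) →
      (∀ k, ContDiffOn ℝ 1 (w k) (closure C.Ω)) → (∀ k, ∀ x ∈ closure C.Ω, 0 ≤ w k x) →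
      (∀ k, ∀ x ∈ closure C.Ω, C.rho k x = 0 → |fderiv ℝ (C.rho k) x (F x)| ≤ w k x) →
      |∫ x, C.divergence F x ∂C.vol| ≤
        c * ∑ k, ∫ x, (w k x + ‖fderivWithin ℝ (w k) (closure C.Ω) x‖) ∂C.vol := by
  obtain ⟨c, hc, δ₀, hδ₀, hcol⟩ := C.exists_collar_bound
  refine ⟨c, hc, fun F w hF hw hw0 hb => ?_⟩
  have hlim : Tendsto (fun δ => ∫ x, C.cut δ x * C.divergence F x ∂C.vol) (𝓝[>] 0)
      (𝓝 (∫ x, C.divergence F x ∂C.vol)) := by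
    refine tendsto_integral_filter_of_dominated_convergence
      (fun x => ‖C.divergence F x‖) ?_ ?_ ?_ ?_
    · refine Eventually.of_forall fun δ => C.aestronglyMeasurable_of_continuousOn ?_
      exact (C.contDiff_cut δ).continuous.continuousOn.mul (C.continuousOn_divergence hF)
    · refine Eventually.of_forall fun δ => Eventually.of_forall fun x => ?_
      rw [norm_mul, Real.norm_eq_abs, abs_of_nonneg (C.cut_nonneg δ x)]
      exact mul_le_of_le_one_left (norm_nonneg _) (C.cut_le_one δ x)
    · exact (C.integrable_of_continuousOn (C.continuousOn_divergence hF)).norm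
    · filter_upwards [C.ae_mem_Ω] with x hx
      simpa using (C.tendsto_cut hx).mul_const (C.divergence F x)
  have hrF : ∀ k, ContinuousOn (fun x => fderiv ℝ (C.rho k) x (F x)) (closure C.Ω) := fun k =>
    (((C.contDiff_rho k).continuous_fderiv (by norm_num)).continuousOn).clm_apply hF.continuousOn
  refine le_of_forall_pos_le_add fun ε hε => ?_
  -- The slack `e` makes the boundary inequality strict, so that it persists in a collar. Its total
  -- cost over the two faces is at most ε.
  obtain ⟨e, he, hee⟩ : ∃ e > 0, c * (2 * (e * C.vol.real univ)) ≤ ε := by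
    have hv : 0 ≤ C.vol.real univ := measureReal_nonneg
    refine ⟨ε / (2 * (c * C.vol.real univ + 1)), by positivity, ?_⟩
    rw [show c * (2 * (ε / (2 * (c * C.vol.real univ + 1)) * C.vol.real univ)) =
      ε * ((c * C.vol.real univ) / (c * C.vol.real univ + 1)) by field_simp]
    refine mul_le_of_le_one_right hε.le ?_
    rw [div_le_one (by positivity)]; linarith
  have hex : ∀ k, ∃ δ > 0, ∀ x ∈ closure C.Ω, C.rho k x < δ →
      0 < w k x + e - |fderiv ℝ (C.rho k) x (F x)| := fun k =>
    C.exists_collar_pos (f := fun x => w k x + e - |fderiv ℝ (C.rho k) x (F x)|) (((hw k).continuousOn.add continuousOn_const).sub (hrF k).abs) k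
      (fun x hx h => by have := hb k x hx h; linarith)
  choose d hd hd' using hex
  have hev : ∀ᶠ δ in 𝓝[>] (0 : ℝ), |∫ x, C.cut δ x * C.divergence F x ∂C.vol| ≤
      c * ∑ k, ∫ x, (w k x + ‖fderivWithin ℝ (w k) (closure C.Ω) x‖) ∂C.vol + ε := by
    have h1 : ∀ k, ∀ᶠ δ in 𝓝[>] (0 : ℝ), δ ≤ d k := fun k =>
      (eventually_le_nhds (hd k)).filter_mono nhdsWithin_le_nhds
    have h2 : ∀ᶠ δ in 𝓝[>] (0 : ℝ), δ ≤ δ₀ :=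
      (eventually_le_nhds hδ₀).filter_mono nhdsWithin_le_nhds
    filter_upwards [eventually_all.2 h1, h2, self_mem_nhdsWithin] with δ hδd hδδ₀ hδ
    have hδ' : (0 : ℝ) < δ := hδ
    rw [C.integral_cut_mul_divergence hF hδ, abs_neg]
    have hwtc := fun k => (C.continuous_wt δ k).continuousOn (s := closure C.Ω)
    have hwe : ∀ k, ContDiffOn ℝ 1 (fun x => w k x + e) (closure C.Ω) := fun k =>
      (hw k).add contDiffOn_const
    calc |∫ x, ∑ k, C.wt δ k x * fderiv ℝ (C.rho k) x (F x) ∂C.vol|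
        ≤ ∫ x, ∑ k, (w k x + e) * C.wt δ k x ∂C.vol := by
          rw [← Real.norm_eq_abs]
          refine norm_integral_le_of_norm_le ?_ ?_
          · refine C.integrable_of_continuousOn ?_
            exact continuousOn_finsetSum _ fun k _ => (hwe k).continuousOn.mul (hwtc k)
          · filter_upwards [C.ae_mem_Ω] with x hx
            refine (norm_sum_le _ _).trans (Finset.sum_le_sum fun k _ => ?_)
            rw [norm_mul, Real.norm_eq_abs, abs_of_nonneg (C.wt_nonneg hδ' k x), mul_comm,
              Real.norm_eq_abs]
            rcases lt_or_ge (C.rho k x) δ with hlt | hge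
            · refine mul_le_mul_of_nonneg_right ?_ (C.wt_nonneg hδ' k x)
              have := hd' k x (subset_closure hx) (hlt.trans_le (hδd k))
              linarith
            · simp [C.wt_eq_zero hδ' hge]
      _ = ∑ k, ∫ x, (w k x + e) * C.wt δ k x ∂C.vol :=
          integral_finsetSum _ fun k _ =>
            C.integrable_of_continuousOn ((hwe k).continuousOn.mul (hwtc k))
      _ ≤ ∑ k, c * (∫ x, (w k x + ‖fderivWithin ℝ (w k) (closure C.Ω) x‖) ∂C.vol +
            e * C.vol.real univ) := by
          refine Finset.sum_le_sum fun k _ => ?_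
          refine (hcol δ hδ' hδδ₀ k _ (hwe k) fun x hx => by
            have := hw0 k x hx; linarith).trans ?_
          refine mul_le_mul_of_nonneg_left (le_of_eq ?_) hc
          have hint : Integrable (fun x => w k x + ‖fderivWithin ℝ (w k) (closure C.Ω) x‖) C.vol :=
            C.integrable_of_continuousOn
              ((hw k).continuousOn.add (C.continuousOn_fderivWithin (hw k)).norm)
          have : ∀ x, w k x + e + ‖fderivWithin ℝ (fun x => w k x + e) (closure C.Ω) x‖ =
              w k x + ‖fderivWithin ℝ (w k) (closure C.Ω) x‖ + e := fun x => by
            rw [fderivWithin_add_const]; ring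
          simp only [this]
          rw [integral_add hint (integrable_const _)]
          simp [mul_comm]
      _ = c * ∑ k, ∫ x, (w k x + ‖fderivWithin ℝ (w k) (closure C.Ω) x‖) ∂C.vol +
            c * (2 * (e * C.vol.real univ)) := by
          rw [← Finset.mul_sum, Finset.sum_add_distrib]; simp; ring
      _ ≤ _ := by linarith
  exact le_of_tendsto hlim.abs hev

/-- The divergence theorem for fields tangent to the boundary. -/
theorem integral_divergence_eq_zero {F : E3 → E3} (hF : ContDiffOn ℝ 1 F (closure C.Ω))
    (hb : ∀ k, ∀ x ∈ closure C.Ω, C.rho k x = 0 → fderiv ℝ (C.rho k) x (F x) = 0) :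
    ∫ x, C.divergence F x ∂C.vol = 0 := by
  obtain ⟨c, hc, h⟩ := C.exists_flux_bound
  have := h F (fun _ _ => 0) hF (fun _ => contDiffOn_const) (fun _ _ _ => le_rfl)
    (fun k x hx h0 => by simp [hb k x hx h0])
  simpa using this

end Cylinder

/-! ### Integration along vertical lines. -/

theorem measurePreserving_liftPt :
    MeasurePreserving (fun z : E2 × ℝ => liftPt z.1 z.2) (volume.prod volume) volume := by
  have h1 := (EuclideanSpace.volume_preserving_symm_measurableEquiv_toLp (Fin 3)).symm
  have h2 := (volume_preserving_piFinSuccAbove (fun _ : Fin 3 => ℝ) 2).symm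
  have h3 := EuclideanSpace.volume_preserving_symm_measurableEquiv_toLp (Fin 2)
  have h4 : MeasurePreserving (Prod.swap : E2 × ℝ → ℝ × E2) (volume.prod volume)
      (volume.prod volume) := Measure.measurePreserving_swap
  have h5 := (MeasurePreserving.id (volume : Measure ℝ)).prod h3
  have h := h1.comp (h2.comp (h5.comp h4))
  have he : (fun z : E2 × ℝ => liftPt z.1 z.2) =
      ⇑(MeasurableEquiv.toLp 2 (Fin 3 → ℝ)).symm.symm ∘
      ⇑(MeasurableEquiv.piFinSuccAbove (fun _ => ℝ) 2).symm ∘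
        Prod.map id ⇑(MeasurableEquiv.toLp 2 (Fin 2 → ℝ)).symm ∘ Prod.swap := by
    funext z
    ext i
    fin_cases i <;> rfl
  rw [he]
  exact h

theorem continuous_liftPt : Continuous fun z : E2 × ℝ => liftPt z.1 z.2 := by
  unfold liftPt
  refine (PiLp.continuous_toLp 2 _).comp (continuous_pi fun i => ?_)
  fin_cases i
  · exact (EuclideanSpace.proj (𝕜 := ℝ) (0 : Fin 2)).continuous.comp continuous_fst
  · exact (EuclideanSpace.proj (𝕜 := ℝ) (1 : Fin 2)).continuous.comp continuous_fst
  · exact continuous_snd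

@[simp] theorem horiz_liftPt (y : E2) (s : ℝ) : horiz (liftPt y s) = y := by
  ext i; fin_cases i <;> simp [horiz, liftPt]

@[simp] theorem liftPt_two (y : E2) (s : ℝ) : liftPt y s 2 = s := by simp [liftPt]

theorem liftPt_horiz (x : E3) : liftPt (horiz x) (x 2) = x := by
  ext i; fin_cases i <;> simp [horiz, liftPt]

theorem hasDerivAt_liftPt (y : E2) (s : ℝ) :
    HasDerivAt (fun s => liftPt y s) (EuclideanSpace.single 2 1) s := by
  have : (fun s => liftPt y s) = fun s => liftPt y 0 + s • EuclideanSpace.single 2 (1 : ℝ) := by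
    ext s i; fin_cases i <;> simp [liftPt]
  rw [this]
  simpa using ((hasDerivAt_id s).smul_const (EuclideanSpace.single (2 : Fin 3) (1 : ℝ))).const_add
    (liftPt y 0)

theorem norm_clm_sq_le (L : E3 →L[ℝ] ℝ) : ‖L‖ ^ 2 ≤ ∑ i, L (EuclideanSpace.single i 1) ^ 2 := by
  have h : ‖L‖ ≤ √(∑ i, L (EuclideanSpace.single i 1) ^ 2) := by
    refine L.opNorm_le_bound (Real.sqrt_nonneg _) fun d => ?_
    rw [clm_apply_eq_sum, EuclideanSpace.norm_eq, ← Real.sqrt_mul (by positivity),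
      Real.norm_eq_abs]
    refine Real.abs_le_sqrt ?_
    have := Finset.sum_mul_sq_le_sq_mul_sq Finset.univ (fun i => d i)
      (fun i => L (EuclideanSpace.single i 1))
    simp only [Real.norm_eq_abs, sq_abs]
    linarith
  calc ‖L‖ ^ 2 ≤ (√(∑ i, L (EuclideanSpace.single i 1) ^ 2)) ^ 2 := by gcongr
    _ = _ := Real.sq_sqrt (by positivity)

/-- The quadratic t ↦ ∫ (t f + g)² is nonnegative, so its discriminant is not positive. -/
theorem integral_mul_sq_le {X : Type*} [MeasurableSpace X] {μ : Measure X} {f g : X → ℝ}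
    (hf : Integrable (fun x => f x ^ 2) μ) (hg : Integrable (fun x => g x ^ 2) μ)
    (hfg : Integrable (fun x => f x * g x) μ) :
    (∫ x, f x * g x ∂μ) ^ 2 ≤ (∫ x, f x ^ 2 ∂μ) * ∫ x, g x ^ 2 ∂μ := by
  have key : ∀ t : ℝ, 0 ≤ (∫ x, f x ^ 2 ∂μ) * (t * t) + (2 * ∫ x, f x * g x ∂μ) * t +
      ∫ x, g x ^ 2 ∂μ := fun t => by
    have h : 0 ≤ ∫ x, (t * f x + g x) ^ 2 ∂μ := integral_nonneg fun x => sq_nonneg _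
    have e : ∀ x, (t * f x + g x) ^ 2 = (t * t) * f x ^ 2 + (2 * t) * (f x * g x) + g x ^ 2 :=
      fun x => by ring
    simp only [e] at h
    have h1 : Integrable (fun x => (t * t) * f x ^ 2 + (2 * t) * (f x * g x)) μ :=
      (hf.const_mul _).add (hfg.const_mul _)
    rw [integral_add h1 hg, integral_add (hf.const_mul _) (hfg.const_mul _),
      integral_const_mul, integral_const_mul] at h
    linarith
  have := discrim_le_zero key
  rw [discrim] at this
  nlinarith

namespace Cylinder

variable (C : Cylinder)

theorem preimage_liftPt_Ω :
    (fun z : E2 × ℝ => liftPt z.1 z.2) ⁻¹' C.Ω = C.ω ×ˢ Ioo (-C.b) C.b := by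
  ext z
  simp [Ω]

theorem measurePreserving_liftPt_vol :
    MeasurePreserving (fun z : E2 × ℝ => liftPt z.1 z.2)
      ((volume.restrict C.ω).prod (volume.restrict (Ioo (-C.b) C.b))) C.vol := by
  rw [Measure.prod_restrict, ← preimage_liftPt_Ω]
  exact measurePreserving_liftPt.restrict_preimage C.measurableSet_Ω

theorem liftPt_mem_closure {y : E2} (hy : y ∈ C.ω) {s : ℝ} (hs : s ∈ Icc (-C.b) C.b) :
    liftPt y s ∈ closure C.Ω := by
  rw [mem_closure_iff']
  simpa using ⟨le_of_lt hy, hs.1, hs.2⟩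

theorem liftPt_mem_Ω {y : E2} (hy : y ∈ C.ω) {s : ℝ} (hs : s ∈ Ioo (-C.b) C.b) :
    liftPt y s ∈ C.Ω := by
  simpa [Ω] using ⟨hy, hs.1, hs.2⟩

/-- Fubini's theorem and the fundamental theorem of calculus on vertical segments. Unlike the flux
bound, this gives exact boundary integrals on the bottom and the top, as the pressure and trace
terms require. -/
theorem integral_pd_two {G : E3 → ℝ} (hG : ContDiffOn ℝ 1 G (closure C.Ω)) :
    ∫ x, C.pd 2 G x ∂C.vol = ∫ y in C.ω, (G (liftPt y C.b) - G (liftPt y (-C.b))) := by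
  have hmp := C.measurePreserving_liftPt_vol
  have hc := C.continuousOn_pd hG 2
  have hint := C.integrable_of_continuousOn hc
  have hint' : Integrable (fun z : E2 × ℝ => C.pd 2 G (liftPt z.1 z.2))
      ((volume.restrict C.ω).prod (volume.restrict (Ioo (-C.b) C.b))) :=
    hmp.integrable_comp_of_integrable hint
  have h1 : ∫ x, C.pd 2 G x ∂C.vol = ∫ z, C.pd 2 G (liftPt z.1 z.2)
      ∂((volume.restrict C.ω).prod (volume.restrict (Ioo (-C.b) C.b))) := by
    rw [← hmp.map_eq, integral_map hmp.measurable.aemeasurable]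
    rw [hmp.map_eq]
    exact hint.aestronglyMeasurable
  rw [h1, integral_prod _ hint']
  refine setIntegral_congr_fun C.isOpen_ω.measurableSet fun y hy => ?_
  have hb : -C.b ≤ C.b := by linarith [C.b_pos]
  change ∫ s in Ioo (-C.b) C.b, C.pd 2 G (liftPt y s) = _
  have hl : Continuous fun s => liftPt y s :=
    continuous_liftPt.comp (continuous_const.prodMk continuous_id)
  have hmaps : MapsTo (fun s => liftPt y s) (Icc (-C.b) C.b) (closure C.Ω) := fun s hs =>
    C.liftPt_mem_closure hy hs
  rw [← integral_Ioc_eq_integral_Ioo, ← intervalIntegral.integral_of_le hb]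
  refine intervalIntegral.integral_eq_sub_of_hasDerivAt_of_le (f := fun s => G (liftPt y s)) hb
    (hG.continuousOn.comp hl.continuousOn hmaps) ?_ ?_
  · intro s hs
    have hx := C.liftPt_mem_Ω hy hs
    rw [C.pd_eq hx]
    have hd : DifferentiableAt ℝ G (liftPt y s) :=
      (hG.contDiffAt (C.closure_mem_nhds hx)).differentiableAt (by norm_num)
    exact hd.hasFDerivAt.comp_hasDerivAt s (hasDerivAt_liftPt y s)
  · refine ContinuousOn.intervalIntegrable ?_
    rw [uIcc_of_le hb]
    exact hc.comp hl.continuousOn hmaps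

/-! ### The Sobolev inequality in the cylinder. -/

/-- The square of the `H¹(Ω)` norm of a scalar function. -/
def h1sq (u : E3 → ℝ) : ℝ := ∫ x, (u x ^ 2 + ∑ i, C.pd i u x ^ 2) ∂C.vol

theorem h1sq_nonneg (u : E3 → ℝ) : 0 ≤ C.h1sq u := integral_nonneg fun x => by positivity

/-- The Gagliardo–Nirenberg–Sobolev inequality for W^{1,1} in dimension 3 applies to `cut δ * w`.
The gradient of the cutoff blows up only in the boundary layer, where `exists_collar_bound` controls
its product with `w` uniformly in δ. -/
theorem exists_sobolev_one : ∃ c, 0 ≤ c ∧ ∀ w : E3 → ℝ, ContDiffOn ℝ 1 w (closure C.Ω) →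
    (∀ x ∈ closure C.Ω, 0 ≤ w x) →
    eLpNorm w ((3 / 2 : ℝ≥0) : ℝ≥0∞) C.vol ≤
      ENNReal.ofReal (c * ∫ x, (w x + ‖fderivWithin ℝ w (closure C.Ω) x‖) ∂C.vol) := by
  obtain ⟨c, hc, δ₀, hδ₀, hcol⟩ := C.exists_collar_bound
  have hg := fun k => ((C.contDiff_rho k).continuous_fderiv (by norm_num)).continuousOn
    (s := closure C.Ω)
  choose B hB0 hB using fun k => C.exists_bound_of_continuousOn (hg k)
  set S := MeasureTheory.eLpNormLESNormFDerivOneConst (volume : Measure E3) ((3 / 2 : ℝ≥0) : ℝ)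
  refine ⟨S * (1 + ∑ k, B k * c), mul_nonneg (NNReal.coe_nonneg S) (add_nonneg zero_le_one
    (Finset.sum_nonneg fun k _ => mul_nonneg (hB0 k) hc)), fun w hw hw0 => ?_⟩
  set I := ∫ x, (w x + ‖fderivWithin ℝ w (closure C.Ω) x‖) ∂C.vol with hI
  have hconj : ((Module.finrank ℝ E3 : ℕ) : ℝ≥0).HolderConjugate (3 / 2) := by
    rw [finrank_euclideanSpace, Fintype.card_fin, NNReal.holderConjugate_iff]
    refine ⟨by norm_num, by norm_num⟩
  have hWc := C.continuousOn_fderivWithin hw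
  have hstep : ∀ δ, 0 < δ → δ ≤ δ₀ →
      eLpNorm (fun x => C.cut δ x * w x) ((3 / 2 : ℝ≥0) : ℝ≥0∞) C.vol ≤
        ENNReal.ofReal (S * (1 + ∑ k, B k * c) * I) := by
    intro δ hδ hδ'
    have hu := C.contDiff_mul_of_tsupport (C.contDiff_cut δ) (C.tsupport_cut_subset_Ω hδ)
      (hw.mono subset_closure)
    have hc' : HasCompactSupport fun x => C.cut δ x * w x :=
      (C.hasCompactSupport_cut hδ).mul_right
    have hgn := eLpNorm_le_eLpNorm_fderiv_one (volume : Measure E3) hu hc' hconj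
    refine (eLpNorm_mono_measure _ Measure.restrict_le_self).trans (hgn.trans ?_)
    rw [mul_assoc, ENNReal.ofReal_mul (NNReal.coe_nonneg S), ENNReal.ofReal_coe_nnreal]
    gcongr
    have hzero : ∀ x, x ∉ C.Ω → ‖fderiv ℝ (fun x => C.cut δ x * w x) x‖ₑ = 0 := fun x hx => by
      have hx' : x ∉ tsupport (fun x => C.cut δ x * w x) := fun h =>
        hx (C.tsupport_cut_subset_Ω hδ (tsupport_mul_subset_left h))
      have h0 : fderiv ℝ (fun x => C.cut δ x * w x) x = 0 :=
        (notMem_tsupport_iff_eventuallyEq.1 hx').fderiv_eq.trans (fderiv_const_apply (0 : ℝ))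
      rw [h0, ← ofReal_norm, norm_zero, ENNReal.ofReal_zero]
    have hwtc := fun k => (C.continuous_wt δ k).continuousOn (s := closure C.Ω)
    rw [eLpNorm_one_eq_lintegral_enorm, ← setLIntegral_eq_of_support_subset (s := C.Ω)]
    · have hpt : ∀ x ∈ C.Ω, ‖fderiv ℝ (fun x => C.cut δ x * w x) x‖ ≤
          ‖fderivWithin ℝ w (closure C.Ω) x‖ + ∑ k, B k * (w x * C.wt δ k x) := fun x hx => by
        have hxK := subset_closure hx
        have hd : DifferentiableAt ℝ w x :=
          (hw.contDiffAt (C.closure_mem_nhds hx)).differentiableAt (by norm_num)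
        have hm := ((C.contDiff_cut δ).differentiable (by norm_num) x).hasFDerivAt.mul
          hd.hasFDerivAt
        simp only [Pi.mul_def] at hm
        rw [hm.fderiv, C.fderivWithin_eq w hx]
        have h1 : ‖fderiv ℝ (C.cut δ) x‖ ≤ ∑ k, C.wt δ k x * B k := by
          refine ContinuousLinearMap.opNorm_le_bound _ (Finset.sum_nonneg fun k _ =>
            mul_nonneg (C.wt_nonneg hδ k x) (hB0 k)) fun d => ?_
          rw [fderiv_cut, Finset.sum_mul]
          refine (norm_sum_le _ _).trans (Finset.sum_le_sum fun k _ => ?_)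
          rw [norm_mul, Real.norm_eq_abs, abs_of_nonneg (C.wt_nonneg hδ k x), mul_assoc]
          refine mul_le_mul_of_nonneg_left ?_ (C.wt_nonneg hδ k x)
          exact (ContinuousLinearMap.le_opNorm _ _).trans (by gcongr; exact hB k x hxK)
        refine (norm_add_le _ _).trans ?_
        rw [norm_smul, norm_smul, Real.norm_eq_abs, Real.norm_eq_abs,
          abs_of_nonneg (C.cut_nonneg δ x), abs_of_nonneg (hw0 x hxK)]
        refine add_le_add (mul_le_of_le_one_left (norm_nonneg _) (C.cut_le_one δ x)) ?_
        refine (mul_le_mul_of_nonneg_left h1 (hw0 x hxK)).trans (le_of_eq ?_)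
        rw [Finset.mul_sum]
        exact Finset.sum_congr rfl fun k _ => by ring
      have hcont : ContinuousOn (fun x => ‖fderivWithin ℝ w (closure C.Ω) x‖ +
          ∑ k, B k * (w x * C.wt δ k x)) (closure C.Ω) :=
        hWc.norm.add (continuousOn_finsetSum _ fun k _ =>
          continuousOn_const.mul (hw.continuousOn.mul (hwtc k)))
      calc ∫⁻ x in C.Ω, ‖fderiv ℝ (fun x => C.cut δ x * w x) x‖ₑ
          ≤ ∫⁻ x in C.Ω, ENNReal.ofReal (‖fderivWithin ℝ w (closure C.Ω) x‖ +
              ∑ k, B k * (w x * C.wt δ k x)) := by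
            refine setLIntegral_mono_ae' C.measurableSet_Ω (Eventually.of_forall fun x hx => ?_)
            rw [← ofReal_norm]
            exact ENNReal.ofReal_le_ofReal (hpt x hx)
        _ = ENNReal.ofReal (∫ x, (‖fderivWithin ℝ w (closure C.Ω) x‖ +
              ∑ k, B k * (w x * C.wt δ k x)) ∂C.vol) := by
            rw [ofReal_integral_eq_lintegral_ofReal (C.integrable_of_continuousOn hcont)]
            · rfl
            · filter_upwards [C.ae_mem_Ω] with x hx
              exact add_nonneg (norm_nonneg _) (Finset.sum_nonneg fun k _ =>
                mul_nonneg (hB0 k) (mul_nonneg (hw0 x (subset_closure hx)) (C.wt_nonneg hδ k x)))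
        _ ≤ ENNReal.ofReal ((1 + ∑ k, B k * c) * I) := by
            refine ENNReal.ofReal_le_ofReal ?_
            have i1 := C.integrable_of_continuousOn hWc.norm
            have i2 : ∀ k, Integrable (fun x => B k * (w x * C.wt δ k x)) C.vol := fun k =>
              (C.integrable_of_continuousOn
              (hw.continuousOn.mul (hwtc k))).const_mul (B k)
            rw [integral_add i1 (integrable_finsetSum _ fun k _ => i2 k),
              integral_finsetSum _ fun k _ => i2 k, add_mul, one_mul, Finset.sum_mul]
            refine add_le_add ?_ (Finset.sum_le_sum fun k _ => ?_)
            · refine integral_mono_ae i1 (C.integrable_of_continuousOn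
                (hw.continuousOn.add hWc.norm)) ?_
              filter_upwards [C.ae_mem_Ω] with x hx
              have := hw0 x (subset_closure hx)
              simpa using this
            · rw [integral_const_mul, mul_assoc]
              exact mul_le_mul_of_nonneg_left (hcol δ hδ hδ' k w hw hw0) (hB0 k)
    · intro x hx
      by_contra h
      exact hx (hzero x h)
  have hmeas : ∀ n : ℕ, AEStronglyMeasurable (fun x => C.cut (δ₀ / (n + 1)) x * w x) C.vol :=
    fun n => C.aestronglyMeasurable_of_continuousOn
      ((C.contDiff_cut _).continuous.continuousOn.mul hw.continuousOn)
  have hpos : ∀ n : ℕ, 0 < δ₀ / (n + 1 : ℝ) := fun n => by positivity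
  have hδlim : Tendsto (fun n : ℕ => δ₀ / (n + 1 : ℝ)) atTop (𝓝[>] 0) := by
    refine tendsto_nhdsWithin_iff.2 ⟨?_, Eventually.of_forall hpos⟩
    have := (tendsto_one_div_add_atTop_nhds_zero_nat (𝕜 := ℝ)).const_mul δ₀
    simpa [div_eq_mul_inv] using this
  -- Fatou's lemma: the bound is uniform in δ and the cutoffs tend to 1 in the cylinder.
  refine (Lp.eLpNorm_lim_le_liminf_eLpNorm hmeas w ?_).trans ?_
  · filter_upwards [C.ae_mem_Ω] with x hx
    simpa using ((C.tendsto_cut hx).comp hδlim).mul_const (w x)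
  · refine liminf_le_of_le (by isBoundedDefault) fun b hb => ?_
    obtain ⟨n, hn⟩ := hb.exists
    refine hn.trans (hstep _ (hpos n) (div_le_self hδ₀.le ?_))
    have : (0 : ℝ) ≤ n := n.cast_nonneg
    linarith

/-- The Sobolev inequality `‖u‖₆⁶ ≤ c ‖u‖_{H¹}⁶`. -/
theorem exists_sobolev : ∃ c, 0 ≤ c ∧ ∀ u : E3 → ℝ, ContDiffOn ℝ 1 u (closure C.Ω) →
    ∫ x, u x ^ 6 ∂C.vol ≤ c * C.h1sq u ^ 3 := by
  obtain ⟨c, hc, hsob⟩ := C.exists_sobolev_one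
  refine ⟨c ^ 6 * 32 ^ 3, by positivity, fun u hu => ?_⟩
  set A := ∫ x, u x ^ 6 ∂C.vol with hA
  set D := fun x => fderivWithin ℝ u (closure C.Ω) x with hD
  have hDc : ContinuousOn D (closure C.Ω) := C.continuousOn_fderivWithin hu
  have huc := hu.continuousOn
  have hA0 : 0 ≤ A := integral_nonneg fun x => by positivity
  -- With H = `h1sq u`, the L_{3/2} inequality for u⁴ reads A^{2/3} ≤ c S, while Cauchy–Schwarz
  -- gives S² ≤ 32 A H. Hence A⁴ ≤ c⁶ (32 A H)³, and A³ cancels.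
  have h := hsob (fun x => u x ^ 4) (hu.pow 4) (fun x _ => by positivity)
  set S := ∫ x, |u x| ^ 3 * (|u x| + 4 * ‖D x‖) ∂C.vol with hS
  have hSeq : ∫ x, (u x ^ 4 + ‖fderivWithin ℝ (fun x => u x ^ 4) (closure C.Ω) x‖) ∂C.vol = S := by
    refine integral_congr_ae ?_
    filter_upwards [C.ae_mem_Ω] with x hx
    have hxK := subset_closure hx
    have hd := (hu.differentiableOn (by norm_num) x hxK).hasFDerivWithinAt.pow 4
    rw [hd.fderivWithin (C.uniqueDiffOn_closure_Ω x hxK), norm_smul]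
    have e : u x ^ 4 = |u x| ^ 4 := by rw [← abs_pow]; exact (abs_of_nonneg (by positivity)).symm
    simp only [Real.norm_eq_abs, e]
    simp [hD]
    ring
  rw [hSeq] at h
  have hS0 : 0 ≤ S := integral_nonneg fun x => by positivity
  have h1 : A ^ 2 ≤ (c * S) ^ 3 := by
    have hm : MemLp (fun x => u x ^ 4) ((3 / 2 : ℝ≥0) : ℝ≥0∞) C.vol :=
      C.memLp_of_continuousOn (huc.pow 4) _
    rw [hm.eLpNorm_eq_integral_rpow_norm (by simp) ENNReal.coe_ne_top,
      ENNReal.ofReal_le_ofReal_iff (mul_nonneg hc hS0)] at h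
    have e : ∫ x, ‖u x ^ 4‖ ^ ((3 / 2 : ℝ≥0) : ℝ≥0∞).toReal ∂C.vol = A := by
      refine integral_congr_ae (Eventually.of_forall fun x => ?_)
      have e1 : u x ^ 6 = |u x| ^ 6 := by
        rw [← abs_pow]; exact (abs_of_nonneg (by positivity)).symm
      simp only [e1, norm_pow, Real.norm_eq_abs]
      rw [← Real.rpow_natCast, ← Real.rpow_natCast, ← Real.rpow_mul (abs_nonneg _)]
      congr 1
      simp; norm_num
    rw [e] at h
    have h2 := pow_le_pow_left₀ (by positivity) h 3
    refine le_trans (le_of_eq ?_) h2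
    rw [← Real.rpow_natCast, ← Real.rpow_natCast, ← Real.rpow_mul hA0]
    congr 1
    simp
  have h2 : S ^ 2 ≤ A * (32 * C.h1sq u) := by
    have c1 : ContinuousOn (fun x => |u x| ^ 3) (closure C.Ω) := huc.abs.pow 3
    have c2 : ContinuousOn (fun x => |u x| + 4 * ‖D x‖) (closure C.Ω) :=
      huc.abs.add (continuousOn_const.mul hDc.norm)
    have := integral_mul_sq_le (C.integrable_of_continuousOn (c1.pow 2))
      (C.integrable_of_continuousOn (c2.pow 2)) (C.integrable_of_continuousOn (c1.mul c2))
    refine this.trans ?_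
    have e1 : ∫ x, (|u x| ^ 3) ^ 2 ∂C.vol = A := by
      refine integral_congr_ae (Eventually.of_forall fun x => ?_)
      change (|u x| ^ 3) ^ 2 = u x ^ 6
      rw [← pow_mul, ← abs_pow]
      exact abs_of_nonneg (by positivity : (0 : ℝ) ≤ u x ^ 6)
    rw [e1]
    refine mul_le_mul_of_nonneg_left ?_ hA0
    rw [h1sq, ← integral_const_mul]
    refine integral_mono (C.integrable_of_continuousOn (c2.pow 2))
      ((C.integrable_of_continuousOn ((huc.pow 2).add
        (continuousOn_finsetSum _ fun i _ => (C.continuousOn_pd hu i).pow 2))).const_mul _)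
      fun x => ?_
    have h3 := norm_clm_sq_le (D x)
    have h4 : (∑ i, D x (EuclideanSpace.single i 1) ^ 2) = ∑ i, C.pd i u x ^ 2 := rfl
    rw [h4] at h3
    have h5 : |u x| ^ 2 = u x ^ 2 := sq_abs _
    change (|u x| + 4 * ‖D x‖) ^ 2 ≤ 32 * (u x ^ 2 + ∑ i, C.pd i u x ^ 2)
    nlinarith [sq_nonneg (|u x| - 4 * ‖D x‖), sq_nonneg (u x)]
  rcases hA0.eq_or_lt with h0 | hpos
  · rw [← h0]; exact mul_nonneg (by positivity) (pow_nonneg (C.h1sq_nonneg u) 3)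
  · have hH := C.h1sq_nonneg u
    have h3 : A ^ 3 * A ≤ A ^ 3 * (c ^ 6 * 32 ^ 3 * C.h1sq u ^ 3) := by
      calc A ^ 3 * A = (A ^ 2) ^ 2 := by ring
        _ ≤ ((c * S) ^ 3) ^ 2 := by gcongr
        _ = c ^ 6 * (S ^ 2) ^ 3 := by ring
        _ ≤ c ^ 6 * (A * (32 * C.h1sq u)) ^ 3 := by gcongr
        _ = _ := by ring
    exact le_of_mul_le_mul_left h3 (by positivity)

end Cylinder

/-! ### The Poincaré inequality on convex sets. -/

theorem lintegral_comp_add_smul_le {g : E3 → ℝ≥0∞} (hg : Measurable g) (c : E3) {s : ℝ}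
    (hs : 1 / 2 ≤ s) : ∫⁻ x, g (c + s • x) ≤ 8 * ∫⁻ x, g x := by
  have hs0 : s ≠ 0 := by linarith
  have h1 : ∫⁻ x, g (c + s • x) = ∫⁻ z, g (c + z) ∂(Measure.map (fun x : E3 => s • x) volume) := by
    exact (lintegral_map (hg.comp (measurable_const_add c)) (measurable_const_smul s)).symm
  rw [h1, Measure.map_addHaar_smul volume hs0, lintegral_smul_measure,
    lintegral_add_left_eq_self g c, finrank_euclideanSpace, Fintype.card_fin, smul_eq_mul]
  gcongr
  rw [show (8 : ℝ≥0∞) = ENNReal.ofReal 8 by simp]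
  refine ENNReal.ofReal_le_ofReal ?_
  -- The Jacobian factor s⁻³ is at most 8.
  have h3 : (1 / 2 : ℝ) ^ 3 ≤ s ^ 3 := by gcongr
  rw [abs_of_nonneg (by positivity), inv_le_comm₀ (by positivity) (by norm_num)]
  norm_num at h3 ⊢
  linarith

/-- Averages over segments of a convex set. -/
theorem lintegral_segment_le {Q : Set E3} {g : E3 → ℝ≥0∞} (hg : Measurable g)
    {s : ℝ} : ∫⁻ y in Q, ∫⁻ x in Q, g (y + s • (x - y)) ≤ 8 * volume Q * ∫⁻ x, g x := by
  have hm : Measurable fun z : E3 × E3 => g (z.1 + s • (z.2 - z.1)) :=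
    hg.comp (by fun_prop)
  -- In y + s(x − y) the coefficients of `x` and `y` are s and 1 − s. The inner integral is taken
  -- over a variable whose coefficient is at least 1/2.
  rcases le_total (1 / 2) s with hs | hs
  · have hin : ∀ y, ∫⁻ x in Q, g (y + s • (x - y)) ≤ 8 * ∫⁻ x, g x := fun y => by
      refine (setLIntegral_le_lintegral _ _).trans ?_
      have e : ∀ x, y + s • (x - y) = (y - s • y) + s • x := fun x => by
        rw [smul_sub]; abel
      simp only [e]
      exact lintegral_comp_add_smul_le hg _ hs
    refine (lintegral_mono hin).trans (le_of_eq ?_)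
    rw [lintegral_const, Measure.restrict_apply_univ]; ring
  · rw [lintegral_lintegral_swap hm.aemeasurable]
    have hin : ∀ x, ∫⁻ y in Q, g (y + s • (x - y)) ≤ 8 * ∫⁻ x, g x := fun x => by
      refine (setLIntegral_le_lintegral _ _).trans ?_
      have e : ∀ y, y + s • (x - y) = s • x + (1 - s) • y := fun y => by
        rw [smul_sub, sub_smul, one_smul]; abel
      simp only [e]
      exact lintegral_comp_add_smul_le hg _ (by linarith)
    refine (lintegral_mono hin).trans (le_of_eq ?_)
    rw [lintegral_const, Measure.restrict_apply_univ]; ring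

namespace Cylinder

variable (C : Cylinder)

/-- The fundamental theorem of calculus along the segment, followed by Cauchy–Schwarz. The indicator
of `Q` turns the integrand into a function on the whole space, ready for linear changes of
variables. -/
theorem sq_sub_le_segment {Q : Set E3} (hQ : Convex ℝ Q) (hQΩ : Q ⊆ C.Ω) {d : ℝ}
    (hd : ∀ x ∈ Q, ∀ y ∈ Q, ‖x - y‖ ≤ d) {u : E3 → ℝ} (hu : ContDiffOn ℝ 1 u (closure C.Ω))
    {x y : E3} (hx : x ∈ Q) (hy : y ∈ Q) :
    ENNReal.ofReal ((u x - u y) ^ 2) ≤ ENNReal.ofReal (d ^ 2) * ∫⁻ s in Ioc (0 : ℝ) 1,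
      Q.indicator (fun z => ENNReal.ofReal (‖fderivWithin ℝ u (closure C.Ω) z‖ ^ 2))
        (y + s • (x - y)) := by
  set D := fderivWithin ℝ u (closure C.Ω) with hD
  have hmem : ∀ s ∈ Icc (0 : ℝ) 1, y + s • (x - y) ∈ Q := fun s hs =>
    hQ.add_smul_sub_mem hy hx hs
  have hγ : Continuous fun s : ℝ => y + s • (x - y) := by fun_prop
  have hDc : ContinuousOn (fun s : ℝ => D (y + s • (x - y))) (Icc 0 1) :=
    (C.continuousOn_fderivWithin hu).comp hγ.continuousOn
      fun s hs => subset_closure (hQΩ (hmem s hs))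
  have hDi : ContinuousOn (fun s : ℝ => D (y + s • (x - y)) (x - y)) (Icc 0 1) :=
    hDc.clm_apply continuousOn_const
  have h1 : ∫ s in (0 : ℝ)..1, D (y + s • (x - y)) (x - y) = u x - u y := by
    have := intervalIntegral.integral_eq_sub_of_hasDerivAt
      (f := fun s : ℝ => u (y + s • (x - y))) (f' := fun s => D (y + s • (x - y)) (x - y))
      (a := 0) (b := 1) ?_ ?_
    · simpa using this
    · intro s hs
      rw [uIcc_of_le zero_le_one] at hs
      have hz := hQΩ (hmem s hs)
      have hdu : DifferentiableAt ℝ u (y + s • (x - y)) :=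
        (hu.contDiffAt (C.closure_mem_nhds hz)).differentiableAt (by norm_num)
      rw [hD, C.fderivWithin_eq u hz]
      have h2 : HasDerivAt (fun s : ℝ => y + s • (x - y)) (x - y) s := by
        simpa using ((hasDerivAt_id s).smul_const (x - y)).const_add y
      exact hdu.hasFDerivAt.comp_hasDerivAt s h2
    · exact ContinuousOn.intervalIntegrable (by rwa [uIcc_of_le zero_le_one])
  rw [intervalIntegral.integral_of_le zero_le_one] at h1
  have hint : ∀ {f : ℝ → ℝ}, ContinuousOn f (Icc 0 1) →
      Integrable f (volume.restrict (Ioc 0 1)) := fun hf =>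
    (hf.integrableOn_Icc).mono_set Ioc_subset_Icc_self
  have h2 := integral_mul_sq_le (μ := volume.restrict (Ioc (0 : ℝ) 1)) (f := fun _ => (1 : ℝ))
    (g := fun s => D (y + s • (x - y)) (x - y)) (hint continuousOn_const) (hint (hDi.pow 2))
    (by simpa using hint hDi)
  simp only [one_mul, h1, one_pow] at h2
  have hone : ∫ _ in Ioc (0 : ℝ) 1, (1 : ℝ) = 1 := by simp
  rw [hone, one_mul] at h2
  have h3 : ∫ s in Ioc (0 : ℝ) 1, D (y + s • (x - y)) (x - y) ^ 2 ≤
      ∫ s in Ioc (0 : ℝ) 1, d ^ 2 * ‖D (y + s • (x - y))‖ ^ 2 := by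
    refine integral_mono (hint (hDi.pow 2))
      (hint (continuousOn_const.mul (hDc.norm.pow 2))) fun s => ?_
    have a1 := (D (y + s • (x - y))).le_opNorm (x - y)
    have a2 := hd x hx y hy
    rw [Real.norm_eq_abs] at a1
    calc D (y + s • (x - y)) (x - y) ^ 2 = |D (y + s • (x - y)) (x - y)| ^ 2 := (sq_abs _).symm
      _ ≤ (‖D (y + s • (x - y))‖ * d) ^ 2 := by gcongr; exact a1.trans (by gcongr)
      _ = _ := by ring
  have iD : Integrable (fun s : ℝ => ‖D (y + s • (x - y))‖ ^ 2) (volume.restrict (Ioc 0 1)) :=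
    hint (hDc.norm.pow 2)
  refine (ENNReal.ofReal_le_ofReal (h2.trans h3)).trans ?_
  rw [integral_const_mul, ENNReal.ofReal_mul (sq_nonneg d),
    ofReal_integral_eq_lintegral_ofReal iD (Eventually.of_forall fun s => by positivity)]
  refine mul_le_mul' le_rfl ?_
  refine setLIntegral_mono_ae' measurableSet_Ioc (Eventually.of_forall fun s hs => ?_)
  rw [indicator_of_mem (hmem s ⟨hs.1.le, hs.2⟩)]

theorem measurable_indicator_of_continuousOn {Q : Set E3} (hQ : MeasurableSet Q)
    {g : E3 → ℝ≥0∞} (hg : ContinuousOn g Q) : Measurable (Q.indicator g) := by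
  classical
  rw [← piecewise_eq_indicator]
  exact hg.measurable_piecewise continuousOn_const hQ

/-- The Poincaré inequality on a convex set. -/
theorem poincare_convex {Q : Set E3} (hQ : Convex ℝ Q) (hQm : MeasurableSet Q) (hQΩ : Q ⊆ C.Ω)
    {d : ℝ} (hd : ∀ x ∈ Q, ∀ y ∈ Q, ‖x - y‖ ≤ d) {u : E3 → ℝ}
    (hu : ContDiffOn ℝ 1 u (closure C.Ω)) :
    ∫ x in Q, u x ^ 2 ≤ 4 * d ^ 2 * (∫ x in Q, ‖fderivWithin ℝ u (closure C.Ω) x‖ ^ 2) +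
      (volume.real Q)⁻¹ * (∫ x in Q, u x) ^ 2 := by
  have hint : ∀ {f : E3 → ℝ}, ContinuousOn f (closure C.Ω) →
      Integrable f (volume.restrict Q) := fun hf => by
    have h1 : IntegrableOn _ C.Ω volume := C.integrable_of_continuousOn hf
    exact h1.mono_set hQΩ
  have hQfin : volume Q ≠ ∞ := ((measure_mono hQΩ).trans_lt C.isBounded_Ω.measure_lt_top).ne
  rcases eq_or_ne (volume Q) 0 with h0 | h0
  · have : volume.restrict Q = 0 := Measure.restrict_eq_zero.2 h0
    simp [this]
  have huc := hu.continuousOn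
  have hDc := C.continuousOn_fderivWithin hu
  have hV : 0 < volume.real Q := ENNReal.toReal_pos h0 hQfin
  have : IsFiniteMeasure (volume.restrict Q) := ⟨by
    rw [Measure.restrict_apply_univ]; exact hQfin.lt_top⟩
  set G : E3 → ℝ≥0∞ :=
    Q.indicator (fun z => ENNReal.ofReal (‖fderivWithin ℝ u (closure C.Ω) z‖ ^ 2)) with hG
  have hGm : Measurable G := measurable_indicator_of_continuousOn hQm
    (ENNReal.continuous_ofReal.comp_continuousOn
      ((hDc.norm.pow 2).mono (hQΩ.trans subset_closure)))
  have iD : Integrable (fun x => ‖fderivWithin ℝ u (closure C.Ω) x‖ ^ 2) (volume.restrict Q) :=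
    hint (hDc.norm.pow 2)
  have i2 : Integrable (fun x => u x ^ 2) (volume.restrict Q) := hint (huc.pow 2)
  have i1 : ∀ a : ℝ, Integrable (fun x => a * u x) (volume.restrict Q) := fun a =>
    (hint huc).const_mul a
  have i21 : ∀ a : ℝ, Integrable (fun x => u x ^ 2 - a * u x) (volume.restrict Q) := fun a =>
    i2.sub (i1 a)
  have hGint : ∫⁻ x, G x =
      ENNReal.ofReal (∫ x in Q, ‖fderivWithin ℝ u (closure C.Ω) x‖ ^ 2) := by
    rw [hG, lintegral_indicator hQm, ofReal_integral_eq_lintegral_ofReal iD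
      (Eventually.of_forall fun s => by positivity)]
  -- The double integral of (u(x) − u(y))² is computed in two ways: here it is bounded by 8 d² |Q| ∫
  -- |∇u|², and `hL` expands it to 2 |Q| ∫ u² − 2 (∫ u)².
  have hT : ∫⁻ y in Q, ∫⁻ x in Q, ENNReal.ofReal ((u x - u y) ^ 2) ≤
      ENNReal.ofReal (d ^ 2) * (8 * volume Q * ∫⁻ x, G x) := by
    calc ∫⁻ y in Q, ∫⁻ x in Q, ENNReal.ofReal ((u x - u y) ^ 2)
        ≤ ∫⁻ y in Q, ∫⁻ x in Q, ENNReal.ofReal (d ^ 2) *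
            ∫⁻ s in Ioc (0 : ℝ) 1, G (y + s • (x - y)) := by
          refine setLIntegral_mono_ae' hQm (Eventually.of_forall fun y hy => ?_)
          refine setLIntegral_mono_ae' hQm (Eventually.of_forall fun x hx => ?_)
          exact C.sq_sub_le_segment hQ hQΩ hd hu hx hy
      _ = ENNReal.ofReal (d ^ 2) * ∫⁻ s in Ioc (0 : ℝ) 1, ∫⁻ y in Q, ∫⁻ x in Q,
            G (y + s • (x - y)) := by
          have hm1 : Measurable fun z : E3 × E3 × ℝ => G (z.1 + z.2.2 • (z.2.1 - z.1)) :=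
            hGm.comp (by fun_prop)
          have e1 : ∀ y, ∫⁻ x in Q, ENNReal.ofReal (d ^ 2) *
              ∫⁻ s in Ioc (0 : ℝ) 1, G (y + s • (x - y)) =
              ENNReal.ofReal (d ^ 2) * ∫⁻ s in Ioc (0 : ℝ) 1, ∫⁻ x in Q,
                G (y + s • (x - y)) := fun y => by
            rw [lintegral_const_mul' _ _ ENNReal.ofReal_ne_top, lintegral_lintegral_swap]
            exact (hm1.comp (measurable_const.prodMk measurable_id)).aemeasurable
          simp only [e1]
          rw [lintegral_const_mul' _ _ ENNReal.ofReal_ne_top, lintegral_lintegral_swap]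
          have hm2 : Measurable fun z : (E3 × ℝ) × E3 => G (z.1.1 + z.1.2 • (z.2 - z.1.1)) :=
            hGm.comp (by fun_prop)
          exact (Measurable.lintegral_prod_right' (ν := volume.restrict Q) hm2).aemeasurable
      _ ≤ ENNReal.ofReal (d ^ 2) * ∫⁻ s in Ioc (0 : ℝ) 1, 8 * volume Q * ∫⁻ x, G x := by
          gcongr with s
          exact lintegral_segment_le hGm
      _ = _ := by simp
  have hL : ∫⁻ y in Q, ∫⁻ x in Q, ENNReal.ofReal ((u x - u y) ^ 2) =
      ENNReal.ofReal (2 * volume.real Q * (∫ x in Q, u x ^ 2) - 2 * (∫ x in Q, u x) ^ 2) := by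
    have e1 : ∀ y, ∫⁻ x in Q, ENNReal.ofReal ((u x - u y) ^ 2) =
        ENNReal.ofReal ((∫ x in Q, u x ^ 2) - 2 * (∫ x in Q, u x) * u y +
          volume.real Q * u y ^ 2) := fun y => by
      have hc : ContinuousOn (fun x => (u x - u y) ^ 2) (closure C.Ω) :=
        (huc.sub continuousOn_const).pow 2
      rw [← ofReal_integral_eq_lintegral_ofReal (hint hc)
        (Eventually.of_forall fun s => by positivity)]
      congr 1
      have e2 : ∀ x, (u x - u y) ^ 2 = u x ^ 2 - 2 * u y * u x + u y ^ 2 := fun x => by ring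
      simp only [e2]
      rw [integral_add (i21 _) (integrable_const _), integral_sub i2 (i1 _), integral_const_mul]
      simp
      ring
    simp only [e1]
    have hc : ContinuousOn (fun y => (∫ x in Q, u x ^ 2) - 2 * (∫ x in Q, u x) * u y +
          volume.real Q * u y ^ 2) (closure C.Ω) :=
      (continuousOn_const.sub (continuousOn_const.mul huc)).add
        (continuousOn_const.mul (huc.pow 2))
    rw [← ofReal_integral_eq_lintegral_ofReal (hint hc)]
    · congr 1
      have i4 : Integrable (fun y => (∫ x in Q, u x ^ 2) - 2 * (∫ x in Q, u x) * u y)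
          (volume.restrict Q) := (integrable_const _).sub (i1 _)
      rw [integral_add i4 (i2.const_mul _), integral_sub (integrable_const _) (i1 _),
        integral_const_mul, integral_const_mul]
      simp
      ring
    · refine Eventually.of_forall fun y => ?_
      change 0 ≤ (∫ x in Q, u x ^ 2) - 2 * (∫ x in Q, u x) * u y + volume.real Q * u y ^ 2
      have e2 : ∀ x, (u x - u y) ^ 2 = u x ^ 2 - 2 * u y * u x + u y ^ 2 := fun x => by ring
      have h3 : 0 ≤ ∫ x in Q, (u x - u y) ^ 2 := integral_nonneg fun x => sq_nonneg _
      simp only [e2] at h3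
      rw [integral_add (i21 _) (integrable_const _), integral_sub i2 (i1 _), integral_const_mul] at h3
      simp at h3
      linarith
  set I2 := ∫ x in Q, u x ^ 2
  set I1 := ∫ x in Q, u x
  set J := ∫ x in Q, ‖fderivWithin ℝ u (closure C.Ω) x‖ ^ 2
  have hJ : 0 ≤ J := integral_nonneg fun x => by positivity
  rw [hL, hGint] at hT
  have hVe : volume Q = ENNReal.ofReal (volume.real Q) := by
    rw [measureReal_def, ENNReal.ofReal_toReal hQfin]
  rw [hVe, show (8 : ℝ≥0∞) = ENNReal.ofReal 8 by simp, ← ENNReal.ofReal_mul (by norm_num),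
    ← ENNReal.ofReal_mul (by positivity), ← ENNReal.ofReal_mul (by positivity),
    ENNReal.ofReal_le_ofReal_iff (by positivity)] at hT
  have h5 : volume.real Q * I2 ≤ volume.real Q * (4 * d ^ 2 * J + (volume.real Q)⁻¹ * I1 ^ 2) := by
    rw [mul_add, ← mul_assoc (volume.real Q) (volume.real Q)⁻¹, mul_inv_cancel₀ hV.ne']
    linarith
  exact le_of_mul_le_mul_left h5 hV

end Cylinder

/-! ### Control of the L₂ norm by finitely many averages. -/

/-- The half-open lattice cube of side `l` with index `k`. -/
def latticeCube (l : ℝ) (k : Fin 3 → ℤ) : Set E3 := {x | ∀ i, k i * l ≤ x i ∧ x i < (k i + 1) * l}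

theorem convex_latticeCube (l : ℝ) (k : Fin 3 → ℤ) : Convex ℝ (latticeCube l k) := by
  intro x hx y hy a b ha hb hab i
  obtain ⟨h1, h2⟩ := hx i
  obtain ⟨h3, h4⟩ := hy i
  have e : (a • x + b • y) i = a * x i + b * y i := by simp
  rw [e]
  have hb' : b = 1 - a := by linarith
  subst hb'
  constructor
  · nlinarith
  · rcases ha.eq_or_lt with h | h
    · subst h; linarith
    · nlinarith [mul_nonneg hb (sub_nonneg.2 h4.le), mul_pos h (sub_pos.2 h2)]

theorem measurableSet_latticeCube (l : ℝ) (k : Fin 3 → ℤ) : MeasurableSet (latticeCube l k) := by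
  have : latticeCube l k = ⋂ i, (fun x : E3 => x i) ⁻¹' Ico (k i * l) ((k i + 1) * l) := by
    ext x; simp [latticeCube]
  rw [this]
  exact MeasurableSet.iInter fun i =>
    (Cylinder.contDiff_coord (n := 0) i).continuous.measurable measurableSet_Ico

theorem norm_sub_le_of_mem_latticeCube {l : ℝ} (hl : 0 < l) {k : Fin 3 → ℤ} {x y : E3}
    (hx : x ∈ latticeCube l k) (hy : y ∈ latticeCube l k) : ‖x - y‖ ≤ 2 * l := by
  refine abs_le_of_sq_le_sq' ?_ (by positivity) |>.2
  rw [EuclideanSpace.norm_sq_eq, Fin.sum_univ_three]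
  have : ∀ i, ‖(x - y) i‖ ^ 2 ≤ l ^ 2 := fun i => by
    obtain ⟨h1, h2⟩ := hx i
    obtain ⟨h3, h4⟩ := hy i
    rw [Real.norm_eq_abs, sq_abs, PiLp.sub_apply]
    refine sq_le_sq' ?_ ?_ <;> linarith
  nlinarith [this 0, this 1, this 2]

theorem mem_latticeCube_floor {l : ℝ} (hl : 0 < l) (x : E3) :
    x ∈ latticeCube l (fun i => ⌊x i / l⌋) := fun i => by
  constructor
  · rw [← le_div_iff₀ hl]; exact Int.floor_le _
  · rw [← div_lt_iff₀ hl]; exact Int.lt_floor_add_one _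

theorem eq_floor_of_mem_latticeCube {l : ℝ} (hl : 0 < l) {k : Fin 3 → ℤ} {x : E3}
    (hx : x ∈ latticeCube l k) : k = fun i => ⌊x i / l⌋ := by
  ext i
  obtain ⟨h1, h2⟩ := hx i
  symm
  rw [Int.floor_eq_iff, le_div_iff₀ hl, div_lt_iff₀ hl]
  exact ⟨h1, h2⟩

theorem pairwise_disjoint_latticeCube {l : ℝ} (hl : 0 < l) :
    Pairwise fun j k => Disjoint (latticeCube l j) (latticeCube l k) := by
  intro j k hjk
  rw [Set.disjoint_left]
  intro x hj hk
  exact hjk ((eq_floor_of_mem_latticeCube hl hj).trans (eq_floor_of_mem_latticeCube hl hk).symm)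

namespace Cylinder

variable (C : Cylinder)

/-- The part of the cylinder away from the boundary. -/
def interiorPart (δ : ℝ) : Set E3 := {x | ∀ k, δ ≤ C.rho k x}

theorem isClosed_interiorPart (δ : ℝ) : IsClosed (C.interiorPart δ) := by
  unfold interiorPart
  simp only [ofPred_forall]
  exact isClosed_iInter fun k => isClosed_le continuous_const (C.continuous_rho k)

theorem interiorPart_subset {δ : ℝ} (hδ : 0 < δ) : C.interiorPart δ ⊆ C.Ω := fun x hx =>
  (C.mem_Ω_iff x).2 fun k => hδ.trans_le (hx k)

theorem isCompact_interiorPart {δ : ℝ} (hδ : 0 < δ) : IsCompact (C.interiorPart δ) :=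
  C.isCompact_closure_Ω.of_isClosed_subset (C.isClosed_interiorPart δ)
    ((C.interiorPart_subset hδ).trans subset_closure)

theorem exists_collar_measure_lt {ε : ℝ} (hε : 0 < ε) :
    ∃ δ > 0, C.vol.real (C.interiorPart δ)ᶜ < ε := by
  have hanti : Antitone fun n : ℕ => (C.interiorPart (1 / (n + 1 : ℝ)))ᶜ := by
    intro m n hmn
    refine compl_subset_compl.2 fun x hx k => le_trans ?_ (hx k)
    have : (m : ℝ) ≤ n := by exact_mod_cast hmn
    gcongr
  have h1 := tendsto_measure_iInter_atTop (μ := C.vol)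
    (fun n => (C.isClosed_interiorPart (1 / ((n : ℕ) + 1 : ℝ))).measurableSet.compl.nullMeasurableSet)
    hanti ⟨0, measure_ne_top _ _⟩
  have h2 : C.vol (⋂ n : ℕ, (C.interiorPart (1 / (n + 1 : ℝ)))ᶜ) = 0 := by
    rw [measure_eq_zero_iff_ae_notMem]
    filter_upwards [C.ae_mem_Ω] with x hx hmem
    rw [mem_iInter] at hmem
    rw [mem_Ω_iff] at hx
    have hp : 0 < min (C.rho 0 x) (C.rho 1 x) := lt_min (hx 0) (hx 1)
    obtain ⟨n, hn⟩ := exists_nat_one_div_lt hp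
    refine hmem n fun k => ?_
    fin_cases k
    · exact (hn.trans_le (min_le_left _ _)).le
    · exact (hn.trans_le (min_le_right _ _)).le
  rw [h2] at h1
  have h3 := (ENNReal.tendsto_toReal ENNReal.zero_ne_top).comp h1
  have h4 := h3.eventually (gt_mem_nhds (show (0 : ℝ≥0∞).toReal < ε by simpa using hε))
  obtain ⟨n, hn⟩ := h4.exists
  exact ⟨1 / (n + 1 : ℝ), by positivity, hn⟩

theorem h1sq_eq {u : E3 → ℝ} (hu : ContDiffOn ℝ 1 u (closure C.Ω)) :
    C.h1sq u = ∫ x, u x ^ 2 ∂C.vol + ∫ x, ∑ i, C.pd i u x ^ 2 ∂C.vol :=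
  integral_add (C.integrable_of_continuousOn (hu.continuousOn.pow 2))
    (C.integrable_of_continuousOn (continuousOn_finsetSum _ fun i _ =>
      (C.continuousOn_pd hu i).pow 2))

/-- The collar has small measure, and by the Sobolev inequality the L₆ norm prevents the mass of u²
from concentrating there. -/
theorem exists_integral_collar_le {ε : ℝ} (hε : 0 < ε) :
    ∃ δ > 0, ∀ u : E3 → ℝ, ContDiffOn ℝ 1 u (closure C.Ω) →
      ∫ x in (C.interiorPart δ)ᶜ, u x ^ 2 ∂C.vol ≤ ε * C.h1sq u := by
  obtain ⟨c, hc, hsob⟩ := C.exists_sobolev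
  set t : ℝ := ε / (2 * (c + 1)) with ht
  have ht0 : 0 < t := by positivity
  obtain ⟨δ, hδ, hm⟩ := C.exists_collar_measure_lt (ε := ε / 2 * √t) (by positivity)
  refine ⟨δ, hδ, fun u hu => ?_⟩
  set H := C.h1sq u with hH
  have huc := hu.continuousOn
  have hH0 : 0 ≤ H := C.h1sq_nonneg u
  have hle : ∫ x in (C.interiorPart δ)ᶜ, u x ^ 2 ∂C.vol ≤ ∫ x, u x ^ 2 ∂C.vol :=
    setIntegral_le_integral (C.integrable_of_continuousOn (huc.pow 2))
      (Eventually.of_forall fun x => by positivity)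
  rcases hH0.eq_or_lt with h0 | hpos
  · have h1 := C.h1sq_eq hu
    have h2 : 0 ≤ ∫ x, ∑ i, C.pd i u x ^ 2 ∂C.vol := integral_nonneg fun x => by positivity
    rw [← h0, mul_zero]
    linarith
  · have hsq : √t ^ 2 = t := Real.sq_sqrt ht0.le
    have hst : 0 < √t := Real.sqrt_pos.2 ht0
    -- Here `a` stands for u². Above the level H/√t the cubic term dominates; its integral is at
    -- most t c H ≤ ε H/2. The level itself is paid for by the measure of the collar, below (ε/2)√t.
    have hpt : ∀ a : ℝ, 0 ≤ a → a ≤ t / H ^ 2 * a ^ 3 + H / √t := fun a ha => by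
      rcases le_total a (H / √t) with h | h
      · have : 0 ≤ t / H ^ 2 * a ^ 3 := by positivity
        linarith
      · have h1 : H ≤ a * √t := by rwa [div_le_iff₀ hst] at h
        have h2 : H ^ 2 ≤ a ^ 2 * t := by
          calc H ^ 2 ≤ (a * √t) ^ 2 := by gcongr
            _ = a ^ 2 * t := by rw [mul_pow, hsq]
        have h3 : a ≤ t / H ^ 2 * a ^ 3 := by
          rw [div_mul_eq_mul_div, le_div_iff₀ (by positivity)]
          nlinarith
        have : 0 ≤ H / √t := by positivity
        linarith
    have hi6 : Integrable (fun x => t / H ^ 2 * u x ^ 6) C.vol :=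
      (C.integrable_of_continuousOn (huc.pow 6)).const_mul _
    calc ∫ x in (C.interiorPart δ)ᶜ, u x ^ 2 ∂C.vol
        ≤ ∫ x in (C.interiorPart δ)ᶜ, (t / H ^ 2 * u x ^ 6 + H / √t) ∂C.vol := by
          refine integral_mono (C.integrable_of_continuousOn (huc.pow 2)).integrableOn
            (hi6.add (integrable_const _)).integrableOn fun x => ?_
          have := hpt (u x ^ 2) (sq_nonneg _)
          rwa [← pow_mul] at this
      _ = ∫ x in (C.interiorPart δ)ᶜ, t / H ^ 2 * u x ^ 6 ∂C.vol +
            C.vol.real (C.interiorPart δ)ᶜ * (H / √t) := by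
          rw [integral_add hi6.integrableOn (integrable_const _)]
          simp
      _ ≤ t / H ^ 2 * (c * H ^ 3) + (ε / 2 * √t) * (H / √t) := by
          refine add_le_add ?_ (by gcongr)
          refine (setIntegral_le_integral hi6
            (Eventually.of_forall fun x => by positivity)).trans ?_
          rw [integral_const_mul]
          exact mul_le_mul_of_nonneg_left (hsob u hu) (by positivity)
      _ = t * c * H + ε / 2 * H := by field_simp
      _ ≤ ε * H := by
          have : t * c ≤ ε / 2 := by
            rw [ht, div_mul_eq_mul_div, div_le_iff₀ (by positivity)]
            nlinarith
          nlinarith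

/-- Up to a small multiple of the `H¹` norm, the `L²` norm is controlled by finitely many
averages. -/
theorem exists_finite_averages {ε : ℝ} (hε : 0 < ε) :
    ∃ (s : Finset (Fin 3 → ℤ)) (Q : (Fin 3 → ℤ) → Set E3) (M : ℝ), 0 ≤ M ∧
      (∀ k ∈ s, MeasurableSet (Q k)) ∧ (∀ k ∈ s, Q k ⊆ C.Ω) ∧
      ∀ u : E3 → ℝ, ContDiffOn ℝ 1 u (closure C.Ω) →
        ∫ x, u x ^ 2 ∂C.vol ≤ ε * C.h1sq u + M * ∑ k ∈ s, (∫ x in Q k, u x) ^ 2 := by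
  classical
  obtain ⟨δ, hδ, hcol⟩ := C.exists_integral_collar_le (half_pos hε)
  obtain ⟨r, hr, hrΩ⟩ := (C.isCompact_interiorPart hδ).exists_thickening_subset_open C.isOpen_Ω
    (C.interiorPart_subset hδ)
  -- Two points of a cube are at distance at most 2l. Keeping 2l below `r` leaves in the cylinder
  -- every cube that meets the interior part, and the Poincaré constant is 4(2l)² = 16 l².
  obtain ⟨l, hl, hlr, hlε⟩ : ∃ l > 0, 2 * l < r ∧ 16 * l ^ 2 ≤ ε / 2 := by
    have hc : Continuous fun l : ℝ => 16 * l ^ 2 := by fun_prop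
    have h1 : ∀ᶠ l in 𝓝[>] (0 : ℝ), 16 * l ^ 2 < ε / 2 :=
      (hc.tendsto 0).eventually (gt_mem_nhds (by simpa using half_pos hε))
        |>.filter_mono nhdsWithin_le_nhds
    have h2 : ∀ᶠ l in 𝓝[>] (0 : ℝ), l < r / 2 :=
      (eventually_lt_nhds (half_pos hr)).filter_mono nhdsWithin_le_nhds
    obtain ⟨l, h1, h2, h3⟩ := (h1.and (h2.and self_mem_nhdsWithin)).exists
    exact ⟨l, h3, by linarith, h1.le⟩
  obtain ⟨R, hR⟩ := C.isBounded_Ω.exists_norm_le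
  obtain ⟨N, hN⟩ := exists_nat_gt (R / l + 1)
  set s : Finset (Fin 3 → ℤ) :=
    (Fintype.piFinset fun _ => Finset.Icc (-(N : ℤ)) N).filter
      fun k => latticeCube l k ⊆ C.Ω with hs
  have hsΩ : ∀ k ∈ s, latticeCube l k ⊆ C.Ω := fun k hk => (Finset.mem_filter.1 hk).2
  have hcover : C.interiorPart δ ⊆ ⋃ k ∈ s, latticeCube l k := by
    intro x hx
    have hk := mem_latticeCube_floor hl x
    refine mem_biUnion (x := fun i => ⌊x i / l⌋) ?_ hk
    have hsub : latticeCube l (fun i => ⌊x i / l⌋) ⊆ C.Ω := fun y hy => hrΩ <| by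
      rw [Metric.mem_thickening_iff]
      refine ⟨x, hx, ?_⟩
      rw [dist_eq_norm]
      exact (norm_sub_le_of_mem_latticeCube hl hy hk).trans_lt hlr
    refine Finset.mem_coe.2 (Finset.mem_filter.2 ⟨Fintype.mem_piFinset.2 fun i => ?_, hsub⟩)
    have h1 : |x i| ≤ R := (PiLp.norm_apply_le x i).trans (hR x (C.interiorPart_subset hδ hx))
    have h2 : |x i / l| ≤ R / l := by rw [abs_div, abs_of_pos hl]; gcongr
    rw [abs_le] at h2
    rw [Finset.mem_Icc]
    constructor
    · rw [Int.le_floor]; push_cast; linarith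
    · have : (⌊x i / l⌋ : ℝ) ≤ N := (Int.floor_le _).trans (by linarith)
      exact_mod_cast this
  -- Poincaré's inequality weights each squared average by the inverse volume of its cube; the sum
  -- of these weights dominates each of them.
  refine ⟨s, latticeCube l, ∑ k ∈ s, (volume.real (latticeCube l k))⁻¹,
    Finset.sum_nonneg fun k _ => inv_nonneg.2 measureReal_nonneg,
    fun k _ => measurableSet_latticeCube l k, hsΩ, fun u hu => ?_⟩
  have huc := hu.continuousOn
  have hDc := C.continuousOn_fderivWithin hu
  have hΩ : ∀ {f : E3 → ℝ}, ContinuousOn f (closure C.Ω) → IntegrableOn f C.Ω volume :=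
    fun hf => C.integrable_of_continuousOn hf
  set D := fun x => ‖fderivWithin ℝ u (closure C.Ω) x‖ ^ 2
  set U : Set E3 := ⋃ k ∈ s, latticeCube l k with hU
  have hUΩ : U ⊆ C.Ω := iUnion₂_subset hsΩ
  have hUm : MeasurableSet U := Finset.measurableSet_biUnion _ fun k _ =>
    measurableSet_latticeCube l k
  have hsplit : ∀ {f : E3 → ℝ}, ContinuousOn f (closure C.Ω) →
      ∫ x in U, f x = ∑ k ∈ s, ∫ x in latticeCube l k, f x := fun hf =>
    integral_biUnion_finset s (fun k _ => measurableSet_latticeCube l k)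
      (fun j _ k _ hjk => pairwise_disjoint_latticeCube hl hjk)
      fun k hk => (hΩ hf).mono_set (hsΩ k hk)
  have hDle : ∫ x in U, D x ≤ C.h1sq u := by
    calc ∫ x in U, D x ≤ ∫ x in C.Ω, D x :=
          setIntegral_mono_set (hΩ (hDc.norm.pow 2))
            (Eventually.of_forall fun x => by positivity) (Eventually.of_forall hUΩ)
      _ ≤ C.h1sq u := by
          refine integral_mono (C.integrable_of_continuousOn (hDc.norm.pow 2))
            (C.integrable_of_continuousOn ((huc.pow 2).add (continuousOn_finsetSum _ fun i _ =>
              (C.continuousOn_pd hu i).pow 2))) fun x => ?_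
          exact (norm_clm_sq_le _).trans (le_add_of_nonneg_left (sq_nonneg _))
  have h1 : ∫ x in C.interiorPart δ, u x ^ 2 ∂C.vol ≤ ∫ x in U, u x ^ 2 := by
    rw [vol, Measure.restrict_restrict (C.isClosed_interiorPart δ).measurableSet]
    refine setIntegral_mono_set ((hΩ (huc.pow 2)).mono_set hUΩ)
      (Eventually.of_forall fun x => by positivity)
      (Eventually.of_forall fun x hx => hcover hx.1)
  have h2 : ∫ x in U, u x ^ 2 ≤ 16 * l ^ 2 * (∫ x in U, D x) +
      (∑ k ∈ s, (volume.real (latticeCube l k))⁻¹) *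
        ∑ k ∈ s, (∫ x in latticeCube l k, u x) ^ 2 := by
    have e1 : ∫ x in U, u x ^ 2 = ∑ k ∈ s, ∫ x in latticeCube l k, u x ^ 2 := hsplit (huc.pow 2)
    have e2 : ∫ x in U, D x = ∑ k ∈ s, ∫ x in latticeCube l k, D x := hsplit (hDc.norm.pow 2)
    rw [e1, e2, Finset.mul_sum, Finset.mul_sum,
      ← Finset.sum_add_distrib]
    refine Finset.sum_le_sum fun k hk => ?_
    refine (C.poincare_convex (convex_latticeCube l k) (measurableSet_latticeCube l k) (hsΩ k hk)
      (fun x hx y hy => norm_sub_le_of_mem_latticeCube hl hx hy) hu).trans ?_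
    refine add_le_add (le_of_eq (by ring)) (mul_le_mul_of_nonneg_right ?_ (sq_nonneg _))
    exact Finset.single_le_sum (f := fun k => (volume.real (latticeCube l k))⁻¹)
      (fun j _ => inv_nonneg.2 measureReal_nonneg) hk
  have h3 : ∫ x in C.interiorPart δ, u x ^ 2 ∂C.vol + ∫ x in (C.interiorPart δ)ᶜ, u x ^ 2 ∂C.vol =
      ∫ x, u x ^ 2 ∂C.vol := integral_add_compl (μ := C.vol) (C.isClosed_interiorPart δ).measurableSet
    (C.integrable_of_continuousOn (huc.pow 2))
  have h4 := hcol u hu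
  have h5 : 16 * l ^ 2 * (∫ x in U, D x) ≤ ε / 2 * C.h1sq u :=
    mul_le_mul hlε hDle (integral_nonneg fun x => by positivity) (by positivity)
  linarith

end Cylinder

/-! ### Faces of the boundary and tangential derivatives. -/

namespace Cylinder

variable (C : Cylinder)

/-- The relatively open faces of the boundary: `face 0 = S₁`, `face 1 = S₂`. -/
def face (k : Fin 2) : Set E3 := {x | x ∈ closure C.Ω ∧ C.rho k x = 0 ∧ 0 < C.rho (1 - k) x}

theorem S₁_eq_face : C.S₁ = C.face 0 := by
  ext x
  have hb := C.b_pos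
  simp only [S₁, face, mem_ofPred_eq, mem_closure_iff', rho_zero, show (1 : Fin 2) - 0 = 1 from rfl,
    rho_one]
  constructor
  · rintro ⟨h1, h2, h3⟩
    exact ⟨⟨h1.le, h2.le, h3.le⟩, by linarith, by nlinarith⟩
  · rintro ⟨⟨h1, h2, h3⟩, h4, h5⟩
    have := abs_lt_of_sq_lt_sq (a := x 2) (b := C.b) (by linarith) hb.le
    exact ⟨by linarith, (abs_lt.1 this).1, (abs_lt.1 this).2⟩

theorem S₂_eq_face : C.S₂ = C.face 1 := by
  ext x
  have hb := C.b_pos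
  have hω : horiz x ∈ C.ω ↔ C.φ₀ (horiz x) < C.cstar := Iff.rfl
  simp only [S₂, face, mem_ofPred_eq, mem_closure_iff', rho_zero, show (1 : Fin 2) - 1 = 0 from rfl,
    rho_one, hω]
  constructor
  · rintro ⟨h1, h2⟩
    rcases h2 with h2 | h2 <;> rw [h2] <;> exact ⟨⟨h1.le, by linarith, by linarith⟩, by ring,
      by linarith⟩
  · rintro ⟨⟨h1, h2, h3⟩, h4, h5⟩
    refine ⟨by linarith, ?_⟩
    have h6 : (x 2 + C.b) * (x 2 - C.b) = 0 := by linarith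
    rcases mul_eq_zero.1 h6 with h | h
    · left; linarith
    · right; linarith

/-- For S₁ the height is scaled towards 0; for S₂ nearby points of the cylinder are moved vertically
to the height of `x`. Conditions given on the relatively open faces thus extend by continuity to the
edge. -/
theorem exists_face_seq {k : Fin 2} {x : E3} (hx : x ∈ closure C.Ω) (h : C.rho k x = 0) :
    x ∈ closure (C.face k) := by
  have hb := C.b_pos
  have hlift : ∀ y : E3, Continuous fun z : E2 => liftPt z (y 2) := fun y =>
    continuous_liftPt.comp (continuous_id.prodMk continuous_const)
  obtain rfl | rfl : k = 0 ∨ k = 1 := by omega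
  · rw [← S₁_eq_face]
    rw [mem_closure_iff'] at hx
    rw [rho_zero] at h
    have ht : Tendsto (fun s : ℝ => liftPt (horiz x) (s * x 2)) (𝓝[<] 1) (𝓝 x) := by
      have hc : Continuous fun s : ℝ => liftPt (horiz x) (s * x 2) :=
        continuous_liftPt.comp (continuous_const.prodMk (continuous_id.mul continuous_const))
      have := (hc.tendsto 1).mono_left (nhdsWithin_le_nhds (s := Iio 1))
      rwa [one_mul, liftPt_horiz] at this
    refine mem_closure_of_tendsto ht ?_
    have h0 : ∀ᶠ s in 𝓝[<] (1 : ℝ), 0 < s :=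
      (eventually_gt_nhds one_pos).filter_mono nhdsWithin_le_nhds
    filter_upwards [h0, self_mem_nhdsWithin] with s hs hs1
    have hs1' : s < 1 := hs1
    refine ⟨by rw [horiz_liftPt]; linarith, ?_, ?_⟩
    · rw [liftPt_two]; nlinarith [hx.2.1, hx.2.2]
    · rw [liftPt_two]; nlinarith [hx.2.1, hx.2.2]
  · rw [← S₂_eq_face]
    rw [rho_one] at h
    have h6 : (x 2 + C.b) * (x 2 - C.b) = 0 := by linarith
    have hx2 : x 2 = -C.b ∨ x 2 = C.b := by
      rcases mul_eq_zero.1 h6 with h | h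
      · left; linarith
      · right; linarith
    have hmem : (fun y : E3 => liftPt (horiz y) (x 2)) x ∈
        closure ((fun y : E3 => liftPt (horiz y) (x 2)) '' C.Ω) :=
      image_closure_subset_closure_image ((hlift x).comp continuous_horiz) ⟨x, hx, rfl⟩
    simp only [liftPt_horiz] at hmem
    refine closure_mono ?_ hmem
    rintro _ ⟨y, hy, rfl⟩
    exact ⟨by simpa using hy.1, by simpa using hx2⟩

theorem face_subset (k : Fin 2) : C.face k ⊆ closure C.Ω := fun _ hx => hx.1

/-- A continuous function which vanishes on a face vanishes on the closed face. -/
theorem eq_zero_of_face {F : Type*} [NormedAddCommGroup F] {f : E3 → F}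
    (hf : ContinuousOn f (closure C.Ω)) {k : Fin 2}
    (h : ∀ x ∈ C.face k, f x = 0) {x : E3} (hx : x ∈ closure C.Ω) (hxk : C.rho k x = 0) :
    f x = 0 := by
  have h1 := C.exists_face_seq hx hxk
  have h2 : ContinuousWithinAt f (C.face k) x := (hf x hx).mono (C.face_subset k)
  have h3 : f x ∈ closure (f '' C.face k) := h2.mem_closure_image h1
  have h4 : f '' C.face k ⊆ {0} := by rintro _ ⟨y, hy, rfl⟩; exact h y hy
  simpa using closure_mono h4 h3

/-- A continuous inequality on a face extends to the closed face. -/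
theorem le_of_face {f : E3 → ℝ} (hf : ContinuousOn f (closure C.Ω)) {k : Fin 2}
    (h : ∀ x ∈ C.face k, f x ≤ 0) {x : E3} (hx : x ∈ closure C.Ω) (hxk : C.rho k x = 0) :
    f x ≤ 0 := by
  have h0 := C.eq_zero_of_face (f := fun x => max (f x) 0) (hf.sup continuousOn_const) (k := k)
    (fun y hy => max_eq_right (h y hy)) hx hxk
  exact max_eq_right_iff.1 h0

/-- For small steps `rho k` has opposite signs in the directions τ + eN and τ − eN, so by the
intermediate value theorem some τ + rN with |r| ≤ e leads back to the face. This takes the place of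
a parametrisation by the implicit function theorem. -/
theorem tangent_mem_tangentConeAt {k : Fin 2} {x τ : E3} (hx : x ∈ C.face k)
    (hτ : fderiv ℝ (C.rho k) x τ = 0) : τ ∈ tangentConeAt ℝ (C.face k) x := by
  set N := C.gradRho k x with hN
  have hN0 : N ≠ 0 := C.gradRho_ne_zero hx.2.1
  have hNN : 0 < fderiv ℝ (C.rho k) x N := by
    rw [fderiv_rho, real_inner_self_eq_norm_sq]
    have := norm_pos_iff.2 hN0
    positivity
  have hder : ∀ d : E3, HasDerivAt (fun s : ℝ => C.rho k (x + s • d))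
      (fderiv ℝ (C.rho k) x d) 0 := fun d => by
    have h1 : HasFDerivAt (C.rho k) (fderiv ℝ (C.rho k) x) (x + (0 : ℝ) • d) := by
      simpa using (C.differentiable_rho k x).hasFDerivAt
    have h2 : HasDerivAt (fun s : ℝ => x + s • d) d 0 := by
      simpa using ((hasDerivAt_id (0 : ℝ)).smul_const d).const_add x
    exact h1.comp_hasDerivAt 0 h2
  have hsl : ∀ d : E3, Tendsto (fun s : ℝ => s⁻¹ * C.rho k (x + s • d)) (𝓝[>] 0)
      (𝓝 (fderiv ℝ (C.rho k) x d)) := fun d => by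
    have := (hder d).tendsto_slope_zero_right
    simpa [hx.2.1] using this
  have key : ∀ n : ℕ, ∃ s : ℝ, 0 < s ∧ s ≤ 1 / (n + 1) ∧ ∃ r ∈ Icc (-(1 / (n + 1 : ℝ))) (1 / (n + 1)),
      x + s • (τ + r • N) ∈ C.face k := by
    intro n
    set e : ℝ := 1 / (n + 1) with he
    have he0 : 0 < e := by positivity
    have h1 := (hsl (τ + e • N)).eventually (lt_mem_nhds (show 0 < fderiv ℝ (C.rho k) x (τ + e • N) by
      rw [map_add, map_smul, hτ, zero_add, smul_eq_mul]; positivity))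
    have h2 := (hsl (τ + (-e) • N)).eventually (gt_mem_nhds (show fderiv ℝ (C.rho k) x (τ + (-e) • N) < 0 by
      rw [map_add, map_smul, hτ, zero_add, smul_eq_mul]; nlinarith))
    have h3 : ∀ᶠ s in 𝓝[>] (0 : ℝ), s ≤ e :=
      (eventually_le_nhds he0).filter_mono nhdsWithin_le_nhds
    have h4 : ∀ᶠ s in 𝓝[>] (0 : ℝ), ∀ r ∈ Icc (-e) e, 0 < C.rho (1 - k) (x + s • (τ + r • N)) := by
      have hop : {y | 0 < C.rho (1 - k) y} ∈ 𝓝 x :=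
        (isOpen_lt continuous_const (C.continuous_rho (1 - k))).mem_nhds hx.2.2
      obtain ⟨ε, hε, hball⟩ := Metric.mem_nhds_iff.1 hop
      have hc : Continuous fun s : ℝ => s * (‖τ‖ + e * ‖N‖) := by fun_prop
      have h5 : ∀ᶠ s in 𝓝[>] (0 : ℝ), s * (‖τ‖ + e * ‖N‖) < ε :=
        ((hc.tendsto 0).eventually (gt_mem_nhds (by simpa using hε))).filter_mono
          nhdsWithin_le_nhds
      filter_upwards [h5, self_mem_nhdsWithin] with s hs hs0 r hr
      refine hball ?_
      rw [Metric.mem_ball, dist_eq_norm, add_sub_cancel_left, norm_smul, Real.norm_eq_abs,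
        abs_of_pos hs0]
      refine lt_of_le_of_lt (mul_le_mul_of_nonneg_left ?_ (le_of_lt hs0)) hs
      refine (norm_add_le _ _).trans (add_le_add le_rfl ?_)
      rw [norm_smul, Real.norm_eq_abs]
      exact mul_le_mul_of_nonneg_right (abs_le.2 hr) (norm_nonneg _)
    obtain ⟨s, hs1, hs2, hs3, hs4, hs0⟩ :=
      (h1.and (h2.and (h3.and (h4.and self_mem_nhdsWithin)))).exists
    have hs0' : (0 : ℝ) < s := hs0
    refine ⟨s, hs0', hs3, ?_⟩
    have hc : Continuous fun r : ℝ => C.rho k (x + s • (τ + r • N)) :=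
      (C.continuous_rho _).comp (by fun_prop)
    have hpos : 0 < C.rho k (x + s • (τ + e • N)) := (mul_pos_iff_of_pos_left (inv_pos.2 hs0')).1 hs1
    have hneg : C.rho k (x + s • (τ + (-e) • N)) < 0 := by
      by_contra! hcon
      have := mul_nonneg (inv_pos.2 hs0').le hcon
      linarith
    obtain ⟨r, hr, hr0⟩ := intermediate_value_Icc (by linarith : -e ≤ e) hc.continuousOn
      ⟨hneg.le, hpos.le⟩
    have hr0' : C.rho k (x + s • (τ + r • N)) = 0 := hr0
    refine ⟨r, hr, ?_, hr0', hs4 r hr⟩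
    rw [closure_Ω_eq]
    intro j
    have hj : j = k ∨ j = 1 - k := by omega
    rcases hj with rfl | rfl
    · exact hr0'.ge
    · exact (hs4 r hr).le
  choose s hs0 hs1 r hr hmem using key
  have hlim := tendsto_one_div_add_atTop_nhds_zero_nat (𝕜 := ℝ)
  have hs : Tendsto s atTop (𝓝 0) := squeeze_zero (fun n => (hs0 n).le) hs1 hlim
  have hrl : Tendsto r atTop (𝓝 0) := by
    refine squeeze_zero_norm (fun n => ?_) hlim
    exact abs_le.2 ⟨(hr n).1, (hr n).2⟩
  have hd : Tendsto (fun n => τ + r n • N) atTop (𝓝 τ) := by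
    simpa using (hrl.smul_const N).const_add τ
  refine mem_tangentConeAt_of_seq atTop (fun n => (s n)⁻¹) (fun n => s n • (τ + r n • N)) ?_
    (Eventually.of_forall hmem) ?_
  · simpa using hs.smul hd
  · refine hd.congr fun n => ?_
    rw [smul_smul, inv_mul_cancel₀ (hs0 n).ne', one_smul]

/-- Tangential derivatives of a function which vanishes on a face. -/
theorem fderivWithin_tangent_eq_zero {w : E3 → ℝ} (hw : ContDiffOn ℝ 1 w (closure C.Ω))
    {k : Fin 2} (h0 : ∀ x ∈ C.face k, w x = 0) {x τ : E3} (hx : x ∈ C.face k)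
    (hτ : fderiv ℝ (C.rho k) x τ = 0) : fderivWithin ℝ w (closure C.Ω) x τ = 0 := by
  have h1 : HasFDerivWithinAt w (fderivWithin ℝ w (closure C.Ω) x) (C.face k) x :=
    ((hw.differentiableOn (by norm_num) x hx.1).hasFDerivWithinAt).mono (C.face_subset k)
  have h2 : HasFDerivWithinAt w (0 : E3 →L[ℝ] ℝ) (C.face k) x :=
    (hasFDerivWithinAt_const (0 : ℝ) x (C.face k)).congr h0 (h0 x hx)
  exact h1.unique_on h2 (C.tangent_mem_tangentConeAt hx hτ)

/-! ### Calculus of partial derivatives up to the boundary. -/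

section PartialDerivatives

variable {C} {v w : E3 → ℝ} {x : E3}

theorem differentiableWithinAt_of_contDiffOn (hw : ContDiffOn ℝ 1 w (closure C.Ω))
    (hx : x ∈ closure C.Ω) : DifferentiableWithinAt ℝ w (closure C.Ω) x :=
  hw.differentiableOn (by norm_num) x hx

theorem contDiffOn_pd (hw : ContDiffOn ℝ 2 w (closure C.Ω)) (i : Fin 3) :
    ContDiffOn ℝ 1 (C.pd i w) (closure C.Ω) :=
  (hw.fderivWithin C.uniqueDiffOn_closure_Ω (by norm_num)).clm_apply contDiffOn_const

theorem pd_add (hv : ContDiffOn ℝ 1 v (closure C.Ω)) (hw : ContDiffOn ℝ 1 w (closure C.Ω))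
    (hx : x ∈ closure C.Ω) (i : Fin 3) :
    C.pd i (fun y => v y + w y) x = C.pd i v x + C.pd i w x := by
  rw [pd, fderivWithin_fun_add (C.uniqueDiffOn_closure_Ω x hx)
    (differentiableWithinAt_of_contDiffOn hv hx) (differentiableWithinAt_of_contDiffOn hw hx)]
  rfl

theorem pd_sub (hv : ContDiffOn ℝ 1 v (closure C.Ω)) (hw : ContDiffOn ℝ 1 w (closure C.Ω))
    (hx : x ∈ closure C.Ω) (i : Fin 3) :
    C.pd i (fun y => v y - w y) x = C.pd i v x - C.pd i w x := by
  rw [pd, fderivWithin_fun_sub (C.uniqueDiffOn_closure_Ω x hx)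
    (differentiableWithinAt_of_contDiffOn hv hx) (differentiableWithinAt_of_contDiffOn hw hx)]
  rfl

theorem pd_mul (hv : ContDiffOn ℝ 1 v (closure C.Ω)) (hw : ContDiffOn ℝ 1 w (closure C.Ω))
    (hx : x ∈ closure C.Ω) (i : Fin 3) :
    C.pd i (fun y => v y * w y) x = C.pd i v x * w x + v x * C.pd i w x := by
  rw [pd, fderivWithin_fun_mul (C.uniqueDiffOn_closure_Ω x hx)
    (differentiableWithinAt_of_contDiffOn hv hx) (differentiableWithinAt_of_contDiffOn hw hx)]
  simp [pd]
  ring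

theorem pd_const_mul (a : ℝ) (hw : ContDiffOn ℝ 1 w (closure C.Ω))
    (hx : x ∈ closure C.Ω) (i : Fin 3) : C.pd i (fun y => a * w y) x = a * C.pd i w x := by
  rw [pd, fderivWithin_const_mul (C.uniqueDiffOn_closure_Ω x hx) (differentiableWithinAt_of_contDiffOn hw hx)]
  rfl

theorem pd_sum {ι : Type*} {s : Finset ι} {f : ι → E3 → ℝ}
    (hf : ∀ j ∈ s, ContDiffOn ℝ 1 (f j) (closure C.Ω)) (hx : x ∈ closure C.Ω) (i : Fin 3) :
    C.pd i (fun y => ∑ j ∈ s, f j y) x = ∑ j ∈ s, C.pd i (f j) x := by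
  rw [pd, fderivWithin_fun_sum (C.uniqueDiffOn_closure_Ω x hx)
    (fun j hj => differentiableWithinAt_of_contDiffOn (hf j hj) hx)]
  simp [pd]

theorem pd_congr (h : ∀ y ∈ closure C.Ω, v y = w y) (hx : x ∈ closure C.Ω) (i : Fin 3) :
    C.pd i v x = C.pd i w x := by
  rw [pd, fderivWithin_congr h (h x hx)]; rfl

theorem pd_eq_zero_of_eqOn (h : ∀ y ∈ C.Ω, w y = 0) (hx : x ∈ C.Ω) (i : Fin 3) :
    C.pd i w x = 0 := by
  have : w =ᶠ[𝓝 x] fun _ => 0 := by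
    filter_upwards [C.isOpen_Ω.mem_nhds hx] with y hy using h y hy
  rw [C.pd_eq hx, this.fderiv_eq]
  simp

theorem pd_coord (i j : Fin 3) (hx : x ∈ closure C.Ω) :
    C.pd i (fun y => y j) x = if i = j then 1 else 0 := by
  have h : HasFDerivWithinAt (fun y : E3 => y j) (EuclideanSpace.proj (𝕜 := ℝ) j) (closure C.Ω) x :=
    (EuclideanSpace.proj (𝕜 := ℝ) j).hasFDerivWithinAt
  rw [pd, h.fderivWithin (C.uniqueDiffOn_closure_Ω x hx)]
  simp [eq_comm]

theorem pd_comm (hw : ContDiffOn ℝ 2 w (closure C.Ω)) (hx : x ∈ C.Ω) (i j : Fin 3) :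
    C.pd i (C.pd j w) x = C.pd j (C.pd i w) x := by
  have hat : ContDiffAt ℝ 2 w x := hw.contDiffAt (C.closure_mem_nhds hx)
  have hd : DifferentiableAt ℝ (fderiv ℝ w) x :=
    (hat.fderiv_right (m := 1) (by norm_num)).differentiableAt (by norm_num)
  have key : ∀ i j, C.pd i (C.pd j w) x =
      fderiv ℝ (fderiv ℝ w) x (EuclideanSpace.single i 1) (EuclideanSpace.single j 1) := by
    intro i j
    have he : C.pd j w =ᶠ[𝓝 x] fun y => fderiv ℝ w y (EuclideanSpace.single j 1) := by
      filter_upwards [C.isOpen_Ω.mem_nhds hx] with y hy using C.pd_eq hy j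
    rw [C.pd_eq hx, he.fderiv_eq]
    have h2 := hd.hasFDerivAt.clm_apply
      (hasFDerivAt_const (EuclideanSpace.single j (1 : ℝ) : E3) x)
    rw [h2.fderiv]
    simp
  rw [key, key]
  exact (hat.isSymmSndFDerivAt (by simp)) _ _

theorem fderivWithin_comp_apply {u : E3 → E3} (hu : ContDiffOn ℝ 1 u (closure C.Ω))
    (hx : x ∈ closure C.Ω) (i : Fin 3) (d : E3) :
    fderivWithin ℝ (fun y => u y i) (closure C.Ω) x d =
      fderivWithin ℝ u (closure C.Ω) x d i := by
  have h := (EuclideanSpace.proj (𝕜 := ℝ) i).hasFDerivAt.comp_hasFDerivWithinAt x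
    (hu.differentiableOn (by norm_num) x hx).hasFDerivWithinAt
  have h' : HasFDerivWithinAt (fun y => u y i) ((EuclideanSpace.proj (𝕜 := ℝ) i).comp
    (fderivWithin ℝ u (closure C.Ω) x)) (closure C.Ω) x := h
  rw [h'.fderivWithin (C.uniqueDiffOn_closure_Ω x hx)]
  rfl

theorem convect_eq {u : E3 → E3} (w : E3 → ℝ) :
    C.convect u w x = fderivWithin ℝ w (closure C.Ω) x (u x) := by
  rw [clm_apply_eq_sum]; rfl

end PartialDerivatives

/-! ### The second Korn inequality. -/

/-- The square of the `H¹(Ω)` norm of a vector field. -/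
def h1v (u : E3 → E3) : ℝ := ∑ i, C.h1sq fun x => u x i

/-- The square of the `L²(Ω)` norm of the dilatation tensor. -/
def dilSq (u : E3 → E3) : ℝ := ∫ x, ∑ i, ∑ j, C.dil u x i j ^ 2 ∂C.vol

theorem h1v_nonneg (u : E3 → E3) : 0 ≤ C.h1v u := Finset.sum_nonneg fun _ _ => C.h1sq_nonneg _

theorem dilSq_nonneg (u : E3 → E3) : 0 ≤ C.dilSq u := integral_nonneg fun x => by positivity

variable {C} in
theorem continuousOn_dil {u : E3 → E3} (hu : ContDiffOn ℝ 1 u (closure C.Ω)) (i j : Fin 3) :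
    ContinuousOn (fun x => C.dil u x i j) (closure C.Ω) :=
  (C.continuousOn_pd (contDiffOn_comp hu i) j).add (C.continuousOn_pd (contDiffOn_comp hu j) i)

variable {C} in
theorem contDiffOn_dil {u : E3 → E3} (hu : ContDiffOn ℝ 2 u (closure C.Ω)) (i j : Fin 3) :
    ContDiffOn ℝ 1 (fun x => C.dil u x i j) (closure C.Ω) :=
  (contDiffOn_pd (contDiffOn_comp hu i) j).add (contDiffOn_pd (contDiffOn_comp hu j) i)

/-- The square integral of the gradient in terms of the dilatation tensor. -/
theorem integral_grad_eq {u : E3 → E3} (hu : ContDiffOn ℝ 2 u (closure C.Ω))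
    (hdiv : ∀ x ∈ C.Ω, C.divergence u x = 0) :
    ∫ x, ∑ i, ∑ j, C.pd j (fun y => u y i) x ^ 2 ∂C.vol =
      1 / 2 * C.dilSq u -
        ∫ x, C.divergence (fun y => fderivWithin ℝ u (closure C.Ω) y (u y)) x ∂C.vol := by
  have hu1 := hu.of_le (m := 1) (by norm_num)
  have hc := fun i => contDiffOn_comp hu i
  have hc1 := fun i => contDiffOn_comp hu1 i
  have hp := fun i j => contDiffOn_pd (hc i) j
  have hF : ContDiffOn ℝ 1 (fun y => fderivWithin ℝ u (closure C.Ω) y (u y)) (closure C.Ω) :=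
    (hu.fderivWithin C.uniqueDiffOn_closure_Ω (by norm_num)).clm_apply hu1
  have hFi : ∀ i, ∀ y ∈ closure C.Ω, fderivWithin ℝ u (closure C.Ω) y (u y) i =
      ∑ j, u y j * C.pd j (fun y => u y i) y := fun i y hy => by
    rw [← fderivWithin_comp_apply hu1 hy, clm_apply_eq_sum]; rfl
  have i1 : Integrable (fun x => 1 / 2 * ∑ i, ∑ j, C.dil u x i j ^ 2) C.vol :=
    C.integrable_of_continuousOn (continuousOn_const.mul (continuousOn_finsetSum _ fun i _ =>
      continuousOn_finsetSum _ fun j _ => (continuousOn_dil hu1 i j).pow 2))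
  rw [dilSq, ← integral_const_mul, ← integral_sub i1
    (C.integrable_of_continuousOn (C.continuousOn_divergence hF))]
  refine integral_congr_ae ?_
  filter_upwards [C.ae_mem_Ω] with x hx
  have hxK := subset_closure hx
  -- In general div((u·∇)u) = Σ u_{i,j} u_{j,i} + u·∇(div u), and the last term vanishes. On the
  -- other hand ½|D(u)|² = |∇u|² + Σ u_{i,j} u_{j,i}.
  have hdivF : C.divergence (fun y => fderivWithin ℝ u (closure C.Ω) y (u y)) x =
      ∑ i, ∑ j, C.pd i (fun y => u y j) x * C.pd j (fun y => u y i) x := by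
    have h1 : C.divergence (fun y => fderivWithin ℝ u (closure C.Ω) y (u y)) x =
        ∑ i, ∑ j, (C.pd i (fun y => u y j) x * C.pd j (fun y => u y i) x +
          u x j * C.pd i (C.pd j (fun y => u y i)) x) := by
      refine Finset.sum_congr rfl fun i _ => ?_
      rw [pd_congr (hFi i) hxK, pd_sum (fun j _ => (hc1 j).mul (hp i j)) hxK]
      exact Finset.sum_congr rfl fun j _ => pd_mul (hc1 j) (hp i j) hxK i
    rw [h1]
    simp only [Finset.sum_add_distrib]
    rw [add_eq_left, Finset.sum_comm]
    refine Finset.sum_eq_zero fun j _ => ?_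
    rw [← Finset.mul_sum]
    have h2 : ∑ i, C.pd i (C.pd j (fun y => u y i)) x = C.pd j (C.divergence u) x := by
      have : C.divergence u = fun y => ∑ i, C.pd i (fun z => u z i) y := rfl
      rw [this, pd_sum (fun i _ => hp i i) hxK]
      exact Finset.sum_congr rfl fun i _ => pd_comm (hc i) hx i j
    rw [h2, pd_eq_zero_of_eqOn hdiv hx, mul_zero]
  simp only [hdivF, dil, Fin.sum_univ_three]
  ring

/-- The second Korn inequality for solenoidal fields tangent to the lateral boundary. -/
theorem exists_korn_second : ∃ c, 0 ≤ c ∧ ∀ u : E3 → E3, ContDiffOn ℝ 2 u (closure C.Ω) →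
    (∀ x ∈ C.Ω, C.divergence u x = 0) → (∀ x ∈ C.face 0, fderiv ℝ (C.rho 0) x (u x) = 0) →
    (∀ x ∈ C.face 1, C.convect u (fun y => u y 2) x = 0) →
    C.h1v u ≤ C.dilSq u + c * ∫ x, ∑ i, u x i ^ 2 ∂C.vol := by
  obtain ⟨c, hc, hflux⟩ := C.exists_flux_bound
  have hgd : Continuous (fderiv ℝ (C.gradRho 0)) :=
    (C.contDiff_gradRho 0).continuous_fderiv (by norm_num)
  obtain ⟨B, hB0, hB⟩ := C.exists_bound_of_continuousOn hgd.continuousOn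
  refine ⟨2 * c * (B + 2 * c * B ^ 2) + 1, by positivity, fun u hu hdiv h0 h1 => ?_⟩
  have hu1 := hu.of_le (m := 1) (by norm_num)
  have hc1 := fun i => contDiffOn_comp hu1 i
  have hF : ContDiffOn ℝ 1 (fun y => fderivWithin ℝ u (closure C.Ω) y (u y)) (closure C.Ω) :=
    (hu.fderivWithin C.uniqueDiffOn_closure_Ω (by norm_num)).clm_apply hu1
  set F := fun y => fderivWithin ℝ u (closure C.Ω) y (u y) with hFdef
  set w : Fin 2 → E3 → ℝ := fun k x => if k = 0 then B * ∑ i, u x i ^ 2 else 0 with hw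
  have hsq : ContDiffOn ℝ 1 (fun x => ∑ i, u x i ^ 2) (closure C.Ω) :=
    ContDiffOn.sum fun i _ => (hc1 i).pow 2
  have hnorm : ∀ x, ‖u x‖ ^ 2 = ∑ i, u x i ^ 2 := fun x => by
    simp [EuclideanSpace.norm_sq_eq]
  have hw0 : w 0 = fun x => B * ∑ i, u x i ^ 2 := by funext x; simp [hw]
  have hw1 : w 1 = fun _ => 0 := by funext x; simp [hw]
  have hwC : ∀ k, ContDiffOn ℝ 1 (w k) (closure C.Ω) := by
    rw [Fin.forall_fin_two, hw0, hw1]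
    exact ⟨contDiffOn_const.mul hsq, contDiffOn_const⟩
  have hgC : ContDiffOn ℝ 1 (fun x => fderiv ℝ (C.rho 0) x (u x)) (closure C.Ω) := by
    have : ContDiff ℝ 1 (fderiv ℝ (C.rho 0)) := (C.contDiff_rho 0).fderiv_right (by norm_num)
    exact this.contDiffOn.clm_apply hu1
  have hrF : ∀ k, ContinuousOn (fun x => fderiv ℝ (C.rho k) x (F x)) (closure C.Ω) := fun k =>
    (((C.contDiff_rho k).continuous_fderiv (by norm_num)).continuousOn).clm_apply hF.continuousOn
  -- With N = `gradRho 0`, the identity N·u = 0 on S₁ is differentiated along the tangent vector u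
  -- itself. This gives N·(u·∇)u = −(∂_u N)·u, which contains no derivative of u. On S₂ the normal
  -- component vanishes by hypothesis.
  have hface : ∀ k, ∀ x ∈ C.face k, |fderiv ℝ (C.rho k) x (F x)| ≤ w k x := by
    rw [Fin.forall_fin_two]
    constructor
    · intro x hx
      have ht := C.fderivWithin_tangent_eq_zero hgC h0 hx (h0 x hx)
      have e : ∀ x, fderiv ℝ (C.rho 0) x (u x) = inner ℝ (C.gradRho 0 x) (u x) := fun x =>
        C.fderiv_rho 0 x (u x)
      simp only [e] at ht
      have hg := ((C.contDiff_gradRho 0).differentiable (by norm_num) x).hasFDerivAt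
        |>.hasFDerivWithinAt (s := closure C.Ω)
      have hud := (hu1.differentiableOn (by norm_num) x hx.1).hasFDerivWithinAt
      rw [(hg.inner ℝ hud).fderivWithin (C.uniqueDiffOn_closure_Ω x hx.1)] at ht
      simp only [ContinuousLinearMap.comp_apply, ContinuousLinearMap.prod_apply,
        fderivInnerCLM_apply] at ht
      have e2 : fderiv ℝ (C.rho 0) x (F x) = -inner ℝ (fderiv ℝ (C.gradRho 0) x (u x)) (u x) := by
        rw [C.fderiv_rho]; linarith
      rw [e2, abs_neg, hw0]
      refine (abs_real_inner_le_norm _ _).trans ?_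
      change _ ≤ B * ∑ i, u x i ^ 2
      rw [← hnorm]
      have := (fderiv ℝ (C.gradRho 0) x).le_opNorm (u x)
      have h3 : ‖fderiv ℝ (C.gradRho 0) x‖ * ‖u x‖ ≤ B * ‖u x‖ := by gcongr; exact hB x hx.1
      calc _ ≤ (B * ‖u x‖) * ‖u x‖ := by gcongr; exact this.trans h3
        _ = B * ‖u x‖ ^ 2 := by ring
    · intro x hx
      have h2 := h1 x hx
      rw [convect_eq, fderivWithin_comp_apply hu1 hx.1] at h2
      have h3 : F x 2 = 0 := h2
      rw [fderiv_rho_one, hw1, h3]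
      simp
  have hclosed : ∀ k, ∀ x ∈ closure C.Ω, C.rho k x = 0 →
      |fderiv ℝ (C.rho k) x (F x)| ≤ w k x := fun k x hx hk => by
    have := C.le_of_face (f := fun x => |fderiv ℝ (C.rho k) x (F x)| - w k x)
      ((hrF k).abs.sub (hwC k).continuousOn)
      (fun y hy => sub_nonpos.2 (hface k y hy)) hx hk
    linarith
  have hwnn : ∀ k, ∀ x ∈ closure C.Ω, 0 ≤ w k x := by
    rw [Fin.forall_fin_two, hw0, hw1]
    exact ⟨fun x _ => by positivity, fun x _ => le_rfl⟩
  have hfl := hflux F w hF hwC hwnn hclosed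
  rw [Fin.sum_univ_two, hw0, hw1] at hfl
  have hz : ∫ x, ((0 : ℝ) + ‖fderivWithin ℝ (fun _ : E3 => (0 : ℝ)) (closure C.Ω) x‖) ∂C.vol = 0 := by
    simp
  rw [hz, add_zero] at hfl
  set L := ∫ x, ∑ i, u x i ^ 2 ∂C.vol with hL
  set G := ∫ x, ∑ i, ∑ j, C.pd j (fun y => u y i) x ^ 2 ∂C.vol with hG
  have hLi : Integrable (fun x => ∑ i, u x i ^ 2) C.vol := C.integrable_of_continuousOn hsq.continuousOn
  have hGi : Integrable (fun x => ∑ i, ∑ j, C.pd j (fun y => u y i) x ^ 2) C.vol :=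
    C.integrable_of_continuousOn (continuousOn_finsetSum _ fun i _ =>
      continuousOn_finsetSum _ fun j _ => (C.continuousOn_pd (hc1 i) j).pow 2)
  -- The gradient of B|u|² is split by Young's inequality with a free parameter `e`, so that its
  -- part in ∇u can be absorbed.
  have hbound : ∀ e : ℝ, 0 < e → ∫ x, (B * ∑ i, u x i ^ 2 +
      ‖fderivWithin ℝ (fun x => B * ∑ i, u x i ^ 2) (closure C.Ω) x‖) ∂C.vol ≤
      (B + B ^ 2 / e) * L + e * G := fun e he => by
    rw [hL, hG, ← integral_const_mul, ← integral_const_mul,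
      ← integral_add (hLi.const_mul _) (hGi.const_mul _)]
    have hcw := C.continuousOn_fderivWithin (contDiffOn_const (c := B) |>.mul hsq)
    refine integral_mono_ae (C.integrable_of_continuousOn
      ((continuousOn_const.mul hsq.continuousOn).add hcw.norm))
      ((hLi.const_mul _).add (hGi.const_mul _)) ?_
    filter_upwards [C.ae_mem_Ω] with x hx
    have hxK := subset_closure hx
    have hd : HasFDerivWithinAt (fun x => B * ∑ i, u x i ^ 2)
        (B • ∑ i, (2 * u x i) • fderivWithin ℝ (fun y => u y i) (closure C.Ω) x) (closure C.Ω) x := by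
      refine HasFDerivWithinAt.const_mul (HasFDerivWithinAt.fun_sum fun i _ => ?_) B
      have := ((hc1 i).differentiableOn (by norm_num) x hxK).hasFDerivWithinAt.pow 2
      simpa using this
    have hn : ‖fderivWithin ℝ (fun x => B * ∑ i, u x i ^ 2) (closure C.Ω) x‖ ≤
        ∑ i, (B ^ 2 / e * u x i ^ 2 + e * ∑ j, C.pd j (fun y => u y i) x ^ 2) := by
      rw [hd.fderivWithin (C.uniqueDiffOn_closure_Ω x hxK), Finset.smul_sum]
      refine (norm_sum_le _ _).trans (Finset.sum_le_sum fun i _ => ?_)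
      have h5 := norm_clm_sq_le (fderivWithin ℝ (fun y => u y i) (closure C.Ω) x)
      have h6 : ∑ j, fderivWithin ℝ (fun y => u y i) (closure C.Ω) x (EuclideanSpace.single j 1) ^ 2
        = ∑ j, C.pd j (fun y => u y i) x ^ 2 := rfl
      rw [h6] at h5
      set n := ‖fderivWithin ℝ (fun y => u y i) (closure C.Ω) x‖
      rw [norm_smul, norm_smul, Real.norm_eq_abs, Real.norm_eq_abs, abs_of_nonneg hB0, abs_mul,
        abs_two]
      have h7 : 2 * (B * |u x i|) * n ≤ B ^ 2 / e * u x i ^ 2 + e * n ^ 2 := by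
        have h8 : 0 ≤ (B * |u x i| - e * n) ^ 2 / e := by positivity
        have h9 : (B * |u x i| - e * n) ^ 2 / e =
            B ^ 2 / e * |u x i| ^ 2 + e * n ^ 2 - 2 * (B * |u x i|) * n := by
          field_simp
          ring
        rw [sq_abs] at h9
        linarith
      nlinarith
    rw [Finset.sum_add_distrib, ← Finset.mul_sum, ← Finset.mul_sum] at hn
    change B * ∑ i, u x i ^ 2 + _ ≤ (B + B ^ 2 / e) * ∑ i, u x i ^ 2 +
      e * ∑ i, ∑ j, C.pd j (fun y => u y i) x ^ 2
    linarith
  have hid := C.integral_grad_eq hu hdiv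
  have hh1 : C.h1v u = L + G := by
    rw [hL, hG, h1v, ← integral_add hLi hGi]
    simp only [h1sq]
    rw [← integral_finsetSum]
    · simp only [Finset.sum_add_distrib]
    · intro i _
      exact C.integrable_of_continuousOn (((hc1 i).continuousOn.pow 2).add
        (continuousOn_finsetSum _ fun j _ => (C.continuousOn_pd (hc1 i) j).pow 2))
  have hL0 : 0 ≤ L := integral_nonneg fun x => by positivity
  have hG0 : 0 ≤ G := integral_nonneg fun x => by positivity
  have hD0 := C.dilSq_nonneg u
  have habs := neg_abs_le (∫ x, C.divergence F x ∂C.vol)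
  -- The choice e = 1/(2c) leaves G/2 to be absorbed. It is not available for c = 0, where the flux
  -- bound already gives zero.
  rcases hc.eq_or_lt with hc0 | hcpos
  · rw [← hc0] at hfl ⊢
    rw [zero_mul] at hfl
    rw [hh1]
    change G = 1 / 2 * C.dilSq u - ∫ x, C.divergence F x ∂C.vol at hid
    nlinarith
  · have h10 := hbound (1 / (2 * c)) (by positivity)
    have h11 := hfl.trans (mul_le_mul_of_nonneg_left h10 hc)
    have h12 : c * ((B + B ^ 2 / (1 / (2 * c))) * L + 1 / (2 * c) * G) =
        c * (B + 2 * c * B ^ 2) * L + G / 2 := by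
      field_simp
    rw [h12] at h11
    rw [hh1]
    change G = 1 / 2 * C.dilSq u - ∫ x, C.divergence F x ∂C.vol at hid
    nlinarith

end Cylinder

/-! ### L₂ limits and functions with vanishing weak gradient. -/

theorem eLpNorm_two_sq {X : Type*} [MeasurableSpace X] {μ : Measure X} {f : X → ℝ}
    (hf : MemLp f 2 μ) : eLpNorm f 2 μ ^ 2 = ENNReal.ofReal (∫ x, f x ^ 2 ∂μ) := by
  rw [hf.eLpNorm_eq_integral_rpow_norm (by simp) (by simp), ← ENNReal.ofReal_pow (by positivity)]
  congr 1
  have e : ∫ x, ‖f x‖ ^ (2 : ℝ≥0∞).toReal ∂μ = ∫ x, f x ^ 2 ∂μ := by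
    refine integral_congr_ae (Eventually.of_forall fun x => ?_)
    simp
  rw [e, ← Real.rpow_natCast, ← Real.rpow_mul (integral_nonneg fun x => sq_nonneg _)]
  simp

theorem exists_L2_limit {X : Type*} [MeasurableSpace X] {μ : Measure X} {f : ℕ → X → ℝ}
    (hf : ∀ n, MemLp (f n) 2 μ)
    (hc : ∀ ε > 0, ∃ N, ∀ n ≥ N, ∀ m ≥ N, ∫ x, (f n x - f m x) ^ 2 ∂μ < ε) :
    ∃ g, MemLp g 2 μ ∧ Tendsto (fun n => ∫ x, (f n x - g x) ^ 2 ∂μ) atTop (𝓝 0) := by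
  have hnorm : ∀ {g h : X → ℝ} (hg : MemLp g 2 μ) (hh : MemLp h 2 μ),
      dist (hg.toLp g) (hh.toLp h) ^ 2 = ∫ x, (g x - h x) ^ 2 ∂μ := fun {g h} hg hh => by
    have h1 := eLpNorm_two_sq (hg.sub hh)
    rw [dist_eq_norm, ← MemLp.toLp_sub, Lp.norm_toLp, ← ENNReal.toReal_pow, h1,
      ENNReal.toReal_ofReal (integral_nonneg fun x => sq_nonneg _)]
    rfl
  have hcau : CauchySeq fun n => (hf n).toLp (f n) := by
    rw [Metric.cauchySeq_iff]
    intro ε hε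
    obtain ⟨N, hN⟩ := hc (ε ^ 2) (by positivity)
    refine ⟨N, fun n hn m hm => ?_⟩
    have := hN n hn m hm
    rw [← hnorm (hf n) (hf m)] at this
    exact lt_of_pow_lt_pow_left₀ 2 hε.le this
  obtain ⟨G, hG⟩ := cauchySeq_tendsto_of_complete hcau
  refine ⟨G, Lp.memLp G, ?_⟩
  have h1 := (tendsto_iff_dist_tendsto_zero.1 hG).pow 2
  rw [zero_pow two_ne_zero] at h1
  refine h1.congr fun n => ?_
  rw [← hnorm (hf n) (Lp.memLp G), Lp.toLp_coeFn]

theorem tendsto_integral_mul_of_L2 {X : Type*} [MeasurableSpace X] {μ : Measure X} {f : ℕ → X → ℝ}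
    {g ζ : X → ℝ} (hf : ∀ n, MemLp (f n) 2 μ) (hg : MemLp g 2 μ) (hζ : MemLp ζ 2 μ)
    (h : Tendsto (fun n => ∫ x, (f n x - g x) ^ 2 ∂μ) atTop (𝓝 0)) :
    Tendsto (fun n => ∫ x, f n x * ζ x ∂μ) atTop (𝓝 (∫ x, g x * ζ x ∂μ)) := by
  rw [tendsto_iff_norm_sub_tendsto_zero]
  have hint : ∀ n, Integrable (fun x => (f n x - g x) * ζ x) μ := fun n =>
    ((hf n).sub hg).integrable_mul hζ
  have hle : ∀ n, ‖(∫ x, f n x * ζ x ∂μ) - ∫ x, g x * ζ x ∂μ‖ ≤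
      √((∫ x, (f n x - g x) ^ 2 ∂μ) * ∫ x, ζ x ^ 2 ∂μ) := fun n => by
    have e : (∫ x, f n x * ζ x ∂μ) - ∫ x, g x * ζ x ∂μ = ∫ x, (f n x - g x) * ζ x ∂μ := by
      have i1 : Integrable (fun x => f n x * ζ x) μ := (hf n).integrable_mul hζ
      have i2 : Integrable (fun x => g x * ζ x) μ := hg.integrable_mul hζ
      rw [← integral_sub i1 i2]
      congr 1; ext x; ring
    rw [e, Real.norm_eq_abs]
    exact Real.abs_le_sqrt (integral_mul_sq_le ((hf n).sub hg).integrable_sq hζ.integrable_sq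
      (hint n))
  refine squeeze_zero (fun n => norm_nonneg _) hle ?_
  have := (h.mul_const (∫ x, ζ x ^ 2 ∂μ)).sqrt
  simpa using this

namespace Cylinder

variable (C : Cylinder)

theorem isPreconnected_Ω : IsPreconnected C.Ω := by
  have h1 : IsPreconnected (C.ω ×ˢ Ioo (-C.b) C.b) :=
    C.connected.isPreconnected.prod isPreconnected_Ioo
  have h2 : C.Ω = (fun z : E2 × ℝ => liftPt z.1 z.2) '' (C.ω ×ˢ Ioo (-C.b) C.b) := by
    ext x
    constructor
    · intro hx
      exact ⟨(horiz x, x 2), ⟨hx.1, hx.2⟩, liftPt_horiz x⟩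
    · rintro ⟨z, hz, rfl⟩
      exact C.liftPt_mem_Ω hz.1 hz.2
  rw [h2]
  exact h1.image _ continuous_liftPt.continuousOn

/-- The derivatives of the mollifications of `g` are weak gradients tested with bumps, so inside a
small ball the mollifications are eventually constant; they converge to `g` almost everywhere. -/
theorem exists_ball_ae_eq_const {g : E3 → ℝ} (hg : Integrable g C.vol)
    (h : ∀ ψ : E3 → ℝ, ContDiff ℝ 1 ψ → HasCompactSupport ψ → tsupport ψ ⊆ C.Ω → ∀ k,
      ∫ x, g x * fderiv ℝ ψ x (EuclideanSpace.single k 1) ∂C.vol = 0) {x₀ : E3} (hx₀ : x₀ ∈ C.Ω) :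
    ∃ r > 0, ∃ a : ℝ, ∀ᵐ x, x ∈ Metric.ball x₀ r → x ∈ C.Ω ∧ g x = a := by
  set g₀ := C.Ω.indicator g with hg₀
  have hg₀i : Integrable g₀ := (integrable_indicator_iff C.measurableSet_Ω).2 hg
  obtain ⟨R, hR, hball⟩ := Metric.isOpen_iff.1 C.isOpen_Ω x₀ hx₀
  set φ : ℕ → ContDiffBump (0 : E3) := fun n =>
    ⟨1 / (n + 1) / 2, 1 / (n + 1), by positivity, half_lt_self (by positivity)⟩ with hφ
  have hlim := tendsto_one_div_add_atTop_nhds_zero_nat (𝕜 := ℝ)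
  have hae := ContDiffBump.ae_convolution_tendsto_right_of_locallyIntegrable (φ := φ) (l := atTop)
    (K := 2) (μ := volume) hlim
    (Eventually.of_forall fun n => by simp only [hφ]; linarith) hg₀i.locallyIntegrable
  have hconst : ∀ᶠ n in atTop, ∀ x ∈ Metric.ball x₀ (R / 2), ∀ y ∈ Metric.ball x₀ (R / 2),
      (convolution ((φ n).normed volume) g₀ (ContinuousLinearMap.lsmul ℝ ℝ) volume) x =
      (convolution ((φ n).normed volume) g₀ (ContinuousLinearMap.lsmul ℝ ℝ) volume) y := by
    filter_upwards [hlim.eventually (gt_mem_nhds (half_pos hR))] with n hn x hx y hy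
    have hsm : ContDiff ℝ 1 ((φ n).normed (volume : Measure E3)) := (φ n).contDiff_normed
    have hcs : HasCompactSupport ((φ n).normed (volume : Measure E3)) := (φ n).hasCompactSupport_normed
    have hflip : convolution ((φ n).normed volume) g₀ (ContinuousLinearMap.lsmul ℝ ℝ) volume =
        convolution g₀ ((φ n).normed volume) (ContinuousLinearMap.lsmul ℝ ℝ : ℝ →L[ℝ] ℝ →L[ℝ] ℝ).flip volume :=
      (convolution_flip (ContinuousLinearMap.lsmul ℝ ℝ)).symm
    rw [hflip]
    have hder : ∀ z ∈ Metric.ball x₀ (R / 2), HasFDerivAt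
        (convolution g₀ ((φ n).normed volume) (ContinuousLinearMap.lsmul ℝ ℝ : ℝ →L[ℝ] ℝ →L[ℝ] ℝ).flip volume)
        (0 : E3 →L[ℝ] ℝ) z := fun z hz => by
      have h1 := hcs.hasFDerivAt_convolution_right (ContinuousLinearMap.lsmul ℝ ℝ : ℝ →L[ℝ] ℝ →L[ℝ] ℝ).flip
        hg₀i.locallyIntegrable hsm z
      refine h1.congr_fderiv (ContinuousLinearMap.ext fun d => ?_)
      rw [clm_apply_eq_sum]
      change _ = (0 : ℝ)
      refine Finset.sum_eq_zero fun k _ => ?_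
      rw [convolution_precompR_apply _ hg₀i.locallyIntegrable (hcs.fderiv (𝕜 := ℝ))
        (hsm.continuous_fderiv (by norm_num))]
      -- The reflected bump centred at `z` is admissible: its radius and the distance from `z` to x₀
      -- are both below R/2, so its support stays in the cylinder.
      set ψ : E3 → ℝ := fun t => (φ n).normed volume (z - t) with hψ
      have hψs : ContDiff ℝ 1 ψ := hsm.comp (contDiff_const.sub contDiff_id)
      have hsupp : Function.support ψ ⊆ Metric.closedBall z (1 / (n + 1)) := fun t ht => by
        have : z - t ∈ Function.support ((φ n).normed (volume : Measure E3)) := ht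
        rw [ContDiffBump.support_normed_eq] at this
        rw [Metric.mem_closedBall, dist_comm, dist_eq_norm]
        rw [Metric.mem_ball, dist_zero_right] at this
        exact this.le
      have hts : tsupport ψ ⊆ Metric.closedBall z (1 / (n + 1)) :=
        closure_minimal hsupp Metric.isClosed_closedBall
      have hψc : HasCompactSupport ψ :=
        (isCompact_closedBall z _).of_isClosed_subset (isClosed_tsupport _) hts
      have hψΩ : tsupport ψ ⊆ C.Ω := fun t ht => hball <| by
        have h2 := Metric.mem_closedBall.1 (hts ht)
        have h3 := Metric.mem_ball.1 hz
        rw [Metric.mem_ball]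
        have := dist_triangle t z x₀
        linarith
      have h4 := h ψ hψs hψc hψΩ k
      have hfd : ∀ t, fderiv ℝ ψ t (EuclideanSpace.single k 1) =
          -fderiv ℝ ((φ n).normed volume) (z - t) (EuclideanSpace.single k 1) := fun t => by
        have h5 := (hsm.differentiable (by norm_num) (z - t)).hasFDerivAt.comp t
          ((hasFDerivAt_id t).const_sub z)
        have h6 : HasFDerivAt ψ _ t := h5
        rw [h6.fderiv]
        simp
      have h5 : ∫ t, g₀ t * fderiv ℝ ψ t (EuclideanSpace.single k 1) = 0 := by
        rw [← h4, vol, ← integral_indicator C.measurableSet_Ω]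
        congr 1
        ext t
        by_cases ht : t ∈ C.Ω <;> simp [hg₀, ht]
      rw [mul_eq_zero]
      right
      rw [convolution_def]
      have h7 : ∀ t, (ContinuousLinearMap.lsmul ℝ ℝ : ℝ →L[ℝ] ℝ →L[ℝ] ℝ).flip (g₀ t)
          (fderiv ℝ ((φ n).normed volume) (z - t) (EuclideanSpace.single k 1)) =
          -(g₀ t * fderiv ℝ ψ t (EuclideanSpace.single k 1)) := fun t => by
        rw [hfd]; simp [mul_comm]
      simp only [h7]
      rw [integral_neg, h5, neg_zero]
    refine (convex_ball x₀ (R / 2)).is_const_of_fderivWithin_eq_zero (𝕜 := ℝ)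
      (fun z hz => (hder z hz).differentiableAt.differentiableWithinAt) (fun z hz => ?_) hx hy
    rw [fderivWithin_of_isOpen Metric.isOpen_ball hz, (hder z hz).fderiv]
  have hne : (ae (volume.restrict (Metric.ball x₀ (R / 2)))).NeBot := by
    rw [ae_neBot, Ne, Measure.restrict_eq_zero]
    exact (Metric.measure_ball_pos volume x₀ (half_pos hR)).ne'
  obtain ⟨x₁, hx₁, hx₁b⟩ := ((ae_restrict_of_ae (s := Metric.ball x₀ (R / 2)) hae).and
    (ae_restrict_mem Metric.isOpen_ball.measurableSet)).exists
  have hsub : Metric.ball x₀ (R / 2) ⊆ C.Ω :=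
    (Metric.ball_subset_ball (by linarith)).trans hball
  refine ⟨R / 2, half_pos hR, g x₁, ?_⟩
  filter_upwards [hae] with x hx hxb
  have hxΩ := hsub hxb
  refine ⟨hxΩ, ?_⟩
  have h1 : Tendsto (fun n => (convolution ((φ n).normed volume) g₀
      (ContinuousLinearMap.lsmul ℝ ℝ) volume) x) atTop (𝓝 (g₀ x₁)) :=
    hx₁.congr' (hconst.mono fun n hn => hn x₁ hx₁b x hxb)
  have h2 := tendsto_nhds_unique hx h1
  simpa [hg₀, hxΩ, hsub hx₁b] using h2

/-- The lemma of du Bois-Reymond: a function whose weak gradient vanishes is constant. -/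
theorem exists_ae_eq_const {g : E3 → ℝ} (hg : Integrable g C.vol)
    (h : ∀ ψ : E3 → ℝ, ContDiff ℝ 1 ψ → HasCompactSupport ψ → tsupport ψ ⊆ C.Ω → ∀ k,
      ∫ x, g x * fderiv ℝ ψ x (EuclideanSpace.single k 1) ∂C.vol = 0) :
    ∃ a : ℝ, ∀ᵐ x ∂C.vol, g x = a := by
  have hloc := fun x : C.Ω => C.exists_ball_ae_eq_const hg h x.2
  choose r hr a ha using hloc
  obtain ⟨y₀, hy₀⟩ := C.connected.nonempty
  have hx₀ : liftPt y₀ 0 ∈ C.Ω :=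
    C.liftPt_mem_Ω hy₀ ⟨by linarith [C.b_pos], C.b_pos⟩
  -- Overlapping balls meet in a set of positive measure, so the local constants are locally equal,
  -- and connectedness makes them equal throughout.
  have hconst : ∀ x y : C.Ω, a x = a y := by
    classical
    set a' : E3 → ℝ := fun x => if hx : x ∈ C.Ω then a ⟨x, hx⟩ else 0
    have key : ∀ x ∈ C.Ω, ∀ᶠ y in 𝓝[C.Ω] x, a' x = a' y := fun x hx => by
      have h1 : Metric.ball x (r ⟨x, hx⟩) ∈ 𝓝 x := Metric.ball_mem_nhds x (hr _)
      filter_upwards [nhdsWithin_le_nhds h1, self_mem_nhdsWithin] with y hy hyΩ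
      have hop : IsOpen (Metric.ball x (r ⟨x, hx⟩) ∩ Metric.ball y (r ⟨y, hyΩ⟩)) :=
        Metric.isOpen_ball.inter Metric.isOpen_ball
      have hpos : 0 < volume (Metric.ball x (r ⟨x, hx⟩) ∩ Metric.ball y (r ⟨y, hyΩ⟩)) :=
        hop.measure_pos volume ⟨y, hy, Metric.mem_ball_self (hr _)⟩
      have hne : (ae (volume.restrict
          (Metric.ball x (r ⟨x, hx⟩) ∩ Metric.ball y (r ⟨y, hyΩ⟩)))).NeBot := by
        rw [ae_neBot, Ne, Measure.restrict_eq_zero]; exact hpos.ne'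
      obtain ⟨z, ⟨hz1, hz2⟩, hz3⟩ := ((ae_restrict_of_ae ((ha ⟨x, hx⟩).and (ha ⟨y, hyΩ⟩))).and
        (ae_restrict_mem hop.measurableSet)).exists
      simp only [a', hx, hyΩ, dif_pos]
      exact (hz1 hz3.1).2.symm.trans (hz2 hz3.2).2
    intro x y
    have := C.isPreconnected_Ω.induction₂ (fun x y => a' x = a' y) key
      (fun _ _ _ _ _ _ h1 h2 => h1.trans h2) (fun _ _ _ _ h1 => h1.symm) x.2 y.2
    simpa [a'] using this
  refine ⟨a ⟨_, hx₀⟩, ?_⟩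
  rw [vol, ae_restrict_iff' C.measurableSet_Ω, ae_iff]
  refine measure_null_of_locally_null _ fun x hx => ?_
  have hxΩ : x ∈ C.Ω := by
    by_contra hcon
    exact hx fun h => absurd h hcon
  refine ⟨Metric.ball x (r ⟨x, hxΩ⟩) ∩ {y | ¬(y ∈ C.Ω → g y = a ⟨_, hx₀⟩)},
    inter_mem (nhdsWithin_le_nhds (Metric.ball_mem_nhds x (hr _))) self_mem_nhdsWithin, ?_⟩
  have h1 := ha ⟨x, hxΩ⟩
  rw [ae_iff] at h1
  refine measure_mono_null ?_ h1
  intro y hy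
  simp only [mem_inter_iff, mem_ofPred_eq] at hy ⊢
  intro hcon
  refine hy.2 fun _ => ?_
  rw [(hcon hy.1).2]
  exact hconst _ _

end Cylinder

/-! ### Compactness: Korn's inequality modulo rigid motions. -/

namespace Cylinder

variable (C : Cylinder)

theorem vol_real_pos : 0 < C.vol.real univ := by
  obtain ⟨y, hy⟩ := C.connected.nonempty
  have hne : C.Ω.Nonempty :=
    ⟨liftPt y 0, C.liftPt_mem_Ω hy ⟨by linarith [C.b_pos], C.b_pos⟩⟩
  refine ENNReal.toReal_pos ?_ (measure_ne_top _ _)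
  rw [vol, Measure.restrict_apply_univ]
  exact (C.isOpen_Ω.measure_pos _ hne).ne'

theorem integral_congr_Ω {v w : E3 → ℝ} (h : ∀ x ∈ C.Ω, v x = w x) :
    ∫ x, v x ∂C.vol = ∫ x, w x ∂C.vol :=
  setIntegral_congr_fun C.measurableSet_Ω h

theorem integral_mono_Ω {v w : E3 → ℝ} (hv : ContinuousOn v (closure C.Ω))
    (hw : ContinuousOn w (closure C.Ω)) (h : ∀ x ∈ C.Ω, v x ≤ w x) :
    ∫ x, v x ∂C.vol ≤ ∫ x, w x ∂C.vol :=
  integral_mono_ae (C.integrable_of_continuousOn hv) (C.integrable_of_continuousOn hw)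
    (C.ae_mem_Ω.mono fun x hx => h x hx)

section

variable {C}

theorem continuousOn_h1 {w : E3 → ℝ} (hw : ContDiffOn ℝ 1 w (closure C.Ω)) :
    ContinuousOn (fun x => w x ^ 2 + ∑ i, C.pd i w x ^ 2) (closure C.Ω) :=
  (hw.continuousOn.pow 2).add (continuousOn_finsetSum _ fun i _ => (C.continuousOn_pd hw i).pow 2)

theorem integral_sq_le_h1sq {w : E3 → ℝ} (hw : ContDiffOn ℝ 1 w (closure C.Ω)) :
    ∫ x, w x ^ 2 ∂C.vol ≤ C.h1sq w :=
  C.integral_mono_Ω (hw.continuousOn.pow 2) (continuousOn_h1 hw) fun _ _ =>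
    le_add_of_nonneg_right (Finset.sum_nonneg fun _ _ => sq_nonneg _)

theorem integral_pd_sq_le_h1sq {w : E3 → ℝ} (hw : ContDiffOn ℝ 1 w (closure C.Ω)) (j : Fin 3) :
    ∫ x, C.pd j w x ^ 2 ∂C.vol ≤ C.h1sq w :=
  C.integral_mono_Ω ((C.continuousOn_pd hw j).pow 2) (continuousOn_h1 hw) fun x _ => by
    have := Finset.single_le_sum (f := fun i => C.pd i w x ^ 2) (fun i _ => sq_nonneg _)
      (Finset.mem_univ j)
    nlinarith [sq_nonneg (w x)]

theorem h1sq_le_h1v (u : E3 → E3) (i : Fin 3) : C.h1sq (fun x => u x i) ≤ C.h1v u :=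
  Finset.single_le_sum (f := fun i => C.h1sq fun x => u x i) (fun _ _ => C.h1sq_nonneg _)
    (Finset.mem_univ i)

theorem h1v_smul {u : E3 → E3} (hu : ContDiffOn ℝ 1 u (closure C.Ω)) (r : ℝ) :
    C.h1v (fun x => r • u x) = r ^ 2 * C.h1v u := by
  simp only [h1v, h1sq, Finset.mul_sum, ← integral_const_mul]
  refine Finset.sum_congr rfl fun i _ => C.integral_congr_Ω fun x hx => ?_
  simp only [PiLp.smul_apply, smul_eq_mul]
  simp only [pd_const_mul r (contDiffOn_comp hu i) (subset_closure hx), mul_add, Finset.mul_sum,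
    mul_pow]

theorem dil_smul {u : E3 → E3} (hu : ContDiffOn ℝ 1 u (closure C.Ω)) (r : ℝ) {x : E3}
    (hx : x ∈ closure C.Ω) (i j : Fin 3) :
    C.dil (fun x => r • u x) x i j = r * C.dil u x i j := by
  simp only [dil, PiLp.smul_apply, smul_eq_mul]
  rw [pd_const_mul r (contDiffOn_comp hu i) hx, pd_const_mul r (contDiffOn_comp hu j) hx]
  ring

theorem dil_sub {u v : E3 → E3} (hu : ContDiffOn ℝ 1 u (closure C.Ω))
    (hv : ContDiffOn ℝ 1 v (closure C.Ω)) {x : E3} (hx : x ∈ closure C.Ω) (i j : Fin 3) :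
    C.dil (fun x => u x - v x) x i j = C.dil u x i j - C.dil v x i j := by
  simp only [dil, PiLp.sub_apply]
  rw [pd_sub (contDiffOn_comp hu i) (contDiffOn_comp hv i) hx,
    pd_sub (contDiffOn_comp hu j) (contDiffOn_comp hv j) hx]
  ring

theorem continuousOn_dil_sq {u : E3 → E3} (hu : ContDiffOn ℝ 1 u (closure C.Ω)) :
    ContinuousOn (fun x => ∑ i, ∑ j, C.dil u x i j ^ 2) (closure C.Ω) :=
  continuousOn_finsetSum _ fun i _ => continuousOn_finsetSum _ fun j _ =>
    (continuousOn_dil hu i j).pow 2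

theorem dilSq_smul {u : E3 → E3} (hu : ContDiffOn ℝ 1 u (closure C.Ω)) (r : ℝ) :
    C.dilSq (fun x => r • u x) = r ^ 2 * C.dilSq u := by
  simp only [dilSq, ← integral_const_mul]
  refine C.integral_congr_Ω fun x hx => ?_
  simp only [dil_smul hu r (subset_closure hx), mul_pow, Finset.mul_sum]

theorem dilSq_sub_le {u v : E3 → E3} (hu : ContDiffOn ℝ 1 u (closure C.Ω))
    (hv : ContDiffOn ℝ 1 v (closure C.Ω)) :
    C.dilSq (fun x => u x - v x) ≤ 2 * C.dilSq u + 2 * C.dilSq v := by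
  have i1 := C.integrable_of_continuousOn ((continuousOn_dil_sq hu).const_smul (2 : ℝ))
  have i2 := C.integrable_of_continuousOn ((continuousOn_dil_sq hv).const_smul (2 : ℝ))
  simp only [dilSq, ← integral_const_mul]
  erw [← integral_add i1 i2]
  refine C.integral_mono_Ω (continuousOn_dil_sq (hu.sub hv))
    (((continuousOn_dil_sq hu).const_smul (2 : ℝ)).add
      ((continuousOn_dil_sq hv).const_smul (2 : ℝ))) fun x hx => ?_
  change _ ≤ (2 : ℝ) * _ + (2 : ℝ) * _
  simp only [Finset.mul_sum, ← Finset.sum_add_distrib]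
  refine Finset.sum_le_sum fun i _ => Finset.sum_le_sum fun j _ => ?_
  rw [dil_sub hu hv (subset_closure hx)]
  nlinarith [sq_nonneg (C.dil u x i j + C.dil v x i j)]

theorem integral_dil_sq_le {u : E3 → E3} (hu : ContDiffOn ℝ 1 u (closure C.Ω)) (i j : Fin 3) :
    ∫ x, C.dil u x i j ^ 2 ∂C.vol ≤ C.dilSq u :=
  C.integral_mono_Ω ((continuousOn_dil hu i j).pow 2) (continuousOn_dil_sq hu) fun x _ =>
    (Finset.single_le_sum (f := fun j => C.dil u x i j ^ 2) (fun _ _ => sq_nonneg _)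
      (Finset.mem_univ j)).trans
    (Finset.single_le_sum (f := fun i => ∑ j, C.dil u x i j ^ 2)
      (fun _ _ => Finset.sum_nonneg fun _ _ => sq_nonneg _) (Finset.mem_univ i))

theorem integral_mul_fderiv_eq {ψ G : E3 → ℝ} (hψ : ContDiff ℝ 1 ψ) (hc : HasCompactSupport ψ)
    (hs : tsupport ψ ⊆ C.Ω) (hG : ContDiffOn ℝ 1 G (closure C.Ω)) (k : Fin 3) :
    ∫ x, G x * fderiv ℝ ψ x (EuclideanSpace.single k 1) ∂C.vol
      = -∫ x, ψ x * C.pd k G x ∂C.vol := by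
  have h := C.integral_cutoff_mul_fderiv hψ hc hs (hG.mono subset_closure)
    (EuclideanSpace.single k 1)
  have hcψ : Continuous fun x => fderiv ℝ ψ x (EuclideanSpace.single k 1) :=
    (hψ.continuous_fderiv one_ne_zero).clm_apply continuous_const
  have i1 : Integrable (fun x => ψ x * C.pd k G x) C.vol := C.integrable_of_continuousOn
    (hψ.continuous.continuousOn.mul (C.continuousOn_pd hG k))
  have i2 : Integrable (fun x => G x * fderiv ℝ ψ x (EuclideanSpace.single k 1)) C.vol :=
    C.integrable_of_continuousOn (hG.continuousOn.mul hcψ.continuousOn)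
  have e : ∫ x, (ψ x * fderiv ℝ G x (EuclideanSpace.single k 1)
      + G x * fderiv ℝ ψ x (EuclideanSpace.single k 1)) ∂C.vol =
      ∫ x, (ψ x * C.pd k G x + G x * fderiv ℝ ψ x (EuclideanSpace.single k 1)) ∂C.vol :=
    C.integral_congr_Ω fun x hx => by rw [C.pd_eq hx]
  rw [e, integral_add i1 i2] at h
  linarith

end

/-- The sequence `u` converges in `H¹(Ω)` to the infinitesimal rigid motion `a + B x`. -/
structure TendstoRigid (u : ℕ → E3 → E3) (a : Fin 3 → ℝ) (B : Fin 3 → Fin 3 → ℝ) : Prop where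
  antisymm : ∀ i j, B j i = -B i j
  val : ∀ i, Tendsto (fun n => ∫ x, (u n x i - (a i + ∑ j, B i j * x j)) ^ 2 ∂C.vol) atTop (𝓝 0)
  der : ∀ i j, Tendsto (fun n => ∫ x, (C.pd j (fun y => u n y i) x - B i j) ^ 2 ∂C.vol)
    atTop (𝓝 0)

variable {C} in
theorem h1v_eq {u : E3 → E3} (hu : ContDiffOn ℝ 1 u (closure C.Ω)) :
    C.h1v u = ∑ i, (∫ x, u x i ^ 2 ∂C.vol + ∑ j, ∫ x, C.pd j (fun y => u y i) x ^ 2 ∂C.vol) := by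
  refine Finset.sum_congr rfl fun i _ => ?_
  rw [C.h1sq_eq (contDiffOn_comp hu i), integral_finsetSum]
  exact fun j _ => C.integrable_of_continuousOn
    ((C.continuousOn_pd (contDiffOn_comp hu i) j).pow 2)

/-- Second derivatives are combinations of first derivatives of D = D(u): u_{i,jk} = ½(D_{ij,k} +
D_{ik,j} − D_{jk,i}). Since D tends to 0, each limit of a first derivative has zero weak gradient
and is a constant `B i j`. The matrix is antisymmetric because D tends to 0, and removing the linear
part from the limit of u leaves a function with zero weak gradient. -/
theorem exists_tendstoRigid {u : ℕ → E3 → E3} (hu : ∀ n, ContDiffOn ℝ 2 (u n) (closure C.Ω))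
    (hd : Tendsto (fun n => C.dilSq (u n)) atTop (𝓝 0))
    (hc : ∀ ε > 0, ∃ N, ∀ n ≥ N, ∀ m ≥ N, C.h1v (fun x => u n x - u m x) < ε) :
    ∃ a B, C.TendstoRigid u a B := by
  have hu1 : ∀ n, ContDiffOn ℝ 1 (u n) (closure C.Ω) := fun n => (hu n).of_le (by norm_num)
  have hui : ∀ n i, ContDiffOn ℝ 1 (fun x => u n x i) (closure C.Ω) := fun n i =>
    contDiffOn_comp (hu1 n) i
  have hsub : ∀ n m i, ContDiffOn ℝ 1 (fun x => (u n x - u m x) i) (closure C.Ω) := fun n m i =>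
    contDiffOn_comp ((hu1 n).sub (hu1 m)) i
  have hU : ∀ i, ∃ g, MemLp g 2 C.vol ∧
      Tendsto (fun n => ∫ x, (u n x i - g x) ^ 2 ∂C.vol) atTop (𝓝 0) := fun i => by
    refine exists_L2_limit (fun n => C.memLp_of_continuousOn (hui n i).continuousOn 2) fun ε hε => ?_
    obtain ⟨N, hN⟩ := hc ε hε
    exact ⟨N, fun n hn m hm => (((integral_sq_le_h1sq (hsub n m i)).trans
      (h1sq_le_h1v (fun x => u n x - u m x) i)).trans_lt (hN n hn m hm))⟩
  have hV : ∀ i j, ∃ g, MemLp g 2 C.vol ∧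
      Tendsto (fun n => ∫ x, (C.pd j (fun y => u n y i) x - g x) ^ 2 ∂C.vol) atTop (𝓝 0) :=
      fun i j => by
    refine exists_L2_limit
      (fun n => C.memLp_of_continuousOn (C.continuousOn_pd (hui n i) j) 2) fun ε hε => ?_
    obtain ⟨N, hN⟩ := hc ε hε
    refine ⟨N, fun n hn m hm => lt_of_eq_of_lt (C.integral_congr_Ω fun x hx => ?_)
      (((integral_pd_sq_le_h1sq (hsub n m i) j).trans
      (h1sq_le_h1v (fun x => u n x - u m x) i)).trans_lt (hN n hn m hm))⟩
    simp only [PiLp.sub_apply]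
    rw [pd_sub (hui n i) (hui m i) (subset_closure hx)]
  choose U hUm hU using hU
  choose V hVm hV using hV
  have hVlim : ∀ i j {ζ : E3 → ℝ}, MemLp ζ 2 C.vol →
      Tendsto (fun n => ∫ x, C.pd j (fun y => u n y i) x * ζ x ∂C.vol) atTop
        (𝓝 (∫ x, V i j x * ζ x ∂C.vol)) := fun i j ζ hζ =>
    tendsto_integral_mul_of_L2 (fun n => C.memLp_of_continuousOn (C.continuousOn_pd (hui n i) j) 2)
      (hVm i j) hζ (hV i j)
  have hDlim : ∀ i j {ζ : E3 → ℝ}, MemLp ζ 2 C.vol →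
      Tendsto (fun n => ∫ x, C.dil (u n) x i j * ζ x ∂C.vol) atTop (𝓝 0) := fun i j ζ hζ => by
    have h := tendsto_integral_mul_of_L2 (g := fun _ => 0)
      (fun n => C.memLp_of_continuousOn (continuousOn_dil (hu1 n) i j) 2)
      (memLp_const 0) hζ (squeeze_zero (fun n => integral_nonneg fun x => sq_nonneg _)
        (fun n => by simpa only [sub_zero] using integral_dil_sq_le (hu1 n) i j) hd)
    simpa using h
  have htest : ∀ {ψ : E3 → ℝ}, ContDiff ℝ 1 ψ → ∀ k : Fin 3,
      MemLp (fun x => fderiv ℝ ψ x (EuclideanSpace.single k 1)) 2 C.vol := fun hψ k =>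
    C.memLp_of_continuousOn
      ((hψ.continuous_fderiv one_ne_zero).clm_apply continuous_const).continuousOn 2
  have hB : ∀ i j, ∃ β : ℝ, ∀ᵐ x ∂C.vol, V i j x = β := fun i j => by
    refine C.exists_ae_eq_const ((hVm i j).integrable (by norm_num)) fun ψ hψ hψc hψs k => ?_
    refine tendsto_nhds_unique (hVlim i j (htest hψ k)) ?_
    have hlim : Tendsto (fun n => 1 / 2 * (
        ∫ x, C.dil (u n) x i j * fderiv ℝ ψ x (EuclideanSpace.single k 1) ∂C.vol
        + ∫ x, C.dil (u n) x i k * fderiv ℝ ψ x (EuclideanSpace.single j 1) ∂C.vol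
        - ∫ x, C.dil (u n) x j k * fderiv ℝ ψ x (EuclideanSpace.single i 1) ∂C.vol))
        atTop (𝓝 (1 / 2 * (0 + 0 - 0))) :=
      (((hDlim i j (htest hψ k)).add (hDlim i k (htest hψ j))).sub
        (hDlim j k (htest hψ i))).const_mul _
    rw [show (1 / 2 * (0 + 0 - 0) : ℝ) = 0 by norm_num] at hlim
    refine hlim.congr fun n => ?_
    have hpd : ∀ i j, ContDiffOn ℝ 1 (C.pd j (fun y => u n y i)) (closure C.Ω) := fun i j =>
      contDiffOn_pd (contDiffOn_comp (hu n) i) j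
    have hI : ∀ i j k, Integrable (fun x => ψ x * C.pd k (fun x => C.dil (u n) x i j) x) C.vol :=
      fun i j k => C.integrable_of_continuousOn
        (hψ.continuous.continuousOn.mul (C.continuousOn_pd (contDiffOn_dil (hu n) i j) k))
    rw [integral_mul_fderiv_eq hψ hψc hψs (contDiffOn_dil (hu n) i j),
      integral_mul_fderiv_eq hψ hψc hψs (contDiffOn_dil (hu n) i k),
      integral_mul_fderiv_eq hψ hψc hψs (contDiffOn_dil (hu n) j k),
      integral_mul_fderiv_eq hψ hψc hψs (hpd i j)]
    have e : ∫ x, ψ x * C.pd k (C.pd j fun y => u n y i) x ∂C.vol = ∫ x, 1 / 2 *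
        (ψ x * C.pd k (fun x => C.dil (u n) x i j) x + ψ x * C.pd j (fun x => C.dil (u n) x i k) x
        - ψ x * C.pd i (fun x => C.dil (u n) x j k) x) ∂C.vol := by
      refine C.integral_congr_Ω fun x hx => ?_
      have hx' := subset_closure hx
      simp only [dil]
      rw [pd_add (hpd i j) (hpd j i) hx', pd_add (hpd i k) (hpd k i) hx',
        pd_add (hpd j k) (hpd k j) hx', pd_comm (contDiffOn_comp (hu n) i) hx j k,
        pd_comm (contDiffOn_comp (hu n) j) hx i k, pd_comm (contDiffOn_comp (hu n) k) hx i j]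
      ring
    rw [e, integral_const_mul]
    have hs2 : Integrable (fun x => ψ x * C.pd k (fun x => C.dil (u n) x i j) x
        + ψ x * C.pd j (fun x => C.dil (u n) x i k) x) C.vol := (hI i j k).add (hI i k j)
    rw [integral_sub hs2 (hI j k i), integral_add (hI i j k) (hI i k j)]
    ring
  choose B hB using hB
  have hder : ∀ i j, Tendsto (fun n => ∫ x, (C.pd j (fun y => u n y i) x - B i j) ^ 2 ∂C.vol)
      atTop (𝓝 0) := fun i j => (hV i j).congr fun n =>
    integral_congr_ae ((hB i j).mono fun x hx => by simp only [hx])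
  have hanti : ∀ i j, B j i = -B i j := fun i j => by
    have h1 : Tendsto (fun n => ∫ x, C.dil (u n) x i j * 1 ∂C.vol) atTop
        (𝓝 (∫ x, V i j x * 1 ∂C.vol + ∫ x, V j i x * 1 ∂C.vol)) := by
      refine ((hVlim i j (memLp_const 1)).add (hVlim j i (memLp_const 1))).congr fun n => ?_
      simp only [mul_one, dil]
      rw [integral_add (C.integrable_of_continuousOn (C.continuousOn_pd (hui n i) j))
        (C.integrable_of_continuousOn (C.continuousOn_pd (hui n j) i))]
    have h2 := tendsto_nhds_unique h1 (hDlim i j (memLp_const 1))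
    have e : ∀ i j, ∫ x, V i j x * 1 ∂C.vol = ∫ _, B i j ∂C.vol := fun i j =>
      integral_congr_ae ((hB i j).mono fun x hx => by simp only [hx, mul_one])
    rw [e i j, e j i] at h2
    simp only [integral_const, smul_eq_mul, ← mul_add, mul_eq_zero, C.vol_real_pos.ne',
      false_or] at h2
    linarith
  have hlin : ∀ i, ContDiffOn ℝ 1 (fun x : E3 => ∑ j, B i j * x j) (closure C.Ω) := fun i =>
    (ContDiff.sum fun j _ => contDiff_const.mul (contDiff_coord j)).contDiffOn
  have ha : ∀ i, ∃ a : ℝ, ∀ᵐ x ∂C.vol, U i x - ∑ j, B i j * x j = a := fun i => by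
    have hlinL := C.memLp_of_continuousOn (hlin i).continuousOn 2
    refine C.exists_ae_eq_const (((hUm i).sub hlinL).integrable (by norm_num))
      fun ψ hψ hψc hψs k => ?_
    have h1 := tendsto_integral_mul_of_L2
      (fun n => C.memLp_of_continuousOn (hui n i).continuousOn 2) (hUm i) (htest hψ k) (hU i)
    have hψL : MemLp ψ 2 C.vol := C.memLp_of_continuousOn hψ.continuous.continuousOn 2
    have h2 := (hVlim i k hψL).neg
    have h3 := tendsto_nhds_unique h1 (h2.congr fun n => by
      rw [integral_mul_fderiv_eq hψ hψc hψs (hui n i)]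
      simp only [mul_comm])
    have h4 := integral_mul_fderiv_eq hψ hψc hψs (hlin i) k
    have h5 : ∫ x, ψ x * C.pd k (fun x => ∑ j, B i j * x j) x ∂C.vol
        = ∫ x, V i k x * ψ x ∂C.vol := by
      refine integral_congr_ae ?_
      filter_upwards [hB i k, C.ae_mem_Ω] with x hx hxΩ
      have hx' := subset_closure hxΩ
      rw [hx, pd_sum (fun j _ => contDiffOn_const.mul (contDiff_coord j).contDiffOn) hx']
      simp only [pd_const_mul _ (contDiff_coord _).contDiffOn hx', pd_coord _ _ hx']
      simp [mul_comm]
    have i1 : Integrable (fun x => U i x * fderiv ℝ ψ x (EuclideanSpace.single k 1)) C.vol :=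
      (hUm i).integrable_mul (htest hψ k)
    have i2 : Integrable (fun x : E3 => (∑ j, B i j * x j) *
        fderiv ℝ ψ x (EuclideanSpace.single k 1)) C.vol := hlinL.integrable_mul (htest hψ k)
    simp only [sub_mul]
    rw [integral_sub i1 i2, h3, h4, h5, sub_self]
  choose a ha using ha
  refine ⟨a, B, hanti, fun i => (hU i).congr fun n => integral_congr_ae ((ha i).mono fun x hx => ?_),
    hder⟩
  simp only [← hx, sub_add_cancel]

/-- Applied to differences, the inequality `hK` and the bound by averages control the H¹ distance by
the norms of D(u) and finitely many averages. These averages are bounded in a finite-dimensional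
space, so Bolzano–Weierstrass replaces Rellich's compactness theorem. -/
theorem exists_cauchy_subseq {P : (E3 → E3) → Prop}
    (hC2 : ∀ u, P u → ContDiffOn ℝ 2 u (closure C.Ω))
    (hsub : ∀ u v, P u → P v → P fun x => u x - v x) {c : ℝ} (hc : 0 ≤ c)
    (hK : ∀ u, P u → C.h1v u ≤ C.dilSq u + c * ∫ x, ∑ i, u x i ^ 2 ∂C.vol)
    {u : ℕ → E3 → E3} (hu : ∀ n, P (u n)) (h1 : ∀ n, C.h1v (u n) ≤ 1)
    (hd : Tendsto (fun n => C.dilSq (u n)) atTop (𝓝 0)) :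
    ∃ φ : ℕ → ℕ, StrictMono φ ∧
      ∀ ε > 0, ∃ N, ∀ n ≥ N, ∀ m ≥ N, C.h1v (fun x => u (φ n) x - u (φ m) x) < ε := by
  have hC1 : ∀ u, P u → ContDiffOn ℝ 1 u (closure C.Ω) := fun u h => (hC2 u h).of_le (by norm_num)
  -- With this ε the product c ε is at most 1/2, so half of the H¹ norm can be absorbed.
  obtain ⟨s, Q, M, hM, hQm, hQ, hav⟩ := C.exists_finite_averages (ε := 1 / (2 * (c + 1)))
    (by positivity)
  have hkey : ∀ w, P w → C.h1v w ≤ 2 * C.dilSq w +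
      2 * c * M * ∑ i, ∑ k ∈ s, (∫ x in Q k, w x i) ^ 2 := fun w hw => by
    have hi := fun i => contDiffOn_comp (hC1 w hw) i
    have e : ∫ x, ∑ i, w x i ^ 2 ∂C.vol = ∑ i, ∫ x, w x i ^ 2 ∂C.vol :=
      integral_finsetSum _ fun i _ => C.integrable_of_continuousOn ((hi i).continuousOn.pow 2)
    have h2 : ∑ i, ∫ x, w x i ^ 2 ∂C.vol ≤ 1 / (2 * (c + 1)) * C.h1v w
        + M * ∑ i, ∑ k ∈ s, (∫ x in Q k, w x i) ^ 2 := by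
      rw [h1v, Finset.mul_sum, Finset.mul_sum, ← Finset.sum_add_distrib]
      exact Finset.sum_le_sum fun i _ => hav _ (hi i)
    have h3 := hK w hw
    rw [e] at h3
    have h4 : c * (1 / (2 * (c + 1))) ≤ 1 / 2 := by
      rw [mul_one_div, div_le_div_iff₀ (by positivity) (by positivity)]
      linarith
    have h5 := mul_le_mul_of_nonneg_right h4 (C.h1v_nonneg w)
    have h6 := mul_le_mul_of_nonneg_left h2 hc
    nlinarith
  set A : ℕ → (Fin 3 × s → ℝ) := fun n ik => ∫ x in Q ik.2, u n x ik.1 with hA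
  have hbd : Bornology.IsBounded (range A) := by
    refine (Metric.isBounded_iff_subset_closedBall 0).2
      ⟨C.vol.real univ + 1, ?_⟩
    rintro _ ⟨n, rfl⟩
    rw [mem_closedBall_zero_iff, pi_norm_le_iff_of_nonneg (by positivity)]
    rintro ⟨i, k⟩
    have hi := contDiffOn_comp (hC1 _ (hu n)) i
    have e : ∫ x in Q k, u n x i = ∫ x in Q k, u n x i ∂C.vol := by
      rw [vol, Measure.restrict_restrict (hQm k k.2), inter_eq_left.2 (hQ k k.2)]
    have h2 : |∫ x in Q k, u n x i ∂C.vol| ≤ ∫ x, |u n x i| ∂C.vol :=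
      (abs_integral_le_integral_abs).trans (setIntegral_le_integral
        (C.integrable_of_continuousOn hi.continuousOn.abs)
        (Eventually.of_forall fun x => abs_nonneg _))
    have h3 : ∫ x, |u n x i| ∂C.vol ≤ ∫ x, (1 + u n x i ^ 2) ∂C.vol := by
      refine C.integral_mono_Ω hi.continuousOn.abs
        (continuousOn_const.add (hi.continuousOn.pow 2)) fun x _ => ?_
      rw [← sq_abs (u n x i)]
      nlinarith [sq_nonneg (|u n x i| - 1), abs_nonneg (u n x i)]
    have i2 : Integrable (fun x => u n x i ^ 2) C.vol :=
      C.integrable_of_continuousOn (hi.continuousOn.pow 2)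
    rw [integral_add (integrable_const _) i2] at h3
    have h4 := ((integral_sq_le_h1sq hi).trans (h1sq_le_h1v _ i)).trans (h1 n)
    simp only [hA, Real.norm_eq_abs]
    rw [e]
    simp only [integral_const, smul_eq_mul, mul_one] at h3
    linarith
  obtain ⟨A₀, -, φ, hφ, hlim⟩ := tendsto_subseq_of_bounded hbd fun n => mem_range_self n
  refine ⟨φ, hφ, fun ε hε => ?_⟩
  have hint : ∀ n i (k : s), Integrable (fun x => u n x i) (volume.restrict (Q k)) :=
    fun n i k => by
    have := C.integrable_of_continuousOn (contDiffOn_comp (hC1 _ (hu n)) i).continuousOn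
    exact IntegrableOn.mono_set this (hQ k k.2)
  have hG : Tendsto (fun p : ℕ × ℕ => 2 * (2 * C.dilSq (u (φ p.1)) + 2 * C.dilSq (u (φ p.2))) +
      2 * c * M * ∑ ik : Fin 3 × s, (A (φ p.1) ik - A (φ p.2) ik) ^ 2) atTop
      (𝓝 (2 * (2 * 0 + 2 * 0) + 2 * c * M * ∑ ik : Fin 3 × s, (A₀ ik - A₀ ik) ^ 2)) := by
    rw [← prod_atTop_atTop_eq]
    have hd' := hd.comp hφ.tendsto_atTop
    have hl := tendsto_pi_nhds.1 hlim
    refine Tendsto.add (Tendsto.const_mul _ (((hd'.comp tendsto_fst).const_mul _).add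
      ((hd'.comp tendsto_snd).const_mul _))) (Tendsto.const_mul _ (tendsto_finsetSum _
        fun ik _ => Tendsto.pow (((hl ik).comp tendsto_fst).sub ((hl ik).comp tendsto_snd)) 2))
  simp only [sub_self, mul_zero, add_zero, ne_eq, OfNat.ofNat_ne_zero, not_false_eq_true, zero_pow,
    Finset.sum_const_zero] at hG
  obtain ⟨⟨N₁, N₂⟩, hN⟩ := eventually_atTop.1 (hG.eventually_lt_const hε)
  refine ⟨max N₁ N₂, fun n hn m hm => ?_⟩
  have h3 := hN (n, m) ⟨(le_max_left _ _).trans hn, (le_max_right _ _).trans hm⟩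
  refine lt_of_le_of_lt ((hkey _ (hsub _ _ (hu (φ n)) (hu (φ m)))).trans ?_) h3
  refine add_le_add (mul_le_mul_of_nonneg_left
    (dilSq_sub_le (hC1 _ (hu _)) (hC1 _ (hu _))) zero_le_two)
    (mul_le_mul_of_nonneg_left (le_of_eq ?_) (by positivity))
  rw [Fintype.sum_prod_type]
  refine Finset.sum_congr rfl fun i _ => ?_
  rw [← Finset.sum_coe_sort s]
  refine Finset.sum_congr rfl fun k _ => ?_
  simp only [hA, PiLp.sub_apply]
  rw [integral_sub (hint _ _ _) (hint _ _ _)]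

/-- Otherwise there are fields of H¹ norm 1 with D(u) → 0. A subsequence converges in H¹ to a rigid
motion, which `hrigid` forces to be zero, contrary to the normalisation. -/
theorem exists_korn_of_rigid {P : (E3 → E3) → Prop}
    (hC2 : ∀ u, P u → ContDiffOn ℝ 2 u (closure C.Ω))
    (hsub : ∀ u v, P u → P v → P fun x => u x - v x)
    (hsmul : ∀ (r : ℝ) u, P u → P fun x => r • u x) {c : ℝ} (hc : 0 ≤ c)
    (hK : ∀ u, P u → C.h1v u ≤ C.dilSq u + c * ∫ x, ∑ i, u x i ^ 2 ∂C.vol)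
    (hrigid : ∀ u a B, (∀ n, P (u n)) → C.TendstoRigid u a B → (∀ i, a i = 0) ∧ ∀ i j, B i j = 0) :
    ∃ c', 0 ≤ c' ∧ ∀ u, P u → C.h1v u ≤ c' * C.dilSq u := by
  by_contra! hcon
  have hC1 : ∀ u, P u → ContDiffOn ℝ 1 u (closure C.Ω) := fun u h => (hC2 u h).of_le (by norm_num)
  choose w hwP hw using fun n : ℕ => hcon n n.cast_nonneg
  have hpos : ∀ n, 0 < C.h1v (w n) := fun n =>
    lt_of_le_of_lt (mul_nonneg n.cast_nonneg (C.dilSq_nonneg _)) (hw n)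
  set u : ℕ → E3 → E3 := fun n x => (√(C.h1v (w n)))⁻¹ • w n x with hu
  have huP : ∀ n, P (u n) := fun n => hsmul _ _ (hwP n)
  have hu1 : ∀ n, C.h1v (u n) = 1 := fun n => by
    rw [hu, h1v_smul (hC1 _ (hwP n)), inv_pow, Real.sq_sqrt (hpos n).le,
      inv_mul_cancel₀ (hpos n).ne']
  have hd : Tendsto (fun n => C.dilSq (u n)) atTop (𝓝 0) := by
    have hlim := tendsto_one_div_atTop_nhds_zero_nat (𝕜 := ℝ)
    refine squeeze_zero' (Eventually.of_forall fun n => C.dilSq_nonneg _)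
      (eventually_atTop.2 ⟨1, fun n hn => ?_⟩) hlim
    have hn' : (0 : ℝ) < n := by exact_mod_cast hn
    rw [hu, dilSq_smul (hC1 _ (hwP n)), inv_pow, Real.sq_sqrt (hpos n).le, inv_mul_eq_div,
      div_le_div_iff₀ (hpos n) hn', one_mul, mul_comm]
    exact (hw n).le
  obtain ⟨φ, hφ, hcau⟩ := C.exists_cauchy_subseq hC2 hsub hc hK huP (fun n => (hu1 n).le) hd
  obtain ⟨a, B, h⟩ := C.exists_tendstoRigid (fun n => hC2 _ (huP (φ n)))
    (hd.comp hφ.tendsto_atTop) hcau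
  obtain ⟨ha, hB⟩ := hrigid _ a B (fun n => huP (φ n)) h
  have hlim : Tendsto (fun n => C.h1v (u (φ n))) atTop (𝓝 (∑ i : Fin 3, (0 + ∑ j : Fin 3, 0))) := by
    refine Tendsto.congr (fun n => (h1v_eq (hC1 _ (huP (φ n)))).symm)
      (tendsto_finsetSum _ fun i _ => Tendsto.add ?_ (tendsto_finsetSum _ fun j _ => ?_))
    · simpa [ha, hB] using h.val i
    · simpa [hB] using h.der i j
  simp only [hu1, Finset.sum_const_zero, add_zero] at hlim
  exact one_ne_zero (tendsto_nhds_unique tendsto_const_nhds hlim)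

end Cylinder

/-! ### Rotations of the plane and axial symmetry. -/

/-- The rotation of the plane by the angle `s` about `c`. -/
def rot (c : E2) (s : ℝ) (y : E2) : E2 :=
  !₂[c 0 + Real.cos s * (y 0 - c 0) - Real.sin s * (y 1 - c 1),
    c 1 + Real.sin s * (y 0 - c 0) + Real.cos s * (y 1 - c 1)]

/-- The velocity field of the rotations about `c`. -/
def rotField (c y : E2) : E2 := !₂[-(y 1 - c 1), y 0 - c 0]

theorem rot_add (c : E2) (s t : ℝ) (y : E2) : rot c (s + t) y = rot c s (rot c t y) := by
  ext i
  fin_cases i <;> simp [rot, Real.cos_add, Real.sin_add] <;> ring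

theorem rot_zero (c y : E2) : rot c 0 y = y := by
  ext i
  fin_cases i <;> simp [rot]

theorem rot_neg_rot (c : E2) (s : ℝ) (y : E2) : rot c (-s) (rot c s y) = y := by
  rw [← rot_add, neg_add_cancel, rot_zero]

theorem contDiff_rot (c : E2) (s : ℝ) {n : WithTop ℕ∞} : ContDiff ℝ n (rot c s) := by
  have h : ∀ i : Fin 2, ContDiff ℝ n fun y : E2 => y i := fun i =>
    (EuclideanSpace.proj i : E2 →L[ℝ] ℝ).contDiff
  refine contDiff_euclidean.2 fun i => ?_
  fin_cases i
  · exact (contDiff_const.add (contDiff_const.mul ((h 0).sub contDiff_const))).sub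
      (contDiff_const.mul ((h 1).sub contDiff_const))
  · exact (contDiff_const.add (contDiff_const.mul ((h 0).sub contDiff_const))).add
      (contDiff_const.mul ((h 1).sub contDiff_const))

theorem hasDerivAt_rot (c : E2) (s : ℝ) (y : E2) :
    HasDerivAt (fun s => rot c s y) (rotField c (rot c s y)) s := by
  suffices h : HasDerivAt (fun s => WithLp.ofLp (rot c s y)) (WithLp.ofLp (rotField c (rot c s y))) s
    from (PiLp.continuousLinearEquiv 2 ℝ fun _ : Fin 2 => ℝ).symm.hasFDerivAt.comp_hasDerivAt s h
  rw [hasDerivAt_pi]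
  intro i
  have hc := (Real.hasDerivAt_cos s).mul_const (y 0 - c 0)
  have hs := (Real.hasDerivAt_sin s).mul_const (y 1 - c 1)
  have hc' := (Real.hasDerivAt_cos s).mul_const (y 1 - c 1)
  have hs' := (Real.hasDerivAt_sin s).mul_const (y 0 - c 0)
  fin_cases i
  · refine ((hc.const_add (c 0)).sub hs).congr_deriv ?_
    simp [rot, rotField]
    ring
  · refine ((hs'.const_add (c 1)).add hc').congr_deriv ?_
    simp [rot, rotField]
    ring

theorem continuous_rotField (c : E2) : Continuous (rotField c) := by
  have h : ∀ i : Fin 2, Continuous fun y : E2 => y i := fun i =>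
    (EuclideanSpace.proj i : E2 →L[ℝ] ℝ).continuous
  refine (contDiff_euclidean (n := 0)).2 (fun i => ?_) |>.continuous
  fin_cases i
  · exact contDiff_zero.2 ((h 1).sub continuous_const).neg
  · exact contDiff_zero.2 ((h 0).sub continuous_const)

theorem norm_rotField_rot (c : E2) (s : ℝ) (y : E2) :
    ‖rotField c (rot c s y)‖ = ‖rotField c y‖ := by
  rw [EuclideanSpace.norm_eq, EuclideanSpace.norm_eq]
  congr 1
  simp only [rotField, rot, Fin.sum_univ_two, Real.norm_eq_abs, sq_abs]
  simp
  linear_combination ((y 0 - c 0) ^ 2 + (y 1 - c 1) ^ 2) * Real.sin_sq_add_cos_sq s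

namespace Cylinder

variable (C : Cylinder)

/-- By the group law of rotations, the derivative at the angle `s` is the integral in `hinv` for the
function φ ∘ `rot c s`, hence zero. Rotations preserve the length of the rotation field, which
supplies the dominating function. -/
theorem integral_comp_rot {c : E2}
    (hinv : ∀ φ : E2 → ℝ, ContDiff ℝ 1 φ →
      ∫ x, fderiv ℝ φ (horiz x) (rotField c (horiz x)) ∂C.vol = 0)
    {φ : E2 → ℝ} (hφ : ContDiff ℝ 1 φ) (hc : HasCompactSupport φ) (s : ℝ) :
    ∫ x, φ (rot c s (horiz x)) ∂C.vol = ∫ x, φ (horiz x) ∂C.vol := by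
  have hF : ∀ s x, HasDerivAt (fun s => φ (rot c s (horiz x)))
      (fderiv ℝ φ (rot c s (horiz x)) (rotField c (rot c s (horiz x)))) s := fun s x =>
    ((hφ.differentiable one_ne_zero _).hasFDerivAt).comp_hasDerivAt s (hasDerivAt_rot c s _)
  obtain ⟨M, hM⟩ := (hc.fderiv ℝ).exists_bound_of_continuous
    (hφ.continuous_fderiv one_ne_zero)
  have hcont : ∀ s, Continuous fun x => φ (rot c s (horiz x)) := fun s =>
    hφ.continuous.comp ((contDiff_rot c s (n := 1)).continuous.comp continuous_horiz)
  have hd : ∀ s, HasDerivAt (fun s => ∫ x, φ (rot c s (horiz x)) ∂C.vol) 0 s := fun s => by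
    have h := hasDerivAt_integral_of_dominated_loc_of_deriv_le (μ := C.vol) (s := univ) (x₀ := s)
      (F := fun s x => φ (rot c s (horiz x)))
      (F' := fun s x => fderiv ℝ φ (rot c s (horiz x)) (rotField c (rot c s (horiz x))))
      (bound := fun x => M * ‖rotField c (horiz x)‖) univ_mem
      (Eventually.of_forall fun s => (hcont s).aestronglyMeasurable)
      (C.integrable_of_continuousOn (hcont s).continuousOn)
      (Continuous.aestronglyMeasurable (((hφ.continuous_fderiv one_ne_zero).comp
        ((contDiff_rot c s (n := 1)).continuous.comp continuous_horiz)).clm_apply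
        ((continuous_rotField c).comp ((contDiff_rot c s (n := 1)).continuous.comp
          continuous_horiz))))
      (Eventually.of_forall fun x t _ => ?_)
      (C.integrable_of_continuousOn (continuous_const.mul
        ((continuous_rotField c).comp continuous_horiz).norm).continuousOn)
      (Eventually.of_forall fun x t _ => hF t x)
    · have e : ∫ x, fderiv ℝ φ (rot c s (horiz x)) (rotField c (rot c s (horiz x))) ∂C.vol = 0 := by
        have hΦ : ContDiff ℝ 1 (fun y => φ (rot c s y)) := hφ.comp (contDiff_rot c s)
        rw [← hinv _ hΦ]
        refine integral_congr_ae (Eventually.of_forall fun x => ?_)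
        have h1 : HasDerivAt (fun t => φ (rot c s (rot c t (horiz x))))
            (fderiv ℝ (fun y => φ (rot c s y)) (horiz x) (rotField c (horiz x))) 0 := by
          have h2 := hasDerivAt_rot c 0 (horiz x)
          have h3 := (hΦ.differentiable one_ne_zero (rot c 0 (horiz x))).hasFDerivAt
          have h4 := h3.comp_hasDerivAt 0 h2
          rwa [rot_zero] at h4
        have h5 : HasDerivAt (fun t => φ (rot c (s + t) (horiz x)))
            (fderiv ℝ φ (rot c s (horiz x)) (rotField c (rot c s (horiz x)))) 0 := by
          have h6 := hF (s + 0) x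
          have h7 := h6.comp_const_add s 0
          simpa using h7
        simp only [rot_add] at h5
        exact h5.unique h1
      rw [← e]
      exact h.2
    · rw [← norm_rotField_rot c t]
      exact (ContinuousLinearMap.le_opNorm _ _).trans
        (mul_le_mul_of_nonneg_right (hM _) (norm_nonneg _))
  have h := is_const_of_deriv_eq_zero (fun s => (hd s).differentiableAt) (fun s => (hd s).deriv) s 0
  simpa only [rot_zero] using h

/-- The hypothesis is a weak form of tangency of the rotation field to ∂ω, and it makes integrals
over the cylinder invariant under rotations. If a rotation carried a point of ω outside, a bump
supported in {φ₀ > c⋆} would have integral zero while its rotated copy had a positive one. -/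
theorem axiallySymmetric_of_integral_eq_zero {c : E2}
    (hinv : ∀ φ : E2 → ℝ, ContDiff ℝ 1 φ →
      ∫ x, fderiv ℝ φ (horiz x) (rotField c (horiz x)) ∂C.vol = 0) : C.AxiallySymmetric := by
  refine ⟨c, fun s y hy => ?_⟩
  change rot c s y ∈ C.ω
  by_contra hz
  have hz' : C.cstar ≤ C.φ₀ (rot c s y) := not_lt.1 hz
  -- If the rotated point lies on the level c⋆, regularity of the level rules out a local maximum of
  -- φ₀, so points with φ₀ > c⋆ exist arbitrarily near.
  have hfreq : ∃ᶠ z in 𝓝 (rot c s y), C.cstar < C.φ₀ z := by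
    rcases hz'.lt_or_eq with h | h
    · exact (C.contDiff.continuous.continuousAt.eventually_const_lt h).frequently
    · intro hcon
      have hmax : IsLocalMax C.φ₀ (rot c s y) := hcon.mono fun z hz => by
        rw [← h]
        exact not_lt.1 hz
      refine C.regular _ h.symm ?_
      rw [gradient, hmax.fderiv_eq_zero, map_zero]
  have hev : ∀ᶠ z in 𝓝 (rot c s y), rot c (-s) z ∈ C.ω := by
    refine (contDiff_rot c (-s) (n := 1)).continuous.continuousAt.eventually_mem
      (C.isOpen_ω.mem_nhds ?_)
    rwa [rot_neg_rot]
  obtain ⟨z, hz1, hz2⟩ := (hfreq.and_eventually hev).exists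
  obtain ⟨r, hr, hball⟩ := Metric.isOpen_iff.1 (isOpen_lt continuous_const C.contDiff.continuous)
    z hz1
  set φ : ContDiffBump z := ⟨r / 2, r, half_pos hr, half_lt_self hr⟩
  have h := C.integral_comp_rot hinv (φ := φ) (φ.contDiff (n := 1)) φ.hasCompactSupport s
  have h0 : ∫ x, φ (horiz x) ∂C.vol = 0 := by
    rw [C.integral_congr_Ω (w := fun _ => 0), integral_zero]
    intro x hx
    by_contra hne
    have hmem : horiz x ∈ Function.support φ := hne
    rw [φ.support_eq] at hmem
    exact lt_asymm (show C.cstar < C.φ₀ (horiz x) from hball hmem) hx.1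
  have hcont : Continuous fun x => φ (rot c s (horiz x)) :=
    φ.continuous.comp ((contDiff_rot c s (n := 1)).continuous.comp continuous_horiz)
  rw [h0, integral_eq_zero_iff_of_nonneg (fun x => φ.nonneg)
    (C.integrable_of_continuousOn hcont.continuousOn)] at h
  have hmem : liftPt (rot c (-s) z) 0 ∈ C.Ω := C.liftPt_mem_Ω hz2 ⟨by linarith [C.b_pos], C.b_pos⟩
  have h2 := Measure.eqOn_open_of_ae_eq h C.isOpen_Ω hcont.continuousOn continuousOn_const hmem
  have h3 : rot c s (rot c (-s) z) = z := by
    have := rot_neg_rot c (-s) z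
    rwa [neg_neg] at this
  simp only [horiz_liftPt, h3, Pi.zero_apply] at h2
  have h4 := φ.pos_of_mem_ball (Metric.mem_ball_self φ.rOut_pos)
  exact h4.ne' h2

/-! ### Rigid limits under the boundary conditions, and Korn's inequalities for the velocity and its
derivative. -/

section

variable {C} {u : ℕ → E3 → E3} {a : Fin 3 → ℝ} {B : Fin 3 → Fin 3 → ℝ}

theorem contDiff_rigid (a : Fin 3 → ℝ) (B : Fin 3 → Fin 3 → ℝ) (i : Fin 3) {n : WithTop ℕ∞} :
    ContDiff ℝ n fun x : E3 => a i + ∑ j, B i j * x j :=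
  contDiff_const.add (ContDiff.sum fun j _ => contDiff_const.mul (contDiff_coord j))

theorem pd_rigid (a : Fin 3 → ℝ) (B : Fin 3 → Fin 3 → ℝ) (i k : Fin 3) {x : E3}
    (hx : x ∈ closure C.Ω) : C.pd k (fun x : E3 => a i + ∑ j, B i j * x j) x = B i k := by
  rw [pd_add contDiffOn_const
    (ContDiff.sum fun j _ => contDiff_const.mul (contDiff_coord j)).contDiffOn hx,
    pd_sum (fun j _ => contDiffOn_const.mul (contDiff_coord j).contDiffOn) hx]
  simp only [pd_const_mul _ (contDiff_coord _).contDiffOn hx, pd_coord _ _ hx]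
  simp [pd]

theorem TendstoRigid.tendsto_val (h : C.TendstoRigid u a B)
    (hu : ∀ n, ContDiffOn ℝ 1 (u n) (closure C.Ω)) {ζ : E3 → ℝ}
    (hζ : ContinuousOn ζ (closure C.Ω)) (i : Fin 3) :
    Tendsto (fun n => ∫ x, u n x i * ζ x ∂C.vol) atTop
      (𝓝 (∫ x, (a i + ∑ j, B i j * x j) * ζ x ∂C.vol)) :=
  tendsto_integral_mul_of_L2
    (fun n => C.memLp_of_continuousOn (contDiffOn_comp (hu n) i).continuousOn 2)
    (C.memLp_of_continuousOn (contDiff_rigid a B i (n := 1)).continuous.continuousOn 2)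
    (C.memLp_of_continuousOn hζ 2) (h.val i)

theorem TendstoRigid.tendsto_der (h : C.TendstoRigid u a B)
    (hu : ∀ n, ContDiffOn ℝ 1 (u n) (closure C.Ω)) {ζ : E3 → ℝ}
    (hζ : ContinuousOn ζ (closure C.Ω)) (i j : Fin 3) :
    Tendsto (fun n => ∫ x, C.pd j (fun y => u n y i) x * ζ x ∂C.vol) atTop
      (𝓝 (∫ x, B i j * ζ x ∂C.vol)) :=
  tendsto_integral_mul_of_L2
    (fun n => C.memLp_of_continuousOn (C.continuousOn_pd (contDiffOn_comp (hu n) i) j) 2)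
    (memLp_const _) (C.memLp_of_continuousOn hζ 2) (h.der i j)

theorem liftPt_mem_face_one {y : E2} (hy : y ∈ C.ω) {s : ℝ} (hs : s = -C.b ∨ s = C.b) :
    liftPt y s ∈ C.face 1 := by
  rw [← S₂_eq_face]
  exact ⟨by rwa [horiz_liftPt], by rwa [liftPt_two]⟩

theorem eq_zero_of_integral_sq {w : E3 → ℝ} (hw : ContinuousOn w (closure C.Ω))
    (h : ∫ x, w x ^ 2 ∂C.vol = 0) {x : E3} (hx : x ∈ C.Ω) : w x = 0 := by
  rw [integral_eq_zero_iff_of_nonneg (fun x => sq_nonneg _)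
    (C.integrable_of_continuousOn (hw.pow 2))] at h
  have h2 := Measure.eqOn_open_of_ae_eq h C.isOpen_Ω ((hw.mono subset_closure).pow 2)
    continuousOn_const hx
  exact pow_eq_zero_iff two_ne_zero |>.1 h2

theorem coeff_eq_zero_of_rigid_eq_zero {i : Fin 3}
    (h : ∀ x ∈ C.Ω, a i + ∑ j, B i j * x j = 0) : a i = 0 ∧ ∀ j, B i j = 0 := by
  obtain ⟨y, hy⟩ := C.connected.nonempty
  have hx : liftPt y 0 ∈ C.Ω := C.liftPt_mem_Ω hy ⟨by linarith [C.b_pos], C.b_pos⟩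
  have hB : ∀ j, B i j = 0 := fun j => by
    rw [← pd_rigid a B i j (subset_closure hx)]
    exact pd_eq_zero_of_eqOn h hx j
  exact ⟨by simpa [hB] using h _ hx, hB⟩

/-- Since u_i vanishes at both ends of each vertical segment, ∫ ∂₃(u_i ζ) = 0 for every smooth ζ,
and this identity passes to the limit R = a_i + Σ B_{ij} x_j. The choice ζ = 1 shows that R does not
depend on x₃; then ζ = x₃ R gives ∫ R² = 0. -/
theorem TendstoRigid.eq_zero_of_face_one (h : C.TendstoRigid u a B)
    (hu : ∀ n, ContDiffOn ℝ 1 (u n) (closure C.Ω)) {i : Fin 3}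
    (h0 : ∀ n, ∀ x ∈ C.face 1, u n x i = 0) : a i = 0 ∧ ∀ j, B i j = 0 := by
  have hui := fun n => contDiffOn_comp (hu n) i
  have hflux : ∀ n, ∀ ζ : E3 → ℝ, ContDiff ℝ 1 ζ →
      ∫ x, C.pd 2 (fun x => u n x i * ζ x) x ∂C.vol = 0 := fun n ζ hζ => by
    rw [C.integral_pd_two ((hui n).mul hζ.contDiffOn)]
    refine (setIntegral_congr_fun C.isOpen_ω.measurableSet (fun y hy => ?_)).trans
      (integral_zero _ _)
    simp only
    rw [h0 n _ (liftPt_mem_face_one hy (Or.inr rfl)), h0 n _ (liftPt_mem_face_one hy (Or.inl rfl))]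
    ring
  have hB2 : B i 2 = 0 := by
    have h1 := tendsto_nhds_unique (h.tendsto_der hu (ζ := fun _ => 1) continuousOn_const i 2)
      ((tendsto_const_nhds (x := (0 : ℝ))).congr fun n => by
        have := hflux n (fun _ => 1) contDiff_const
        simp only [mul_one] at this ⊢
        exact this.symm)
    simpa [C.vol_real_pos.ne'] using h1
  refine coeff_eq_zero_of_rigid_eq_zero (C := C) fun x hx =>
    eq_zero_of_integral_sq (contDiff_rigid a B i (n := 1)).continuous.continuousOn ?_ hx
  set R : E3 → ℝ := fun x => a i + ∑ j, B i j * x j with hR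
  have hRc : ContDiff ℝ 1 R := contDiff_rigid a B i
  have h2c : ContDiff ℝ 1 fun x : E3 => x 2 := contDiff_coord 2
  have h1 := (h.tendsto_val hu (ζ := R) hRc.continuous.continuousOn i).add
    (h.tendsto_der hu (ζ := fun x => x 2 * R x) (h2c.mul hRc).continuous.continuousOn i 2)
  have h2 := tendsto_nhds_unique h1 ((tendsto_const_nhds (x := (0 : ℝ))).congr fun n => by
    rw [← hflux n (fun x => x 2 * R x) (h2c.mul hRc)]
    have i1 : Integrable (fun x => u n x i * R x) C.vol := C.integrable_of_continuousOn
      ((hui n).continuousOn.mul hRc.continuous.continuousOn)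
    have i2 : Integrable (fun x => C.pd 2 (fun y => u n y i) x * (x 2 * R x)) C.vol :=
      C.integrable_of_continuousOn ((C.continuousOn_pd (hui n) 2).mul
        (h2c.mul hRc).continuous.continuousOn)
    rw [← integral_add i1 i2]
    refine C.integral_congr_Ω fun x hx => ?_
    have hx' := subset_closure hx
    rw [pd_mul (hui n) (h2c.mul hRc).contDiffOn hx', pd_mul h2c.contDiffOn hRc.contDiffOn hx',
      pd_coord 2 2 hx', hR, pd_rigid a B i 2 hx', hB2]
    simp
    ring)
  simpa [hB2, sq] using h2

/-- The velocity fields that are tangent to the whole boundary. -/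
structure VelocityField (C : Cylinder) (u : E3 → E3) : Prop where
  contDiffOn : ContDiffOn ℝ 2 u (closure C.Ω)
  div_free : ∀ x ∈ C.Ω, C.divergence u x = 0
  tangent : ∀ x ∈ C.face 0, fderiv ℝ (C.rho 0) x (u x) = 0
  bottom : ∀ x ∈ C.face 1, u x 2 = 0

/-- The `x₃`-derivatives of velocity fields. -/
structure VelocityDeriv (C : Cylinder) (u : E3 → E3) : Prop where
  contDiffOn : ContDiffOn ℝ 2 u (closure C.Ω)
  div_free : ∀ x ∈ C.Ω, C.divergence u x = 0
  tangent : ∀ x ∈ C.face 0, fderiv ℝ (C.rho 0) x (u x) = 0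
  bottom₀ : ∀ x ∈ C.face 1, u x 0 = 0
  bottom₁ : ∀ x ∈ C.face 1, u x 1 = 0
  bottom_pd : ∀ x ∈ C.face 1, C.pd 2 (fun y => u y 2) x = 0
  mean : ∫ x, u x 2 ∂C.vol = 0

theorem divergence_sub {u v : E3 → E3} (hu : ContDiffOn ℝ 1 u (closure C.Ω))
    (hv : ContDiffOn ℝ 1 v (closure C.Ω)) {x : E3} (hx : x ∈ closure C.Ω) :
    C.divergence (fun y => u y - v y) x = C.divergence u x - C.divergence v x := by
  simp only [divergence, PiLp.sub_apply, ← Finset.sum_sub_distrib]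
  exact Finset.sum_congr rfl fun i _ => pd_sub (contDiffOn_comp hu i) (contDiffOn_comp hv i) hx i

theorem divergence_const_smul {u : E3 → E3} (hu : ContDiffOn ℝ 1 u (closure C.Ω)) (r : ℝ) {x : E3}
    (hx : x ∈ closure C.Ω) : C.divergence (fun y => r • u y) x = r * C.divergence u x := by
  simp only [divergence, PiLp.smul_apply, smul_eq_mul, Finset.mul_sum]
  exact Finset.sum_congr rfl fun i _ => pd_const_mul r (contDiffOn_comp hu i) hx i

theorem VelocityField.sub {u v : E3 → E3} (hu : C.VelocityField u) (hv : C.VelocityField v) :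
    C.VelocityField fun x => u x - v x where
  contDiffOn := hu.contDiffOn.sub hv.contDiffOn
  div_free x hx := by
    rw [divergence_sub (hu.contDiffOn.of_le one_le_two) (hv.contDiffOn.of_le one_le_two)
      (subset_closure hx), hu.div_free x hx, hv.div_free x hx, sub_zero]
  tangent x hx := by rw [map_sub, hu.tangent x hx, hv.tangent x hx, sub_zero]
  bottom x hx := by simp [hu.bottom x hx, hv.bottom x hx]

theorem VelocityField.smul {u : E3 → E3} (r : ℝ) (hu : C.VelocityField u) :
    C.VelocityField fun x => r • u x where
  contDiffOn := hu.contDiffOn.const_smul r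
  div_free x hx := by
    rw [divergence_const_smul (hu.contDiffOn.of_le one_le_two) r (subset_closure hx),
      hu.div_free x hx, mul_zero]
  tangent x hx := by rw [map_smul, hu.tangent x hx, smul_zero]
  bottom x hx := by simp [hu.bottom x hx]

theorem VelocityDeriv.sub {u v : E3 → E3} (hu : C.VelocityDeriv u) (hv : C.VelocityDeriv v) :
    C.VelocityDeriv fun x => u x - v x where
  contDiffOn := hu.contDiffOn.sub hv.contDiffOn
  div_free x hx := by
    rw [divergence_sub (hu.contDiffOn.of_le one_le_two) (hv.contDiffOn.of_le one_le_two)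
      (subset_closure hx), hu.div_free x hx, hv.div_free x hx, sub_zero]
  tangent x hx := by rw [map_sub, hu.tangent x hx, hv.tangent x hx, sub_zero]
  bottom₀ x hx := by simp [hu.bottom₀ x hx, hv.bottom₀ x hx]
  bottom₁ x hx := by simp [hu.bottom₁ x hx, hv.bottom₁ x hx]
  bottom_pd x hx := by
    simp only [PiLp.sub_apply]
    rw [pd_sub (contDiffOn_comp (hu.contDiffOn.of_le one_le_two) 2)
      (contDiffOn_comp (hv.contDiffOn.of_le one_le_two) 2) (C.face_subset 1 hx),
      hu.bottom_pd x hx, hv.bottom_pd x hx, sub_zero]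
  mean := by
    simp only [PiLp.sub_apply]
    rw [integral_sub
      (C.integrable_of_continuousOn (contDiffOn_comp hu.contDiffOn 2).continuousOn)
      (C.integrable_of_continuousOn (contDiffOn_comp hv.contDiffOn 2).continuousOn),
      hu.mean, hv.mean, sub_zero]

theorem VelocityDeriv.smul {u : E3 → E3} (r : ℝ) (hu : C.VelocityDeriv u) :
    C.VelocityDeriv fun x => r • u x where
  contDiffOn := hu.contDiffOn.const_smul r
  div_free x hx := by
    rw [divergence_const_smul (hu.contDiffOn.of_le one_le_two) r (subset_closure hx),
      hu.div_free x hx, mul_zero]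
  tangent x hx := by rw [map_smul, hu.tangent x hx, smul_zero]
  bottom₀ x hx := by simp [hu.bottom₀ x hx]
  bottom₁ x hx := by simp [hu.bottom₁ x hx]
  bottom_pd x hx := by
    simp only [PiLp.smul_apply, smul_eq_mul]
    rw [pd_const_mul r (contDiffOn_comp (hu.contDiffOn.of_le one_le_two) 2) (C.face_subset 1 hx),
      hu.bottom_pd x hx, mul_zero]
  mean := by
    simp only [PiLp.smul_apply, smul_eq_mul]
    rw [integral_const_mul, hu.mean, mul_zero]

theorem fderiv_rho_one_eq_zero {d : E3} (x : E3) (hd : d 2 = 0) : fderiv ℝ (C.rho 1) x d = 0 := by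
  simp [fderiv_rho_one, hd]

theorem VelocityField.tangent_closure {u : E3 → E3} (hu : C.VelocityField u) (k : Fin 2) {x : E3}
    (hx : x ∈ closure C.Ω) (hk : C.rho k x = 0) : fderiv ℝ (C.rho k) x (u x) = 0 := by
  have hcont : ∀ k, ContinuousOn (fun x => fderiv ℝ (C.rho k) x (u x)) (closure C.Ω) := fun k =>
    ((C.contDiff_rho k).continuous_fderiv two_ne_zero).continuousOn.clm_apply
      hu.contDiffOn.continuousOn
  refine C.eq_zero_of_face (hcont k) (fun y hy => ?_) hx hk
  fin_cases k
  · exact hu.tangent y hy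
  · exact fderiv_rho_one_eq_zero y (hu.bottom y hy)

/-- A weak form of tangency, tested with functions of the horizontal variables. Unlike pointwise
boundary values, this integral identity passes to L₂ limits. -/
theorem VelocityField.integral_fderiv_horiz {u : E3 → E3} (hu : C.VelocityField u) {φ : E2 → ℝ}
    (hφ : ContDiff ℝ 1 φ) : ∫ x, fderiv ℝ φ (horiz x) (horiz (u x)) ∂C.vol = 0 := by
  have hu1 := hu.contDiffOn.of_le one_le_two
  have hΦ : ContDiff ℝ 1 fun x => φ (horiz x) := hφ.comp contDiff_horiz
  rw [← C.integral_divergence_eq_zero (F := fun x => φ (horiz x) • u x) (hΦ.contDiffOn.smul hu1)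
    fun k x hx hk => by rw [map_smul, hu.tangent_closure k hx hk, smul_zero]]
  refine C.integral_congr_Ω fun x hx => ?_
  rw [C.divergence_smul hΦ.contDiffOn hu1 (subset_closure hx), hu.div_free x hx, mul_zero, add_zero,
    C.fderivWithin_eq _ hx]
  have h1 : HasFDerivAt (fun x => φ (horiz x)) ((fderiv ℝ φ (horiz x)).comp horizL) x :=
    (hφ.differentiable one_ne_zero _).hasFDerivAt.comp x horizL.hasFDerivAt
  rw [h1.fderiv]
  rfl

end

theorem clm_two_apply (L : E2 →L[ℝ] ℝ) (d : E2) :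
    L d = d 0 * L (EuclideanSpace.single 0 1) + d 1 * L (EuclideanSpace.single 1 1) := by
  have h : d = d 0 • EuclideanSpace.single 0 1 + d 1 • EuclideanSpace.single 1 1 := by
    ext i
    fin_cases i <;> simp
  conv_lhs => rw [h]
  simp

-- The condition on S₂ removes the third row, and antisymmetry leaves the plane field (a 0 + β x 1,
-- a 1 − β x 0). It inherits the weak tangency of the approximating fields, which is stated in
-- `key`.
variable {C} in
theorem VelocityField.rigid_eq_zero (hC : ¬ C.AxiallySymmetric) {u : ℕ → E3 → E3} {a : Fin 3 → ℝ}
    {B : Fin 3 → Fin 3 → ℝ} (hu : ∀ n, C.VelocityField (u n)) (h : C.TendstoRigid u a B) :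
    (∀ i, a i = 0) ∧ ∀ i j, B i j = 0 := by
  have hu1 := fun n => (hu n).contDiffOn.of_le one_le_two
  obtain ⟨ha2, hB2⟩ := h.eq_zero_of_face_one hu1 fun n => (hu n).bottom
  have h02 : B 0 2 = 0 := by have := h.antisymm 2 0; rw [hB2] at this; linarith
  have h12 : B 1 2 = 0 := by have := h.antisymm 2 1; rw [hB2] at this; linarith
  have h00 : B 0 0 = 0 := by have := h.antisymm 0 0; linarith
  have h11 : B 1 1 = 0 := by have := h.antisymm 1 1; linarith
  have h10 := h.antisymm 0 1
  set β := B 0 1 with hβ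
  have key : ∀ φ : E2 → ℝ, ContDiff ℝ 1 φ →
      ∫ x, fderiv ℝ φ (horiz x) (!₂[a 0 + β * x 1, a 1 - β * x 0]) ∂C.vol = 0 := fun φ hφ => by
    have hc : ∀ e : E2, ContinuousOn (fun x => fderiv ℝ φ (horiz x) e) (closure C.Ω) := fun e =>
      (((hφ.continuous_fderiv one_ne_zero).comp continuous_horiz).clm_apply
        continuous_const).continuousOn
    have h1 := (h.tendsto_val hu1 (hc (EuclideanSpace.single 0 1)) 0).add
      (h.tendsto_val hu1 (hc (EuclideanSpace.single 1 1)) 1)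
    have hi : ∀ (w : E3 → ℝ) (e : E2), ContinuousOn w (closure C.Ω) →
        Integrable (fun x => w x * fderiv ℝ φ (horiz x) e) C.vol := fun w e hw =>
      C.integrable_of_continuousOn (hw.mul (hc e))
    have h2 := tendsto_nhds_unique h1 ((tendsto_const_nhds (x := (0 : ℝ))).congr fun n => by
      rw [← (hu n).integral_fderiv_horiz hφ, ← integral_add
        (hi _ _ (contDiffOn_comp (hu1 n) 0).continuousOn)
        (hi _ _ (contDiffOn_comp (hu1 n) 1).continuousOn)]
      refine C.integral_congr_Ω fun x _ => ?_
      rw [clm_two_apply _ (horiz (u n x))]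
      simp [horiz])
    rw [← h2, ← integral_add (hi _ _ (contDiff_rigid a B 0 (n := 1)).continuous.continuousOn)
      (hi _ _ (contDiff_rigid a B 1 (n := 1)).continuous.continuousOn)]
    refine C.integral_congr_Ω fun x _ => ?_
    rw [clm_two_apply]
    simp only [Fin.sum_univ_three, h00, h02, h11, h12, h10, ← hβ,
      Matrix.cons_val_zero, Matrix.cons_val_one]
    ring
  -- For β = 0 the limit is a translation, excluded by testing with the linear function whose
  -- gradient is (a 0, a 1). For β ≠ 0 it is −β times the rotation field about its zero (a 1/β, −a
  -- 0/β), which contradicts the lack of axial symmetry.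
  by_cases h0 : β = 0
  · have hL := key (fun y => a 0 * y 0 + a 1 * y 1) (by
      have hp : ∀ i : Fin 2, ContDiff ℝ 1 fun y : E2 => y i := fun i =>
        (EuclideanSpace.proj i : E2 →L[ℝ] ℝ).contDiff
      exact (contDiff_const.mul (hp 0)).add (contDiff_const.mul (hp 1)))
    have hfd : ∀ y : E2, fderiv ℝ (fun y : E2 => a 0 * y 0 + a 1 * y 1) y =
        a 0 • (EuclideanSpace.proj 0 : E2 →L[ℝ] ℝ) + a 1 • EuclideanSpace.proj 1 := fun y =>
      (a 0 • (EuclideanSpace.proj 0 : E2 →L[ℝ] ℝ) + a 1 • EuclideanSpace.proj 1).fderiv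
    simp only [hfd, h0] at hL
    simp [C.vol_real_pos.ne'] at hL
    have ha0 : a 0 = 0 := by nlinarith [mul_self_nonneg (a 0), mul_self_nonneg (a 1)]
    have ha1 : a 1 = 0 := by nlinarith [mul_self_nonneg (a 0), mul_self_nonneg (a 1)]
    rw [h0, neg_zero] at h10
    refine ⟨fun i => ?_, fun i j => ?_⟩
    · fin_cases i <;> assumption
    · rw [hβ] at h0
      fin_cases i <;> fin_cases j <;> first | assumption | exact hB2 _
  · refine absurd (C.axiallySymmetric_of_integral_eq_zero (c := !₂[a 1 / β, -(a 0 / β)])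
      fun φ hφ => ?_) hC
    have h3 := key φ hφ
    have h4 : ∀ x : E3, fderiv ℝ φ (horiz x) (!₂[a 0 + β * x 1, a 1 - β * x 0]) =
        -β * fderiv ℝ φ (horiz x) (rotField !₂[a 1 / β, -(a 0 / β)] (horiz x)) := fun x => by
      rw [← smul_eq_mul (-β), ← map_smul]
      congr 1
      ext i
      fin_cases i <;> simp [rotField, horiz] <;> field_simp <;> ring
    simp only [h4, integral_const_mul] at h3
    exact (mul_eq_zero.1 h3).resolve_left (neg_ne_zero.2 h0)

-- The conditions on S₂ annihilate the first two rows, and antisymmetry then annihilates `B`. The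
-- vertical translation that is left is excluded by `mean`, and the shape of ω plays no role.
variable {C} in
theorem VelocityDeriv.rigid_eq_zero {u : ℕ → E3 → E3} {a : Fin 3 → ℝ}
    {B : Fin 3 → Fin 3 → ℝ} (hu : ∀ n, C.VelocityDeriv (u n)) (h : C.TendstoRigid u a B) :
    (∀ i, a i = 0) ∧ ∀ i j, B i j = 0 := by
  have hu1 := fun n => (hu n).contDiffOn.of_le one_le_two
  obtain ⟨ha0, hB0⟩ := h.eq_zero_of_face_one hu1 fun n => (hu n).bottom₀
  obtain ⟨ha1, hB1⟩ := h.eq_zero_of_face_one hu1 fun n => (hu n).bottom₁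
  have hB : ∀ i j, B i j = 0 := fun i j => by
    have h1 := h.antisymm i j
    have h2 := hB0 j
    have h3 := hB1 j
    have h4 := hB0 i
    have h5 := hB1 i
    fin_cases i <;> fin_cases j <;> simp at * <;> linarith
  refine ⟨fun i => ?_, hB⟩
  have h2 : a 2 = 0 := by
    have h1 := tendsto_nhds_unique (h.tendsto_val hu1 (ζ := fun _ => 1) continuousOn_const 2)
      ((tendsto_const_nhds (x := (0 : ℝ))).congr fun n => by simp only [mul_one, (hu n).mean])
    simpa [hB, C.vol_real_pos.ne'] using h1
  fin_cases i <;> assumption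

/-- On S₂ the third component vanishes and u is tangent to the face, so the derivative of u₃ along u
vanishes there, as `exists_korn_second` requires. -/
theorem exists_korn_velocity (hC : ¬ C.AxiallySymmetric) :
    ∃ c, 0 ≤ c ∧ ∀ u, C.VelocityField u → C.h1v u ≤ c * C.dilSq u := by
  obtain ⟨c, hc, hK⟩ := C.exists_korn_second
  refine C.exists_korn_of_rigid (fun u hu => hu.contDiffOn) (fun u v hu hv => hu.sub hv)
    (fun r u hu => hu.smul r) hc (fun u hu => ?_) fun u a B hu h =>
      VelocityField.rigid_eq_zero hC hu h
  refine hK u hu.contDiffOn hu.div_free hu.tangent fun x hx => ?_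
  rw [convect_eq]
  exact C.fderivWithin_tangent_eq_zero (contDiffOn_comp (hu.contDiffOn.of_le one_le_two) 2)
    hu.bottom hx (fderiv_rho_one_eq_zero x (hu.bottom x hx))

/-- On S₂ the field is vertical and ∂₃u₃ = 0, so the derivative of u₃ along u vanishes there, as
`exists_korn_second` requires. -/
theorem exists_korn_velocityDeriv :
    ∃ c, 0 ≤ c ∧ ∀ u, C.VelocityDeriv u → C.h1v u ≤ c * C.dilSq u := by
  obtain ⟨c, hc, hK⟩ := C.exists_korn_second
  refine C.exists_korn_of_rigid (fun u hu => hu.contDiffOn) (fun u v hu hv => hu.sub hv)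
    (fun r u hu => hu.smul r) hc (fun u hu => ?_) fun u a B hu h =>
      VelocityDeriv.rigid_eq_zero hu h
  refine hK u hu.contDiffOn hu.div_free hu.tangent fun x hx => ?_
  simp [convect, Fin.sum_univ_three, hu.bottom₀ x hx, hu.bottom₁ x hx, hu.bottom_pd x hx]

end Cylinder

/-! ### Grönwall's inequality with integrable coefficients. -/

theorem AbsolutelyContinuousOnInterval.lipschitz_comp {f Ψ : ℝ → ℝ} {K : ℝ≥0} {a b : ℝ}
    (hΨ : LipschitzWith K Ψ) (hf : AbsolutelyContinuousOnInterval f a b) :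
    AbsolutelyContinuousOnInterval (fun x => Ψ (f x)) a b := by
  refine squeeze_zero (fun E => Finset.sum_nonneg fun i _ => dist_nonneg) (fun E => ?_)
    (by simpa using Tendsto.const_mul (K : ℝ) hf)
  rw [Finset.mul_sum]
  exact Finset.sum_le_sum fun i _ => hΨ.dist_le_mul _ _

/-- Truncation at 0 makes the exponential globally Lipschitz, so that composition with it preserves
absolute continuity. It is harmless in the application, where the argument is the integral of a
nonnegative function. -/
theorem lipschitzWith_exp_neg_max : LipschitzWith 1 fun s : ℝ => Real.exp (-max s 0) := by
  have key : ∀ s t : ℝ, 0 ≤ s → s ≤ t → Real.exp (-s) - Real.exp (-t) ≤ t - s := fun s t hs hst => by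
    have h1 : Real.exp (-t) = Real.exp (-s) * Real.exp (s - t) := by rw [← Real.exp_add]; ring_nf
    have h2 := Real.add_one_le_exp (s - t)
    have h3 : Real.exp (-s) ≤ 1 := Real.exp_le_one_iff.2 (by linarith)
    have h4 := Real.exp_pos (-s)
    rw [h1]
    nlinarith
  have hmono : ∀ s t : ℝ, s ≤ t → Real.exp (-t) ≤ Real.exp (-s) := fun s t h =>
    Real.exp_le_exp.2 (by linarith)
  refine LipschitzWith.of_dist_le_mul fun s t => ?_
  rw [Real.dist_eq, Real.dist_eq, NNReal.coe_one, one_mul]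
  refine le_trans ?_ (abs_max_sub_max_le_abs s t 0)
  rcases le_total (max s 0) (max t 0) with h | h
  · rw [abs_of_nonneg (sub_nonneg.2 (hmono _ _ h)), abs_sub_comm, abs_of_nonneg (sub_nonneg.2 h)]
    exact key _ _ (le_max_right _ _) h
  · rw [abs_sub_comm, abs_of_nonneg (sub_nonneg.2 (hmono _ _ h)), abs_of_nonneg (sub_nonneg.2 h)]
    exact key _ _ (le_max_right _ _) h

/-- Since `a` is merely integrable, the integrating factor exp(−∫ a) is only absolutely continuous.
So is its product with `y`, and the fundamental theorem of calculus applies although the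
differential inequality holds only almost everywhere. -/
theorem gronwall_integrable {y y' D a b : ℝ → ℝ} {ε t : ℝ} (hεt : ε ≤ t)
    (hy : ∀ s ∈ Icc ε t, HasDerivAt y (y' s) s) (hy' : ContinuousOn y' (Icc ε t))
    (hD : ContinuousOn D (Icc ε t)) (hD0 : ∀ s ∈ Icc ε t, 0 ≤ D s)
    (ha : IntervalIntegrable a volume ε t) (hb : IntervalIntegrable b volume ε t)
    (ha0 : ∀ s, 0 ≤ a s) (hb0 : ∀ s, 0 ≤ b s)
    (h : ∀ᵐ s, s ∈ Ioc ε t → y' s + D s ≤ a s * y s + b s) :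
    Real.exp (-∫ s in ε..t, a s) * (y t + ∫ s in ε..t, D s) ≤ y ε + ∫ s in ε..t, b s := by
  set α : ℝ → ℝ := fun s => ∫ r in ε..s, a r with hα
  set E : ℝ → ℝ := fun s => Real.exp (-max (α s) 0) with hE
  have hα0 : ∀ s, ε ≤ s → 0 ≤ α s := fun s hs =>
    intervalIntegral.integral_nonneg hs fun r _ => ha0 r
  have hEeq : ∀ s, ε ≤ s → E s = Real.exp (-α s) := fun s hs => by
    simp only [hE, max_eq_left (hα0 s hs)]
  have hαac : AbsolutelyContinuousOnInterval α ε t :=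
    ha.absolutelyContinuousOnInterval_intervalIntegral left_mem_uIcc
  have hEac : AbsolutelyContinuousOnInterval E ε t := 
    hαac.lipschitz_comp (Ψ := fun s => Real.exp (-max s 0)) lipschitzWith_exp_neg_max
  have hyac : AbsolutelyContinuousOnInterval y ε t := by
    obtain ⟨M, hM⟩ := isCompact_Icc.exists_bound_of_continuousOn hy'
    have hl : LipschitzOnWith M.toNNReal y (uIcc ε t) := by
      rw [uIcc_of_le hεt]
      refine (convex_Icc ε t).lipschitzOnWith_of_nnnorm_hasDerivWithin_le
        (fun s hs => (hy s hs).hasDerivWithinAt) fun s hs => ?_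
      rw [← NNReal.coe_le_coe, coe_nnnorm]
      exact (hM s hs).trans (Real.le_coe_toNNReal M)
    exact hl.absolutelyContinuousOnInterval
  have hac := hyac.fun_mul hEac
  have hftc := hac.integral_deriv_eq_sub
  have hEpos : ∀ s, 0 < E s := fun s => Real.exp_pos _
  have hE1 : ∀ s, E s ≤ 1 := fun s => Real.exp_le_one_iff.2 (by simp)
  have hDi : IntervalIntegrable D volume ε t :=
    ContinuousOn.intervalIntegrable (by rwa [uIcc_of_le hεt])
  -- The factor `E` is nonincreasing because a ≥ 0. Its last value bounds from below the weight of
  -- `D`, while E ≤ 1 bounds the weight of `b`.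
  have hEt : ∀ s ∈ Icc ε t, E t ≤ E s := fun s hs => by
    rw [hEeq t hεt, hEeq s hs.1, Real.exp_le_exp, neg_le_neg_iff]
    have i1 : IntervalIntegrable a volume ε s := ha.mono_set (by
      rw [uIcc_of_le hs.1, uIcc_of_le hεt]; exact Icc_subset_Icc_right hs.2)
    have i2 : IntervalIntegrable a volume s t := ha.mono_set (by
      rw [uIcc_of_le hs.2, uIcc_of_le hεt]; exact Icc_subset_Icc_left hs.1)
    simp only [hα]
    rw [← intervalIntegral.integral_add_adjacent_intervals i1 i2]
    exact le_add_of_nonneg_right (intervalIntegral.integral_nonneg hs.2 fun r _ => ha0 r)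
  have hle : ∫ s in ε..t, deriv (fun s => y s * E s) s ≤ ∫ s in ε..t, (b s - E t * D s) := by
    refine intervalIntegral.integral_mono_ae_restrict hεt hac.intervalIntegrable_deriv
      (hb.sub (hDi.const_mul _)) ?_
    have hderiv := ha.ae_hasDerivAt_integral
    rw [EventuallyLE, ae_restrict_iff' measurableSet_Icc]
    have hne : ∀ᵐ s : ℝ, s ≠ ε := by simp [ae_iff, measure_singleton]
    filter_upwards [h, hderiv, hne] with s hs hs2 hsne hsI
    have hsI' : s ∈ Ioc ε t := ⟨lt_of_le_of_ne hsI.1 hsne.symm, hsI.2⟩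
    have hds : HasDerivAt α (a s) s := hs2 (by rwa [uIcc_of_le hεt]) ε left_mem_uIcc
    have hEd : HasDerivAt E (Real.exp (-α s) * -a s) s := by
      refine (hds.neg.exp).congr_of_eventuallyEq ?_
      filter_upwards [lt_mem_nhds hsI'.1] with r hr
      exact hEeq r hr.le
    rw [((hy s hsI).fun_mul hEd).deriv, ← hEeq s hsI.1]
    have h1 := hs hsI'
    have h2 := hEt s hsI
    have h3 := hD0 s hsI
    have h4 := hE1 s
    have h5 := hEpos s
    have h6 := hb0 s
    have h7 := mul_le_mul_of_nonneg_left h1 h5.le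
    have h8 := mul_le_mul_of_nonneg_right h2 h3
    have h9 := mul_le_mul_of_nonneg_right h4 h6
    linarith
  rw [hftc, intervalIntegral.integral_sub hb (hDi.const_mul _),
    intervalIntegral.integral_const_mul] at hle
  have hEε : E ε = 1 := by simp [hE, hα]
  rw [hEε] at hle
  change Real.exp (-α t) * _ ≤ _
  rw [← hEeq t hεt]
  linarith

theorem intervalIntegrable_toReal {A : ℝ → ℝ≥0∞} {t ε : ℝ} (hε : 0 ≤ ε) (hεt : ε ≤ t)
    (hA : AEMeasurable A (volume.restrict (Ioo 0 t))) (hAi : ∫⁻ s in Ioo 0 t, A s ≠ ∞) :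
    IntervalIntegrable (fun s => (A s).toReal) volume ε t := by
  rw [intervalIntegrable_iff_integrableOn_Ioo_of_le hεt]
  exact IntegrableOn.mono_set (integrable_toReal_of_lintegral_ne_top hA hAi)
    (Ioo_subset_Ioo_left hε)

theorem ofReal_integral_toReal_le {A : ℝ → ℝ≥0∞} {t ε s : ℝ} (hε : 0 ≤ ε) (hεs : ε ≤ s)
    (hst : s ≤ t) : ENNReal.ofReal (∫ r in ε..s, (A r).toReal) ≤ ∫⁻ r in Ioo 0 t, A r := by
  by_cases hi : IntervalIntegrable (fun r => (A r).toReal) volume ε s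
  · rw [intervalIntegral.integral_of_le hεs, integral_Ioc_eq_integral_Ioo,
      ofReal_integral_eq_lintegral_ofReal
        ((intervalIntegrable_iff_integrableOn_Ioo_of_le hεs).1 hi)
        (Eventually.of_forall fun r => ENNReal.toReal_nonneg)]
    exact (lintegral_mono fun r => ENNReal.ofReal_toReal_le).trans
      (lintegral_mono_set (Ioo_subset_Ioo hε hst))
  · rw [intervalIntegral.integral_undef hi]
    simp

/-- Grönwall's inequality with integrable coefficients, for a function that is differentiable on
the open interval only. -/
theorem gronwall_lintegral {y y' D : ℝ → ℝ} {A B : ℝ → ℝ≥0∞} {Y : ℝ≥0∞} {T : ℝ}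
    (hy : ∀ s ∈ Ioo 0 T, HasDerivAt y (y' s) s) (hy' : ContinuousOn y' (Ioo 0 T))
    (hD : ContinuousOn D (Ioo 0 T)) (hy0 : ∀ s ∈ Ioo 0 T, 0 ≤ y s) (hD0 : ∀ s ∈ Ioo 0 T, 0 ≤ D s)
    (hA : AEMeasurable A (volume.restrict (Ioo 0 T)))
    (hB : AEMeasurable B (volume.restrict (Ioo 0 T)))
    (hAi : ∫⁻ s in Ioo 0 T, A s ≠ ∞)
    (hY : Tendsto (fun s => ENNReal.ofReal (y s)) (𝓝[>] 0) (𝓝 Y))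
    (h : ∀ᵐ s ∂(volume.restrict (Ioo 0 T)),
      ENNReal.ofReal (y' s + D s) ≤ A s * ENNReal.ofReal (y s) + B s)
    {t : ℝ} (ht : t ∈ Ioc 0 T) :
    (∀ s ∈ Ioo 0 t, ENNReal.ofReal (y s) ≤
      ENNReal.ofReal (Real.exp (∫⁻ s in Ioo 0 t, A s).toReal) * (Y + ∫⁻ s in Ioo 0 t, B s)) ∧
    ∫⁻ s in Ioo 0 t, ENNReal.ofReal (D s) ≤
      ENNReal.ofReal (Real.exp (∫⁻ s in Ioo 0 t, A s).toReal) * (Y + ∫⁻ s in Ioo 0 t, B s) := by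
  set a := (∫⁻ s in Ioo 0 t, A s).toReal with ha
  have hsub : Ioo 0 t ⊆ Ioo 0 T := Ioo_subset_Ioo_right ht.2
  have hAt : ∫⁻ s in Ioo 0 t, A s ≠ ∞ := ((lintegral_mono_set hsub).trans_lt hAi.lt_top).ne
  by_cases hBt : ∫⁻ s in Ioo 0 t, B s = ∞
  · have htop : ENNReal.ofReal (Real.exp a) * (Y + ∫⁻ s in Ioo 0 t, B s) = ∞ := by
      rw [hBt, add_top, ENNReal.mul_top]
      simpa using Real.exp_pos a
    rw [htop]
    exact ⟨fun s _ => le_top, le_top⟩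
  have hAm := hA.mono_set hsub
  have hBm := hB.mono_set hsub
  have hAf : ∀ᵐ s ∂(volume.restrict (Ioo 0 t)), A s < ∞ := ae_lt_top' hAm hAt
  have hBf : ∀ᵐ s ∂(volume.restrict (Ioo 0 t)), B s < ∞ := ae_lt_top' hBm hBt
  have hreal : ∀ᵐ s, s ∈ Ioo 0 t → y' s + D s ≤ (A s).toReal * y s + (B s).toReal := by
    rw [← ae_restrict_iff' measurableSet_Ioo]
    filter_upwards [ae_restrict_of_ae_restrict_of_subset hsub h, hAf, hBf,
      ae_restrict_mem measurableSet_Ioo] with s hs hA' hB' hsI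
    have h1 := (ENNReal.ofReal_le_iff_le_toReal (by finiteness)).1 hs
    rwa [ENNReal.toReal_add (by finiteness) (by finiteness), ENNReal.toReal_mul,
      ENNReal.toReal_ofReal (hy0 s (hsub hsI))] at h1
  -- On a closed interval away from 0 and `t` all data are regular. The limit ε → 0 then needs only
  -- the convergence of y(ε) to the initial value.
  have key : ∀ ε s, 0 < ε → ε ≤ s → s < t →
      ENNReal.ofReal (y s) + ∫⁻ r in Ioc ε s, ENNReal.ofReal (D r) ≤
      ENNReal.ofReal (Real.exp a) * (ENNReal.ofReal (y ε) + ∫⁻ s in Ioo 0 t, B s) := by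
    intro ε s hε hεs hst
    have hIcc : Icc ε s ⊆ Ioo 0 T := fun r hr => ⟨hε.trans_le hr.1, (hr.2.trans_lt hst).trans_le ht.2⟩
    have hmono : uIcc ε s ⊆ uIcc ε t := by
      rw [uIcc_of_le hεs, uIcc_of_le (hεs.trans hst.le)]; exact Icc_subset_Icc_right hst.le
    have hAI := (intervalIntegrable_toReal hε.le (hεs.trans hst.le) hAm hAt).mono_set hmono
    have hBI := (intervalIntegrable_toReal hε.le (hεs.trans hst.le) hBm hBt).mono_set hmono
    have hg := gronwall_integrable hεs (fun r hr => hy r (hIcc hr)) (hy'.mono hIcc) (hD.mono hIcc)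
      (fun r hr => hD0 r (hIcc hr)) hAI hBI
      (fun r => ENNReal.toReal_nonneg) (fun r => ENNReal.toReal_nonneg)
      (hreal.mono fun r hr hrI => hr ⟨hε.trans hrI.1, hrI.2.trans_lt hst⟩)
    have hle : ∫ r in ε..s, (A r).toReal ≤ a := by
      rw [ha, ← ENNReal.ofReal_le_iff_le_toReal hAt]
      exact ofReal_integral_toReal_le hε.le hεs hst.le
    have hys := hy0 s (hIcc (right_mem_Icc.2 hεs))
    have hyε := hy0 ε (hIcc (left_mem_Icc.2 hεs))
    have hDi : IntegrableOn D (Ioc ε s) :=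
      ((hD.mono hIcc).integrableOn_Icc).mono_set Ioc_subset_Icc_self
    have hDn : 0 ≤ᵐ[volume.restrict (Ioc ε s)] D := by
      filter_upwards [ae_restrict_mem measurableSet_Ioc] with r hr
      exact hD0 r (hIcc (Ioc_subset_Icc_self hr))
    have hDnn : 0 ≤ ∫ r in ε..s, D r := by
      rw [intervalIntegral.integral_of_le hεs]
      exact integral_nonneg_of_ae hDn
    have e1 : ENNReal.ofReal (y s) + ∫⁻ r in Ioc ε s, ENNReal.ofReal (D r) =
        ENNReal.ofReal (y s + ∫ r in ε..s, D r) := by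
      rw [ENNReal.ofReal_add hys hDnn, intervalIntegral.integral_of_le hεs,
        ofReal_integral_eq_lintegral_ofReal hDi hDn]
    have h2 : y s + ∫ r in ε..s, D r ≤ Real.exp a * (y ε + ∫ r in ε..s, (B r).toReal) := by
      have h3 : Real.exp (-a) ≤ Real.exp (-∫ r in ε..s, (A r).toReal) :=
        Real.exp_le_exp.2 (by linarith)
      have h4 := (mul_le_mul_of_nonneg_right h3 (add_nonneg hys hDnn)).trans hg
      have h5 := mul_le_mul_of_nonneg_left h4 (Real.exp_pos a).le
      rwa [← mul_assoc, ← Real.exp_add, add_neg_cancel, Real.exp_zero, one_mul] at h5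
    rw [e1]
    refine (ENNReal.ofReal_le_ofReal h2).trans ?_
    rw [ENNReal.ofReal_mul (Real.exp_pos a).le, ENNReal.ofReal_add hyε
      (intervalIntegral.integral_nonneg hεs fun r _ => ENNReal.toReal_nonneg)]
    gcongr
    exact ofReal_integral_toReal_le hε.le hεs hst.le
  have hlimR : Tendsto (fun ε => ENNReal.ofReal (Real.exp a) *
      (ENNReal.ofReal (y ε) + ∫⁻ s in Ioo 0 t, B s)) (𝓝[>] 0)
      (𝓝 (ENNReal.ofReal (Real.exp a) * (Y + ∫⁻ s in Ioo 0 t, B s))) :=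
    ENNReal.Tendsto.const_mul (hY.add_const _) (Or.inr ENNReal.ofReal_ne_top)
  constructor
  · intro s hs
    refine ge_of_tendsto hlimR ?_
    filter_upwards [Ioo_mem_nhdsGT hs.1] with ε hε
    exact le_self_add.trans (key ε s hε.1 hε.2.le hs.2)
  -- The shift by 3 gives εn ≤ t/3, so that εn ≤ t − εn for every `n`.
  · set εn : ℕ → ℝ := fun n => t / (n + 3) with hεn
    have hε0 : Tendsto εn atTop (𝓝 0) := by
      have h1 : Tendsto (fun n : ℕ => (n : ℝ) + 3) atTop atTop :=
        tendsto_atTop_add_const_right _ _ tendsto_natCast_atTop_atTop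
      exact h1.const_div_atTop t
    have hεpos : ∀ n, 0 < εn n := fun n => div_pos ht.1 (by positivity)
    have hε3 : ∀ n, εn n ≤ t / 3 := fun n =>
      div_le_div_of_nonneg_left ht.1.le (by norm_num) (by linarith [n.cast_nonneg (α := ℝ)])
    have hcov : AECover (volume.restrict (Ioo 0 t)) atTop fun n => Ioc (εn n) (t - εn n) :=
      aecover_Ioo_of_Ioc hε0 (by simpa using hε0.const_sub t)
    have hDm : AEMeasurable (fun r => ENNReal.ofReal (D r)) (volume.restrict (Ioo 0 t)) :=
      ((hD.mono hsub).aemeasurable measurableSet_Ioo).ennreal_ofReal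
    have hlim := hcov.lintegral_tendsto_of_countably_generated hDm
    refine le_of_tendsto_of_tendsto hlim (hlimR.comp (tendsto_nhdsWithin_iff.2
      ⟨hε0, Eventually.of_forall hεpos⟩)) (Eventually.of_forall fun n => ?_)
    have hpos := hεpos n
    have h3 := hε3 n
    simp only [Function.comp_apply]
    have hIoc : Ioc (εn n) (t - εn n) ⊆ Ioo 0 t := fun r hr =>
      ⟨hpos.trans hr.1, lt_of_le_of_lt hr.2 (by linarith)⟩
    rw [Measure.restrict_restrict measurableSet_Ioc, inter_eq_left.2 hIoc]
    exact le_add_self.trans (key _ _ hpos (by linarith) (by linarith))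

/-! ### Integrals depending on time, and initial values. -/

namespace Cylinder

variable {C : Cylinder} {T : ℝ}

/-- Regularity is available on the open time interval only. Bounds are therefore uniform just on
compact neighbourhoods of a time, which suffices for dominated convergence. -/
theorem exists_bound_near {F : Type*} [NormedAddCommGroup F] {w : ℝ → E3 → F}
    (hw : ContinuousOn (fun z : ℝ × E3 => w z.1 z.2) (Ioo 0 T ×ˢ closure C.Ω)) {t : ℝ}
    (ht : t ∈ Ioo 0 T) :
    ∃ U ∈ 𝓝 t, U ⊆ Ioo 0 T ∧ ∃ M, ∀ s ∈ U, ∀ x ∈ closure C.Ω, ‖w s x‖ ≤ M := by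
  obtain ⟨l, r, htlr, hnhds, hsub⟩ := exists_Icc_mem_subset_of_mem_nhds (isOpen_Ioo.mem_nhds ht)
  obtain ⟨M, hM⟩ := (isCompact_Icc.prod C.isCompact_closure_Ω).exists_bound_of_continuousOn
    (hw.mono (prod_mono_left hsub))
  exact ⟨Icc l r, hnhds, hsub, M, fun s hs x hx => hM (s, x) ⟨hs, hx⟩⟩

theorem continuousOn_slice {F : Type*} [NormedAddCommGroup F] {w : ℝ → E3 → F}
    (hw : ContinuousOn (fun z : ℝ × E3 => w z.1 z.2) (Ioo 0 T ×ˢ closure C.Ω)) {t : ℝ}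
    (ht : t ∈ Ioo 0 T) : ContinuousOn (w t) (closure C.Ω) :=
  hw.comp (Continuous.prodMk_right t).continuousOn fun _ hx => ⟨ht, hx⟩

theorem continuousOn_integral {w : ℝ → E3 → ℝ}
    (hw : ContinuousOn (fun z : ℝ × E3 => w z.1 z.2) (Ioo 0 T ×ˢ closure C.Ω)) :
    ContinuousOn (fun t => ∫ x, w t x ∂C.vol) (Ioo 0 T) := by
  intro t ht
  obtain ⟨U, hU, hsub, M, hM⟩ := exists_bound_near hw ht
  refine ContinuousAt.continuousWithinAt (continuousAt_of_dominated (bound := fun _ => M) ?_ ?_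
    (integrable_const M) ?_)
  · filter_upwards [hU] with s hs
    exact C.aestronglyMeasurable_of_continuousOn (continuousOn_slice hw (hsub hs))
  · filter_upwards [hU] with s hs
    filter_upwards [C.ae_mem_Ω] with x hx
    exact hM s hs x (subset_closure hx)
  · filter_upwards [C.ae_mem_Ω] with x hx
    have h1 : ContinuousOn (fun s => w s x) (Ioo 0 T) :=
      hw.comp (Continuous.prodMk_left x).continuousOn fun _ hs => ⟨hs, subset_closure hx⟩
    exact h1.continuousAt (isOpen_Ioo.mem_nhds ht)

theorem hasDerivAt_integral {w w' : ℝ → E3 → ℝ}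
    (hw : ContinuousOn (fun z : ℝ × E3 => w z.1 z.2) (Ioo 0 T ×ˢ closure C.Ω))
    (hw' : ContinuousOn (fun z : ℝ × E3 => w' z.1 z.2) (Ioo 0 T ×ˢ closure C.Ω))
    (hd : ∀ t ∈ Ioo 0 T, ∀ x ∈ C.Ω, HasDerivAt (fun s => w s x) (w' t x) t) {t : ℝ}
    (ht : t ∈ Ioo 0 T) :
    HasDerivAt (fun t => ∫ x, w t x ∂C.vol) (∫ x, w' t x ∂C.vol) t := by
  obtain ⟨U, hU, hsub, M, hM⟩ := exists_bound_near hw' ht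
  refine (hasDerivAt_integral_of_dominated_loc_of_deriv_le (bound := fun _ => M) hU ?_
    (C.integrable_of_continuousOn (continuousOn_slice hw ht))
    (C.aestronglyMeasurable_of_continuousOn (continuousOn_slice hw' ht)) ?_
    (integrable_const M) ?_).2
  · filter_upwards [hU] with s hs
    exact C.aestronglyMeasurable_of_continuousOn (continuousOn_slice hw (hsub hs))
  · filter_upwards [C.ae_mem_Ω] with x hx s hs
    exact hM s hs x (subset_closure hx)
  · filter_upwards [C.ae_mem_Ω] with x hx s hs
    exact hd s (hsub hs) x hx

theorem HasInitial.tendsto_eLpNorm {F : Type*} [NormedAddCommGroup F] {u : ℝ → E3 → F}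
    {u₀ : E3 → F} (h : C.HasInitial u u₀) (hT : 0 < T)
    (hu : ∀ t ∈ Ioo 0 T, ContinuousOn (u t) (closure C.Ω)) (h₀ : MemLp u₀ 2 C.vol) :
    Tendsto (fun t => eLpNorm (u t) 2 C.vol) (𝓝[>] 0) (𝓝 (eLpNorm u₀ 2 C.vol)) := by
  have hev : ∀ᶠ t in 𝓝[>] (0 : ℝ), t ∈ Ioo 0 T := Ioo_mem_nhdsGT hT
  have hsub : ∀ t, eLpNorm (fun x => u₀ x - u t x) 2 C.vol
      = eLpNorm (fun x => u t x - u₀ x) 2 C.vol := fun t => by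
    rw [← eLpNorm_neg]
    congr 1
    ext x
    simp
  refine tendsto_of_tendsto_of_tendsto_of_le_of_le'
    (g := fun t => eLpNorm u₀ 2 C.vol - eLpNorm (fun x => u t x - u₀ x) 2 C.vol)
    (h := fun t => eLpNorm u₀ 2 C.vol + eLpNorm (fun x => u t x - u₀ x) 2 C.vol) ?_ ?_ ?_ ?_
  · simpa using ENNReal.Tendsto.sub (tendsto_const_nhds (x := eLpNorm u₀ 2 C.vol)) h
      (Or.inr ENNReal.zero_ne_top)
  · simpa using (tendsto_const_nhds (x := eLpNorm u₀ 2 C.vol)).add h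
  · filter_upwards [hev] with t ht
    have hm := (C.memLp_of_continuousOn (hu t ht) 2)
    rw [tsub_le_iff_right, ← hsub]
    have e : u₀ = u t + fun x => u₀ x - u t x := by ext x; simp
    conv_lhs => rw [e]
    exact eLpNorm_add_le hm.1 (h₀.sub hm).1 (by norm_num)
  · filter_upwards [hev] with t ht
    have hm := (C.memLp_of_continuousOn (hu t ht) 2)
    have e : u t = u₀ + fun x => u t x - u₀ x := by ext x; simp
    conv_lhs => rw [e]
    exact eLpNorm_add_le h₀.1 (hm.sub h₀).1 (by norm_num)

end Cylinder

/-! ### Integration by parts for the stress, the convection, the pressure and the Laplacian. -/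

namespace Cylinder

variable {C : Cylinder}

theorem fderiv_rho_zero_eq_zero_of_normal {x d : E3} (hx : x ∈ C.S₁)
    (h : inner ℝ (C.normal₁ x) d = 0) : fderiv ℝ (C.rho 0) x d = 0 := by
  rw [fderiv_rho, gradRho_zero, inner_neg_left, neg_eq_zero]
  rw [normal₁, real_inner_smul_left, mul_eq_zero, inv_eq_zero, norm_eq_zero] at h
  exact h.resolve_left (C.regular _ hx.1)

theorem two_eq_zero_of_normal {x d : E3} (h : inner ℝ (C.normal₂ x) d = 0) : d 2 = 0 := by
  rw [normal₂] at h
  split_ifs at h <;> simpa [PiLp.inner_apply, Fin.sum_univ_three] using h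

/-- The vector `D(u) u`. -/
def dilVec (C : Cylinder) (u : E3 → E3) (x : E3) : E3 :=
  WithLp.toLp 2 fun i => ∑ j, C.dil u x i j * u x j

theorem dilVec_apply (u : E3 → E3) (x : E3) (i : Fin 3) :
    C.dilVec u x i = ∑ j, C.dil u x i j * u x j := rfl

/-- The slip condition with τ = u, which is orthogonal to `n`. -/
theorem inner_dilVec_eq_zero {n x : E3} {u : E3 → E3} (hs : C.SlipAt n u x)
    (h : inner ℝ n (u x) = 0) : inner ℝ n (C.dilVec u x) = 0 := by
  rw [← hs (u x) h, PiLp.inner_apply]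
  refine Finset.sum_congr rfl fun i _ => ?_
  simp only [dilVec_apply, RCLike.inner_apply, conj_trivial, Finset.sum_mul]
  exact Finset.sum_congr rfl fun j _ => by ring

theorem contDiffOn_dilVec {u : E3 → E3} (hu : ContDiffOn ℝ 2 u (closure C.Ω)) :
    ContDiffOn ℝ 1 (C.dilVec u) (closure C.Ω) := by
  refine contDiffOn_euclidean.2 fun i => ?_
  simp only [dilVec_apply]
  exact ContDiffOn.sum fun j _ => (contDiffOn_dil hu i j).mul
    (contDiffOn_comp (hu.of_le one_le_two) j)

theorem tangent_of_face {F : E3 → E3} (hF : ContinuousOn F (closure C.Ω))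
    (h0 : ∀ x ∈ C.face 0, fderiv ℝ (C.rho 0) x (F x) = 0) (h1 : ∀ x ∈ C.face 1, F x 2 = 0)
    (k : Fin 2) {x : E3} (hx : x ∈ closure C.Ω) (hk : C.rho k x = 0) :
    fderiv ℝ (C.rho k) x (F x) = 0 := by
  have hcont : ∀ k, ContinuousOn (fun x => fderiv ℝ (C.rho k) x (F x)) (closure C.Ω) := fun k =>
    ((C.contDiff_rho k).continuous_fderiv two_ne_zero).continuousOn.clm_apply hF
  refine C.eq_zero_of_face (hcont k) (fun y hy => ?_) hx hk
  fin_cases k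
  · exact h0 y hy
  · exact fderiv_rho_one_eq_zero y (h1 y hy)

theorem divStress_eq {ν : ℝ} {u : E3 → E3} {p : E3 → ℝ} (hu : ContDiffOn ℝ 2 u (closure C.Ω))
    (hp : ContDiffOn ℝ 1 p (closure C.Ω)) {x : E3} (hx : x ∈ closure C.Ω) (i : Fin 3) :
    C.divStress ν u p x i =
      ν * (∑ j, C.pd j (fun y => C.dil u y i j) x) - C.pd i p x := by
  have h : ∀ j, C.pd j (fun y => C.stress ν u p y i j) x =
      ν * C.pd j (fun y => C.dil u y i j) x - if j = i then C.pd i p x else 0 := fun j => by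
    have hd := contDiffOn_dil hu i j
    have hνd : ContDiffOn ℝ 1 (fun y => ν * C.dil u y i j) (closure C.Ω) :=
      contDiffOn_const.mul hd
    by_cases hij : j = i
    · subst hij
      simp only [stress, if_true]
      rw [pd_sub hνd hp hx, pd_const_mul ν hd hx]
    · simp only [stress, hij, Ne.symm hij, if_false, sub_zero]
      rw [pd_const_mul ν hd hx]
  rw [divStress]
  simp only [h, Finset.sum_sub_distrib, Finset.mul_sum, Finset.sum_ite_eq', Finset.mem_univ,
    if_true]

theorem continuousOn_divStress {ν : ℝ} {u : E3 → E3} {p : E3 → ℝ}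
    (hu : ContDiffOn ℝ 2 u (closure C.Ω)) (hp : ContDiffOn ℝ 1 p (closure C.Ω)) (i : Fin 3) :
    ContinuousOn (fun x => C.divStress ν u p x i) (closure C.Ω) := by
  refine ContinuousOn.congr (f := fun x =>
    ν * (∑ j, C.pd j (fun y => C.dil u y i j) x) - C.pd i p x) ?_ fun x hx => divStress_eq hu hp hx i
  exact (continuousOn_const.mul (continuousOn_finsetSum _ fun j _ =>
    C.continuousOn_pd (contDiffOn_dil hu i j) j)).sub (C.continuousOn_pd hp i)

theorem continuousOn_convect {u : E3 → E3} {w : E3 → ℝ} (hu : ContinuousOn u (closure C.Ω))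
    (hw : ContDiffOn ℝ 1 w (closure C.Ω)) : ContinuousOn (C.convect u w) (closure C.Ω) := by
  refine continuousOn_finsetSum _ fun j _ => ContinuousOn.mul ?_ (C.continuousOn_pd hw j)
  exact (EuclideanSpace.proj j : E3 →L[ℝ] ℝ).continuous.comp_continuousOn hu

theorem divergence_smul_eq_convect {u : E3 → E3} {w : E3 → ℝ}
    (hw : ContDiffOn ℝ 1 w (closure C.Ω)) (hu : ContDiffOn ℝ 1 u (closure C.Ω)) {x : E3}
    (hx : x ∈ C.Ω) (hdiv : C.divergence u x = 0) :
    C.divergence (fun y => w y • u y) x = C.convect u w x := by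
  rw [C.divergence_smul hw hu (subset_closure hx), hdiv, mul_zero, add_zero, convect_eq]

/-- The symmetry of D(u) gives D(u):∇u = ½|D(u)|², hence the factor ν/2, and the boundary flux of
D(u)u vanishes by `hslip`. The pressure flux is kept as it stands: it vanishes for `v` but not for
`h`. -/
theorem integral_stress {ν : ℝ} {u : E3 → E3} {p : E3 → ℝ} (hu : ContDiffOn ℝ 2 u (closure C.Ω))
    (hp : ContDiffOn ℝ 1 p (closure C.Ω)) (hdiv : ∀ x ∈ C.Ω, C.divergence u x = 0)
    (hslip : ∀ k, ∀ x ∈ closure C.Ω, C.rho k x = 0 → fderiv ℝ (C.rho k) x (C.dilVec u x) = 0) :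
    ∫ x, ∑ i, u x i * C.divStress ν u p x i ∂C.vol =
      -(ν / 2) * C.dilSq u - ∫ x, C.divergence (fun y => p y • u y) x ∂C.vol := by
  have hu1 := hu.of_le one_le_two
  have h0 := C.integral_divergence_eq_zero (contDiffOn_dilVec hu) hslip
  have hDV := C.integrable_of_continuousOn (C.continuousOn_divergence (contDiffOn_dilVec hu))
  have hP : Integrable (fun x => C.divergence (fun y => p y • u y) x) C.vol :=
    C.integrable_of_continuousOn (C.continuousOn_divergence (hp.smul hu1))
  have hD2 := C.integrable_of_continuousOn (continuousOn_dil_sq hu1)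
  have e : ∫ x, ∑ i, u x i * C.divStress ν u p x i ∂C.vol =
      ∫ x, (ν * C.divergence (C.dilVec u) x - ν / 2 * (∑ i, ∑ j, C.dil u x i j ^ 2)
        - C.divergence (fun y => p y • u y) x) ∂C.vol := by
    refine C.integral_congr_Ω fun x hx => ?_
    have hx' := subset_closure hx
    rw [divergence_smul_eq_convect hp hu1 hx (hdiv x hx)]
    have hdv : C.divergence (C.dilVec u) x = ∑ i, ∑ j,
        (C.pd i (fun y => C.dil u y i j) x * u x j + C.dil u x i j * C.pd i (fun y => u y j) x) := by
      refine Finset.sum_congr rfl fun i _ => ?_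
      simp only [dilVec_apply]
      rw [pd_sum (fun j _ => (contDiffOn_dil hu i j).mul (contDiffOn_comp hu1 j)) hx']
      exact Finset.sum_congr rfl fun j _ =>
        pd_mul (contDiffOn_dil hu i j) (contDiffOn_comp hu1 j) hx' i
    have hsymm : ∀ i j, (fun y => C.dil u y i j) = fun y => C.dil u y j i := fun i j => by
      ext y
      simp only [dil]
      ring
    rw [hdv, convect]
    simp only [divStress_eq hu hp hx', Fin.sum_univ_three]
    rw [hsymm 1 0, hsymm 2 0, hsymm 2 1]
    simp only [dil]
    ring
  rw [e]
  erw [integral_sub ((hDV.const_mul ν).sub (hD2.const_mul (ν / 2))) hP,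
    integral_sub (hDV.const_mul ν) (hD2.const_mul (ν / 2)), integral_const_mul,
    integral_const_mul, h0]
  rw [dilSq]
  ring

theorem VelocityField.integral_convect {u : E3 → E3} (hu : C.VelocityField u) {G : E3 → ℝ}
    (hG : ContDiffOn ℝ 1 G (closure C.Ω)) : ∫ x, C.convect u G x ∂C.vol = 0 := by
  have hu1 := hu.contDiffOn.of_le one_le_two
  rw [← C.integral_divergence_eq_zero (F := fun x => G x • u x) (hG.smul hu1)
    fun k x hx hk => by rw [map_smul, hu.tangent_closure k hx hk, smul_zero]]
  exact C.integral_congr_Ω fun x hx =>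
    (divergence_smul_eq_convect hG hu1 hx (hu.div_free x hx)).symm

/-- The integrand is ½ u·∇(w²), the divergence of a field tangent to the boundary. -/
theorem VelocityField.integral_mul_convect {u : E3 → E3} (hu : C.VelocityField u) {w : E3 → ℝ}
    (hw : ContDiffOn ℝ 1 w (closure C.Ω)) : ∫ x, w x * C.convect u w x ∂C.vol = 0 := by
  have h := hu.integral_convect (hw.mul hw)
  rw [C.integral_congr_Ω (w := fun x => 2 * (w x * C.convect u w x)), integral_const_mul] at h
  · linarith
  · intro x hx
    simp only [convect, pd_mul hw hw (subset_closure hx), Finset.mul_sum]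
    exact Finset.sum_congr rfl fun j _ => by ring

theorem VelocityField.integral_pressure {u : E3 → E3} (hu : C.VelocityField u) {p : E3 → ℝ}
    (hp : ContDiffOn ℝ 1 p (closure C.Ω)) :
    ∫ x, C.divergence (fun y => p y • u y) x ∂C.vol = 0 :=
  C.integral_divergence_eq_zero (hp.smul (hu.contDiffOn.of_le one_le_two))
    fun k x hx hk => by rw [map_smul, hu.tangent_closure k hx hk, smul_zero]

/-- The horizontal part of q u is tangent to the whole boundary and its divergence integrates to
zero. The vertical part is integrated along vertical segments and leaves the flux through the bottom
and the top, where u₃ need not vanish. -/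
theorem VelocityDeriv.integral_pressure {u : E3 → E3} (hu : C.VelocityDeriv u) {q : E3 → ℝ}
    (hq : ContDiffOn ℝ 1 q (closure C.Ω)) :
    ∫ x, C.divergence (fun y => q y • u y) x ∂C.vol = ∫ y in C.ω,
      (q (liftPt y C.b) * u (liftPt y C.b) 2 - q (liftPt y (-C.b)) * u (liftPt y (-C.b)) 2) := by
  have hu1 := hu.contDiffOn.of_le one_le_two
  have hui := fun i => contDiffOn_comp hu1 i
  set F : E3 → E3 := fun x => !₂[q x * u x 0, q x * u x 1, 0] with hF
  have hFc : ContDiffOn ℝ 1 F (closure C.Ω) := by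
    refine contDiffOn_euclidean.2 fun i => ?_
    fin_cases i
    · exact hq.mul (hui 0)
    · exact hq.mul (hui 1)
    · exact contDiffOn_const
  have h0 : ∫ x, C.divergence F x ∂C.vol = 0 := by
    refine C.integral_divergence_eq_zero hFc fun k x hx hk => tangent_of_face hFc.continuousOn
      (fun x hx => ?_) (fun x hx => ?_) k hx hk
    · have h1 := hu.tangent x hx
      rw [fderiv_rho_zero] at h1 ⊢
      have e : horiz (F x) = q x • horiz (u x) := by
        ext i
        fin_cases i <;> simp [horiz, hF]
      rw [e, map_smul, ← smul_neg, h1, smul_zero]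
    · simp [hF]
  have hG := C.integral_pd_two (hq.mul (hui 2))
  have i1 := C.integrable_of_continuousOn (C.continuousOn_divergence hFc)
  have i2 : Integrable (fun x => C.pd 2 (fun y => q y * u y 2) x) C.vol :=
    C.integrable_of_continuousOn (C.continuousOn_pd (hq.mul (hui 2)) 2)
  rw [← hG, ← zero_add (∫ x, C.pd 2 _ x ∂C.vol), ← h0]
  erw [← integral_add i1 i2]
  refine C.integral_congr_Ω fun x hx => ?_
  have hz : C.pd 2 (fun _ => (0 : ℝ)) x = 0 := pd_eq_zero_of_eqOn (fun _ _ => rfl) hx 2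
  simp only [divergence, Fin.sum_univ_three, hF, PiLp.smul_apply, smul_eq_mul]
  simp [hz]

/-- The boundary conditions concern the product φ∇w, so that Neumann conditions on `w` and Dirichlet
conditions on φ are both covered. -/
theorem integral_mul_laplacian {w φ : E3 → ℝ} (hw : ContDiffOn ℝ 2 w (closure C.Ω))
    (hφ : ContDiffOn ℝ 1 φ (closure C.Ω))
    (h0 : ∀ x ∈ C.face 0, fderiv ℝ (C.rho 0) x (φ x • C.grad w x) = 0)
    (h1 : ∀ x ∈ C.face 1, φ x * C.pd 2 w x = 0) :
    ∫ x, φ x * C.laplacian w x ∂C.vol = -∫ x, ∑ i, C.pd i φ x * C.pd i w x ∂C.vol := by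
  have hgrad : ContDiffOn ℝ 1 (C.grad w) (closure C.Ω) :=
    contDiffOn_euclidean.2 fun i => contDiffOn_pd hw i
  have hF := hφ.smul hgrad
  have h := C.integral_divergence_eq_zero hF fun k x hx hk =>
    tangent_of_face hF.continuousOn h0 h1 k hx hk
  have i1 : Integrable (fun x => φ x * C.laplacian w x) C.vol := C.integrable_of_continuousOn
    (hφ.continuousOn.mul (C.continuousOn_divergence hgrad))
  have i2 : Integrable (fun x => ∑ i, C.pd i φ x * C.pd i w x) C.vol :=
    C.integrable_of_continuousOn (continuousOn_finsetSum _ fun i _ =>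
      (C.continuousOn_pd hφ i).mul (contDiffOn_pd hw i).continuousOn)
  rw [C.integral_congr_Ω (w := fun x => φ x * C.laplacian w x + ∑ i, C.pd i φ x * C.pd i w x),
    integral_add i1 i2] at h
  · linarith
  · intro x hx
    simp only [divergence, laplacian, Finset.mul_sum, ← Finset.sum_add_distrib]
    refine Finset.sum_congr rfl fun i _ => ?_
    exact (pd_mul hφ (contDiffOn_pd hw i) (subset_closure hx) i).trans (by rw [add_comm])

theorem integral_abs_mul_le {v w : E3 → ℝ} (hv : ContinuousOn v (closure C.Ω))
    (hw : ContinuousOn w (closure C.Ω)) :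
    ∫ x, |v x * w x| ∂C.vol ≤ √(∫ x, v x ^ 2 ∂C.vol) * √(∫ x, w x ^ 2 ∂C.vol) := by
  rw [← Real.sqrt_mul (integral_nonneg fun x => sq_nonneg _)]
  refine Real.le_sqrt_of_sq_le ?_
  have h := integral_mul_sq_le (f := fun x => |v x|) (g := fun x => |w x|) (μ := C.vol)
    (C.integrable_of_continuousOn (hv.abs.pow 2)) (C.integrable_of_continuousOn (hw.abs.pow 2))
    (C.integrable_of_continuousOn (hv.abs.mul hw.abs))
  simpa only [abs_mul, sq_abs] using h

/-! ### Poincaré and trace inequalities on the bottom and the top. -/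

/-- Poincaré's inequality for functions that vanish on the bottom and the top. -/
theorem h1sq_le_of_face_one {w : E3 → ℝ} (hw : ContDiffOn ℝ 1 w (closure C.Ω))
    (h0 : ∀ x ∈ C.face 1, w x = 0) :
    C.h1sq w ≤ (1 + 4 * C.b ^ 2) * ∫ x, ∑ i, C.pd i w x ^ 2 ∂C.vol := by
  have h2c : ContDiffOn ℝ 1 (fun x : E3 => x 2) (closure C.Ω) := (contDiff_coord 2).contDiffOn
  -- The derivative of x₃ w² integrates to zero, so ∫ w² = −2 ∫ x₃ w ∂₃w. With |x₃| ≤ b and Young's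
  -- inequality, half of the left side is absorbed.
  have h := C.integral_pd_two (hw.mul (hw.mul h2c))
  rw [setIntegral_congr_fun (g := fun _ => (0 : ℝ)) C.isOpen_ω.measurableSet fun y hy => by
    simp only [h0 _ (liftPt_mem_face_one hy (Or.inr rfl)),
      h0 _ (liftPt_mem_face_one hy (Or.inl rfl)), zero_mul, sub_zero], integral_zero] at h
  have hp2 := C.continuousOn_pd hw 2
  have i1 : Integrable (fun x => w x ^ 2) C.vol :=
    C.integrable_of_continuousOn (hw.continuousOn.pow 2)
  have i2 : Integrable (fun x => 2 * (x 2 * (w x * C.pd 2 w x))) C.vol :=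
    C.integrable_of_continuousOn (continuousOn_const.mul
      (h2c.continuousOn.mul (hw.continuousOn.mul hp2)))
  have i3 : Integrable (fun x => C.pd 2 w x ^ 2) C.vol := C.integrable_of_continuousOn (hp2.pow 2)
  have i4 : Integrable (fun x => ∑ i, C.pd i w x ^ 2) C.vol := C.integrable_of_continuousOn
    (continuousOn_finsetSum _ fun i _ => (C.continuousOn_pd hw i).pow 2)
  rw [C.integral_congr_Ω (w := fun x => w x ^ 2 + 2 * (x 2 * (w x * C.pd 2 w x))),
    integral_add i1 i2] at h
  · have hle : -∫ x, 2 * (x 2 * (w x * C.pd 2 w x)) ∂C.vol ≤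
        ∫ x, (1 / 2 * w x ^ 2 + 2 * C.b ^ 2 * C.pd 2 w x ^ 2) ∂C.vol := by
      rw [← integral_neg]
      refine C.integral_mono_Ω (continuousOn_const.mul
        (h2c.continuousOn.mul (hw.continuousOn.mul hp2))).neg
        ((continuousOn_const.mul (hw.continuousOn.pow 2)).add
          (continuousOn_const.mul (hp2.pow 2))) fun x hx => ?_
      have hb : (x 2) ^ 2 ≤ C.b ^ 2 := sq_le_sq' hx.2.1.le hx.2.2.le
      have h3 := mul_le_mul_of_nonneg_right hb (sq_nonneg (C.pd 2 w x))
      nlinarith [sq_nonneg (w x + 2 * (x 2 * C.pd 2 w x))]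
    rw [integral_add (i1.const_mul _) (i3.const_mul _), integral_const_mul (1 / 2 : ℝ),
      integral_const_mul (2 * C.b ^ 2)] at hle
    have h4 : ∫ x, C.pd 2 w x ^ 2 ∂C.vol ≤ ∫ x, ∑ i, C.pd i w x ^ 2 ∂C.vol :=
      integral_mono i3 i4 fun x => Finset.single_le_sum (f := fun i => C.pd i w x ^ 2)
        (fun i _ => sq_nonneg _) (Finset.mem_univ 2)
    have h5 := mul_le_mul_of_nonneg_left h4 (sq_nonneg C.b)
    rw [C.h1sq_eq hw]
    linarith
  · intro x hx
    have hx' := subset_closure hx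
    simp only
    rw [pd_mul hw (hw.mul h2c) hx', pd_mul hw h2c hx', pd_coord 2 2 hx']
    simp
    ring

/-- The affine weight (r x₃ + b)/(2b) is 1 on the face x₃ = r b and 0 on the opposite one, so the
vertical derivative of w⁴ times the weight integrates to r times the trace. Cauchy–Schwarz bounds ∫
|w³ ∂₃w| by ‖w‖₆³ ‖∂₃w‖₂, and the Sobolev inequality finishes. -/
theorem integral_face_pow_four_le {c : ℝ} (hc : 0 ≤ c) {w : E3 → ℝ}
    (hS : ∫ x, w x ^ 6 ∂C.vol ≤ c * C.h1sq w ^ 3)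
    (hw : ContDiffOn ℝ 1 w (closure C.Ω)) {r : ℝ} (hr : r ^ 2 = 1) :
    ∫ y in C.ω, w (liftPt y (r * C.b)) ^ 4 ≤ (4 + 1 / (2 * C.b)) * √c * C.h1sq w ^ 2 := by
  have hb := C.b_pos
  have h2c : ContDiffOn ℝ 1 (fun x : E3 => (r * x 2 + C.b) / (2 * C.b)) (closure C.Ω) :=
    (((contDiff_const.mul (contDiff_coord 2)).add contDiff_const).div_const _).contDiffOn
  have h := C.integral_pd_two ((hw.pow 4).mul h2c)
  have hw' := hw.continuousOn
  have hp2 := C.continuousOn_pd hw 2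
  have h1 : ∫ x, C.pd 2 (fun y => w y ^ 4 * ((r * y 2 + C.b) / (2 * C.b))) x ∂C.vol =
      r * ∫ y in C.ω, w (liftPt y (r * C.b)) ^ 4 := by
    rw [h, ← integral_const_mul]
    refine integral_congr_ae (Eventually.of_forall fun y => ?_)
    rcases sq_eq_one_iff.1 hr with rfl | rfl
    · simp only [liftPt_two, one_mul]
      field_simp
      ring
    · simp only [liftPt_two]
      field_simp
      ring
  have hpt : ∀ x ∈ C.Ω, |C.pd 2 (fun y => w y ^ 4 * ((r * y 2 + C.b) / (2 * C.b))) x| ≤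
      4 * |w x ^ 3 * C.pd 2 w x| + 1 / (2 * C.b) * |w x ^ 3 * w x| := fun x hx => by
    have hx' := subset_closure hx
    have hlin : C.pd 2 (fun y => (r * y 2 + C.b) / (2 * C.b)) x = r / (2 * C.b) := by
      rw [C.pd_eq hx]
      have hd : HasFDerivAt (fun y : E3 => (r * y 2 + C.b) / (2 * C.b))
          ((2 * C.b)⁻¹ • r • (EuclideanSpace.proj 2 : E3 →L[ℝ] ℝ)) x :=
        ((((EuclideanSpace.proj 2 : E3 →L[ℝ] ℝ).hasFDerivAt.const_mul r).add_const
          C.b).mul_const (2 * C.b)⁻¹)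
      rw [hd.fderiv]
      simp
      ring
    have hpow : C.pd 2 (fun y => w y ^ 4) x = 4 * w x ^ 3 * C.pd 2 w x := by
      have e : (fun y => w y ^ 4) = fun y => (w y * w y) * (w y * w y) := by ext y; ring
      rw [e, pd_mul (hw.mul hw) (hw.mul hw) hx', pd_mul hw hw hx']
      ring
    rw [pd_mul (hw.pow 4) h2c hx', hlin, hpow]
    have hr1 : |r| = 1 := by rw [← sq_eq_sq₀ (abs_nonneg _) zero_le_one, sq_abs, hr, one_pow]
    have hs : |(r * x 2 + C.b) / (2 * C.b)| ≤ 1 := by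
      rw [abs_div, abs_of_pos (by positivity : 0 < 2 * C.b), div_le_one (by positivity)]
      refine (abs_add_le _ _).trans ?_
      rw [abs_mul, hr1, one_mul, abs_of_pos hb]
      linarith [abs_le.2 ⟨hx.2.1.le, hx.2.2.le⟩]
    refine (abs_add_le _ _).trans (add_le_add ?_ ?_)
    · rw [abs_mul, mul_assoc (4 : ℝ), abs_mul (4 : ℝ), abs_of_pos (by norm_num : (0 : ℝ) < 4)]
      exact mul_le_of_le_one_right (by positivity) hs
    · rw [abs_mul, abs_div, hr1, abs_of_pos (by positivity : 0 < 2 * C.b)]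
      rw [show w x ^ 4 = w x ^ 3 * w x by ring, mul_comm]
  have hcont : ContinuousOn (C.pd 2 fun y => w y ^ 4 * ((r * y 2 + C.b) / (2 * C.b)))
      (closure C.Ω) := C.continuousOn_pd ((hw.pow 4).mul h2c) 2
  have hle : |∫ x, C.pd 2 (fun y => w y ^ 4 * ((r * y 2 + C.b) / (2 * C.b))) x ∂C.vol| ≤
      4 * ∫ x, |w x ^ 3 * C.pd 2 w x| ∂C.vol + 1 / (2 * C.b) * ∫ x, |w x ^ 3 * w x| ∂C.vol := by
    have i1 : Integrable (fun x => |w x ^ 3 * C.pd 2 w x|) C.vol :=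
      C.integrable_of_continuousOn ((hw'.pow 3).mul hp2).abs
    have i2 : Integrable (fun x => |w x ^ 3 * w x|) C.vol :=
      C.integrable_of_continuousOn ((hw'.pow 3).mul hw').abs
    rw [← integral_const_mul, ← integral_const_mul,
      ← integral_add (i1.const_mul _) (i2.const_mul _)]
    exact abs_integral_le_integral_abs.trans (C.integral_mono_Ω hcont.abs
      ((continuousOn_const.mul ((hw'.pow 3).mul hp2).abs).add
        (continuousOn_const.mul ((hw'.pow 3).mul hw').abs)) hpt)
  have hh := C.h1sq_nonneg w
  have hsix : √(∫ x, (w x ^ 3) ^ 2 ∂C.vol) ≤ √c * (C.h1sq w * √(C.h1sq w)) := by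
    rw [show (fun x => (w x ^ 3) ^ 2) = fun x => w x ^ 6 by ext x; ring]
    refine (Real.sqrt_le_sqrt hS).trans (le_of_eq ?_)
    rw [Real.sqrt_mul hc, show C.h1sq w ^ 3 = C.h1sq w ^ 2 * C.h1sq w by ring,
      Real.sqrt_mul (sq_nonneg _), Real.sqrt_sq hh]
  have hsq := Real.mul_self_sqrt hh
  have key : ∀ v : E3 → ℝ, ContinuousOn v (closure C.Ω) → ∫ x, v x ^ 2 ∂C.vol ≤ C.h1sq w →
      ∫ x, |w x ^ 3 * v x| ∂C.vol ≤ √c * C.h1sq w ^ 2 := fun v hv hvle => by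
    refine (integral_abs_mul_le (hw'.pow 3) hv).trans ((mul_le_mul hsix (Real.sqrt_le_sqrt hvle)
      (Real.sqrt_nonneg _) (by positivity)).trans (le_of_eq ?_))
    rw [mul_assoc, mul_assoc, hsq, sq]
  have k1 := key _ hp2 (integral_pd_sq_le_h1sq hw 2)
  have k2 := key _ hw' (integral_sq_le_h1sq hw)
  have hI : 0 ≤ ∫ y in C.ω, w (liftPt y (r * C.b)) ^ 4 := integral_nonneg fun y => by positivity
  have hr1 : |r| = 1 := by rw [← sq_eq_sq₀ (abs_nonneg _) zero_le_one, sq_abs, hr, one_pow]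
  rw [h1, abs_mul, hr1, one_mul, abs_of_nonneg hI] at hle
  have k3 := mul_le_mul_of_nonneg_left k2 (by positivity : 0 ≤ 1 / (2 * C.b))
  linarith

end Cylinder

/-! ### Time regularity, and the boundary conditions at a fixed time. -/

namespace Cylinder

/-- Scalar functions with the derivatives that the energy method uses. -/
structure TimeRegular (C : Cylinder) (T : ℝ) (w : ℝ → E3 → ℝ) : Prop where
  contDiffOn : ∀ t ∈ Ioo 0 T, ContDiffOn ℝ 2 (w t) (closure C.Ω)
  hasDerivAt : ∀ t ∈ Ioo 0 T, ∀ x ∈ closure C.Ω,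
    HasDerivAt (fun s => w s x) (deriv (fun s => w s x) t) t
  cont : ContinuousOn (fun z : ℝ × E3 => w z.1 z.2) (Ioo 0 T ×ˢ closure C.Ω)
  cont_pd : ∀ j, ContinuousOn (fun z : ℝ × E3 => C.pd j (w z.1) z.2) (Ioo 0 T ×ˢ closure C.Ω)
  cont_dt : ContinuousOn (fun z : ℝ × E3 => deriv (fun s => w s z.2) z.1)
    (Ioo 0 T ×ˢ closure C.Ω)

variable {C : Cylinder} {T : ℝ}

theorem IsC21.timeRegular {w : ℝ → E3 → ℝ} (hw : C.IsC21 T w) : C.TimeRegular T w where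
  contDiffOn := hw.contDiffOn
  hasDerivAt t ht x hx := (hw.differentiableAt x hx t ht).hasDerivAt
  cont := hw.cont
  cont_pd _ := hw.cont_dx.clm_apply continuousOn_const
  cont_dt := hw.cont_dt

theorem IsC21.timeRegular_comp {u : ℝ → E3 → E3} (hu : C.IsC21 T u) (i : Fin 3) :
    C.TimeRegular T fun t x => u t x i := by
  have hproj : Continuous fun y : E3 => y i := (EuclideanSpace.proj i : E3 →L[ℝ] ℝ).continuous
  have hd : ∀ t ∈ Ioo 0 T, ∀ x ∈ closure C.Ω,
      HasDerivAt (fun s => u s x i) (deriv (fun s => u s x) t i) t := fun t ht x hx =>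
    (EuclideanSpace.proj i : E3 →L[ℝ] ℝ).hasFDerivAt.comp_hasDerivAt t
      (hu.differentiableAt x hx t ht).hasDerivAt
  refine ⟨fun t ht => contDiffOn_comp (hu.contDiffOn t ht) i, fun t ht x hx => ?_,
    hproj.comp_continuousOn hu.cont, fun j => ?_, ?_⟩
  · rw [(hd t ht x hx).deriv]
    exact hd t ht x hx
  · refine (hproj.comp_continuousOn (hu.cont_dx.clm_apply
      (continuousOn_const (c := EuclideanSpace.single j 1)))).congr fun z hz => ?_
    exact fderivWithin_comp_apply ((hu.contDiffOn z.1 hz.1).of_le one_le_two) hz.2 i _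
  · exact (hproj.comp_continuousOn hu.cont_dt).congr fun z hz => (hd z.1 hz.1 z.2 hz.2).deriv

theorem TimeRegular.hasDerivAt_integral_sq {w : ℝ → E3 → ℝ} (hw : C.TimeRegular T w) {t : ℝ}
    (ht : t ∈ Ioo 0 T) :
    HasDerivAt (fun t => ∫ x, w t x ^ 2 ∂C.vol)
      (∫ x, 2 * (w t x * deriv (fun s => w s x) t) ∂C.vol) t := by
  refine Cylinder.hasDerivAt_integral (w := fun t x => w t x ^ 2)
    (w' := fun t x => 2 * (w t x * deriv (fun s => w s x) t)) (hw.cont.pow 2)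
    (continuousOn_const.mul (hw.cont.mul hw.cont_dt)) (fun t ht x hx => ?_) ht
  exact ((hw.hasDerivAt t ht x (subset_closure hx)).pow 2).congr_deriv (by simp; ring)

theorem TimeRegular.continuousOn_integral_mul_dt {w : ℝ → E3 → ℝ} (hw : C.TimeRegular T w) :
    ContinuousOn (fun t => ∫ x, 2 * (w t x * deriv (fun s => w s x) t) ∂C.vol) (Ioo 0 T) :=
  continuousOn_integral (w := fun t x => 2 * (w t x * deriv (fun s => w s x) t))
    (continuousOn_const.mul (hw.cont.mul hw.cont_dt))

theorem TimeRegular.continuousOn_integral_grad {w : ℝ → E3 → ℝ} (hw : C.TimeRegular T w) :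
    ContinuousOn (fun t => ∫ x, ∑ i, C.pd i (w t) x ^ 2 ∂C.vol) (Ioo 0 T) :=
  continuousOn_integral (continuousOn_finsetSum _ fun i _ => (hw.cont_pd i).pow 2)

theorem TimeRegular.continuousOn_h1sq {w : ℝ → E3 → ℝ} (hw : C.TimeRegular T w) :
    ContinuousOn (fun t => C.h1sq (w t)) (Ioo 0 T) :=
  continuousOn_integral ((hw.cont.pow 2).add
    (continuousOn_finsetSum _ fun i _ => (hw.cont_pd i).pow 2))

theorem TimeRegular.tendsto_initial {w : ℝ → E3 → ℝ} (hw : C.TimeRegular T w) (hT : 0 < T)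
    {w₀ : E3 → ℝ} (h : C.HasInitial w w₀) (h₀ : MemLp w₀ 2 C.vol) :
    Tendsto (fun t => ENNReal.ofReal (∫ x, w t x ^ 2 ∂C.vol)) (𝓝[>] 0)
      (𝓝 (eLpNorm w₀ 2 C.vol ^ 2)) := by
  have h1 := h.tendsto_eLpNorm hT (fun t ht => (hw.contDiffOn t ht).continuousOn) h₀
  refine ((ENNReal.continuous_pow 2).continuousAt.tendsto.comp h1).congr' ?_
  filter_upwards [Ioo_mem_nhdsGT hT] with t ht
  exact eLpNorm_two_sq (C.memLp_of_continuousOn (hw.contDiffOn t ht).continuousOn 2)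

section Slices

variable {ν κ : ℝ} {α : ℝ → ℝ} {f g : ℝ → E3 → E3} {v h : ℝ → E3 → E3}
  {p q θ ϑ : ℝ → E3 → ℝ} {v₀ h₀ : E3 → E3} {θ₀ ϑ₀ : E3 → ℝ} {t : ℝ}

theorem SolvesNSHeat.velocityField (hs : C.SolvesNSHeat T ν κ α f v p θ v₀ θ₀)
    (hv : C.IsC21 T v) (ht : t ∈ Ioo 0 T) : C.VelocityField (v t) where
  contDiffOn := hv.contDiffOn t ht
  div_free := hs.div_free t ht
  tangent x hx := by
    rw [← S₁_eq_face] at hx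
    exact fderiv_rho_zero_eq_zero_of_normal hx (hs.impermeable₁ t ht x hx)
  bottom x hx := by
    rw [← S₂_eq_face] at hx
    exact two_eq_zero_of_normal (hs.impermeable₂ t ht x hx)

theorem SolvesNSHeat.dilVec_tangent (hs : C.SolvesNSHeat T ν κ α f v p θ v₀ θ₀)
    (hv : C.IsC21 T v) (ht : t ∈ Ioo 0 T) (k : Fin 2) {x : E3} (hx : x ∈ closure C.Ω)
    (hk : C.rho k x = 0) : fderiv ℝ (C.rho k) x (C.dilVec (v t) x) = 0 := by
  refine tangent_of_face (contDiffOn_dilVec (hv.contDiffOn t ht)).continuousOn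
    (fun x hx => ?_) (fun x hx => ?_) k hx hk
  · rw [← S₁_eq_face] at hx
    exact fderiv_rho_zero_eq_zero_of_normal hx
      (inner_dilVec_eq_zero (hs.slip₁ t ht x hx) (hs.impermeable₁ t ht x hx))
  · rw [← S₂_eq_face] at hx
    exact two_eq_zero_of_normal
      (inner_dilVec_eq_zero (hs.slip₂ t ht x hx) (hs.impermeable₂ t ht x hx))

theorem SolvesNSHeat.fderiv_rho_grad (hs : C.SolvesNSHeat T ν κ α f v p θ v₀ θ₀)
    (ht : t ∈ Ioo 0 T) {x : E3} (hx : x ∈ C.face 0) :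
    fderiv ℝ (C.rho 0) x (C.grad (θ t) x) = 0 := by
  rw [← S₁_eq_face] at hx
  exact fderiv_rho_zero_eq_zero_of_normal hx (hs.neumann₁ t ht x hx)

theorem SolvesNSHeat.pd_two_temperature (hs : C.SolvesNSHeat T ν κ α f v p θ v₀ θ₀)
    (ht : t ∈ Ioo 0 T) {x : E3} (hx : x ∈ C.face 1) : C.pd 2 (θ t) x = 0 := by
  rw [← S₂_eq_face] at hx
  exact two_eq_zero_of_normal (hs.neumann₂ t ht x hx)

theorem SolvesH.velocityDeriv (hH : C.SolvesH T ν α f g v θ ϑ h q h₀) (hh : C.IsC21 T h)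
    (hv : C.VelocityField (v t)) (ht : t ∈ Ioo 0 T)
    (hhv : ∀ x ∈ closure C.Ω, ∀ i, h t x i = C.pd 2 (fun y => v t y i) x) :
    C.VelocityDeriv (h t) where
  contDiffOn := hh.contDiffOn t ht
  div_free := hH.div_free t ht
  tangent x hx := by
    rw [← S₁_eq_face] at hx
    exact fderiv_rho_zero_eq_zero_of_normal hx (hH.impermeable₁ t ht x hx)
  bottom₀ x hx := by
    rw [← S₂_eq_face] at hx
    exact (hH.dirichlet₂ t ht x hx).1
  bottom₁ x hx := by
    rw [← S₂_eq_face] at hx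
    exact (hH.dirichlet₂ t ht x hx).2
  bottom_pd x hx := by
    rw [← S₂_eq_face] at hx
    exact hH.neumann₂ t ht x hx
  -- Since h₃ = ∂₃v₃, its integral is the difference of v₃ between the top and the bottom, where v₃
  -- vanishes.
  mean := by
    rw [C.integral_congr_Ω fun x hx => hhv x (subset_closure hx) 2,
      C.integral_pd_two (contDiffOn_comp (hv.contDiffOn.of_le one_le_two) 2)]
    refine (setIntegral_congr_fun C.isOpen_ω.measurableSet (fun y hy => ?_)).trans
      (integral_zero _ _)
    simp only
    rw [hv.bottom _ (liftPt_mem_face_one hy (Or.inr rfl)),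
      hv.bottom _ (liftPt_mem_face_one hy (Or.inl rfl)), sub_zero]

theorem SolvesH.dilVec_tangent (hH : C.SolvesH T ν α f g v θ ϑ h q h₀) (hh : C.IsC21 T h)
    (ht : t ∈ Ioo 0 T) (k : Fin 2) {x : E3} (hx : x ∈ closure C.Ω)
    (hk : C.rho k x = 0) : fderiv ℝ (C.rho k) x (C.dilVec (h t) x) = 0 := by
  refine tangent_of_face (contDiffOn_dilVec (hh.contDiffOn t ht)).continuousOn
    (fun x hx => ?_) (fun x hx => ?_) k hx hk
  · rw [← S₁_eq_face] at hx
    exact fderiv_rho_zero_eq_zero_of_normal hx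
      (inner_dilVec_eq_zero (hH.slip₁ t ht x hx) (hH.impermeable₁ t ht x hx))
  -- With h₁ = h₂ = 0 on S₂, the third component of D(h)h reduces to 2 h_{3,x₃} h₃, which vanishes
  -- by the Neumann condition.
  · rw [← S₂_eq_face] at hx
    simp [dilVec_apply, Fin.sum_univ_three, hH.dirichlet₂ t ht x hx, dil, hH.neumann₂ t ht x hx]

end Slices

theorem pd_comp_real {F : ℝ → ℝ} {F' : ℝ} {w : E3 → ℝ} {x : E3} (hF : HasDerivAt F F' (w x))
    (hw : ContDiffOn ℝ 1 w (closure C.Ω)) (hx : x ∈ closure C.Ω) (i : Fin 3) :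
    C.pd i (fun y => F (w y)) x = F' * C.pd i w x := by
  have h := hF.comp_hasFDerivWithinAt x (differentiableWithinAt_of_contDiffOn hw hx).hasFDerivWithinAt
  rw [pd, show (fun y => F (w y)) = F ∘ w from rfl, h.fderivWithin (C.uniqueDiffOn_closure_Ω x hx)]
  rfl

end Cylinder

/-! ### The maximum principle for the temperature. -/

/-- A convex function that vanishes exactly on `(-∞, 0]`. -/
def softRamp (s : ℝ) : ℝ := ∫ r in (0 : ℝ)..s, expNegInvGlue r

theorem continuous_expNegInvGlue : Continuous expNegInvGlue := (expNegInvGlue.contDiff (n := 0)).continuous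

theorem hasDerivAt_softRamp (s : ℝ) : HasDerivAt softRamp (expNegInvGlue s) s :=
  intervalIntegral.integral_hasDerivAt_right (continuous_expNegInvGlue.intervalIntegrable _ _)
    (continuous_expNegInvGlue.stronglyMeasurableAtFilter _ _) continuous_expNegInvGlue.continuousAt

theorem contDiff_softRamp : ContDiff ℝ 1 softRamp := by
  rw [contDiff_one_iff_deriv]
  refine ⟨fun s => (hasDerivAt_softRamp s).differentiableAt, ?_⟩
  rw [funext fun s => (hasDerivAt_softRamp s).deriv]
  exact continuous_expNegInvGlue

theorem monotone_softRamp : Monotone softRamp :=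
  monotone_of_deriv_nonneg (fun s => (hasDerivAt_softRamp s).differentiableAt) fun s => by
    rw [(hasDerivAt_softRamp s).deriv]
    exact expNegInvGlue.nonneg s

theorem softRamp_of_nonpos {s : ℝ} (hs : s ≤ 0) : softRamp s = 0 := by
  rw [softRamp, intervalIntegral.integral_congr (g := fun _ => 0)]
  · simp
  · intro r hr
    rw [uIcc_of_ge hs] at hr
    exact expNegInvGlue.zero_of_nonpos hr.2

theorem softRamp_nonneg (s : ℝ) : 0 ≤ softRamp s := by
  rcases le_total s 0 with hs | hs
  · rw [softRamp_of_nonpos hs]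
  · rw [← softRamp_of_nonpos le_rfl]
    exact monotone_softRamp hs

theorem softRamp_le (s : ℝ) : softRamp s ≤ max s 0 := by
  rcases le_total s 0 with hs | hs
  · rw [softRamp_of_nonpos hs]
    exact le_max_right _ _
  · refine le_trans ?_ (le_max_left _ _)
    have h : softRamp s ≤ ∫ r in (0 : ℝ)..s, (1 : ℝ) :=
      intervalIntegral.integral_mono_on hs (continuous_expNegInvGlue.intervalIntegrable _ _)
        (continuous_const.intervalIntegrable _ _) fun r _ => by
          rw [expNegInvGlue]
          split_ifs with hr
          · exact zero_le_one
          · exact Real.exp_le_one_iff.2 (neg_nonpos.2 (inv_nonneg.2 (not_le.1 hr).le))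
    simpa using h

theorem softRamp_pos {s : ℝ} (hs : 0 < s) : 0 < softRamp s :=
  intervalIntegral.intervalIntegral_pos_of_pos_on (continuous_expNegInvGlue.intervalIntegrable _ _)
    (fun _ hr => expNegInvGlue.pos_of_pos hr.1) hs

namespace Cylinder

variable {C : Cylinder} {T : ℝ}

/-- The maximum principle for the heat equation with a solenoidal drift. -/
theorem TimeRegular.le_of_initial {κ : ℝ} (hκ : 0 ≤ κ) {v : ℝ → E3 → E3} {θ : ℝ → E3 → ℝ}
    {θ₀ : E3 → ℝ} (hθ : C.TimeRegular T θ)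
    (hv : ∀ t ∈ Ioo 0 T, C.VelocityField (v t))
    (heat : ∀ t ∈ Ioo 0 T, ∀ x ∈ C.Ω,
      deriv (fun s => θ s x) t + C.convect (v t) (θ t) x - κ * C.laplacian (θ t) x = 0)
    (hN₀ : ∀ t ∈ Ioo 0 T, ∀ x ∈ C.face 0, fderiv ℝ (C.rho 0) x (C.grad (θ t) x) = 0)
    (hN₁ : ∀ t ∈ Ioo 0 T, ∀ x ∈ C.face 1, C.pd 2 (θ t) x = 0)
    (hinit : C.HasInitial θ θ₀) (hθ₀ : MemLp θ₀ 2 C.vol) {σ M : ℝ} (hσ : |σ| ≤ 1)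
    (hM : ∀ᵐ x ∂C.vol, σ * θ₀ x ≤ M) {t : ℝ} (ht : t ∈ Ioo 0 T) {x : E3} (hx : x ∈ C.Ω) :
    σ * θ t x ≤ M := by
  have hc1 : ∀ t ∈ Ioo 0 T, ContDiffOn ℝ 1 (θ t) (closure C.Ω) := fun t ht =>
    (hθ.contDiffOn t ht).of_le one_le_two
  have hlin : ∀ t ∈ Ioo 0 T, ContDiffOn ℝ 1 (fun x => σ * θ t x - M) (closure C.Ω) := fun t ht =>
    (contDiffOn_const.mul (hc1 t ht)).sub contDiffOn_const
  have hpdlin : ∀ t ∈ Ioo 0 T, ∀ x ∈ closure C.Ω, ∀ i,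
      C.pd i (fun x => σ * θ t x - M) x = σ * C.pd i (θ t) x := fun t ht x hx i =>
    pd_comp_real (F := fun r => σ * r - M)
      (((hasDerivAt_id _).const_mul σ).sub_const M |>.congr_deriv (mul_one σ)) (hc1 t ht) hx i
  have hlinc : ContinuousOn (fun z : ℝ × E3 => σ * θ z.1 z.2 - M) (Ioo 0 T ×ˢ closure C.Ω) :=
    (continuousOn_const.mul hθ.cont).sub continuousOn_const
  have hgc := continuous_expNegInvGlue.comp_continuousOn hlinc
  -- This functional measures by how much σθ exceeds M. It is nonincreasing and tends to 0 at the
  -- initial time, hence vanishes.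
  set y : ℝ → ℝ := fun t => ∫ x, softRamp (σ * θ t x - M) ∂C.vol with hy
  have hderiv : ∀ t ∈ Ioo 0 T, HasDerivAt y (∫ x, expNegInvGlue (σ * θ t x - M) *
      (σ * deriv (fun s => θ s x) t) ∂C.vol) t := fun t ht => by
    refine Cylinder.hasDerivAt_integral (w := fun t x => softRamp (σ * θ t x - M))
      (w' := fun t x => expNegInvGlue (σ * θ t x - M) * (σ * deriv (fun s => θ s x) t)) (contDiff_softRamp.continuous.comp_continuousOn hlinc)
      (hgc.mul (continuousOn_const.mul hθ.cont_dt)) (fun t ht x hx => ?_) ht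
    exact (hasDerivAt_softRamp _).comp t
      (((hθ.hasDerivAt t ht x (subset_closure hx)).const_mul σ).sub_const M)
  have hnonpos : ∀ t ∈ Ioo 0 T, ∫ x, expNegInvGlue (σ * θ t x - M) *
      (σ * deriv (fun s => θ s x) t) ∂C.vol ≤ 0 := fun t ht => by
    -- This is the derivative of the soft ramp composed with σθ − M. Used as test function, it turns
    -- the drift into the transport of a single scalar function, whose integral vanishes, and
    -- diffusion has a sign because `expNegInvGlue` is monotone.
    set φ : E3 → ℝ := fun x => σ * expNegInvGlue (σ * θ t x - M) with hφ
    have hφc : ContDiffOn ℝ 1 φ (closure C.Ω) :=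
      contDiffOn_const.mul (expNegInvGlue.contDiff.comp_contDiffOn (hlin t ht))
    have h1 := integral_mul_laplacian (hθ.contDiffOn t ht) hφc
      (fun x hx => by rw [map_smul, hN₀ t ht x hx, smul_zero])
      (fun x hx => by rw [hN₁ t ht x hx, mul_zero])
    have hG : ContDiffOn ℝ 1 (fun x => softRamp (σ * θ t x - M)) (closure C.Ω) :=
      contDiff_softRamp.comp_contDiffOn (hlin t ht)
    have h2 := (hv t ht).integral_convect hG
    have hgrad : 0 ≤ ∫ x, ∑ i, C.pd i φ x * C.pd i (θ t) x ∂C.vol := by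
      refine integral_nonneg_of_ae (C.ae_mem_Ω.mono fun x hx => ?_)
      refine Finset.sum_nonneg fun i _ => ?_
      have hx' := subset_closure hx
      have hd : HasDerivAt (fun r => σ * expNegInvGlue r) (σ * deriv expNegInvGlue (σ * θ t x - M))
          (σ * θ t x - M) :=
        ((expNegInvGlue.contDiff (n := 1)).differentiable one_ne_zero _).hasDerivAt.const_mul σ
      rw [hφ, pd_comp_real (w := fun x => σ * θ t x - M) hd (hlin t ht) hx' i, hpdlin t ht x hx' i]
      have h3 : 0 ≤ deriv expNegInvGlue (σ * θ t x - M) := expNegInvGlue.monotone.deriv_nonneg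
      have e : σ * deriv expNegInvGlue (σ * θ t x - M) * (σ * C.pd i (θ t) x) * C.pd i (θ t) x =
          deriv expNegInvGlue (σ * θ t x - M) * (σ * C.pd i (θ t) x) ^ 2 := by ring
      rw [e]
      positivity
    have i1 : Integrable (fun x => φ x * C.laplacian (θ t) x) C.vol :=
      C.integrable_of_continuousOn (hφc.continuousOn.mul (continuousOn_finsetSum _ fun i _ =>
        C.continuousOn_pd (contDiffOn_pd (hθ.contDiffOn t ht) i) i))
    have i2 : Integrable (C.convect (v t) fun x => softRamp (σ * θ t x - M)) C.vol :=
      C.integrable_of_continuousOn (continuousOn_convect (hv t ht).contDiffOn.continuousOn hG)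
    rw [C.integral_congr_Ω (w := fun x => κ * (φ x * C.laplacian (θ t) x) -
      C.convect (v t) (fun x => softRamp (σ * θ t x - M)) x),
      integral_sub (i1.const_mul κ) i2, integral_const_mul, h1, h2]
    · nlinarith
    · intro x hx
      have hx' := subset_closure hx
      have h3 := heat t ht x hx
      have h4 : C.convect (v t) (fun x => softRamp (σ * θ t x - M)) x =
          φ x * C.convect (v t) (θ t) x := by
        simp only [convect, Finset.mul_sum]
        refine Finset.sum_congr rfl fun j _ => ?_
        rw [pd_comp_real (w := fun x => σ * θ t x - M) (hasDerivAt_softRamp _) (hlin t ht) hx' j,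
          hpdlin t ht x hx' j, hφ]
        ring
      simp only [h4]
      rw [show deriv (fun s => θ s x) t = κ * C.laplacian (θ t) x - C.convect (v t) (θ t) x by
        linarith, hφ]
      ring
  have hanti : AntitoneOn y (Ioo 0 T) :=
    antitoneOn_of_deriv_nonpos (convex_Ioo 0 T)
      (fun t ht => (hderiv t ht).continuousAt.continuousWithinAt)
      (fun t ht => by
        rw [interior_Ioo] at ht
        exact (hderiv t ht).differentiableAt.differentiableWithinAt)
      (fun t ht => by
        rw [interior_Ioo] at ht
        rw [(hderiv t ht).deriv]
        exact hnonpos t ht)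
  have hy0 : ∀ t, 0 ≤ y t := fun t => integral_nonneg fun x => softRamp_nonneg _
  -- Since σθ₀ ≤ M almost everywhere, the soft ramp of σθ − M is at most |θ − θ₀|. Cauchy–Schwarz
  -- then brings in the L₂ convergence to the initial value.
  have hbound : ∀ s ∈ Ioo 0 T, ENNReal.ofReal (y s ^ 2) ≤
      ENNReal.ofReal (C.vol.real univ) * eLpNorm (fun x => θ s x - θ₀ x) 2 C.vol ^ 2 :=
      fun s hs => by
    have hd : MemLp (fun x => θ s x - θ₀ x) 2 C.vol :=
      (C.memLp_of_continuousOn (hc1 s hs).continuousOn 2).sub hθ₀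
    have hda : MemLp (fun x => |θ s x - θ₀ x|) 2 C.vol := hd.abs
    rw [eLpNorm_two_sq hd, ← ENNReal.ofReal_mul measureReal_nonneg]
    refine ENNReal.ofReal_le_ofReal ?_
    have h1 : y s ≤ ∫ x, 1 * |θ s x - θ₀ x| ∂C.vol := by
      simp only [one_mul]
      refine integral_mono_ae (C.integrable_of_continuousOn
        (contDiff_softRamp.continuous.comp_continuousOn (hlin s hs).continuousOn))
        (hda.integrable (by norm_num)) (hM.mono fun x hx => ?_)
      refine (softRamp_le _).trans (max_le ?_ (abs_nonneg _))
      have h2 : σ * (θ s x - θ₀ x) ≤ |θ s x - θ₀ x| := by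
        refine (le_abs_self _).trans ?_
        rw [abs_mul]
        exact mul_le_of_le_one_left (abs_nonneg _) hσ
      linarith
    have h2 := integral_mul_sq_le (f := fun _ => (1 : ℝ)) (g := fun x => |θ s x - θ₀ x|)
      (μ := C.vol) (by simp) (by simpa only [sq_abs] using hd.integrable_sq)
      (by simpa only [one_mul] using hda.integrable (by norm_num))
    simp only [sq_abs, one_pow, integral_const, smul_eq_mul, mul_one] at h2
    exact (pow_le_pow_left₀ (hy0 s) h1 2).trans h2
  have hlim : Tendsto (fun s => ENNReal.ofReal (C.vol.real univ) *
      eLpNorm (fun x => θ s x - θ₀ x) 2 C.vol ^ 2) (𝓝[>] 0) (𝓝 0) := by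
    have h1 := ENNReal.Tendsto.const_mul (a := ENNReal.ofReal (C.vol.real univ))
      ((ENNReal.continuous_pow 2).continuousAt.tendsto.comp hinit) (Or.inr ENNReal.ofReal_ne_top)
    simpa using h1
  have hyt : y t = 0 := by
    have h1 : ENNReal.ofReal (y t ^ 2) ≤ 0 := by
      refine ge_of_tendsto hlim ?_
      filter_upwards [Ioo_mem_nhdsGT ht.1] with s hs
      have hs' : s ∈ Ioo 0 T := ⟨hs.1, hs.2.trans ht.2⟩
      exact (ENNReal.ofReal_le_ofReal (pow_le_pow_left₀ (hy0 t) (hanti hs' ht hs.2.le) 2)).trans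
        (hbound s hs')
    have h2 := ENNReal.ofReal_eq_zero.1 (le_antisymm h1 bot_le)
    exact pow_eq_zero_iff two_ne_zero |>.1 (le_antisymm h2 (sq_nonneg _))
  have hcont := contDiff_softRamp.continuous.comp_continuousOn (hlin t ht).continuousOn
  have hae := (integral_eq_zero_iff_of_nonneg (fun x => softRamp_nonneg _)
    (C.integrable_of_continuousOn hcont)).1 hyt
  have h0 := Measure.eqOn_open_of_ae_eq hae C.isOpen_Ω (hcont.mono subset_closure)
    continuousOn_const hx
  by_contra hlt
  exact (softRamp_pos (by linarith : 0 < σ * θ t x - M)).ne' h0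

end Cylinder

/-! ### Mixed norms and Hölder's inequality. -/

theorem abs_add_abs_deriv_le_aFun {α : ℝ → ℝ} (hα : ContDiff ℝ 1 α) {x y : ℝ} (hy : |y| ≤ x) :
    |α y| + |deriv α y| ≤ aFun α x := by
  -- A real supremum dominates the values only for a bounded set; boundedness comes from continuity
  -- on the compact interval [−x, x].
  refine le_csSup ?_ ⟨y, hy, rfl⟩
  have hset : {y : ℝ | |y| ≤ x} = Icc (-x) x := by
    ext y
    simp only [Set.mem_ofPred_eq, Set.mem_Icc, abs_le]
  rw [hset]
  exact (isCompact_Icc.image (hα.continuous.abs.add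
    (hα.continuous_deriv le_rfl).abs)).bddAbove

theorem mixedNorm_two_sq {X F : Type*} [MeasurableSpace X] [NormedAddCommGroup F] (p : ℝ≥0∞)
    (μ : Measure X) (t : ℝ) (u : ℝ → X → F) :
    mixedNorm 2 p μ t u ^ 2 = ∫⁻ s in Ioo 0 t, eLpNorm (u s) p μ ^ 2 := by
  rw [mixedNorm, eLpNorm_eq_lintegral_rpow_enorm_toReal (by norm_num) (by norm_num),
    ← ENNReal.rpow_natCast, ← ENNReal.rpow_mul]
  simp

theorem mixedNorm_mono {X F : Type*} [MeasurableSpace X] [NormedAddCommGroup F] (r p : ℝ≥0∞)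
    (μ : Measure X) {s t : ℝ} (hst : s ≤ t) (u : ℝ → X → F) :
    mixedNorm r p μ s u ≤ mixedNorm r p μ t u :=
  eLpNorm_mono_measure _ (Measure.restrict_mono (Ioo_subset_Ioo_right hst) le_rfl)

theorem aemeasurable_eLpNorm {X F : Type*} [MeasurableSpace X] [NormedAddCommGroup F] {p : ℝ≥0∞}
    (hp : p ≠ 0) (hp' : p ≠ ∞) {μ : Measure X} [SFinite μ] {τ : Measure ℝ} {u : ℝ → X → F}
    (hu : AEStronglyMeasurable (fun z : ℝ × X => u z.1 z.2) (τ.prod μ)) :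
    AEMeasurable (fun t => eLpNorm (u t) p μ) τ := by
  simp only [eLpNorm_eq_lintegral_rpow_enorm_toReal hp hp']
  exact ((hu.enorm.pow_const p.toReal).lintegral_prod_right').pow_const _

theorem ae_eLpNorm_lt_top {X F : Type*} [MeasurableSpace X] [NormedAddCommGroup F] {p : ℝ≥0∞}
    {μ : Measure X} {t : ℝ} {u : ℝ → X → F}
    (hm : AEMeasurable (fun t => eLpNorm (u t) p μ) (volume.restrict (Ioo 0 t)))
    (h : mixedNorm 2 p μ t u < ∞) :
    ∀ᵐ s ∂(volume.restrict (Ioo 0 t)), eLpNorm (u s) p μ < ∞ := by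
  have h2 : ∫⁻ s in Ioo 0 t, eLpNorm (u s) p μ ^ 2 ≠ ∞ := by
    rw [← mixedNorm_two_sq]
    exact (ENNReal.pow_lt_top h).ne
  filter_upwards [ae_lt_top' (hm.pow_const 2) h2] with s hs
  exact lt_of_not_ge fun hle => by simp [top_le_iff.1 hle] at hs

section Hoelder

variable {X F G H : Type*} [MeasurableSpace X] {μ : Measure X} [NormedAddCommGroup F]
  [NormedAddCommGroup G] [NormedAddCommGroup H]

theorem eLpNorm_norm_mul_norm_le {p q r : ℝ≥0∞} [ENNReal.HolderTriple p q r] {a : X → F} {b : X → G}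
    (ha : AEStronglyMeasurable a μ) (hb : AEStronglyMeasurable b μ) :
    eLpNorm (fun x => ‖a x‖ * ‖b x‖) r μ ≤ eLpNorm a p μ * eLpNorm b q μ := by
  have h := eLpNorm_smul_le_mul_eLpNorm (p := p) (q := q) (r := r) hb.norm ha.norm
  rwa [eLpNorm_norm, eLpNorm_norm] at h

theorem abs_integral_le_of_bilinear {p q : ℝ≥0∞} [ENNReal.HolderTriple p q 1] {W : X → ℝ}
    {a : X → F} {b : X → G} {c : ℝ} (hc : 0 ≤ c) (ha : MemLp a p μ) (hb : MemLp b q μ)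
    (h : ∀ᵐ x ∂μ, |W x| ≤ c * (‖a x‖ * ‖b x‖)) :
    |∫ x, W x ∂μ| ≤ c * ((eLpNorm a p μ).toReal * (eLpNorm b q μ).toReal) := by
  have h1 := eLpNorm_norm_mul_norm_le (r := 1) (p := p) (q := q) ha.1 hb.1
  have hfin : eLpNorm a p μ * eLpNorm b q μ < ∞ := ENNReal.mul_lt_top ha.2 hb.2
  have hint : Integrable (fun x => ‖a x‖ * ‖b x‖) μ :=
    memLp_one_iff_integrable.1 ⟨ha.1.norm.mul hb.1.norm, h1.trans_lt hfin⟩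
  have h2 : |∫ x, W x ∂μ| ≤ ∫ x, c * (‖a x‖ * ‖b x‖) ∂μ := by
    rw [← Real.norm_eq_abs]
    exact norm_integral_le_of_norm_le (hint.const_mul c) h
  rw [integral_const_mul] at h2
  refine h2.trans (mul_le_mul_of_nonneg_left ?_ hc)
  rw [← ENNReal.toReal_mul, ← ENNReal.ofReal_le_iff_le_toReal hfin.ne]
  refine le_trans (le_of_eq ?_) h1
  rw [eLpNorm_one_eq_lintegral_enorm,
    ofReal_integral_eq_lintegral_ofReal hint (Eventually.of_forall fun x => by positivity)]
  exact lintegral_congr fun x => (Real.enorm_of_nonneg (by positivity)).symm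

theorem abs_integral_le_of_trilinear {p q r s : ℝ≥0∞} [ENNReal.HolderTriple q r s]
    [ENNReal.HolderTriple p s 1] {W : X → ℝ} {a : X → F} {b : X → G} {d : X → H} {c : ℝ}
    (hc : 0 ≤ c) (ha : MemLp a p μ) (hb : MemLp b q μ) (hd : MemLp d r μ)
    (h : ∀ᵐ x ∂μ, |W x| ≤ c * (‖a x‖ * (‖b x‖ * ‖d x‖))) :
    |∫ x, W x ∂μ| ≤ c * ((eLpNorm a p μ).toReal *
      ((eLpNorm b q μ).toReal * (eLpNorm d r μ).toReal)) := by
  have h1 := eLpNorm_norm_mul_norm_le (r := s) (p := q) (q := r) hb.1 hd.1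
  have hfin : eLpNorm b q μ * eLpNorm d r μ < ∞ := ENNReal.mul_lt_top hb.2 hd.2
  have hbd : MemLp (fun x => ‖b x‖ * ‖d x‖) s μ := ⟨hb.1.norm.mul hd.1.norm, h1.trans_lt hfin⟩
  refine (abs_integral_le_of_bilinear hc ha hbd (h.mono fun x hx => ?_)).trans ?_
  · rwa [Real.norm_of_nonneg (by positivity : 0 ≤ ‖b x‖ * ‖d x‖)]
  · refine mul_le_mul_of_nonneg_left (mul_le_mul_of_nonneg_left ?_ ENNReal.toReal_nonneg) hc
    rw [← ENNReal.toReal_mul]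
    exact ENNReal.toReal_mono hfin.ne h1

theorem toReal_eLpNorm_le {n : ℕ} (hn : n ≠ 0) {u : X → F} (hu : MemLp u n μ) {K : ℝ} (hK : 0 ≤ K)
    (h : ∫ x, ‖u x‖ ^ n ∂μ ≤ K ^ n) : (eLpNorm u n μ).toReal ≤ K := by
  have hI : 0 ≤ ∫ x, ‖u x‖ ^ n ∂μ := integral_nonneg fun x => by positivity
  rw [hu.eLpNorm_eq_integral_rpow_norm (by simpa using hn) (by simp), ENNReal.toReal_ofReal
    (Real.rpow_nonneg (by simpa using hI) _)]
  simp only [ENNReal.toReal_natCast, Real.rpow_natCast]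
  calc _ ≤ (K ^ n) ^ ((n : ℝ)⁻¹) := Real.rpow_le_rpow hI h (by positivity)
    _ = K := Real.pow_rpow_inv_natCast hK hn

end Hoelder

instance holderTriple_six_fifths : ENNReal.HolderTriple (6 / 5) 6 1 where
  inv_add_inv_eq_inv := by
    rw [ENNReal.inv_div (by simp) (by simp), inv_one, ← one_div, ENNReal.div_add_div_same]
    norm_num
    exact ENNReal.div_self (by simp) (by simp)

instance holderTriple_three_six : ENNReal.HolderTriple 3 6 2 where
  inv_add_inv_eq_inv := by
    have h3 : (3 : ℝ≥0∞) = ENNReal.ofReal 3 := by simp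
    have h6 : (6 : ℝ≥0∞) = ENNReal.ofReal 6 := by simp
    have h2 : (2 : ℝ≥0∞) = ENNReal.ofReal 2 := by simp
    rw [h3, h6, h2, ← ENNReal.ofReal_inv_of_pos (by norm_num),
      ← ENNReal.ofReal_inv_of_pos (by norm_num), ← ENNReal.ofReal_inv_of_pos (by norm_num),
      ← ENNReal.ofReal_add (by norm_num) (by norm_num)]
    norm_num

instance holderTriple_four_thirds : ENNReal.HolderTriple (4 / 3) 4 1 where
  inv_add_inv_eq_inv := by
    rw [ENNReal.inv_div (by simp) (by simp), inv_one, ← one_div, ENNReal.div_add_div_same]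
    norm_num
    exact ENNReal.div_self (by simp) (by simp)

/-! ### The Sobolev inequality for vector fields and the energy estimate for the velocity. -/

namespace Cylinder

/-- The square of the norm of a vector field in `L₂(Ω)`. -/
def l2v (C : Cylinder) (u : E3 → E3) : ℝ := ∑ i, ∫ x, u x i ^ 2 ∂C.vol

variable {C : Cylinder} {T : ℝ}

theorem l2v_nonneg (u : E3 → E3) : 0 ≤ C.l2v u :=
  Finset.sum_nonneg fun _ _ => integral_nonneg fun _ => sq_nonneg _

theorem continuousOn_comp_coord {u : E3 → E3} {s : Set E3} (hu : ContinuousOn u s) (i : Fin 3) :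
    ContinuousOn (fun x => u x i) s :=
  (EuclideanSpace.proj i : E3 →L[ℝ] ℝ).continuous.comp_continuousOn hu

theorem ofReal_l2v {u : E3 → E3} (hu : ContinuousOn u (closure C.Ω)) :
    ENNReal.ofReal (C.l2v u) = eLpNorm u 2 C.vol ^ 2 := by
  have hm := C.memLp_of_continuousOn hu 2
  have hi : ∀ i : Fin 3, Integrable (fun x => u x i ^ 2) C.vol := fun i =>
    C.integrable_of_continuousOn ((continuousOn_comp_coord hu i).pow 2)
  rw [← eLpNorm_norm, eLpNorm_two_sq hm.norm, l2v, ← integral_finsetSum _ fun i _ => hi i]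
  congr 2
  ext x
  rw [EuclideanSpace.norm_sq_eq]
  simp

theorem HasInitial.tendsto_l2v {u : ℝ → E3 → E3} {u₀ : E3 → E3} (h : C.HasInitial u u₀)
    (hT : 0 < T) (hu : C.IsC21 T u) (h₀ : MemLp u₀ 2 C.vol) :
    Tendsto (fun t => ENNReal.ofReal (C.l2v (u t))) (𝓝[>] 0) (𝓝 (eLpNorm u₀ 2 C.vol ^ 2)) := by
  have h1 := h.tendsto_eLpNorm hT (fun t ht => (hu.contDiffOn t ht).continuousOn) h₀
  refine ((ENNReal.continuous_pow 2).continuousAt.tendsto.comp h1).congr' ?_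
  filter_upwards [Ioo_mem_nhdsGT hT] with t ht
  exact (ofReal_l2v (hu.contDiffOn t ht).continuousOn).symm

theorem IsC21.hasDerivAt_l2v {u : ℝ → E3 → E3} (hu : C.IsC21 T u) {t : ℝ} (ht : t ∈ Ioo 0 T) :
    HasDerivAt (fun t => C.l2v (u t))
      (∑ i, ∫ x, 2 * (u t x i * deriv (fun s => u s x i) t) ∂C.vol) t :=
  HasDerivAt.fun_sum fun i _ => (hu.timeRegular_comp i).hasDerivAt_integral_sq ht

theorem IsC21.continuousOn_deriv_l2v {u : ℝ → E3 → E3} (hu : C.IsC21 T u) :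
    ContinuousOn (fun t => ∑ i, ∫ x, 2 * (u t x i * deriv (fun s => u s x i) t) ∂C.vol)
      (Ioo 0 T) :=
  continuousOn_finsetSum _ fun i _ => (hu.timeRegular_comp i).continuousOn_integral_mul_dt

theorem IsC21.continuousOn_h1v {u : ℝ → E3 → E3} (hu : C.IsC21 T u) :
    ContinuousOn (fun t => C.h1v (u t)) (Ioo 0 T) :=
  continuousOn_finsetSum _ fun i _ => (hu.timeRegular_comp i).continuousOn_h1sq

theorem exists_sobolev_norm (C : Cylinder) : ∃ c : ℝ, 0 ≤ c ∧
    (∀ w : E3 → ℝ, ContDiffOn ℝ 1 w (closure C.Ω) →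
      (eLpNorm w 6 C.vol).toReal ≤ c * √(C.h1sq w)) ∧
    ∀ u : E3 → E3, ContDiffOn ℝ 1 u (closure C.Ω) →
      (eLpNorm u 6 C.vol).toReal ≤ c * √(C.h1v u) := by
  obtain ⟨c, hc, hS⟩ := C.exists_sobolev
  -- From K ≥ 1 follows 9c ≤ K ≤ K⁶. The 9 comes from (a + b + d)³ ≤ 9(a³ + b³ + d³), applied to the
  -- squared components.
  set K := max 1 (9 * c) with hK
  have hK1 : 1 ≤ K := le_max_left _ _
  have hK6 : 9 * c ≤ K ^ 6 := (le_max_right _ _).trans (le_self_pow₀ hK1 (by norm_num))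
  have hpow : ∀ y : ℝ, 0 ≤ y → (K * √y) ^ 6 = K ^ 6 * y ^ 3 := fun y hy => by
    rw [mul_pow, show (6 : ℕ) = 2 * 3 by norm_num, pow_mul (√y), Real.sq_sqrt hy]
  refine ⟨K, by linarith, fun w hw => ?_, fun u hu => ?_⟩
  · have hm := C.memLp_of_continuousOn hw.continuousOn ((6 : ℕ) : ℝ≥0∞)
    refine toReal_eLpNorm_le (n := 6) (by norm_num) hm (by positivity) ?_
    rw [hpow _ (C.h1sq_nonneg w)]
    have e : ∀ x, ‖w x‖ ^ 6 = w x ^ 6 := fun x => by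
      rw [Real.norm_eq_abs, Even.pow_abs (by decide)]
    simp only [e]
    exact (hS w hw).trans (mul_le_mul_of_nonneg_right (by linarith)
      (pow_nonneg (C.h1sq_nonneg w) 3))
  · have hm := C.memLp_of_continuousOn hu.continuousOn ((6 : ℕ) : ℝ≥0∞)
    refine toReal_eLpNorm_le (n := 6) (by norm_num) hm (by positivity) ?_
    rw [hpow _ (C.h1v_nonneg u)]
    have hi := fun i => contDiffOn_comp hu i
    have h1 : ∫ x, ‖u x‖ ^ 6 ∂C.vol ≤ ∫ x, 9 * ∑ i, u x i ^ 6 ∂C.vol := by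
      refine C.integral_mono_Ω (hu.continuousOn.norm.pow 6)
        (continuousOn_const.mul (continuousOn_finsetSum _ fun i _ => (hi i).continuousOn.pow 6))
        fun x _ => ?_
      have e : ‖u x‖ ^ 6 = (u x 0 ^ 2 + u x 1 ^ 2 + u x 2 ^ 2) ^ 3 := by
        rw [show (6 : ℕ) = 2 * 3 by norm_num, pow_mul, EuclideanSpace.norm_sq_eq]
        simp [Fin.sum_univ_three]
      rw [e, Fin.sum_univ_three]
      have hq : ∀ a b d : ℝ, 0 ≤ a → 0 ≤ b → 0 ≤ d →
          (a + b + d) ^ 3 ≤ 9 * (a ^ 3 + b ^ 3 + d ^ 3) := fun a b d ha hb hd => by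
        nlinarith [mul_nonneg (add_nonneg ha hb) (sq_nonneg (a - b)),
          mul_nonneg (add_nonneg ha hd) (sq_nonneg (a - d)),
          mul_nonneg (add_nonneg hb hd) (sq_nonneg (b - d)),
          mul_nonneg hd (sq_nonneg (a - b)), mul_nonneg hb (sq_nonneg (a - d)),
          mul_nonneg ha (sq_nonneg (b - d))]
      refine (hq _ _ _ (sq_nonneg _) (sq_nonneg _) (sq_nonneg _)).trans (le_of_eq ?_)
      ring
    have h2 : ∫ x, 9 * ∑ i, u x i ^ 6 ∂C.vol ≤ 9 * (c * C.h1v u ^ 3) := by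
      have hint : ∀ i : Fin 3, Integrable (fun x => u x i ^ 6) C.vol := fun i =>
        C.integrable_of_continuousOn ((hi i).continuousOn.pow 6)
      rw [integral_const_mul, integral_finsetSum _ fun i _ => hint i]
      refine mul_le_mul_of_nonneg_left ?_ (by norm_num)
      refine (Finset.sum_le_sum fun i _ => hS _ (hi i)).trans ?_
      rw [← Finset.mul_sum]
      refine mul_le_mul_of_nonneg_left ?_ hc
      rw [h1v, Fin.sum_univ_three, Fin.sum_univ_three]
      have p0 := C.h1sq_nonneg fun x => u x 0
      have p1 := C.h1sq_nonneg fun x => u x 1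
      have p2 := C.h1sq_nonneg fun x => u x 2
      generalize C.h1sq (fun x => u x 0) = a at *
      generalize C.h1sq (fun x => u x 1) = b at *
      generalize C.h1sq (fun x => u x 2) = d at *
      have : 0 ≤ 3 * (a + b) * (b + d) * (a + d) := by positivity
      nlinarith
    have h3 := pow_nonneg (C.h1v_nonneg u) 3
    nlinarith

theorem ae_slice {P : ℝ → E3 → Prop} (h : ∀ᵐ z ∂(C.volT T), P z.1 z.2) :
    ∀ᵐ t ∂(volume.restrict (Ioo 0 T)), ∀ᵐ x ∂C.vol, P t x :=
  Measure.ae_ae_of_ae_prod h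

/-- The energy identity shared by `v` and `h`: `L` holds the convective terms. No equation of motion
is used; `R` is the tested left-hand side, and the momentum equation enters only when `R` is
estimated. -/
theorem integral_sum_mul_dt {u : ℝ → E3 → E3} (hu : C.IsC21 T u) {t : ℝ} (ht : t ∈ Ioo 0 T)
    {L : Fin 3 → E3 → ℝ} {ν : ℝ} {p : E3 → ℝ} (hp : ContDiffOn ℝ 1 p (closure C.Ω))
    (hL : ∀ i, ContinuousOn (L i) (closure C.Ω)) (hdiv : ∀ x ∈ C.Ω, C.divergence (u t) x = 0)
    (hslip : ∀ k, ∀ x ∈ closure C.Ω, C.rho k x = 0 →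
      fderiv ℝ (C.rho k) x (C.dilVec (u t) x) = 0) {R : ℝ}
    (hR : ∫ x, ∑ i, u t x i * (deriv (fun s => u s x i) t + L i x -
      C.divStress ν (u t) p x i) ∂C.vol = R) :
    ∑ i, ∫ x, 2 * (u t x i * deriv (fun s => u s x i) t) ∂C.vol + ν * C.dilSq (u t) =
      2 * R - 2 * ∫ x, ∑ i, u t x i * L i x ∂C.vol
        - 2 * ∫ x, C.divergence (fun y => p y • u t y) x ∂C.vol := by
  have hc2 := hu.contDiffOn t ht
  have hui := fun i => (contDiffOn_comp hc2 i).continuousOn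
  have hdt : ∀ i, ContinuousOn (fun x => deriv (fun s => u s x i) t) (closure C.Ω) := fun i =>
    continuousOn_slice (w := fun t x => deriv (fun s => u s x i) t) (hu.timeRegular_comp i).cont_dt ht
  have hst := integral_stress (ν := ν) hc2 hp hdiv hslip
  have i1 : Integrable (fun x => ∑ i, u t x i * deriv (fun s => u s x i) t) C.vol :=
    C.integrable_of_continuousOn (continuousOn_finsetSum _ fun i _ => (hui i).mul (hdt i))
  have i2 : Integrable (fun x => ∑ i, u t x i * L i x) C.vol :=
    C.integrable_of_continuousOn (continuousOn_finsetSum _ fun i _ => (hui i).mul (hL i))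
  have i3 : Integrable (fun x => ∑ i, u t x i * C.divStress ν (u t) p x i) C.vol :=
    C.integrable_of_continuousOn (continuousOn_finsetSum _ fun i _ =>
      (hui i).mul (continuousOn_divStress hc2 hp i))
  have i4 : Integrable (fun x => ∑ i, u t x i * deriv (fun s => u s x i) t
      + ∑ i, u t x i * L i x) C.vol := i1.add i2
  have e : ∀ x, ∑ i, u t x i * (deriv (fun s => u s x i) t + L i x -
      C.divStress ν (u t) p x i) = (∑ i, u t x i * deriv (fun s => u s x i) t
      + ∑ i, u t x i * L i x) - ∑ i, u t x i * C.divStress ν (u t) p x i := fun x => by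
    simp only [← Finset.sum_add_distrib, ← Finset.sum_sub_distrib]
    exact Finset.sum_congr rfl fun i _ => by ring
  simp only [e] at hR
  rw [integral_sub i4 i3, integral_add i1 i2, hst] at hR
  have e2 : ∑ i, ∫ x, 2 * (u t x i * deriv (fun s => u s x i) t) ∂C.vol =
      2 * ∫ x, ∑ i, u t x i * deriv (fun s => u s x i) t ∂C.vol := by
    have hint : ∀ i, Integrable (fun x => u t x i * deriv (fun s => u s x i) t) C.vol := fun i =>
      C.integrable_of_continuousOn ((hui i).mul (hdt i))
    rw [integral_finsetSum _ fun i _ => hint i, Finset.mul_sum]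
    simp only [integral_const_mul]
  rw [e2]
  linarith

/-- A bound for the temperature by the maximum principle. -/
theorem SolvesNSHeat.abs_temperature_le {ν κ : ℝ} (hκ : 0 ≤ κ) {α : ℝ → ℝ} {f v : ℝ → E3 → E3}
    {p θ : ℝ → E3 → ℝ} {v₀ : E3 → E3} {θ₀ : E3 → ℝ} (hs : C.SolvesNSHeat T ν κ α f v p θ v₀ θ₀)
    (hv : C.IsC21 T v) (hθ : C.IsC21 T θ) (hθ₀ : MemLp θ₀ ∞ C.vol) {t : ℝ}
    (ht : t ∈ Ioo 0 T) {x : E3} (hx : x ∈ C.Ω) : |θ t x| ≤ (eLpNorm θ₀ ∞ C.vol).toReal := by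
  have hb : ∀ᵐ x ∂C.vol, |θ₀ x| ≤ (eLpNorm θ₀ ∞ C.vol).toReal := by
    filter_upwards [ae_le_eLpNormEssSup (f := θ₀) (μ := C.vol)] with x hx
    rw [← eLpNorm_exponent_top] at hx
    have h1 := ENNReal.toReal_mono hθ₀.2.ne hx
    rwa [toReal_enorm, Real.norm_eq_abs] at h1
  have key : ∀ σ : ℝ, |σ| ≤ 1 → σ * θ t x ≤ (eLpNorm θ₀ ∞ C.vol).toReal := fun σ hσ =>
    hθ.timeRegular.le_of_initial hκ (fun t ht => hs.velocityField hv ht) hs.heat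
      (fun t ht x hx => hs.fderiv_rho_grad ht hx) (fun t ht x hx => hs.pd_two_temperature ht hx)
      hs.initial_θ (hθ₀.mono_exponent le_top) hσ
      (hb.mono fun x hx => (le_abs_self _).trans (by
        rw [abs_mul]
        exact (mul_le_of_le_one_left (abs_nonneg _) hσ).trans hx)) ht hx
  have h1 := key 1 (by simp)
  have h2 := key (-1) (by simp)
  exact abs_le.2 ⟨by linarith, by linarith⟩

/-- Tested with `v`, convection and pressure contribute nothing. Korn's inequality makes viscosity
coercive in H¹, which is where the lack of axial symmetry enters, and the work of the force is
bounded by pairing L_{6/5} with L₆. -/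
theorem exists_energy_velocity (hC : ¬ C.AxiallySymmetric) {ν : ℝ} (hν : 0 < ν) :
    ∃ c : ℝ, 0 ≤ c ∧ ∀ (T : ℝ) (_ : 0 < T) (κ : ℝ) (α : ℝ → ℝ) (f v : ℝ → E3 → E3)
      (p θ : ℝ → E3 → ℝ) (v₀ : E3 → E3) (θ₀ : E3 → ℝ) (c₁ : ℝ), 0 ≤ c₁ →
      AEStronglyMeasurable (fun z : ℝ × E3 => f z.1 z.2) (C.volT T) →
      mixedNorm 2 (6 / 5) C.vol T f < ∞ → MemLp v₀ 2 C.vol → C.IsC21 T v → C.IsC10 T p →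
      C.SolvesNSHeat T ν κ α f v p θ v₀ θ₀ →
      (∀ t ∈ Ioo 0 T, ∀ x ∈ C.Ω, |α (θ t x)| ≤ c₁) →
      ∫⁻ t in Ioo 0 T, ENNReal.ofReal (C.h1v (v t)) ≤ ENNReal.ofReal c *
        (eLpNorm v₀ 2 C.vol ^ 2 + ENNReal.ofReal c₁ ^ 2 * mixedNorm 2 (6 / 5) C.vol T f ^ 2) := by
  obtain ⟨k, hk, hK⟩ := C.exists_korn_velocity hC
  obtain ⟨cS, hcS, -, hS⟩ := C.exists_sobolev_norm
  -- The denominator k + 1, rather than the Korn constant k, is positive even if k = 0.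
  set δ := ν / (k + 1) with hδ
  have hδ0 : 0 < δ := by positivity
  refine ⟨2 / δ * (1 + 2 * cS ^ 2 / δ), by positivity, ?_⟩
  intro T hT κ α f v p θ v₀ θ₀ c₁ hc₁ hfm hf hv₀ hv hp hs hα
  have hfm' := aemeasurable_eLpNorm (p := 6 / 5) (by simp) (by finiteness) hfm
  have hmain : ∀ᵐ t ∂(volume.restrict (Ioo 0 T)),
      ENNReal.ofReal (∑ i, ∫ x, 2 * (v t x i * deriv (fun s => v s x i) t) ∂C.vol
        + δ / 2 * C.h1v (v t)) ≤ 0 * ENNReal.ofReal (C.l2v (v t)) +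
        ENNReal.ofReal (2 * cS ^ 2 / δ * c₁ ^ 2) * eLpNorm (f t) (6 / 5) C.vol ^ 2 := by
    have hslice := ae_slice (P := fun t x => ∀ i, deriv (fun s => v s x i) t +
      C.convect (v t) (fun y => v t y i) x - C.divStress ν (v t) (p t) x i =
        α (θ t x) * f t x i) hs.momentum
    filter_upwards [hslice, ae_restrict_mem measurableSet_Ioo, ae_eLpNorm_lt_top hfm' hf,
      hfm.prodMk_left] with t hmom ht hft hfmt
    have hvf := hs.velocityField hv ht
    have hv1 := hvf.contDiffOn.of_le one_le_two
    have hvi := fun i => contDiffOn_comp hv1 i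
    have hid := integral_sum_mul_dt hv ht (hp.contDiffOn t ht) (ν := ν)
      (L := fun i => C.convect (v t) fun y => v t y i)
      (fun i => continuousOn_convect hv1.continuousOn (hvi i)) hvf.div_free
      (fun k x hx hk => hs.dilVec_tangent hv ht k hx hk) rfl
    have hconv : ∫ x, ∑ i, v t x i * C.convect (v t) (fun y => v t y i) x ∂C.vol = 0 := by
      have hint : ∀ i, Integrable (fun x => v t x i * C.convect (v t) (fun y => v t y i) x) C.vol :=
        fun i => C.integrable_of_continuousOn
          ((hvi i).continuousOn.mul (continuousOn_convect hv1.continuousOn (hvi i)))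
      rw [integral_finsetSum _ fun i _ => hint i]
      exact Finset.sum_eq_zero fun i _ => hvf.integral_mul_convect (hvi i)
    rw [hconv, hvf.integral_pressure (hp.contDiffOn t ht)] at hid
    have hW := abs_integral_le_of_bilinear (p := 6 / 5) (q := 6) (μ := C.vol)
      (W := fun x => ∑ i, v t x i * (deriv (fun s => v s x i) t +
        C.convect (v t) (fun y => v t y i) x - C.divStress ν (v t) (p t) x i))
      (a := f t) (b := v t) hc₁ ⟨hfmt, hft⟩ (C.memLp_of_continuousOn hv1.continuousOn 6) (by
        filter_upwards [hmom, C.ae_mem_Ω] with x hx hxΩ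
        have e : ∑ i, v t x i * (deriv (fun s => v s x i) t +
            C.convect (v t) (fun y => v t y i) x - C.divStress ν (v t) (p t) x i) =
            α (θ t x) * inner ℝ (f t x) (v t x) := by
          rw [PiLp.inner_apply, Finset.mul_sum]
          refine Finset.sum_congr rfl fun i _ => ?_
          rw [hx i]
          simp
          ring
        rw [e, abs_mul]
        exact mul_le_mul (hα t ht x hxΩ) (abs_real_inner_le_norm _ _) (abs_nonneg _) hc₁)
    have hSv := hS (v t) hv1
    have hKv := hK (v t) hvf
    set N := (eLpNorm (f t) (6 / 5) C.vol).toReal with hN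
    have hN0 : 0 ≤ N := ENNReal.toReal_nonneg
    have hh := C.h1v_nonneg (v t)
    have hd := C.dilSq_nonneg (v t)
    have h2 : δ * C.h1v (v t) ≤ ν * C.dilSq (v t) := by
      rw [hδ, div_mul_eq_mul_div, div_le_iff₀ (by positivity)]
      nlinarith [mul_le_mul_of_nonneg_left hKv hν.le, mul_nonneg hν.le hd]
    have h3 := (le_abs_self _).trans (hW.trans (mul_le_mul_of_nonneg_left
      (mul_le_mul_of_nonneg_left hSv hN0) hc₁))
    have hsq := Real.sq_sqrt hh
    have h4 : 2 * (c₁ * (N * (cS * √(C.h1v (v t))))) ≤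
        δ / 2 * C.h1v (v t) + 2 * cS ^ 2 / δ * c₁ ^ 2 * N ^ 2 := by
      have h5 : 2 * cS ^ 2 / δ * c₁ ^ 2 * N ^ 2 = 2 / δ * (c₁ * N * cS) ^ 2 := by ring
      rw [h5, ← sub_nonneg]
      have h6 : δ / 2 * C.h1v (v t) + 2 / δ * (c₁ * N * cS) ^ 2 -
          2 * (c₁ * (N * (cS * √(C.h1v (v t))))) =
          2 / δ * (δ / 2 * √(C.h1v (v t)) - c₁ * N * cS) ^ 2 := by
        nth_rewrite 1 [← hsq]
        field_simp
        ring
      rw [h6]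
      positivity
    rw [zero_mul, zero_add, ← ENNReal.ofReal_toReal hft.ne, ← hN, ← ENNReal.ofReal_pow hN0,
      ← ENNReal.ofReal_mul (by positivity)]
    refine ENNReal.ofReal_le_ofReal ?_
    linarith
  have hg := (gronwall_lintegral (A := fun _ => 0) (fun t ht => hv.hasDerivAt_l2v ht)
    hv.continuousOn_deriv_l2v (continuousOn_const.mul hv.continuousOn_h1v)
    (fun t _ => l2v_nonneg _) (fun t _ => mul_nonneg (by positivity) (C.h1v_nonneg _))
    aemeasurable_const ((hfm'.pow_const 2).const_mul _) (by simp)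
    (hs.initial_v.tendsto_l2v hT hv hv₀) hmain (right_mem_Ioc.2 hT)).2
  simp only [lintegral_zero, ENNReal.toReal_zero, Real.exp_zero, ENNReal.ofReal_one, one_mul] at hg
  rw [lintegral_const_mul' _ _ ENNReal.ofReal_ne_top, ← mixedNorm_two_sq] at hg
  have e1 : ∀ t, ENNReal.ofReal (C.h1v (v t)) =
      ENNReal.ofReal (2 / δ) * ENNReal.ofReal (δ / 2 * C.h1v (v t)) := fun t => by
    rw [← ENNReal.ofReal_mul (by positivity)]
    congr 1
    field_simp
  simp only [e1]
  rw [lintegral_const_mul' _ _ ENNReal.ofReal_ne_top, ENNReal.ofReal_mul (by positivity), mul_assoc]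
  refine mul_le_mul_right ?_ _
  refine hg.trans ?_
  rw [ENNReal.ofReal_mul (by positivity), ENNReal.ofReal_pow hc₁, mul_add, mul_assoc]
  refine add_le_add (le_mul_of_one_le_left' ?_) (mul_le_mul_left ?_ _)
  · rw [ENNReal.one_le_ofReal]
    have : 0 ≤ 2 * cS ^ 2 / δ := by positivity
    linarith
  · exact ENNReal.ofReal_le_ofReal (by linarith)

end Cylinder

/-! ### Traces and the pressure on the bottom and the top. -/

theorem measurableEmbedding_liftPt (s : ℝ) : MeasurableEmbedding fun y : E2 => liftPt y s := by
  refine Continuous.measurableEmbedding (continuous_liftPt.comp (Continuous.prodMk_left s)) ?_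
  intro y z h
  have h2 := congrArg horiz h
  simpa only [horiz_liftPt] using h2

namespace Cylinder

variable {C : Cylinder} {T : ℝ}

theorem ae_surf₂ {P : E3 → Prop}
    (h : ∀ᵐ y ∂(volume.restrict C.ω), ∀ s, (s = -C.b ∨ s = C.b) → P (liftPt y s)) :
    ∀ᵐ x ∂C.surf₂, P x := by
  rw [surf₂, ae_add_measure_iff, (measurableEmbedding_liftPt _).ae_map_iff,
    (measurableEmbedding_liftPt _).ae_map_iff]
  exact ⟨h.mono fun y hy => hy _ (Or.inl rfl), h.mono fun y hy => hy _ (Or.inr rfl)⟩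

theorem ae_mem_closure_surf₂ : ∀ᵐ x ∂C.surf₂, x ∈ closure C.Ω :=
  ae_surf₂ ((ae_restrict_mem C.isOpen_ω.measurableSet).mono fun _ hy _ hs =>
    C.face_subset 1 (liftPt_mem_face_one hy hs))

theorem volume_ω_lt_top (C : Cylinder) : volume C.ω < ∞ := C.bounded.measure_lt_top

instance : IsFiniteMeasure (volume.restrict C.ω) := ⟨by
  rw [Measure.restrict_apply_univ]
  exact C.volume_ω_lt_top⟩

instance : IsFiniteMeasure C.surf₂ := by
  unfold surf₂
  infer_instance

theorem restrict_surf₂ : C.surf₂.restrict (closure C.Ω) = C.surf₂ :=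
  Measure.restrict_eq_self_of_ae_mem ae_mem_closure_surf₂

theorem aestronglyMeasurable_surf₂ {F : Type*} [NormedAddCommGroup F] {w : E3 → F}
    (hw : ContinuousOn w (closure C.Ω)) : AEStronglyMeasurable w C.surf₂ := by
  rw [← restrict_surf₂]
  exact hw.aestronglyMeasurable_of_isCompact C.isCompact_closure_Ω isClosed_closure.measurableSet

theorem memLp_surf₂ {F : Type*} [NormedAddCommGroup F] {w : E3 → F}
    (hw : ContinuousOn w (closure C.Ω)) (p : ℝ≥0∞) : MemLp w p C.surf₂ := by
  obtain ⟨B, -, hB⟩ := C.exists_bound_of_continuousOn hw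
  exact MemLp.of_bound (aestronglyMeasurable_surf₂ hw) B (ae_mem_closure_surf₂.mono fun x hx => hB x hx)

theorem integral_surf₂ {w : E3 → ℝ} (hw : ContinuousOn w (closure C.Ω)) :
    ∫ x, w x ∂C.surf₂ = (∫ y in C.ω, w (liftPt y (-C.b))) + ∫ y in C.ω, w (liftPt y C.b) := by
  have h : Integrable w C.surf₂ := memLp_one_iff_integrable.1 (memLp_surf₂ hw 1)
  rw [surf₂, integrable_add_measure] at h
  rw [surf₂, integral_add_measure h.1 h.2, (measurableEmbedding_liftPt _).integral_map,
    (measurableEmbedding_liftPt _).integral_map]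

theorem aestronglyMeasurable_prod_of_continuousOn {F : Type*} [NormedAddCommGroup F]
    [SecondCountableTopology F] {μ : Measure E3} [SFinite μ]
    (hμ : ∀ᵐ x ∂μ, x ∈ closure C.Ω) {w : ℝ → E3 → F}
    (hw : ContinuousOn (fun z : ℝ × E3 => w z.1 z.2) (Ioo 0 T ×ˢ closure C.Ω)) :
    AEStronglyMeasurable (fun z : ℝ × E3 => w z.1 z.2) ((volume.restrict (Ioo 0 T)).prod μ) := by
  have e : (volume.restrict (Ioo 0 T)).prod μ =
      ((volume : Measure ℝ).prod μ).restrict (Ioo 0 T ×ˢ closure C.Ω) := by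
    rw [← Measure.prod_restrict, Measure.restrict_eq_self_of_ae_mem hμ]
  rw [e]
  exact hw.aestronglyMeasurable (measurableSet_Ioo.prod isClosed_closure.measurableSet)

/-- The trace estimate for the product of a function with a function of class `H¹`. -/
theorem exists_trace_bound (C : Cylinder) : ∃ c : ℝ, 0 ≤ c ∧ ∀ q w : E3 → ℝ,
    ContinuousOn q (closure C.Ω) → ContDiffOn ℝ 1 w (closure C.Ω) →
    |∫ y in C.ω, (q (liftPt y C.b) * w (liftPt y C.b) - q (liftPt y (-C.b)) * w (liftPt y (-C.b)))|
      ≤ (eLpNorm q (4 / 3) C.surf₂).toReal * (c * √(C.h1sq w)) := by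
  obtain ⟨c, hc, hS⟩ := C.exists_sobolev
  have hb := C.b_pos
  set K := max 1 (2 * ((4 + 1 / (2 * C.b)) * √c)) with hK
  have hK1 : 1 ≤ K := le_max_left _ _
  have hK4 : 2 * ((4 + 1 / (2 * C.b)) * √c) ≤ K ^ 4 :=
    (le_max_right _ _).trans (le_self_pow₀ hK1 (by norm_num))
  refine ⟨K, by linarith, fun q w hq hw => ?_⟩
  have hw' := hw.continuousOn
  have hfour : (eLpNorm w 4 C.surf₂).toReal ≤ K * √(C.h1sq w) := by
    refine toReal_eLpNorm_le (n := 4) (by norm_num) (memLp_surf₂ hw' _) (by positivity) ?_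
    have e : ∀ x, ‖w x‖ ^ 4 = w x ^ 4 := fun x => by
      rw [Real.norm_eq_abs, Even.pow_abs (by decide)]
    simp only [e]
    rw [integral_surf₂ (w := fun x => w x ^ 4) (hw'.pow 4)]
    have h1 := integral_face_pow_four_le hc (hS w hw) hw (r := 1) (by norm_num)
    have h2 := integral_face_pow_four_le hc (hS w hw) hw (r := -1) (by norm_num)
    rw [one_mul] at h1
    rw [neg_one_mul] at h2
    have h3 : (K * √(C.h1sq w)) ^ 4 = K ^ 4 * C.h1sq w ^ 2 := by
      rw [mul_pow, show (4 : ℕ) = 2 * 2 by norm_num, pow_mul (√(C.h1sq w)),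
        Real.sq_sqrt (C.h1sq_nonneg w)]
    rw [h3]
    have h4 := mul_le_mul_of_nonneg_right hK4 (sq_nonneg (C.h1sq w))
    linarith
  have hlin : ContinuousOn (fun x : E3 => x 2 / C.b) (closure C.Ω) :=
    ((contDiff_coord (n := 0) 2).continuous.div_const _).continuousOn
  -- The factor x₃/b is −1 on the bottom and 1 on the top, so it carries the sign of the normal.
  have e : ∫ y in C.ω, (q (liftPt y C.b) * w (liftPt y C.b) -
      q (liftPt y (-C.b)) * w (liftPt y (-C.b))) =
      ∫ x, q x * w x * (x 2 / C.b) ∂C.surf₂ := by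
    have hW : ContinuousOn (fun x => q x * w x * (x 2 / C.b)) (closure C.Ω) := (hq.mul hw').mul hlin
    have hi : Integrable (fun x => q x * w x) C.surf₂ :=
      memLp_one_iff_integrable.1 (memLp_surf₂ (hq.mul hw') 1)
    rw [surf₂, integrable_add_measure, (measurableEmbedding_liftPt _).integrable_map_iff,
      (measurableEmbedding_liftPt _).integrable_map_iff] at hi
    rw [integral_surf₂ hW]
    simp only [liftPt_two, div_self hb.ne', neg_div, mul_one, mul_neg]
    rw [integral_neg, neg_add_eq_sub]
    exact integral_sub hi.2 hi.1
  rw [e]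
  refine (abs_integral_le_of_bilinear (p := 4 / 3) (q := 4) zero_le_one (memLp_surf₂ hq _)
    (memLp_surf₂ hw' _) (ae_mem_closure_surf₂.mono fun x hx => ?_)).trans ?_
  · rw [one_mul, abs_mul, abs_mul, Real.norm_eq_abs, Real.norm_eq_abs]
    refine mul_le_of_le_one_right (by positivity) ?_
    rw [abs_div, abs_of_pos hb, div_le_one hb]
    exact abs_le.2 ((C.mem_closure_iff' x).1 hx).2
  · rw [one_mul]
    exact mul_le_mul_of_nonneg_left hfour ENNReal.toReal_nonneg

theorem pd_eq_zero_of_face_one {w : E3 → ℝ} (hw : ContDiffOn ℝ 1 w (closure C.Ω))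
    (h0 : ∀ x ∈ C.face 1, w x = 0) {x : E3} (hx : x ∈ C.face 1) {j : Fin 3} (hj : j ≠ 2) :
    C.pd j w x = 0 :=
  C.fderivWithin_tangent_eq_zero hw h0 hx (fderiv_rho_one_eq_zero x (by simp [hj.symm]))

/-- This is ∂₃(div u) = 0 with the derivatives exchanged. It is needed on the boundary, and reaches
it from the interior by continuity of the second derivatives. -/
theorem sum_pd_pd_two_eq_zero {u : E3 → E3} (hu : ContDiffOn ℝ 2 u (closure C.Ω))
    (hdiv : ∀ x ∈ C.Ω, C.divergence u x = 0) {x : E3} (hx : x ∈ closure C.Ω) :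
    ∑ j, C.pd j (C.pd 2 fun y => u y j) x = 0 := by
  have hui := fun j => contDiffOn_comp hu j
  have h : EqOn (fun x => ∑ j, C.pd j (C.pd 2 fun y => u y j) x) (fun _ => 0) (closure C.Ω) := by
    refine EqOn.of_subset_closure (s := C.Ω) (fun x hx => ?_)
      (continuousOn_finsetSum _ fun j _ => C.continuousOn_pd (contDiffOn_pd (hui j) 2) j)
      continuousOn_const subset_closure le_rfl
    rw [← pd_eq_zero_of_eqOn hdiv hx 2,
      show C.divergence u = fun y => ∑ i, C.pd i (fun z => u z i) y from rfl, pd_sum (fun j _ => contDiffOn_pd (hui j) j) (subset_closure hx)]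
    exact Finset.sum_congr rfl fun j _ => pd_comm (hui j) hx _ _
  exact h hx

section Pressure

variable {ν κ : ℝ} {α : ℝ → ℝ} {f g : ℝ → E3 → E3} {v h : ℝ → E3 → E3}
  {p q θ ϑ : ℝ → E3 → ℝ} {v₀ h₀ : E3 → E3} {θ₀ : E3 → ℝ}

/-- Only the pressure survives on S₂. There v₃ = 0, so its time derivative, its tangential
derivatives and the convection vanish. The viscous term is ν(Δv₃ + ∂₃ div v): the divergence is
zero, the tangential second derivatives of v₃ vanish, and ∂₃²v₃ = ∂₃h₃ = 0. -/
theorem momentum_two_on_face_one (hs : C.SolvesNSHeat T ν κ α f v p θ v₀ θ₀)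
    (hH : C.SolvesH T ν α f g v θ ϑ h q h₀) (hv : C.IsC21 T v) (hp : C.IsC10 T p) {t : ℝ}
    (ht : t ∈ Ioo 0 T) (hhv : ∀ x ∈ closure C.Ω, ∀ i, h t x i = C.pd 2 (fun y => v t y i) x)
    {x : E3} (hx : x ∈ C.face 1) :
    deriv (fun s => v s x 2) t + C.convect (v t) (fun y => v t y 2) x
      - C.divStress ν (v t) (p t) x 2 = C.pd 2 (p t) x := by
  have hvf := hs.velocityField hv ht
  have hxK := C.face_subset 1 hx
  have h2 := hvf.contDiffOn
  have hvi := fun i => contDiffOn_comp h2 i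
  have hvi1 := fun i => contDiffOn_comp (h2.of_le one_le_two) i
  have hd : deriv (fun s => v s x 2) t = 0 := by
    have h1 : (fun s => v s x 2) =ᶠ[𝓝 t] fun _ => 0 := by
      filter_upwards [isOpen_Ioo.mem_nhds ht] with s hs'
      exact (hs.velocityField hv hs').bottom x hx
    rw [h1.deriv_eq, deriv_const]
  have hpd : ∀ j, j ≠ 2 → ∀ y ∈ C.face 1, C.pd j (fun y => v t y 2) y = 0 := fun j hj y hy =>
    pd_eq_zero_of_face_one (hvi1 2) hvf.bottom hy hj
  have hpp : ∀ j, j ≠ 2 → C.pd j (C.pd j fun y => v t y 2) x = 0 := fun j hj =>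
    pd_eq_zero_of_face_one (contDiffOn_pd (hvi 2) j) (hpd j hj) hx hj
  have h22 : C.pd 2 (C.pd 2 fun y => v t y 2) x = 0 := by
    rw [pd_congr (fun y hy => (hhv y hy 2).symm) hxK]
    rw [← S₂_eq_face] at hx
    exact hH.neumann₂ t ht x hx
  have hc : C.convect (v t) (fun y => v t y 2) x = 0 := by
    simp [convect, Fin.sum_univ_three, hpd 0 (by decide) x hx, hpd 1 (by decide) x hx,
      hvf.bottom x hx]
  have hdil : ∑ j, C.pd j (fun y => C.dil (v t) y 2 j) x = 0 := by
    have h3 := sum_pd_pd_two_eq_zero h2 hvf.div_free hxK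
    have e : ∀ j, C.pd j (fun y => C.dil (v t) y 2 j) x =
        C.pd j (C.pd j fun y => v t y 2) x + C.pd j (C.pd 2 fun y => v t y j) x := fun j =>
      pd_add (contDiffOn_pd (hvi 2) j) (contDiffOn_pd (hvi j) 2) hxK j
    simp only [e, Finset.sum_add_distrib, h3]
    simp [Fin.sum_univ_three, hpp 0 (by decide), hpp 1 (by decide), h22]
  rw [hd, hc, divStress_eq h2 (hp.contDiffOn t ht) hxK, hdil]
  ring

theorem continuous_liftPt_snd (y : E2) : Continuous fun s => liftPt y s :=
  continuous_liftPt.comp (Continuous.prodMk_right y)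

/-- On the bottom and the top the pressure derivative equals the normal component of the force. -/
theorem ae_pressure_eq (hα : ContDiff ℝ 2 α) (hfg : C.IsX3Deriv T f g)
    (hs : C.SolvesNSHeat T ν κ α f v p θ v₀ θ₀) (hH : C.SolvesH T ν α f g v θ ϑ h q h₀)
    (hv : C.IsC21 T v) (hθ : C.IsC21 T θ) (hp : C.IsC10 T p)
    (hhv : ∀ t ∈ Ioo 0 T, ∀ x ∈ closure C.Ω, ∀ i, h t x i = C.pd 2 (fun y => v t y i) x)
    (hq : ∀ t ∈ Ioo 0 T, ∀ x ∈ closure C.Ω, q t x = C.pd 2 (p t) x) :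
    ∀ᵐ t ∂(volume.restrict (Ioo 0 T)), ∀ᵐ x ∂C.surf₂, q t x = α (θ t x) * f t x 2 := by
  have hslice := ae_slice (P := fun t x => ∀ i, deriv (fun s => v s x i) t +
    C.convect (v t) (fun y => v t y i) x - C.divStress ν (v t) (p t) x i =
      α (θ t x) * f t x i) hs.momentum
  filter_upwards [hslice, Measure.ae_ae_of_ae_prod hfg, ae_restrict_mem measurableSet_Ioo]
    with t hmom hft ht
  have h1 := C.measurePreserving_liftPt_vol.quasiMeasurePreserving.ae hmom
  have h2 := Measure.ae_ae_of_ae_prod h1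
  refine ae_surf₂ ?_
  filter_upwards [h2, hft, ae_restrict_mem C.isOpen_ω.measurableSet] with y hy hfy hyω s hs'
  have hb := C.b_pos
  have hmaps : MapsTo (fun s => liftPt y s) (Icc (-C.b) C.b) (closure C.Ω) := fun r hr =>
    C.liftPt_mem_closure hyω hr
  have hpull : ∀ {w : E3 → ℝ}, ContinuousOn w (closure C.Ω) →
      ContinuousOn (fun r => w (liftPt y r)) (Icc (-C.b) C.b) := fun hw =>
    hw.comp (continuous_liftPt_snd y).continuousOn hmaps
  have hvf := hs.velocityField hv ht
  have hv1 := hvf.contDiffOn.of_le one_le_two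
  have hdt : ContinuousOn (fun x => deriv (fun s => v s x 2) t) (closure C.Ω) :=
    continuousOn_slice (w := fun t x => deriv (fun s => v s x 2) t) (hv.timeRegular_comp 2).cont_dt ht
  have hL : ContinuousOn (fun x => deriv (fun s => v s x 2) t +
      C.convect (v t) (fun y => v t y 2) x - C.divStress ν (v t) (p t) x 2) (closure C.Ω) :=
    (hdt.add (continuousOn_convect hv1.continuousOn (contDiffOn_comp hv1 2))).sub
      (continuousOn_divStress hvf.contDiffOn (hp.contDiffOn t ht) 2)
  -- Along almost every vertical segment `f` is a primitive of `g`, hence continuous up to both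
  -- ends.
  have hfc : ContinuousOn (fun r => f t (liftPt y r)) (Icc (-C.b) C.b) := by
    have h3 := intervalIntegral.continuousOn_primitive_interval' hfy.1 left_mem_uIcc
    rw [uIcc_of_le (by linarith)] at h3
    refine (continuousOn_const (c := f t (liftPt y (-C.b))) |>.add h3).congr fun r hr => ?_
    change _ = f t (liftPt y (-C.b)) + ∫ s in (-C.b)..r, g t (liftPt y s)
    rw [← hfy.2 _ (left_mem_Icc.2 (by linarith)) r hr, add_sub_cancel]
  have hR : ContinuousOn (fun r => α (θ t (liftPt y r)) * f t (liftPt y r) 2)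
      (Icc (-C.b) C.b) :=
    (hα.continuous.comp_continuousOn (hpull (hθ.contDiffOn t ht).continuousOn)).mul
      ((EuclideanSpace.proj 2 : E3 →L[ℝ] ℝ).continuous.comp_continuousOn hfc)
  -- The momentum equation holds almost everywhere on the segment. As both sides are continuous on
  -- the closed segment, it holds at the ends as well.
  have hEq := Measure.eqOn_Icc_of_ae_eq volume (by linarith : -C.b ≠ C.b) ?_ (hpull hL) hR
  · have hsI : s ∈ Icc (-C.b) C.b := by
      rcases hs' with rfl | rfl
      · exact left_mem_Icc.2 (by linarith)
      · exact right_mem_Icc.2 (by linarith)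
    have h4 := hEq hsI
    have hface := liftPt_mem_face_one hyω hs'
    rw [hq t ht _ (C.face_subset 1 hface), ← momentum_two_on_face_one hs hH hv hp ht (hhv t ht) hface]
    exact h4
  · rw [Measure.restrict_congr_set Ioo_ae_eq_Icc.symm]
    exact hy.mono fun r hr => hr 2

end Pressure

/-! ### The energy estimate for the temperature. -/

theorem energy_temperature {ν κ : ℝ} (hκ : 0 < κ) {α : ℝ → ℝ} {f v : ℝ → E3 → E3}
    {p θ : ℝ → E3 → ℝ} {v₀ : E3 → E3} {θ₀ : E3 → ℝ} (hs : C.SolvesNSHeat T ν κ α f v p θ v₀ θ₀)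
    (hT : 0 < T) (hv : C.IsC21 T v) (hθ : C.IsC21 T θ) (hθ₀ : MemLp θ₀ 2 C.vol) :
    ∫⁻ t in Ioo 0 T, ENNReal.ofReal (∫ x, ∑ i, C.pd i (θ t) x ^ 2 ∂C.vol) ≤
      ENNReal.ofReal (1 / (2 * κ)) * eLpNorm θ₀ 2 C.vol ^ 2 := by
  have hr := hθ.timeRegular
  have hid : ∀ t ∈ Ioo 0 T, ∫ x, 2 * (θ t x * deriv (fun s => θ s x) t) ∂C.vol
      + 2 * κ * ∫ x, ∑ i, C.pd i (θ t) x ^ 2 ∂C.vol = 0 := fun t ht => by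
    have hvf := hs.velocityField hv ht
    have h2 := hθ.contDiffOn t ht
    have h1 := h2.of_le one_le_two
    have hl := integral_mul_laplacian h2 h1
      (fun x hx => by rw [map_smul, hs.fderiv_rho_grad ht hx, smul_zero])
      (fun x hx => by rw [hs.pd_two_temperature ht hx, mul_zero])
    have hc := hvf.integral_mul_convect h1
    have i1 : Integrable (fun x => θ t x * C.laplacian (θ t) x) C.vol :=
      C.integrable_of_continuousOn (h1.continuousOn.mul (continuousOn_finsetSum _ fun i _ =>
        C.continuousOn_pd (contDiffOn_pd h2 i) i))
    have i2 : Integrable (fun x => θ t x * C.convect (v t) (θ t) x) C.vol :=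
      C.integrable_of_continuousOn (h1.continuousOn.mul
        (continuousOn_convect hvf.contDiffOn.continuousOn h1))
    have e : ∫ x, 2 * (θ t x * deriv (fun s => θ s x) t) ∂C.vol =
        ∫ x, (2 * κ * (θ t x * C.laplacian (θ t) x) -
          2 * (θ t x * C.convect (v t) (θ t) x)) ∂C.vol := by
      refine C.integral_congr_Ω fun x hx => ?_
      rw [show deriv (fun s => θ s x) t = κ * C.laplacian (θ t) x - C.convect (v t) (θ t) x by
        linarith [hs.heat t ht x hx]]
      ring
    rw [e, integral_sub (i1.const_mul _) (i2.const_mul _), integral_const_mul, integral_const_mul,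
      hl, hc]
    simp only [sq]
    ring
  have hg := (gronwall_lintegral (A := fun _ => 0) (B := fun _ => 0)
    (fun t ht => hr.hasDerivAt_integral_sq ht)
    hr.continuousOn_integral_mul_dt
    (continuousOn_const.mul hr.continuousOn_integral_grad)
    (fun t _ => integral_nonneg fun x => sq_nonneg _)
    (fun t _ => mul_nonneg (by positivity : 0 ≤ 2 * κ)
      (integral_nonneg fun x => Finset.sum_nonneg fun i _ => sq_nonneg _))
    aemeasurable_const aemeasurable_const (by simp)
    (hr.tendsto_initial hT hs.initial_θ hθ₀)
    (by
      filter_upwards [ae_restrict_mem measurableSet_Ioo] with t ht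
      change ENNReal.ofReal (_ + 2 * κ * _) ≤ _
      rw [hid t ht]
      simp) (right_mem_Ioc.2 hT)).2
  simp only [lintegral_zero, ENNReal.toReal_zero, Real.exp_zero, ENNReal.ofReal_one, one_mul,
    add_zero] at hg
  have e1 : ∀ X : ℝ, ENNReal.ofReal X =
      ENNReal.ofReal (1 / (2 * κ)) * ENNReal.ofReal (2 * κ * X) := fun X => by
    rw [← ENNReal.ofReal_mul (by positivity)]
    congr 1
    field_simp
  conv_lhs => enter [2, t]; rw [e1]
  rw [lintegral_const_mul' _ _ ENNReal.ofReal_ne_top]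
  exact mul_le_mul_right hg _

end Cylinder

/-! ### The energy inequality for the differentiated problems. -/

instance holderTriple_two_three : ENNReal.HolderTriple 2 3 (6 / 5) where
  inv_add_inv_eq_inv := by
    have h3 : (3 : ℝ≥0∞) = ENNReal.ofReal 3 := by simp
    have h5 : (5 : ℝ≥0∞) = ENNReal.ofReal 5 := by simp
    have h6 : (6 : ℝ≥0∞) = ENNReal.ofReal 6 := by simp
    have h2 : (2 : ℝ≥0∞) = ENNReal.ofReal 2 := by simp
    rw [h3, h6, h2, h5, ← ENNReal.ofReal_div_of_pos (by norm_num),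
      ← ENNReal.ofReal_inv_of_pos (by norm_num),
      ← ENNReal.ofReal_inv_of_pos (by norm_num), ← ENNReal.ofReal_inv_of_pos (by norm_num),
      ← ENNReal.ofReal_add (by norm_num) (by norm_num)]
    norm_num

theorem two_mul_sqrt_le {δ a X : ℝ} (hδ : 0 < δ) (hX : 0 ≤ X) :
    2 * (a * √X) ≤ δ / 4 * X + 4 / δ * a ^ 2 := by
  have h := Real.sq_sqrt hX
  have e : δ / 4 * X + 4 / δ * a ^ 2 - 2 * (a * √X) = 4 / δ * (δ / 4 * √X - a) ^ 2 := by
    nth_rewrite 1 [← h]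
    field_simp
    ring
  have h2 : 0 ≤ 4 / δ * (δ / 4 * √X - a) ^ 2 := by positivity
  linarith

/-- Young's inequality is used four times with X and once with Z, each time at the cost of δ/4. Of
the coercive terms 2δX and 2δZ, at least δX and δZ remain. -/
theorem energy_combine {δ X Z S₁ S₂ D G R E F P cS cT Nϑ Nf Ng Q e e' c₁ ν κ : ℝ} (hδ : 0 < δ)
    (hX : 0 ≤ X) (hZ : 0 ≤ Z) (h₁ : S₁ + ν * D = 2 * R - 2 * E - 2 * P)
    (h₂ : S₂ + 2 * κ * G = -(2 * F)) (hD : 2 * δ * X ≤ ν * D) (hG : 2 * δ * Z ≤ 2 * κ * G)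
    (hR : |R| ≤ c₁ * ((Nϑ * Nf + Ng) * (cS * √X))) (hP : |P| ≤ Q * (cT * √X))
    (hE : |E| ≤ e * (cS * √X)) (hF : |F| ≤ e' * (cS * √Z)) :
    S₁ + S₂ + δ * (X + Z) ≤ 4 / δ * (cS ^ 2 + cT ^ 2) *
      (c₁ ^ 2 * Nf ^ 2 * Nϑ ^ 2 + c₁ ^ 2 * Ng ^ 2 + Q ^ 2 + (e ^ 2 + e' ^ 2)) := by
  have y1 := two_mul_sqrt_le (a := c₁ * Nϑ * Nf * cS) hδ hX
  have y2 := two_mul_sqrt_le (a := c₁ * Ng * cS) hδ hX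
  have y3 := two_mul_sqrt_le (a := Q * cT) hδ hX
  have y4 := two_mul_sqrt_le (a := e * cS) hδ hX
  have y5 := two_mul_sqrt_le (a := e' * cS) hδ hZ
  have b1 := (le_abs_self _).trans hR
  have b2 := (neg_le_abs _).trans hP
  have b3 := (neg_le_abs _).trans hE
  have b4 := (neg_le_abs _).trans hF
  have hδZ : 0 ≤ δ * Z := by positivity
  have main : S₁ + S₂ + δ * (X + Z) ≤ 4 / δ * ((c₁ * Nϑ * Nf * cS) ^ 2 + (c₁ * Ng * cS) ^ 2
      + (Q * cT) ^ 2 + (e * cS) ^ 2 + (e' * cS) ^ 2) := by linarith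
  refine main.trans ?_
  rw [mul_assoc (4 / δ)]
  refine mul_le_mul_of_nonneg_left ?_ (by positivity)
  have p1 : 0 ≤ cT ^ 2 * (c₁ ^ 2 * Nf ^ 2 * Nϑ ^ 2 + c₁ ^ 2 * Ng ^ 2 + (e ^ 2 + e' ^ 2)) := by
    positivity
  have p2 : 0 ≤ cS ^ 2 * Q ^ 2 := by positivity
  linarith

namespace Cylinder

variable {C : Cylinder} {T : ℝ}

theorem continuousOn_gradVec {u : E3 → E3} (hu : ContDiffOn ℝ 1 u (closure C.Ω)) :
    ContinuousOn (C.gradVec u) (closure C.Ω) :=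
  (PiLp.continuous_toLp 2 _).comp_continuousOn
    (continuousOn_pi.2 fun ij => C.continuousOn_pd (contDiffOn_comp hu ij.1) ij.2)

theorem continuousOn_grad {w : E3 → ℝ} (hw : ContDiffOn ℝ 1 w (closure C.Ω)) :
    ContinuousOn (C.grad w) (closure C.Ω) :=
  (PiLp.continuous_toLp 2 _).comp_continuousOn (continuousOn_pi.2 fun i => C.continuousOn_pd hw i)

theorem eLpNorm_gradVec_sq_le {u : E3 → E3} (hu : ContDiffOn ℝ 1 u (closure C.Ω)) :
    eLpNorm (C.gradVec u) 2 C.vol ^ 2 ≤ ENNReal.ofReal (C.h1v u) := by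
  have hc := continuousOn_gradVec hu
  rw [← eLpNorm_norm, eLpNorm_two_sq (C.memLp_of_continuousOn hc 2).norm]
  refine ENNReal.ofReal_le_ofReal ?_
  have hint : ∀ i, Integrable (fun x => u x i ^ 2 + ∑ j, C.pd j (fun y => u y i) x ^ 2) C.vol :=
    fun i => C.integrable_of_continuousOn (continuousOn_h1 (contDiffOn_comp hu i))
  simp only [h1v, h1sq]
  rw [← integral_finsetSum _ fun i _ => hint i]
  refine C.integral_mono_Ω (hc.norm.pow 2)
    (continuousOn_finsetSum _ fun i _ => continuousOn_h1 (contDiffOn_comp hu i)) fun x _ => ?_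
  rw [EuclideanSpace.norm_sq_eq, Fintype.sum_prod_type]
  refine Finset.sum_le_sum fun i _ => ?_
  simp only [Real.norm_eq_abs, sq_abs]
  exact le_add_of_nonneg_left (sq_nonneg _)

theorem eLpNorm_grad_sq {w : E3 → ℝ} (hw : ContDiffOn ℝ 1 w (closure C.Ω)) :
    eLpNorm (C.grad w) 2 C.vol ^ 2 = ENNReal.ofReal (∫ x, ∑ i, C.pd i w x ^ 2 ∂C.vol) := by
  rw [← eLpNorm_norm, eLpNorm_two_sq (C.memLp_of_continuousOn (continuousOn_grad hw) 2).norm]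
  congr 2
  ext x
  rw [EuclideanSpace.norm_sq_eq]
  simp [grad]

/-- Cauchy–Schwarz for ∇u against the matrix h ⊗ h, whose Frobenius norm is |h|². -/
theorem abs_sum_mul_convect_le (h : E3 → E3) (u : E3 → E3) (x : E3) :
    |∑ i, h x i * C.convect h (fun y => u y i) x| ≤ ‖C.gradVec u x‖ * (‖h x‖ * ‖h x‖) := by
  set w : EuclideanSpace ℝ (Fin 3 × Fin 3) := WithLp.toLp 2 fun ij => h x ij.1 * h x ij.2 with hw
  have e : ∑ i, h x i * C.convect h (fun y => u y i) x = inner ℝ (C.gradVec u x) w := by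
    rw [PiLp.inner_apply, Fintype.sum_prod_type]
    refine Finset.sum_congr rfl fun i _ => ?_
    rw [convect, Finset.mul_sum]
    refine Finset.sum_congr rfl fun j _ => ?_
    simp only [gradVec, hw, RCLike.inner_apply, conj_trivial]
    ring
  have hn : ‖w‖ = ‖h x‖ * ‖h x‖ := by
    rw [← sq_eq_sq₀ (norm_nonneg _) (by positivity), EuclideanSpace.norm_sq_eq, ← sq (‖h x‖),
      EuclideanSpace.norm_sq_eq, sq (∑ i, _), Finset.sum_mul_sum, Fintype.sum_prod_type]
    refine Finset.sum_congr rfl fun i _ => Finset.sum_congr rfl fun j _ => ?_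
    simp only [hw, Real.norm_eq_abs, sq_abs]
    ring
  rw [e, ← hn]
  exact abs_real_inner_le_norm _ _

theorem abs_convect_le (h : E3 → E3) (w : E3 → ℝ) (x : E3) :
    |C.convect h w x| ≤ ‖h x‖ * ‖C.grad w x‖ := by
  have e : C.convect h w x = inner ℝ (h x) (C.grad w x) := by
    rw [PiLp.inner_apply]
    refine Finset.sum_congr rfl fun j _ => ?_
    simp only [grad, RCLike.inner_apply, conj_trivial]
    ring
  rw [e]
  exact abs_real_inner_le_norm _ _

/-- The time derivative of `‖h‖² + ‖ϑ‖²`. -/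
def energyRate (C : Cylinder) (h : ℝ → E3 → E3) (ϑ : ℝ → E3 → ℝ) (t : ℝ) : ℝ :=
  ∑ i, ∫ x, 2 * (h t x i * deriv (fun s => h s x i) t) ∂C.vol +
    ∫ x, 2 * (ϑ t x * deriv (fun s => ϑ s x) t) ∂C.vol

/-- The alternative for `m` reflects the two Hölder splittings of h·∇v·h and ϑ h·∇θ. One factor, in
L₆, is absorbed by the coercive terms; the others are measured in L₃ and L₂, with the L₃ norm either
on `h` or on the gradients. Both constants precede `T` and all data. -/
theorem exists_energyRate_bound (C : Cylinder) {ν κ : ℝ} (hν : 0 < ν) (hκ : 0 < κ) :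
    ∃ δ > 0, ∃ K ≥ 0, ∀ (T : ℝ) (α : ℝ → ℝ) (f g v h : ℝ → E3 → E3) (p q θ ϑ : ℝ → E3 → ℝ)
      (v₀ h₀ : E3 → E3) (θ₀ ϑ₀ : E3 → ℝ) (c₁ : ℝ), 0 ≤ c₁ →
      C.IsC21 T v → C.IsC21 T θ → C.IsC21 T h → C.IsC21 T ϑ → C.IsC10 T q →
      C.SolvesNSHeat T ν κ α f v p θ v₀ θ₀ → C.SolvesH T ν α f g v θ ϑ h q h₀ →
      C.SolvesTheta T κ v h θ ϑ ϑ₀ →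
      (∀ t ∈ Ioo 0 T, ∀ x ∈ closure C.Ω, ∀ i, h t x i = C.pd 2 (fun y => v t y i) x) →
      (∀ t ∈ Ioo 0 T, ∀ x ∈ C.Ω, |α (θ t x)| ≤ c₁ ∧ |deriv α (θ t x)| ≤ c₁) →
      AEStronglyMeasurable (fun z : ℝ × E3 => f z.1 z.2) (C.volT T) →
      AEStronglyMeasurable (fun z : ℝ × E3 => g z.1 z.2) (C.volT T) →
      mixedNorm 2 3 C.vol T f < ∞ → mixedNorm 2 (6 / 5) C.vol T g < ∞ →
      ∀ᵐ t ∂(volume.restrict (Ioo 0 T)), ∀ m,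
        (m = (eLpNorm (h t) 3 C.vol).toReal ^ 2 *
            ((eLpNorm (C.gradVec (v t)) 2 C.vol).toReal ^ 2
              + (eLpNorm (C.grad (θ t)) 2 C.vol).toReal ^ 2) ∨
          m = (eLpNorm (h t) 2 C.vol).toReal ^ 2 *
            ((eLpNorm (C.gradVec (v t)) 3 C.vol).toReal ^ 2
              + (eLpNorm (C.grad (θ t)) 3 C.vol).toReal ^ 2)) →
        C.energyRate h ϑ t + δ * (C.h1v (h t) + C.h1sq (ϑ t)) ≤
          K * (c₁ ^ 2 * (eLpNorm (f t) 3 C.vol).toReal ^ 2 * (eLpNorm (ϑ t) 2 C.vol).toReal ^ 2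
            + c₁ ^ 2 * (eLpNorm (g t) (6 / 5) C.vol).toReal ^ 2
            + (eLpNorm (q t) (4 / 3) C.surf₂).toReal ^ 2 + m) := by
  obtain ⟨k, hk, hK⟩ := C.exists_korn_velocityDeriv
  obtain ⟨cS, hcS, hS, hSv⟩ := C.exists_sobolev_norm
  obtain ⟨cT, hcT, hTr⟩ := C.exists_trace_bound
  -- The first entry makes viscosity dominate 2δX by Korn's inequality, the second makes diffusion
  -- dominate 2δZ by Poincaré's inequality with its constant 1 + 4b².
  set δ := min (ν / (2 * (k + 1))) (κ / (1 + 4 * C.b ^ 2)) with hδ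
  have hb := C.b_pos
  have hδ0 : 0 < δ := lt_min (by positivity) (by positivity)
  refine ⟨δ, hδ0, 4 / δ * (cS ^ 2 + cT ^ 2), by positivity, ?_⟩
  intro T α f g v h p q θ ϑ v₀ h₀ θ₀ ϑ₀ c₁ hc₁ hv hθ hh hϑ hq hs hH hΘ hhv hα hfm hgm hf hg
  have hfm' := aemeasurable_eLpNorm (p := 3) (by simp) (by simp) hfm
  have hgm' := aemeasurable_eLpNorm (p := 6 / 5) (by simp) (by finiteness) hgm
  have hslice := ae_slice (P := fun t x => ∀ i,
    deriv (fun s => h s x i) t - C.divStress ν (h t) (q t) x i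
      = -C.convect (v t) (fun y => h t y i) x - C.convect (h t) (fun y => v t y i) x
        + deriv α (θ t x) * ϑ t x * f t x i + α (θ t x) * g t x i) hH.momentum
  filter_upwards [hslice, ae_restrict_mem measurableSet_Ioo, ae_eLpNorm_lt_top hfm' hf,
    ae_eLpNorm_lt_top hgm' hg, hfm.prodMk_left, hgm.prodMk_left] with t hmom ht hft hgt hfmt hgmt
  intro m hm
  have hvf := hs.velocityField hv ht
  have hhd := hH.velocityDeriv hh hvf ht (hhv t ht)
  have hv1 := hvf.contDiffOn.of_le one_le_two
  have hh1 := hhd.contDiffOn.of_le one_le_two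
  have hθ1 := (hθ.contDiffOn t ht).of_le one_le_two
  have hϑ1 := (hϑ.contDiffOn t ht).of_le one_le_two
  have hvi := fun i => contDiffOn_comp hv1 i
  have hhi := fun i => contDiffOn_comp hh1 i
  have hq1 := hq.contDiffOn t ht
  have hMf : MemLp (f t) 3 C.vol := ⟨hfmt, hft⟩
  have hMg : MemLp (g t) (6 / 5) C.vol := ⟨hgmt, hgt⟩
  have hMh : ∀ r, MemLp (h t) r C.vol := fun r => C.memLp_of_continuousOn hh1.continuousOn r
  have hMϑ : ∀ r, MemLp (ϑ t) r C.vol := fun r => C.memLp_of_continuousOn hϑ1.continuousOn r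
  have hMv : ∀ r, MemLp (C.gradVec (v t)) r C.vol := fun r =>
    C.memLp_of_continuousOn (continuousOn_gradVec hv1) r
  have hMθ : ∀ r, MemLp (C.grad (θ t)) r C.vol := fun r =>
    C.memLp_of_continuousOn (continuousOn_grad hθ1) r
  set X := C.h1v (h t) with hX
  set Z := C.h1sq (ϑ t) with hZ
  have hX0 : 0 ≤ X := C.h1v_nonneg _
  have hZ0 : 0 ≤ Z := C.h1sq_nonneg _
  have hS6 := hSv (h t) hh1
  have hS6' := hS (ϑ t) hϑ1
  -- the momentum equation tested with `h`
  have hconv1 : ∀ i, ContinuousOn (C.convect (v t) fun y => h t y i) (closure C.Ω) := fun i =>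
    continuousOn_convect hv1.continuousOn (hhi i)
  have hconv2 : ∀ i, ContinuousOn (C.convect (h t) fun y => v t y i) (closure C.Ω) := fun i =>
    continuousOn_convect hh1.continuousOn (hvi i)
  have hid := integral_sum_mul_dt hh ht hq1 (ν := ν)
    (L := fun i x => C.convect (v t) (fun y => h t y i) x + C.convect (h t) (fun y => v t y i) x)
    (fun i => (hconv1 i).add (hconv2 i)) hhd.div_free
    (fun k x hx hk => hH.dilVec_tangent hh ht k hx hk) rfl
  -- The transport term v·∇h is orthogonal to `h`, so only h·∇v contributes.
  have hE : ∫ x, ∑ i, h t x i * (C.convect (v t) (fun y => h t y i) x +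
      C.convect (h t) (fun y => v t y i) x) ∂C.vol =
      ∫ x, ∑ i, h t x i * C.convect (h t) (fun y => v t y i) x ∂C.vol := by
    have i1 : ∀ i, Integrable (fun x => h t x i * C.convect (v t) (fun y => h t y i) x) C.vol :=
      fun i => C.integrable_of_continuousOn ((hhi i).continuousOn.mul (hconv1 i))
    have i2 : Integrable (fun x => ∑ i, h t x i * C.convect (h t) (fun y => v t y i) x) C.vol :=
      C.integrable_of_continuousOn (continuousOn_finsetSum _ fun i _ =>
        (hhi i).continuousOn.mul (hconv2 i))
    simp only [mul_add, Finset.sum_add_distrib]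
    rw [integral_add (integrable_finsetSum _ fun i _ => i1 i) i2,
      integral_finsetSum _ fun i _ => i1 i,
      Finset.sum_eq_zero fun i _ => hvf.integral_mul_convect (hhi i), zero_add]
  rw [hE, hhd.integral_pressure hq1] at hid
  have hP := hTr (q t) (fun y => h t y 2) hq1.continuousOn (hhi 2)
  have hP' := hP.trans (mul_le_mul_of_nonneg_left (mul_le_mul_of_nonneg_left
    (Real.sqrt_le_sqrt (h1sq_le_h1v (h t) 2)) hcT) ENNReal.toReal_nonneg)
  -- the force
  have hMϑf : MemLp (fun x => ‖ϑ t x‖ * ‖f t x‖) (6 / 5) C.vol :=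
    ⟨(hMϑ 2).1.norm.mul hfmt.norm, (eLpNorm_norm_mul_norm_le (p := 2) (q := 3) (hMϑ 2).1
      hfmt).trans_lt (ENNReal.mul_lt_top (hMϑ 2).2 hft)⟩
  have hMa := hMϑf.add hMg.norm
  have hone : (1 : ℝ≥0∞) ≤ 6 / 5 := by
    rw [ENNReal.le_div_iff_mul_le (by simp) (by simp)]
    norm_num
  have hNa : (eLpNorm ((fun x => ‖ϑ t x‖ * ‖f t x‖) + fun x => ‖g t x‖) (6 / 5) C.vol).toReal ≤
      (eLpNorm (ϑ t) 2 C.vol).toReal * (eLpNorm (f t) 3 C.vol).toReal +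
        (eLpNorm (g t) (6 / 5) C.vol).toReal := by
    have h1 := eLpNorm_add_le hMϑf.1 hMg.norm.1 hone
    rw [eLpNorm_norm] at h1
    have h2 := ENNReal.toReal_mono (ENNReal.add_lt_top.2 ⟨hMϑf.2, hgt⟩).ne h1
    rw [ENNReal.toReal_add hMϑf.2.ne hgt.ne] at h2
    refine h2.trans (add_le_add_left ?_ _)
    rw [← ENNReal.toReal_mul]
    exact ENNReal.toReal_mono (ENNReal.mul_lt_top (hMϑ 2).2 hft).ne
      (eLpNorm_norm_mul_norm_le (hMϑ 2).1 hfmt)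
  have hR := abs_integral_le_of_bilinear (p := 6 / 5) (q := 6) (μ := C.vol)
    (W := fun x => ∑ i, h t x i * (deriv (fun s => h s x i) t +
      (C.convect (v t) (fun y => h t y i) x + C.convect (h t) (fun y => v t y i) x) -
      C.divStress ν (h t) (q t) x i))
    (a := (fun x => ‖ϑ t x‖ * ‖f t x‖) + fun x => ‖g t x‖) (b := h t) hc₁ hMa (hMh 6) (by
      filter_upwards [hmom, C.ae_mem_Ω] with x hx hxΩ
      have e : ∑ i, h t x i * (deriv (fun s => h s x i) t +
          (C.convect (v t) (fun y => h t y i) x + C.convect (h t) (fun y => v t y i) x) -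
          C.divStress ν (h t) (q t) x i) =
          inner ℝ ((deriv α (θ t x) * ϑ t x) • f t x + α (θ t x) • g t x) (h t x) := by
        rw [PiLp.inner_apply]
        refine Finset.sum_congr rfl fun i _ => ?_
        simp only [PiLp.add_apply, PiLp.smul_apply, smul_eq_mul, RCLike.inner_apply, conj_trivial]
        rw [show deriv (fun s => h s x i) t + (C.convect (v t) (fun y => h t y i) x +
          C.convect (h t) (fun y => v t y i) x) - C.divStress ν (h t) (q t) x i =
          deriv α (θ t x) * ϑ t x * f t x i + α (θ t x) * g t x i by linarith [hx i]]
      rw [e]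
      have ha := hα t ht x hxΩ
      refine (abs_real_inner_le_norm _ _).trans ?_
      rw [← mul_assoc]
      refine mul_le_mul_of_nonneg_right ?_ (norm_nonneg _)
      have h1 : ‖((fun x => ‖ϑ t x‖ * ‖f t x‖) + fun x => ‖g t x‖) x‖ =
          ‖ϑ t x‖ * ‖f t x‖ + ‖g t x‖ :=
        Real.norm_of_nonneg (add_nonneg (by positivity) (norm_nonneg _))
      rw [h1]
      refine (norm_add_le _ _).trans ?_
      rw [norm_smul, norm_smul, norm_mul, mul_add, Real.norm_eq_abs, Real.norm_eq_abs (α _),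
        mul_assoc]
      exact add_le_add (mul_le_mul_of_nonneg_right ha.2 (by positivity))
        (mul_le_mul_of_nonneg_right ha.1 (norm_nonneg _)))
  have hR' := hR.trans (mul_le_mul_of_nonneg_left (mul_le_mul hNa hS6 ENNReal.toReal_nonneg
    (by positivity)) hc₁)
  -- the heat equation tested with `ϑ`
  have hϑid : ∫ x, 2 * (ϑ t x * deriv (fun s => ϑ s x) t) ∂C.vol
      + 2 * κ * ∫ x, ∑ i, C.pd i (ϑ t) x ^ 2 ∂C.vol =
      -(2 * ∫ x, ϑ t x * C.convect (h t) (θ t) x ∂C.vol) := by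
    have h2 := hϑ.contDiffOn t ht
    have h0 : ∀ x ∈ C.face 1, ϑ t x = 0 := fun x hx => by
      rw [← S₂_eq_face] at hx
      exact hΘ.dirichlet₂ t ht x hx
    have hl := integral_mul_laplacian h2 hϑ1
      (fun x hx => by
        rw [← S₁_eq_face] at hx
        rw [map_smul, fderiv_rho_zero_eq_zero_of_normal hx (hΘ.neumann₁ t ht x hx), smul_zero])
      (fun x hx => by rw [h0 x hx, zero_mul])
    have hc := hvf.integral_mul_convect hϑ1
    have i1 : Integrable (fun x => ϑ t x * C.laplacian (ϑ t) x) C.vol :=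
      C.integrable_of_continuousOn (hϑ1.continuousOn.mul (continuousOn_finsetSum _ fun i _ =>
        C.continuousOn_pd (contDiffOn_pd h2 i) i))
    have i2 : Integrable (fun x => ϑ t x * C.convect (v t) (ϑ t) x) C.vol :=
      C.integrable_of_continuousOn (hϑ1.continuousOn.mul
        (continuousOn_convect hv1.continuousOn hϑ1))
    have i3 : Integrable (fun x => ϑ t x * C.convect (h t) (θ t) x) C.vol :=
      C.integrable_of_continuousOn (hϑ1.continuousOn.mul
        (continuousOn_convect hh1.continuousOn hθ1))
    have i4 : Integrable (fun x => 2 * κ * (ϑ t x * C.laplacian (ϑ t) x) -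
        2 * (ϑ t x * C.convect (v t) (ϑ t) x)) C.vol := (i1.const_mul _).sub (i2.const_mul _)
    have e : ∫ x, 2 * (ϑ t x * deriv (fun s => ϑ s x) t) ∂C.vol =
        ∫ x, (2 * κ * (ϑ t x * C.laplacian (ϑ t) x) - 2 * (ϑ t x * C.convect (v t) (ϑ t) x)
          - 2 * (ϑ t x * C.convect (h t) (θ t) x)) ∂C.vol := by
      refine C.integral_congr_Ω fun x hx => ?_
      rw [show deriv (fun s => ϑ s x) t = κ * C.laplacian (ϑ t) x - C.convect (v t) (ϑ t) x
        - C.convect (h t) (θ t) x by linarith [hΘ.heat t ht x hx]]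
      ring
    rw [e, integral_sub i4 (i3.const_mul _), integral_sub (i1.const_mul _) (i2.const_mul _),
      integral_const_mul, integral_const_mul, integral_const_mul, hl, hc]
    simp only [sq]
    ring
  have hD : 2 * δ * X ≤ ν * C.dilSq (h t) := by
    have h1 : 2 * δ * (k + 1) ≤ ν := by
      have := min_le_left (ν / (2 * (k + 1))) (κ / (1 + 4 * C.b ^ 2))
      rw [← hδ, le_div_iff₀ (by positivity)] at this
      linarith
    have h2 := hK _ hhd
    have hd := C.dilSq_nonneg (h t)
    have h3 := mul_le_mul_of_nonneg_left h2 (by positivity : 0 ≤ 2 * δ)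
    have h4 := mul_le_mul_of_nonneg_right h1 hd
    have h5 : 0 ≤ 2 * δ * C.dilSq (h t) := by positivity
    linarith
  have hG : 2 * δ * Z ≤ 2 * κ * ∫ x, ∑ i, C.pd i (ϑ t) x ^ 2 ∂C.vol := by
    have h1 : δ * (1 + 4 * C.b ^ 2) ≤ κ := by
      have := min_le_right (ν / (2 * (k + 1))) (κ / (1 + 4 * C.b ^ 2))
      rwa [← hδ, le_div_iff₀ (by positivity)] at this
    have h2 := h1sq_le_of_face_one hϑ1 fun x hx => by
      rw [← S₂_eq_face] at hx
      exact hΘ.dirichlet₂ t ht x hx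
    have h0 : 0 ≤ ∫ x, ∑ i, C.pd i (ϑ t) x ^ 2 ∂C.vol :=
      integral_nonneg fun x => Finset.sum_nonneg fun i _ => sq_nonneg _
    have h3 := mul_le_mul_of_nonneg_left h2 hδ0.le
    have h4 := mul_le_mul_of_nonneg_right h1 h0
    linarith
  rw [energyRate]
  -- In the first case `h` is taken in L₃ and the gradients in L₂; in the second the exponents are
  -- exchanged.
  rcases hm with rfl | rfl
  · have hEb := abs_integral_le_of_trilinear (μ := C.vol) (p := 2) (q := 3) (r := 6) (s := 2)
      zero_le_one (hMv 2) (hMh 3) (hMh 6) (Eventually.of_forall fun x => by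
        rw [one_mul]
        exact abs_sum_mul_convect_le (h t) (v t) x)
    have hFb := abs_integral_le_of_trilinear (μ := C.vol) (p := 2) (q := 3) (r := 6) (s := 2)
      (W := fun x => ϑ t x * C.convect (h t) (θ t) x)
      zero_le_one (hMθ 2) (hMh 3) (hMϑ 6) (Eventually.of_forall fun x => by
        rw [one_mul, abs_mul, ← Real.norm_eq_abs]
        have := mul_le_mul_of_nonneg_left (abs_convect_le (C := C) (h t) (θ t) x)
          (norm_nonneg (ϑ t x))
        linarith)
    rw [one_mul, ← mul_assoc] at hEb hFb
    have hEb' := hEb.trans (mul_le_mul_of_nonneg_left hS6 (by positivity))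
    have hFb' := hFb.trans (mul_le_mul_of_nonneg_left hS6' (by positivity))
    refine (energy_combine hδ0 hX0 hZ0 hid hϑid hD hG hR' hP' hEb' hFb').trans (le_of_eq ?_)
    ring
  · have hEb := abs_integral_le_of_trilinear (μ := C.vol) (p := 2) (q := 3) (r := 6) (s := 2)
      zero_le_one (hMh 2) (hMv 3) (hMh 6) (Eventually.of_forall fun x => by
        rw [one_mul]
        have := abs_sum_mul_convect_le (C := C) (h t) (v t) x
        rwa [mul_left_comm] at this)
    have hFb := abs_integral_le_of_trilinear (μ := C.vol) (p := 2) (q := 3) (r := 6) (s := 2)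
      (W := fun x => ϑ t x * C.convect (h t) (θ t) x)
      zero_le_one (hMh 2) (hMθ 3) (hMϑ 6) (Eventually.of_forall fun x => by
        rw [one_mul, abs_mul, ← Real.norm_eq_abs]
        have := mul_le_mul_of_nonneg_left (abs_convect_le (C := C) (h t) (θ t) x)
          (norm_nonneg (ϑ t x))
        linarith)
    rw [one_mul, ← mul_assoc] at hEb hFb
    have hEb' := hEb.trans (mul_le_mul_of_nonneg_left hS6 (by positivity))
    have hFb' := hFb.trans (mul_le_mul_of_nonneg_left hS6' (by positivity))
    refine (energy_combine hδ0 hX0 hZ0 hid hϑid hD hG hR' hP' hEb' hFb').trans (le_of_eq ?_)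
    ring

end Cylinder

/-! ### From the differential inequality to the norms. -/

theorem mixedNorm_top_sq_le {X F : Type*} [MeasurableSpace X] [NormedAddCommGroup F] {p : ℝ≥0∞}
    {μ : Measure X} {t : ℝ} {u : ℝ → X → F} {R : ℝ≥0∞}
    (h : ∀ s ∈ Ioo 0 t, eLpNorm (u s) p μ ^ 2 ≤ R) : mixedNorm ∞ p μ t u ^ 2 ≤ R := by
  have hb : mixedNorm ∞ p μ t u ≤ R ^ (2⁻¹ : ℝ) := by
    rw [mixedNorm, eLpNorm_exponent_top]
    refine eLpNormEssSup_le_of_ae_enorm_bound ?_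
    filter_upwards [ae_restrict_mem measurableSet_Ioo] with s hs
    rw [enorm_eq_self, ENNReal.le_rpow_inv_iff two_pos]
    exact_mod_cast h s hs
  calc _ ≤ (R ^ (2⁻¹ : ℝ)) ^ 2 := by gcongr
    _ = R := by rw [← ENNReal.rpow_natCast, ← ENNReal.rpow_mul]; norm_num

theorem ae_eLpNorm_le_mixedNorm_top {X F : Type*} [MeasurableSpace X] [NormedAddCommGroup F]
    (p : ℝ≥0∞) (μ : Measure X) (t : ℝ) (u : ℝ → X → F) :
    ∀ᵐ s ∂(volume.restrict (Ioo 0 t)), eLpNorm (u s) p μ ≤ mixedNorm ∞ p μ t u := by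
  filter_upwards [enorm_ae_le_eLpNormEssSup (fun s => eLpNorm (u s) p μ)
    (volume.restrict (Ioo 0 t))] with s hs
  rwa [mixedNorm, eLpNorm_exponent_top]

theorem ENNReal.ofReal_toReal_sq_le (a : ℝ≥0∞) : ENNReal.ofReal (a.toReal ^ 2) ≤ a ^ 2 := by
  rw [ENNReal.ofReal_pow ENNReal.toReal_nonneg]
  gcongr
  exact ENNReal.ofReal_toReal_le

theorem ENNReal.ofReal_toReal_sq_mul_le (a b d : ℝ≥0∞) :
    ENNReal.ofReal (a.toReal ^ 2 * (b.toReal ^ 2 + d.toReal ^ 2)) ≤ a ^ 2 * (b ^ 2 + d ^ 2) := by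
  rw [ENNReal.ofReal_mul (sq_nonneg _)]
  exact mul_le_mul' (ENNReal.ofReal_toReal_sq_le _) (ENNReal.ofReal_add_le.trans
    (add_le_add (ENNReal.ofReal_toReal_sq_le _) (ENNReal.ofReal_toReal_sq_le _)))

theorem ENNReal.ofReal_energy_le {K c m : ℝ} (hK : 0 ≤ K) (hc : 0 ≤ c) (F Θ G Q : ℝ≥0∞) :
    ENNReal.ofReal (K * (c ^ 2 * F.toReal ^ 2 * Θ.toReal ^ 2 + c ^ 2 * G.toReal ^ 2
      + Q.toReal ^ 2 + m)) ≤
    ENNReal.ofReal K * (ENNReal.ofReal c ^ 2 * F ^ 2 * Θ ^ 2 + ENNReal.ofReal c ^ 2 * G ^ 2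
      + Q ^ 2 + ENNReal.ofReal m) := by
  rw [ENNReal.ofReal_mul hK]
  refine mul_le_mul_right ?_ _
  refine ENNReal.ofReal_add_le.trans (add_le_add_left ?_ _)
  refine ENNReal.ofReal_add_le.trans (add_le_add ?_ (ENNReal.ofReal_toReal_sq_le _))
  refine ENNReal.ofReal_add_le.trans (add_le_add ?_ ?_)
  · rw [ENNReal.ofReal_mul (by positivity), ENNReal.ofReal_mul (by positivity),
      ENNReal.ofReal_pow hc]
    exact mul_le_mul' (mul_le_mul_right (ENNReal.ofReal_toReal_sq_le _) _)
      (ENNReal.ofReal_toReal_sq_le _)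
  · rw [ENNReal.ofReal_mul (by positivity), ENNReal.ofReal_pow hc]
    exact mul_le_mul_right (ENNReal.ofReal_toReal_sq_le _) _

theorem ENNReal.add_sq_le_two_mul (a b : ℝ≥0∞) : (a + b) ^ 2 ≤ 2 * (a ^ 2 + b ^ 2) := by
  have h := ENNReal.rpow_add_le_mul_rpow_add_rpow a b (p := 2) one_le_two
  norm_num at h
  exact h

/-- Common bookkeeping of constants for both estimates: `M` is the additional source of the first
and is 0 in the second. A single `c` dominates K in the exponent and K(1 + K + KL) as prefactor,
where 1 + K + KL arises from bounding each source by the total sum. -/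
theorem ENNReal.ofReal_exp_mul_le {K L c a : ℝ} {H Θ G F B M : ℝ≥0∞} {b : ℝ} (hK : 0 ≤ K)
    (hL : 0 ≤ L) (hc : c = K * (1 + K + K * L) + K) (hb : 0 ≤ b) (hab : a = b)
    (hB : B ≤ ENNReal.ofReal L * M) :
    ENNReal.ofReal (K * Real.exp (K * a)) * (H + Θ + ENNReal.ofReal K * (G + F + B)) ≤
      ENNReal.ofReal (c * Real.exp (c * b)) * (M + G + F + H + Θ) := by
  have hKL : 0 ≤ K * L := mul_nonneg hK hL
  have hKc : K ≤ c := by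
    rw [hc]
    exact le_add_of_nonneg_left (by positivity)
  set S := M + G + F + H + Θ with hS
  have h1 : H + Θ + ENNReal.ofReal K * (G + F + B) ≤ ENNReal.ofReal (1 + K + K * L) * S := by
    rw [ENNReal.ofReal_add (by positivity) hKL, ENNReal.ofReal_add one_pos.le hK,
      ENNReal.ofReal_one, ENNReal.ofReal_mul hK, add_mul, add_mul, one_mul, mul_add, mul_assoc,
      add_assoc (S)]
    refine add_le_add ?_ ?_
    · rw [hS, add_assoc (M + G + F)]
      exact le_add_self
    · rw [← mul_add, ← mul_add]
      refine mul_le_mul_right (add_le_add ?_ (hB.trans (mul_le_mul_right ?_ _))) _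
      · rw [hS, show M + G + F + H + Θ = (G + F) + (M + H + Θ) by ring]
        exact le_self_add
      · rw [hS, show M + G + F + H + Θ = M + (G + F + H + Θ) by ring]
        exact le_self_add
  refine (mul_le_mul_right h1 _).trans ?_
  rw [← mul_assoc, ← ENNReal.ofReal_mul (by positivity)]
  refine mul_le_mul_left (ENNReal.ofReal_le_ofReal ?_) _
  rw [mul_right_comm, hab]
  exact mul_le_mul (by rw [hc]; linarith) (Real.exp_le_exp.2 (mul_le_mul_of_nonneg_right hKc hb))
    (Real.exp_pos _).le (hK.trans hKc)

namespace Cylinder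

variable {C : Cylinder} {T : ℝ}

theorem ae_mem_closure_vol : ∀ᵐ x ∂C.vol, x ∈ closure C.Ω :=
  C.ae_mem_Ω.mono fun _ hx => subset_closure hx

theorem IsC21.continuousOn_gradVec {u : ℝ → E3 → E3} (hu : C.IsC21 T u) :
    ContinuousOn (fun z : ℝ × E3 => C.gradVec (u z.1) z.2) (Ioo 0 T ×ˢ closure C.Ω) :=
  (PiLp.continuous_toLp 2 _).comp_continuousOn
    (continuousOn_pi.2 fun ij => (hu.timeRegular_comp ij.1).cont_pd ij.2)

theorem IsC21.continuousOn_grad {w : ℝ → E3 → ℝ} (hw : C.IsC21 T w) :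
    ContinuousOn (fun z : ℝ × E3 => C.grad (w z.1) z.2) (Ioo 0 T ×ˢ closure C.Ω) :=
  (PiLp.continuous_toLp 2 _).comp_continuousOn
    (continuousOn_pi.2 fun i => hw.timeRegular.cont_pd i)

theorem aemeasurable_eLpNorm_of_continuousOn {F : Type*} [NormedAddCommGroup F]
    [SecondCountableTopology F] {μ : Measure E3} [SFinite μ] (hμ : ∀ᵐ x ∂μ, x ∈ closure C.Ω)
    {p : ℝ≥0∞} (hp : p ≠ 0) (hp' : p ≠ ∞) {w : ℝ → E3 → F}
    (hw : ContinuousOn (fun z : ℝ × E3 => w z.1 z.2) (Ioo 0 T ×ˢ closure C.Ω)) :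
    AEMeasurable (fun t => eLpNorm (w t) p μ) (volume.restrict (Ioo 0 T)) :=
  aemeasurable_eLpNorm hp hp' (aestronglyMeasurable_prod_of_continuousOn hμ hw)

/-- Each squared supremum norm is at most R and each squared gradient norm at most R/δ. The factor 4
= 2·2 comes from (a + b)² ≤ 2(a² + b²) for the two fields. -/
theorem normV_sq_add_normVScalar_sq_le {h : ℝ → E3 → E3} {ϑ : ℝ → E3 → ℝ} (hh : C.IsC21 T h)
    (hϑ : C.IsC21 T ϑ) {t δ : ℝ} (ht : t ∈ Ioc 0 T) (hδ : 0 < δ) {R : ℝ≥0∞}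
    (h₁ : ∀ s ∈ Ioo 0 t, ENNReal.ofReal (C.l2v (h s) + ∫ x, ϑ s x ^ 2 ∂C.vol) ≤ R)
    (h₂ : ∫⁻ s in Ioo 0 t, ENNReal.ofReal (δ * (C.h1v (h s) + C.h1sq (ϑ s))) ≤ R) :
    C.normV t h ^ 2 + C.normVScalar t ϑ ^ 2 ≤ ENNReal.ofReal (4 + 4 / δ) * R := by
  have hsub : ∀ s ∈ Ioo 0 t, s ∈ Ioo 0 T := fun s hs => ⟨hs.1, hs.2.trans_le ht.2⟩
  have hh1 := fun s hs => (hh.contDiffOn s (hsub s hs)).of_le one_le_two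
  have hϑ1 := fun s hs => (hϑ.contDiffOn s (hsub s hs)).of_le one_le_two
  have hint0 : ∀ s, 0 ≤ ∫ x, ϑ s x ^ 2 ∂C.vol := fun s => integral_nonneg fun x => sq_nonneg _
  have hsup : mixedNorm ∞ 2 C.vol t h ^ 2 ≤ R := mixedNorm_top_sq_le fun s hs => by
    rw [← ofReal_l2v (hh1 s hs).continuousOn]
    exact (ENNReal.ofReal_le_ofReal (le_add_of_nonneg_right (hint0 s))).trans (h₁ s hs)
  have hsup' : mixedNorm ∞ 2 C.vol t ϑ ^ 2 ≤ R := mixedNorm_top_sq_le fun s hs => by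
    rw [eLpNorm_two_sq (C.memLp_of_continuousOn (hϑ1 s hs).continuousOn 2)]
    exact (ENNReal.ofReal_le_ofReal (le_add_of_nonneg_left (l2v_nonneg _))).trans (h₁ s hs)
  have hD : ∫⁻ s in Ioo 0 t, ENNReal.ofReal (C.h1v (h s) + C.h1sq (ϑ s)) ≤
      ENNReal.ofReal (1 / δ) * R := by
    refine le_trans (le_of_eq ?_) (mul_le_mul_right h₂ _)
    rw [← lintegral_const_mul' _ _ ENNReal.ofReal_ne_top]
    refine lintegral_congr fun s => ?_
    rw [← ENNReal.ofReal_mul (by positivity)]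
    congr 1
    field_simp
  have hgr : mixedNorm 2 2 C.vol t (fun s => C.gradVec (h s)) ^ 2 ≤ ENNReal.ofReal (1 / δ) * R := by
    rw [mixedNorm_two_sq]
    refine le_trans (setLIntegral_mono' measurableSet_Ioo fun s hs => ?_) hD
    exact (eLpNorm_gradVec_sq_le (hh1 s hs)).trans
      (ENNReal.ofReal_le_ofReal (le_add_of_nonneg_right (C.h1sq_nonneg _)))
  have hgr' : mixedNorm 2 2 C.vol t (fun s => C.grad (ϑ s)) ^ 2 ≤ ENNReal.ofReal (1 / δ) * R := by
    rw [mixedNorm_two_sq]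
    refine le_trans (setLIntegral_mono' measurableSet_Ioo fun s hs => ?_) hD
    rw [eLpNorm_grad_sq (hϑ1 s hs)]
    refine ENNReal.ofReal_le_ofReal (le_trans ?_ (le_add_of_nonneg_left (C.h1v_nonneg _)))
    exact C.integral_mono_Ω (continuousOn_finsetSum _ fun i _ => (C.continuousOn_pd (hϑ1 s hs) i).pow 2)
      (continuousOn_h1 (hϑ1 s hs)) fun x _ => le_add_of_nonneg_left (sq_nonneg _)
  calc C.normV t h ^ 2 + C.normVScalar t ϑ ^ 2
      ≤ 2 * (R + ENNReal.ofReal (1 / δ) * R) + 2 * (R + ENNReal.ofReal (1 / δ) * R) := by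
        refine add_le_add ((ENNReal.add_sq_le_two_mul _ _).trans ?_)
          ((ENNReal.add_sq_le_two_mul _ _).trans ?_)
        · exact mul_le_mul_right (add_le_add hsup hgr) _
        · exact mul_le_mul_right (add_le_add hsup' hgr') _
    _ = ENNReal.ofReal (4 + 4 / δ) * R := by
        rw [show 4 + 4 / δ = 4 * (1 + 1 / δ) by ring, ENNReal.ofReal_mul (by norm_num),
          ENNReal.ofReal_add (by norm_num) (by positivity)]
        simp only [ENNReal.ofReal_one, ENNReal.ofReal_ofNat]
        ring

theorem lintegral_pressure_le {q θ : ℝ → E3 → ℝ} {α : ℝ → ℝ} {f : ℝ → E3 → E3} {c₁ t : ℝ}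
    (ht : t ∈ Ioc 0 T)
    (hα : ∀ t ∈ Ioo 0 T, ∀ x ∈ closure C.Ω, |α (θ t x)| ≤ c₁)
    (hq : ∀ᵐ t ∂(volume.restrict (Ioo 0 T)), ∀ᵐ x ∂C.surf₂, q t x = α (θ t x) * f t x 2) :
    ∫⁻ s in Ioo 0 t, eLpNorm (q s) (4 / 3) C.surf₂ ^ 2 ≤
      ENNReal.ofReal c₁ ^ 2 * mixedNorm 2 (4 / 3) C.surf₂ t (fun s x => f s x 2) ^ 2 := by
  have hsub : Ioo 0 t ⊆ Ioo 0 T := Ioo_subset_Ioo_right ht.2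
  rw [mixedNorm_two_sq, ← lintegral_const_mul' _ _ (ENNReal.pow_ne_top ENNReal.ofReal_ne_top)]
  refine lintegral_mono_ae ?_
  filter_upwards [ae_restrict_of_ae_restrict_of_subset hsub hq,
    ae_restrict_mem measurableSet_Ioo] with s hs hst
  rw [← mul_pow]
  gcongr
  refine eLpNorm_le_mul_eLpNorm_of_ae_le_mul ?_ _
  filter_upwards [hs, C.ae_mem_closure_surf₂] with x hx hxc
  rw [hx, norm_mul]
  exact mul_le_mul_of_nonneg_right (hα s (hsub hst) x hxc) (norm_nonneg _)

/-- The functions `A` and `B` leave open how the quadratic terms are distributed: at each time one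
of the two Hölder splittings has to be dominated by A‖h‖₂² + B. Then `A` enters the exponential and
`B` the source, so that one argument yields both estimates. -/
theorem exists_energy_bound (C : Cylinder) {ν κ : ℝ} (hν : 0 < ν) (hκ : 0 < κ) :
    ∃ K > 0, ∀ (T : ℝ) (_ : 0 < T) (α : ℝ → ℝ) (_ : ContDiff ℝ 2 α) (f g v h : ℝ → E3 → E3)
      (p q θ ϑ : ℝ → E3 → ℝ) (v₀ h₀ : E3 → E3) (θ₀ ϑ₀ : E3 → ℝ) (c₁ : ℝ), 0 ≤ c₁ →
      C.IsC21 T v → C.IsC21 T θ → C.IsC21 T h → C.IsC21 T ϑ → C.IsC10 T p → C.IsC10 T q →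
      C.SolvesNSHeat T ν κ α f v p θ v₀ θ₀ → C.SolvesH T ν α f g v θ ϑ h q h₀ →
      C.SolvesTheta T κ v h θ ϑ ϑ₀ →
      (∀ t ∈ Ioo 0 T, ∀ x ∈ closure C.Ω, ∀ i, h t x i = C.pd 2 (fun y => v t y i) x) →
      (∀ t ∈ Ioo 0 T, ∀ x ∈ closure C.Ω, q t x = C.pd 2 (p t) x) →
      (∀ t ∈ Ioo 0 T, ∀ x ∈ closure C.Ω, |α (θ t x)| ≤ c₁ ∧ |deriv α (θ t x)| ≤ c₁) →
      AEStronglyMeasurable (fun z : ℝ × E3 => f z.1 z.2) (C.volT T) →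
      AEStronglyMeasurable (fun z : ℝ × E3 => g z.1 z.2) (C.volT T) →
      C.IsX3Deriv T f g → MemLp h₀ 2 C.vol → MemLp ϑ₀ 2 C.vol →
      mixedNorm 2 3 C.vol T f < ∞ → mixedNorm 2 (6 / 5) C.vol T g < ∞ →
      ∀ A B : ℝ → ℝ≥0∞, AEMeasurable A (volume.restrict (Ioo 0 T)) →
      AEMeasurable B (volume.restrict (Ioo 0 T)) → ∫⁻ s in Ioo 0 T, A s ≠ ∞ →
      (∀ s ∈ Ioo 0 T,
        eLpNorm (h s) 3 C.vol ^ 2 * (eLpNorm (C.gradVec (v s)) 2 C.vol ^ 2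
            + eLpNorm (C.grad (θ s)) 2 C.vol ^ 2) ≤ A s * eLpNorm (h s) 2 C.vol ^ 2 + B s ∨
        eLpNorm (h s) 2 C.vol ^ 2 * (eLpNorm (C.gradVec (v s)) 3 C.vol ^ 2
            + eLpNorm (C.grad (θ s)) 3 C.vol ^ 2) ≤ A s * eLpNorm (h s) 2 C.vol ^ 2 + B s) →
      ∀ t ∈ Ioc 0 T, C.normV t h ^ 2 + C.normVScalar t ϑ ^ 2 ≤
        ENNReal.ofReal (K * Real.exp (K * (c₁ ^ 2 * (mixedNorm 2 3 C.vol t f).toReal ^ 2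
          + (∫⁻ s in Ioo 0 t, A s).toReal))) *
        (eLpNorm h₀ 2 C.vol ^ 2 + eLpNorm ϑ₀ 2 C.vol ^ 2 + ENNReal.ofReal K *
          (ENNReal.ofReal c₁ ^ 2 * mixedNorm 2 (6 / 5) C.vol t g ^ 2
          + ENNReal.ofReal c₁ ^ 2 * mixedNorm 2 (4 / 3) C.surf₂ t (fun s x => f s x 2) ^ 2
          + ∫⁻ s in Ioo 0 t, B s)) := by
  obtain ⟨δ, hδ, K₀, hK₀, hE⟩ := C.exists_energyRate_bound hν hκ
  have hδ' : 0 < 4 / δ := by positivity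
  set K := K₀ + (4 + 4 / δ) with hKdef
  have hK : 0 < K := by positivity
  refine ⟨K, hK, ?_⟩
  intro T hT α hα f g v h p q θ ϑ v₀ h₀ θ₀ ϑ₀ c₁ hc₁ hv hθ hh hϑ hp hq hs hH hΘ hhv hqp hαc hfm hgm
    hfg hh₀ hϑ₀ hf hg A B hA hB hAi hAB t ht
  have hsub : Ioo 0 t ⊆ Ioo 0 T := Ioo_subset_Ioo_right ht.2
  have hrate := hE T α f g v h p q θ ϑ v₀ h₀ θ₀ ϑ₀ c₁ hc₁ hv hθ hh hϑ hq hs hH hΘ hhv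
    (fun t ht x hx => hαc t ht x (subset_closure hx)) hfm hgm hf hg
  have hfm' := aemeasurable_eLpNorm (p := 3) (by simp) (by simp) hfm
  have hgm' := aemeasurable_eLpNorm (p := 6 / 5) (by simp) (by finiteness) hgm
  have hqm := aemeasurable_eLpNorm_of_continuousOn C.ae_mem_closure_surf₂ (p := 4 / 3) (by simp)
    (by finiteness) hq.cont
  have hϑt := hϑ.timeRegular
  have ht1 := fun s hs => (hh.contDiffOn s hs).of_le one_le_two
  have ht2 := fun s hs => (hϑ.contDiffOn s hs).of_le one_le_two
  set A' : ℝ → ℝ≥0∞ := fun s =>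
    ENNReal.ofReal K * (ENNReal.ofReal c₁ ^ 2 * eLpNorm (f s) 3 C.vol ^ 2 + A s) with hA'
  set B' : ℝ → ℝ≥0∞ := fun s =>
    ENNReal.ofReal K * (ENNReal.ofReal c₁ ^ 2 * eLpNorm (g s) (6 / 5) C.vol ^ 2
      + eLpNorm (q s) (4 / 3) C.surf₂ ^ 2 + B s) with hB'
  have hIA : ∀ r ≤ T, ∫⁻ s in Ioo 0 r, A' s = ENNReal.ofReal K *
      (ENNReal.ofReal c₁ ^ 2 * mixedNorm 2 3 C.vol r f ^ 2 + ∫⁻ s in Ioo 0 r, A s) := fun r hr => by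
    rw [mixedNorm_two_sq, lintegral_const_mul' _ _ ENNReal.ofReal_ne_top,
      lintegral_add_left' (((hfm'.pow_const 2).const_mul _).mono_measure
        (Measure.restrict_mono_set _ (Ioo_subset_Ioo_right hr))),
      lintegral_const_mul' _ _ (ENNReal.pow_ne_top ENNReal.ofReal_ne_top)]
  have hIB : ∫⁻ s in Ioo 0 t, B' s ≤ ENNReal.ofReal K *
      (ENNReal.ofReal c₁ ^ 2 * mixedNorm 2 (6 / 5) C.vol t g ^ 2
        + ENNReal.ofReal c₁ ^ 2 * mixedNorm 2 (4 / 3) C.surf₂ t (fun s x => f s x 2) ^ 2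
        + ∫⁻ s in Ioo 0 t, B s) := by
    have hle := Measure.restrict_mono_set (μ := (volume : Measure ℝ)) hsub
    have hg2 := ((hgm'.pow_const 2).const_mul (ENNReal.ofReal c₁ ^ 2)).mono_measure hle
    have hq2 := (hqm.pow_const 2).mono_measure hle
    have hgq : AEMeasurable (fun s => ENNReal.ofReal c₁ ^ 2 * eLpNorm (g s) (6 / 5) C.vol ^ 2
      + eLpNorm (q s) (4 / 3) C.surf₂ ^ 2) (volume.restrict (Ioo 0 t)) := hg2.add hq2
    rw [mixedNorm_two_sq (6 / 5) C.vol t g, lintegral_const_mul' _ _ ENNReal.ofReal_ne_top,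
      lintegral_add_left' hgq, lintegral_add_left' hg2,
      lintegral_const_mul' _ _ (ENNReal.pow_ne_top ENNReal.ofReal_ne_top)]
    gcongr
    exact lintegral_pressure_le ht (fun t ht x hx => (hαc t ht x hx).1)
      (ae_pressure_eq hα hfg hs hH hv hθ hp hhv hqp)
  have hAT : ∫⁻ s in Ioo 0 T, A' s ≠ ∞ := by
    rw [hIA T le_rfl]
    have := hf.ne
    finiteness
  have hfin : mixedNorm 2 3 C.vol t f ≠ ∞ := ((mixedNorm_mono 2 3 C.vol ht.2 f).trans_lt hf).ne
  have hAt : ∫⁻ s in Ioo 0 t, A s ≠ ∞ := ((lintegral_mono_set hsub).trans_lt hAi.lt_top).ne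
  have hgr := gronwall_lintegral
    (y := fun s => C.l2v (h s) + ∫ x, ϑ s x ^ 2 ∂C.vol) (y' := C.energyRate h ϑ)
    (D := fun s => δ * (C.h1v (h s) + C.h1sq (ϑ s))) (A := A') (B := B')
    (Y := eLpNorm h₀ 2 C.vol ^ 2 + eLpNorm ϑ₀ 2 C.vol ^ 2) (T := T)
    (fun s hs => (hh.hasDerivAt_l2v hs).fun_add (hϑt.hasDerivAt_integral_sq hs))
    (hh.continuousOn_deriv_l2v.add hϑt.continuousOn_integral_mul_dt)
    ((hh.continuousOn_h1v.add hϑt.continuousOn_h1sq).const_mul δ)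
    (fun s _ => add_nonneg (l2v_nonneg _) (integral_nonneg fun x => sq_nonneg _))
    (fun s _ => mul_nonneg hδ.le (add_nonneg (C.h1v_nonneg _) (C.h1sq_nonneg _)))
    ((((hfm'.pow_const 2).const_mul _).add hA).const_mul _)
    (((((hgm'.pow_const 2).const_mul _).add (hqm.pow_const 2)).add hB).const_mul _) hAT
    (((hH.initial.tendsto_l2v hT hh hh₀).add (hϑt.tendsto_initial hT hΘ.initial hϑ₀)).congr
      fun s => (ENNReal.ofReal_add (l2v_nonneg _) (integral_nonneg fun x => sq_nonneg _)).symm)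
    (by
      filter_upwards [hrate, ae_restrict_mem measurableSet_Ioo] with s hr hs
      have hy : ENNReal.ofReal (C.l2v (h s) + ∫ x, ϑ s x ^ 2 ∂C.vol) =
          eLpNorm (h s) 2 C.vol ^ 2 + eLpNorm (ϑ s) 2 C.vol ^ 2 := by
        rw [ENNReal.ofReal_add (l2v_nonneg _) (integral_nonneg fun x => sq_nonneg _),
          ofReal_l2v (ht1 s hs).continuousOn,
          eLpNorm_two_sq (C.memLp_of_continuousOn (ht2 s hs).continuousOn 2)]
      obtain ⟨m, hm, hmle⟩ : ∃ m, C.energyRate h ϑ s + δ * (C.h1v (h s) + C.h1sq (ϑ s)) ≤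
          K₀ * (c₁ ^ 2 * (eLpNorm (f s) 3 C.vol).toReal ^ 2 * (eLpNorm (ϑ s) 2 C.vol).toReal ^ 2
            + c₁ ^ 2 * (eLpNorm (g s) (6 / 5) C.vol).toReal ^ 2
            + (eLpNorm (q s) (4 / 3) C.surf₂).toReal ^ 2 + m) ∧
          ENNReal.ofReal m ≤ A s * eLpNorm (h s) 2 C.vol ^ 2 + B s := by
        rcases hAB s hs with hcase | hcase
        · exact ⟨_, hr _ (Or.inl rfl), (ENNReal.ofReal_toReal_sq_mul_le _ _ _).trans hcase⟩
        · exact ⟨_, hr _ (Or.inr rfl), (ENNReal.ofReal_toReal_sq_mul_le _ _ _).trans hcase⟩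
      rw [hy]
      refine (ENNReal.ofReal_le_ofReal hm).trans
        ((ENNReal.ofReal_energy_le hK₀ hc₁ _ _ _ _).trans ?_)
      have hK' : ENNReal.ofReal K₀ ≤ ENNReal.ofReal K :=
        ENNReal.ofReal_le_ofReal (by rw [hKdef]; linarith)
      refine (mul_le_mul' hK' (add_le_add_right hmle _)).trans ?_
      simp only [hA', hB', mul_assoc, ← mul_add]
      refine mul_le_mul_right ?_ _
      generalize eLpNorm (h s) 2 C.vol ^ 2 = N
      generalize eLpNorm (ϑ s) 2 C.vol ^ 2 = Θ
      generalize eLpNorm (f s) 3 C.vol ^ 2 = F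
      generalize ENNReal.ofReal c₁ ^ 2 = k
      generalize eLpNorm (g s) (6 / 5) C.vol ^ 2 = G
      generalize eLpNorm (q s) (4 / 3) C.surf₂ ^ 2 = Q
      -- Grönwall's inequality needs the common quantity N + Θ = ‖h‖₂² + ‖ϑ‖₂². Completing to it
      -- only adds the nonnegative cross terms on the right.
      have e : (k * F + A s) * (N + Θ) + (k * G + Q + B s) =
          (k * (F * Θ) + k * G + Q + (A s * N + B s)) + (k * F * N + A s * Θ) := by ring
      rw [e, mul_add k]
      exact le_self_add) ht
  refine (normV_sq_add_normVScalar_sq_le hh hϑ ht hδ hgr.1 hgr.2).trans ?_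
  rw [hIA t ht.2, ← mul_assoc, ← ENNReal.ofReal_mul (by positivity), ENNReal.toReal_mul,
    ENNReal.toReal_ofReal hK.le, ENNReal.toReal_add (by finiteness) hAt, ENNReal.toReal_mul,
    ENNReal.toReal_pow, ENNReal.toReal_pow, ENNReal.toReal_ofReal hc₁]
  refine mul_le_mul' (ENNReal.ofReal_le_ofReal ?_) (add_le_add_right hIB _)
  exact mul_le_mul_of_nonneg_right (by rw [hKdef]; linarith) (Real.exp_pos _).le

end Cylinder

end

/-! ### The two estimates. -/

theorem lemma3p1 (C : Cylinder) (hC : ¬ C.AxiallySymmetric)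
    (ν κ : ℝ) (hν : 0 < ν) (hκ : 0 < κ) :
    ∃ c : ℝ, 0 < c ∧
      ∀ (T : ℝ) (_ : 0 < T) (α : ℝ → ℝ) (_ : ContDiff ℝ 2 α)
        (f g : ℝ → E3 → E3) (v h : ℝ → E3 → E3) (p q θ ϑ : ℝ → E3 → ℝ)
        (v₀ h₀ : E3 → E3) (θ₀ ϑ₀ : E3 → ℝ) (c₀ : ℝ≥0) (c₁ : ℝ),
        -- the data
        AEStronglyMeasurable (fun z : ℝ × E3 => f z.1 z.2) (C.volT T) →
        AEStronglyMeasurable (fun z : ℝ × E3 => g z.1 z.2) (C.volT T) →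
        C.IsX3Deriv T f g →
        mixedNorm 2 (6 / 5) C.vol T f < ∞ →
        mixedNorm 2 3 C.vol T f < ∞ →
        mixedNorm 2 (4 / 3) C.surf₂ T (fun s x => f s x 2) < ∞ →
        mixedNorm 2 (6 / 5) C.vol T g < ∞ →
        MemLp v₀ 2 C.vol → MemLp θ₀ ∞ C.vol → MemLp h₀ 2 C.vol → MemLp ϑ₀ 2 C.vol →
        -- the constants `c₀`, `c₁`
        c₁ = aFun α (eLpNorm θ₀ ∞ C.vol).toReal →
        ENNReal.ofReal c₁ * mixedNorm 2 (6 / 5) C.vol T f + eLpNorm v₀ 2 C.vol ≤ c₀ →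
        eLpNorm θ₀ 2 C.vol ≤ c₀ →
        -- `h = v_{,x_3}`, `q = p_{,x_3}`, `ϑ = θ_{,x_3}`
        (∀ t ∈ Ioo 0 T, ∀ x ∈ closure C.Ω, ∀ i, h t x i = C.pd 2 (fun y => v t y i) x) →
        (∀ t ∈ Ioo 0 T, ∀ x ∈ closure C.Ω, q t x = C.pd 2 (p t) x) →
        (∀ t ∈ Ioo 0 T, ∀ x ∈ closure C.Ω, ϑ t x = C.pd 2 (θ t) x) →
        -- regularity of the solutions
        C.IsC21 T v → C.IsC21 T θ → C.IsC21 T h → C.IsC21 T ϑ → C.IsC10 T p → C.IsC10 T q →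
        -- the three problems
        C.SolvesNSHeat T ν κ α f v p θ v₀ θ₀ →
        C.SolvesH T ν α f g v θ ϑ h q h₀ →
        C.SolvesTheta T κ v h θ ϑ ϑ₀ →
        ∀ t ∈ Ioc 0 T,
          (C.normV t h ^ 2 + C.normVScalar t ϑ ^ 2 ≤
            ENNReal.ofReal (c * Real.exp (c * c₁ ^ 2 * (mixedNorm 2 3 C.vol t f).toReal ^ 2)) *
              ((c₀ : ℝ≥0∞) ^ 2 * mixedNorm ∞ 3 C.vol t h ^ 2
                + ENNReal.ofReal c₁ ^ 2 * mixedNorm 2 (6 / 5) C.vol t g ^ 2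
                + ENNReal.ofReal c₁ ^ 2
                    * mixedNorm 2 (4 / 3) C.surf₂ t (fun s x => f s x 2) ^ 2
                + eLpNorm h₀ 2 C.vol ^ 2 + eLpNorm ϑ₀ 2 C.vol ^ 2)) ∧
          (mixedNorm 2 3 C.vol T (fun s => C.gradVec (v s)) < ∞ →
           mixedNorm 2 3 C.vol T (fun s => C.grad (θ s)) < ∞ →
           C.normV t h ^ 2 + C.normVScalar t ϑ ^ 2 ≤
            ENNReal.ofReal (c * Real.exp (c *
                ((mixedNorm 2 3 C.vol t (fun s => C.gradVec (v s))).toReal ^ 2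
                  + (mixedNorm 2 3 C.vol t (fun s => C.grad (θ s))).toReal ^ 2
                  + c₁ ^ 2 * (mixedNorm 2 3 C.vol t f).toReal ^ 2))) *
              (ENNReal.ofReal c₁ ^ 2 * mixedNorm 2 (6 / 5) C.vol t g ^ 2
                + ENNReal.ofReal c₁ ^ 2
                    * mixedNorm 2 (4 / 3) C.surf₂ t (fun s x => f s x 2) ^ 2
                + eLpNorm h₀ 2 C.vol ^ 2 + eLpNorm ϑ₀ 2 C.vol ^ 2)) := by
  obtain ⟨K, hK, hbound⟩ := C.exists_energy_bound hν hκ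
  obtain ⟨cE, hcE, henergy⟩ := C.exists_energy_velocity hC hν
  -- The sum of the constants in the energy estimates of `v` and `θ`: the time integral of ‖∇v‖₂² +
  -- ‖∇θ‖₂² is at most L c₀².
  set L := cE + 1 / (2 * κ) with hL
  have hL0 : 0 ≤ L := by positivity
  set c := K * (1 + K + K * L) + K with hc
  have hKKL : 0 ≤ K * L := by positivity
  have hKc : K ≤ c := le_add_of_nonneg_left (by positivity)
  have hKc' : K * (1 + K + K * L) ≤ c := le_add_of_nonneg_right hK.le
  have hc0 : 0 < c := hK.trans_le hKc
  refine ⟨c, hc0, ?_⟩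
  intro T hT α hα f g v h p q θ ϑ v₀ h₀ θ₀ ϑ₀ c₀ c₁ hfm hgm hfg hf65 hf3 _ hg hv₀ hθ₀ hh₀ hϑ₀ hc₁
    hc₀v hc₀θ hhv hqp _ hv hθ hh hϑ hp hq hs hH hΘ t ht
  have hsub : Ioo 0 t ⊆ Ioo 0 T := Ioo_subset_Ioo_right ht.2
  have hα1 : ContDiff ℝ 1 α := hα.of_le one_le_two
  have hc₁0 : 0 ≤ c₁ := by
    have := abs_add_abs_deriv_le_aFun hα1 (x := (eLpNorm θ₀ ∞ C.vol).toReal) (y := 0)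
      (by simp)
    rw [hc₁]
    exact le_trans (by positivity) this
  have hαc : ∀ t ∈ Ioo 0 T, ∀ x ∈ closure C.Ω, |α (θ t x)| ≤ c₁ ∧ |deriv α (θ t x)| ≤ c₁ := by
    intro s hs' x hx
    -- The maximum principle is carried over to the closure because the pressure on S₂ is α(θ)f₃.
    have hθs : |θ s x| ≤ (eLpNorm θ₀ ∞ C.vol).toReal :=
      le_on_closure (fun y hy => hs.abs_temperature_le hκ.le hv hθ hθ₀ hs' hy)
        (hθ.contDiffOn s hs').continuousOn.abs continuousOn_const hx
    have h1 := abs_add_abs_deriv_le_aFun hα1 hθs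
    rw [← hc₁] at h1
    exact ⟨(le_add_of_nonneg_right (abs_nonneg _)).trans h1,
      (le_add_of_nonneg_left (abs_nonneg _)).trans h1⟩
  have key := hbound T hT α hα f g v h p q θ ϑ v₀ h₀ θ₀ ϑ₀ c₁ hc₁0 hv hθ hh hϑ hp hq hs hH hΘ hhv
    hqp hαc hfm hgm hfg hh₀ hϑ₀ hf3 hg
  have meas : ∀ {F : Type} [NormedAddCommGroup F] [SecondCountableTopology F] (r : ℝ≥0∞) (_ : r ≠ 0)
      (_ : r ≠ ∞) {w : ℝ → E3 → F} (_ : ContinuousOn (fun z : ℝ × E3 => w z.1 z.2)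
      (Ioo 0 T ×ˢ closure C.Ω)),
      AEMeasurable (fun t => eLpNorm (w t) r C.vol ^ 2) (volume.restrict (Ioo 0 T)) :=
    fun r h0 h1 w hw => (Cylinder.aemeasurable_eLpNorm_of_continuousOn
      Cylinder.ae_mem_closure_vol h0 h1 hw).pow_const 2
  have hθ₀2 : MemLp θ₀ 2 C.vol := hθ₀.mono_exponent le_top
  refine ⟨?_, fun hv3 hθ3 => ?_⟩
  -- For the first estimate the quadratic terms go entirely into the source. The supremum of ‖h‖₃ in
  -- time is taken out of the integral, and the energy estimates bound the rest.
  · set G : ℝ → ℝ≥0∞ := fun s => eLpNorm (C.gradVec (v s)) 2 C.vol ^ 2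
      + eLpNorm (C.grad (θ s)) 2 C.vol ^ 2 with hG
    have hGm : AEMeasurable G (volume.restrict (Ioo 0 T)) :=
      (meas 2 (by simp) (by simp) hv.continuousOn_gradVec).add
        (meas 2 (by simp) (by simp) hθ.continuousOn_grad)
    have hGi : ∫⁻ s in Ioo 0 t, G s ≤ ENNReal.ofReal L * (c₀ : ℝ≥0∞) ^ 2 := by
      have e1 := henergy T hT κ α f v p θ v₀ θ₀ c₁ hc₁0 hfm hf65 hv₀ hv hp hs
        fun t ht x hx => (hαc t ht x (subset_closure hx)).1
      have e2 := C.energy_temperature hκ hs hT hv hθ hθ₀2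
      have e3 : eLpNorm v₀ 2 C.vol ^ 2 + ENNReal.ofReal c₁ ^ 2 * mixedNorm 2 (6 / 5) C.vol T f ^ 2
          ≤ (c₀ : ℝ≥0∞) ^ 2 := by
        refine le_trans ?_ (pow_le_pow_left₀ zero_le hc₀v 2)
        rw [← mul_pow, add_comm]
        exact pow_add_pow_le zero_le zero_le two_ne_zero
      have e4 : eLpNorm θ₀ 2 C.vol ^ 2 ≤ (c₀ : ℝ≥0∞) ^ 2 := pow_le_pow_left₀ zero_le hc₀θ 2
      rw [hL, ENNReal.ofReal_add hcE (by positivity), add_mul]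
      have m1 := meas 2 (by simp) (by simp) (w := fun s => C.gradVec (v s)) hv.continuousOn_gradVec
      refine (lintegral_mono_set hsub).trans ?_
      rw [lintegral_add_left' m1]
      refine add_le_add (le_trans ?_ (e1.trans (mul_le_mul_right e3 _)))
        (le_trans ?_ (e2.trans (mul_le_mul_right e4 _)))
      · exact setLIntegral_mono' measurableSet_Ioo fun s hs' =>
          Cylinder.eLpNorm_gradVec_sq_le ((hv.contDiffOn s hs').of_le one_le_two)
      · exact setLIntegral_mono' measurableSet_Ioo fun s hs' =>
          (Cylinder.eLpNorm_grad_sq ((hθ.contDiffOn s hs').of_le one_le_two)).le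
    have h1 := key (fun _ => 0) (fun s => eLpNorm (h s) 3 C.vol ^ 2 * G s) aemeasurable_const
      ((meas 3 (by simp) (by simp) hh.cont).mul hGm) (by simp)
      (fun s _ => Or.inl (by simp [hG])) t ht
    have hB : ∫⁻ s in Ioo 0 t, eLpNorm (h s) 3 C.vol ^ 2 * G s ≤
        ENNReal.ofReal L * ((c₀ : ℝ≥0∞) ^ 2 * mixedNorm ∞ 3 C.vol t h ^ 2) := by
      calc _ ≤ ∫⁻ s in Ioo 0 t, mixedNorm ∞ 3 C.vol t h ^ 2 * G s := by
            refine lintegral_mono_ae ?_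
            filter_upwards [ae_eLpNorm_le_mixedNorm_top 3 C.vol t h] with s hs'
            gcongr
        _ = mixedNorm ∞ 3 C.vol t h ^ 2 * ∫⁻ s in Ioo 0 t, G s :=
            lintegral_const_mul'' _ (hGm.mono_measure (Measure.restrict_mono_set _ hsub))
        _ ≤ mixedNorm ∞ 3 C.vol t h ^ 2 * (ENNReal.ofReal L * (c₀ : ℝ≥0∞) ^ 2) := by gcongr
        _ = _ := by ring
    refine h1.trans ?_
    simp only [lintegral_zero, ENNReal.toReal_zero, add_zero]
    rw [mul_assoc c]
    exact ENNReal.ofReal_exp_mul_le hK.le hL0 hc (by positivity) rfl hB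
  -- For the second estimate the squared L₃ norms of the gradients are integrable in time and serve
  -- as Grönwall coefficient, so no additional source is left.
  · set A : ℝ → ℝ≥0∞ := fun s => eLpNorm (C.gradVec (v s)) 3 C.vol ^ 2
      + eLpNorm (C.grad (θ s)) 3 C.vol ^ 2 with hA
    have m1 := meas 3 (by simp) (by simp) (w := fun s => C.gradVec (v s)) hv.continuousOn_gradVec
    have hAint : ∀ r ≤ T, ∫⁻ s in Ioo 0 r, A s =
        mixedNorm 2 3 C.vol r (fun s => C.gradVec (v s)) ^ 2
          + mixedNorm 2 3 C.vol r (fun s => C.grad (θ s)) ^ 2 := fun r hr => by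
      rw [mixedNorm_two_sq, mixedNorm_two_sq, lintegral_add_left' (m1.mono_measure
        (Measure.restrict_mono_set _ (Ioo_subset_Ioo_right hr)))]
    have hv3t := ((mixedNorm_mono 2 3 C.vol ht.2 fun s => C.gradVec (v s)).trans_lt hv3).ne
    have hθ3t := ((mixedNorm_mono 2 3 C.vol ht.2 fun s => C.grad (θ s)).trans_lt hθ3).ne
    have h1 := key A (fun _ => 0) (m1.add (meas 3 (by simp) (by simp) hθ.continuousOn_grad))
      aemeasurable_const
      (by rw [hAint T le_rfl]; have := hv3.ne; have := hθ3.ne; finiteness)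
      (fun s _ => Or.inr (by simp only [hA, add_zero]; rw [mul_comm])) t ht
    refine h1.trans ?_
    rw [hAint t ht.2, ENNReal.toReal_add (by finiteness) (by finiteness), ENNReal.toReal_pow,
      ENNReal.toReal_pow, lintegral_zero]
    refine (ENNReal.ofReal_exp_mul_le (M := 0) hK.le hL0 hc (by positivity) (add_comm _ _)
      (by simp)).trans (le_of_eq ?_)
    rw [zero_add]
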